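/- An instance $U$ of quantum circuit satisfiability (QCSAT) consists of a quantum circuit with $s$ gates from the Clifford+T gate set $\{H,S,\mathrm{CNOT},T\}$ acting on $n+m$ qubits ($n$ witness qubits followed by $m$ ancillas), together with a register of $k>0$ distinct output qubits among the $n+m$ qubits. For an $n$-qubit unit vector $|\psi\rangle$ the acceptance probability is $\pi(U,\psi)=\|\Pi_{\mathrm{out}}\,U(|\psi\rangle\otimes|0^m\rangle)\|^2$, where $\Pi_{\mathrm{out}}$ is the projector onto $|1^k\rangle$ on the output register, acting trivially on the other qubits; $|\psi\rangle$ is an optimal input state if it maximizes $\pi(U,\cdot)$ over all $n$-qubit unit vectors. Theorem. There is an assignment $U\mapsto W_U$ such that for every QCSAT instance $U$ whose number $t$ of $T$-gates satisfies $t\le n$, $W_U$ is an $n$-qubit Clifford unitary and there is a $t$-qubit unit vector $|\phi\rangle$ for which $W_U\left(|\phi\rangle\otimes|0^{n-t}\rangle\right)$ is an optimal input state. Moreover $W_U$ can be computed from the description of $U$ in classical deterministic time $\mathrm{poly}(n,s)$: a single deterministic random access machine (addition and truncated subtraction of natural numbers and indirect addressing, each at unit cost) outputs, for every such $U$, a circuit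 over $\{H,S,\mathrm{CNOT}\}$ on $n$ qubits that implements $W_U$, within $c\,(n+s+1)^c$ steps for a constant $c$ independent of $U$. -/

import Mathlib

open scoped Matrix

namespace QCSAT

noncomputable section

/-! ### Qubits, gates and circuits -/

/-- Computational basis labels of `N` qubits. -/
abbrev Bits (N : ℕ) : Type := Fin N → Bool

/-- The Hilbert space of `N` qubits. -/
abbrev Qubits (N : ℕ) : Type := EuclideanSpace ℂ (Bits N)

/-- Operators on `N` qubits, in the computational basis. -/
abbrev Op (N : ℕ) : Type := Matrix (Bits N) (Bits N) ℂ

/-- The action of an operator on a vector. -/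
def applyOp {N : ℕ} (M : Op N) (ψ : Qubits N) : Qubits N :=
  WithLp.toLp 2 (M *ᵥ ψ.ofLp)

/-- The one-qubit operator `A` acting on qubit `q`, tensored with the identity elsewhere. -/
def oneQubit {N : ℕ} (A : Matrix Bool Bool ℂ) (q : Fin N) : Op N :=
  Matrix.of fun x y => if ∀ r, r ≠ q → x r = y r then A (x q) (y q) else 0

/-- The controlled NOT with control `a` and target `b`: it maps the basis vector `|y⟩` to
`|x⟩`, where `x` is `y` with the bit `y b` replaced by `y a ⊕ y b`. -/
def cnotOp {N : ℕ} (a b : Fin N) : Op N :=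
  Matrix.of fun x y => if x = Function.update y b (xor (y a) (y b)) then 1 else 0

/-- Hadamard matrix. -/
def hMat : Matrix Bool Bool ℂ :=
  Matrix.of fun b c => (if b && c then -1 else 1) / (Real.sqrt 2 : ℂ)

/-- `S = diag(1, i)`. -/
def sMat : Matrix Bool Bool ℂ :=
  Matrix.diagonal fun b => if b then Complex.I else 1

/-- `T = diag(1, exp(i π / 4))`. -/
def tMat : Matrix Bool Bool ℂ :=
  Matrix.diagonal fun b => if b then Complex.exp (Complex.I * (Real.pi / 4)) else 1

/-- Pauli `X`. -/
def xMat : Matrix Bool Bool ℂ :=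
  Matrix.of fun b c => if b = c then 0 else 1

/-- Pauli `Z = diag(1, -1)`. -/
def zMat : Matrix Bool Bool ℂ :=
  Matrix.diagonal fun b => if b then -1 else 1

/-- The elementary Clifford gates on `N` qubits. -/
inductive CliffordGate (N : ℕ) : Type
  | H (q : Fin N) : CliffordGate N
  | S (q : Fin N) : CliffordGate N
  | CNOT (a b : Fin N) (hab : a ≠ b) : CliffordGate N

/-- The gates of Clifford+T circuits on `N` qubits. -/
inductive Gate (N : ℕ) : Type
  | clifford (g : CliffordGate N) : Gate N
  | T (q : Fin N) : Gate N

/-- The operator of a Clifford gate. -/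
def CliffordGate.op {N : ℕ} : CliffordGate N → Op N
  | .H q => oneQubit hMat q
  | .S q => oneQubit sMat q
  | .CNOT a b _ => cnotOp a b

/-- The operator of a gate. -/
def Gate.op {N : ℕ} : Gate N → Op N
  | .clifford g => g.op
  | .T q => oneQubit tMat q

/-- Is the gate a T-gate? -/
def Gate.isT {N : ℕ} : Gate N → Bool
  | .clifford _ => false
  | .T _ => true

/-- The operator of a circuit, given as the list of its gates; the first gate of the list is
applied first. -/
def circuitOp {N : ℕ} : List (Gate N) → Op N
  | [] => 1
  | g :: l => circuitOp l * g.op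

/-- The operator of a circuit of Clifford gates. -/
def cliffordOp {N : ℕ} (l : List (CliffordGate N)) : Op N :=
  circuitOp (l.map Gate.clifford)

/-- The Pauli group on `N` qubits, generated by the phase `i` and all `X_q` and `Z_q`. -/
def pauliGroup (N : ℕ) : Submonoid (Op N) :=
  Submonoid.closure
    ({Complex.I • (1 : Op N)} ∪ Set.range (oneQubit xMat) ∪ Set.range (oneQubit zMat))

/-- Clifford unitaries: unitaries that map the Pauli group to itself by conjugation. -/
def IsClifford {N : ℕ} (W : Op N) : Prop :=
  W ∈ Matrix.unitaryGroup (Bits N) ℂ ∧ ∀ P ∈ pauliGroup N, W * P * Wᴴ ∈ pauliGroup N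

/-- `φ ⊗ |0^{b-a}⟩`, for a vector `φ` of `a` qubits, which become the first `a` of `b` qubits. -/
def padZero {a b : ℕ} (h : a ≤ b) (φ : Qubits a) : Qubits b :=
  WithLp.toLp 2 fun x =>
    if ∀ i : Fin b, a ≤ i.val → x i = false then φ (fun i => x (Fin.castLE h i)) else 0

end

end QCSAT

/-! ### Instances -/

/-- An instance of quantum circuit satisfiability: a Clifford+T circuit on `n` witness qubits
(the first ones) and `m` ancillas, and a register of `k > 0` distinct output qubits. -/
structure QCSATInstance : Type where
  /-- number of witness qubits -/
  n : ℕ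
  /-- number of ancillas -/
  m : ℕ
  /-- the gates, in the order in which they are applied -/
  circuit : List (QCSAT.Gate (n + m))
  /-- the measured qubits -/
  out : List (Fin (n + m))
  out_nodup : out.Nodup
  out_ne_nil : out ≠ []

namespace QCSATInstance

open QCSAT

/-- The number `s` of gates. -/
def s (I : QCSATInstance) : ℕ := I.circuit.length

/-- The number `t` of T-gates. -/
def t (I : QCSATInstance) : ℕ := I.circuit.countP Gate.isT

/-- The probability that the output qubits are all found to be `1` when the circuit is run on
`ψ ⊗ |0^m⟩`. -/
noncomputable def accept (I : QCSATInstance) (ψ : Qubits I.n) : ℝ :=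
  ∑ x : Bits (I.n + I.m) with ∀ q ∈ I.out, x q = true,
    ‖applyOp (circuitOp I.circuit) (padZero (Nat.le_add_right I.n I.m) ψ) x‖ ^ 2

/-- `ψ` is a witness state of maximal acceptance probability. -/
def IsOptimal (I : QCSATInstance) (ψ : Qubits I.n) : Prop :=
  ‖ψ‖ = 1 ∧ ∀ ψ' : Qubits I.n, ‖ψ'‖ = 1 → I.accept ψ' ≤ I.accept ψ

end QCSATInstance

/-! ### A random access machine with a step count

Programs work on finitely many registers and finitely many arrays of natural numbers (a program
is a finite text and names registers and arrays by constants). Array cells are addressed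
indirectly. The arithmetic consists of addition and truncated subtraction, and every operation
costs one step. -/

namespace RAM

/-- The memory: `reg i` is a register, `arr i j` is the `j`-th cell of the `i`-th array. -/
structure Mem : Type where
  reg : ℕ → ℕ
  arr : ℕ → ℕ → ℕ

/-- Arithmetic expressions. -/
inductive Expr : Type
  | const (c : ℕ) : Expr
  | reg (i : ℕ) : Expr
  | cell (i : ℕ) (e : Expr) : Expr
  | add (e₁ e₂ : Expr) : Expr
  | sub (e₁ e₂ : Expr) : Expr

/-- The value of an expression; `sub` is truncated at `0`. -/
def Expr.eval (σ : Mem) : Expr → ℕ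
  | .const c => c
  | .reg i => σ.reg i
  | .cell i e => σ.arr i (e.eval σ)
  | .add e₁ e₂ => e₁.eval σ + e₂.eval σ
  | .sub e₁ e₂ => e₁.eval σ - e₂.eval σ

/-- The number of steps that it takes to evaluate an expression. -/
def Expr.cost : Expr → ℕ
  | .const _ => 1
  | .reg _ => 1
  | .cell _ e => e.cost + 1
  | .add e₁ e₂ => e₁.cost + e₂.cost + 1
  | .sub e₁ e₂ => e₁.cost + e₂.cost + 1

/-- Programs. -/
inductive Prog : Type
  | skip : Prog
  /-- `reg i := e` -/
  | assign (i : ℕ) (e : Expr) : Prog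
  /-- `arr i [e₁] := e₂` -/
  | store (i : ℕ) (e₁ e₂ : Expr) : Prog
  | seq (p₁ p₂ : Prog) : Prog
  /-- if `e ≠ 0` then `p₁` else `p₂` -/
  | ite (e : Expr) (p₁ p₂ : Prog) : Prog
  /-- while `e ≠ 0` do `p` -/
  | loop (e : Expr) (p : Prog) : Prog

/-- Writing to a register. -/
def Mem.setReg (σ : Mem) (i v : ℕ) : Mem :=
  { σ with reg := Function.update σ.reg i v }

/-- Writing to an array cell. -/
def Mem.setCell (σ : Mem) (i j v : ℕ) : Mem :=
  { σ with arr := Function.update σ.arr i (Function.update (σ.arr i) j v) }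

/-- `Exec p σ T σ'`: started in memory `σ`, the program `p` halts after exactly `T` steps with
memory `σ'`. -/
inductive Exec : Prog → Mem → ℕ → Mem → Prop
  | skip (σ : Mem) : Exec .skip σ 1 σ
  | assign (i : ℕ) (e : Expr) (σ : Mem) :
      Exec (.assign i e) σ (e.cost + 1) (σ.setReg i (e.eval σ))
  | store (i : ℕ) (e₁ e₂ : Expr) (σ : Mem) :
      Exec (.store i e₁ e₂) σ (e₁.cost + e₂.cost + 1) (σ.setCell i (e₁.eval σ) (e₂.eval σ))
  | seq {p₁ p₂ : Prog} {σ σ' σ'' : Mem} {T₁ T₂ : ℕ} :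
      Exec p₁ σ T₁ σ' → Exec p₂ σ' T₂ σ'' → Exec (.seq p₁ p₂) σ (T₁ + T₂) σ''
  | ite_true {e : Expr} {p₁ p₂ : Prog} {σ σ' : Mem} {T : ℕ} :
      e.eval σ ≠ 0 → Exec p₁ σ T σ' → Exec (.ite e p₁ p₂) σ (e.cost + 1 + T) σ'
  | ite_false {e : Expr} {p₁ p₂ : Prog} {σ σ' : Mem} {T : ℕ} :
      e.eval σ = 0 → Exec p₂ σ T σ' → Exec (.ite e p₁ p₂) σ (e.cost + 1 + T) σ'
  | loop_step {e : Expr} {p : Prog} {σ σ' σ'' : Mem} {T₁ T₂ : ℕ} :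
      e.eval σ ≠ 0 → Exec p σ T₁ σ' → Exec (.loop e p) σ' T₂ σ'' →
      Exec (.loop e p) σ (e.cost + 1 + T₁ + T₂) σ''
  | loop_done {e : Expr} {p : Prog} {σ : Mem} :
      e.eval σ = 0 → Exec (.loop e p) σ (e.cost + 1) σ

/-- The machine is deterministic. -/
theorem Exec.deterministic {p : Prog} {σ σ₁ σ₂ : Mem} {T₁ T₂ : ℕ}
    (h₁ : Exec p σ T₁ σ₁) (h₂ : Exec p σ T₂ σ₂) : T₁ = T₂ ∧ σ₁ = σ₂ := by
  induction h₁ generalizing T₂ σ₂ with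
  | skip => cases h₂; exact ⟨rfl, rfl⟩
  | assign => cases h₂; exact ⟨rfl, rfl⟩
  | store => cases h₂; exact ⟨rfl, rfl⟩
  | seq _ _ ih₁ ih₂ =>
    cases h₂ with
    | seq a b =>
      obtain ⟨rfl, rfl⟩ := ih₁ a
      obtain ⟨rfl, rfl⟩ := ih₂ b
      exact ⟨rfl, rfl⟩
  | ite_true h _ ih =>
    cases h₂ with
    | ite_true _ a => obtain ⟨rfl, rfl⟩ := ih a; exact ⟨rfl, rfl⟩
    | ite_false h' _ => exact absurd h' h
  | ite_false h _ ih =>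
    cases h₂ with
    | ite_true h' _ => exact absurd h h'
    | ite_false _ a => obtain ⟨rfl, rfl⟩ := ih a; exact ⟨rfl, rfl⟩
  | loop_step h _ _ ih₁ ih₂ =>
    cases h₂ with
    | loop_step _ a b =>
      obtain ⟨rfl, rfl⟩ := ih₁ a
      obtain ⟨rfl, rfl⟩ := ih₂ b
      exact ⟨rfl, rfl⟩
    | loop_done h' => exact absurd h' h
  | loop_done h =>
    cases h₂ with
    | loop_step h' _ _ => exact absurd h h'
    | loop_done _ => exact ⟨rfl, rfl⟩

end RAM

/-! ### Computing a Clifford circuit from an instance -/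

namespace QCSAT

/-- A Clifford gate is written as three numbers: a code for the kind of gate and the indices of
the qubits that it acts on (the second index is `0` for a gate on one qubit). -/
def CliffordGate.code {N : ℕ} : CliffordGate N → ℕ × ℕ × ℕ
  | .H q => (0, q, 0)
  | .S q => (1, q, 0)
  | .CNOT a b _ => (2, a, b)

/-- The three numbers that describe a gate. -/
def Gate.code {N : ℕ} : Gate N → ℕ × ℕ × ℕ
  | .clifford g => g.code
  | .T q => (3, q, 0)

/-- The memory that holds the description of an instance: registers `0` to `3` hold `n`, `m`, `s`
and `k`, arrays `0` to `2` hold the gates, array `3` holds the output qubits, and everything else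
is `0`. -/
def inputMem (I : QCSATInstance) : RAM.Mem where
  reg i := [I.n, I.m, I.s, I.out.length].getD i 0
  arr i j :=
    match i with
    | 0 => (I.circuit.map fun g => g.code.1).getD j 0
    | 1 => (I.circuit.map fun g => g.code.2.1).getD j 0
    | 2 => (I.circuit.map fun g => g.code.2.2).getD j 0
    | 3 => (I.out.map Fin.val).getD j 0
    | _ => 0

/-- The memory `σ` displays the Clifford circuit `l`: register `0` holds the number of gates and
the first cells of arrays `0` to `2` hold the gates. -/
def Displays {N : ℕ} (σ : RAM.Mem) (l : List (CliffordGate N)) : Prop :=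
  σ.reg 0 = l.length ∧
    ∀ (j : ℕ) (hj : j < l.length), (σ.arr 0 j, σ.arr 1 j, σ.arr 2 j) = l[j].code

/-- On all instances that satisfy `D`, the Clifford circuit `W I` is computed from the description
of `I`, by a single program and in time polynomial in `n` and `s`. -/
def ComputableInPolyTime (D : QCSATInstance → Prop)
    (W : (I : QCSATInstance) → List (CliffordGate I.n)) : Prop :=
  ∃ (p : RAM.Prog) (c : ℕ), ∀ I, D I → ∃ (T : ℕ) (σ : RAM.Mem),
    RAM.Exec p (inputMem I) T σ ∧ Displays σ (W I) ∧ T ≤ c * (I.n + I.s + 1) ^ c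

end QCSAT

/-! ### Loop programs with a syntactic time bound -/

namespace RAM

/-! ### Programs with counted loops -/

/-! Replace every T gate by a CNOT onto a fresh qubit in the unnormalised magic state |0⟩ +
exp(iπ/4)|1⟩ and project that qubit onto |0⟩; this implements T exactly (`gadget_spec`). After X
gates on the output register, the acceptance probability is ‖Π_J V (ψ ⊗ 0^m ⊗ magic)‖², where V is
Clifford and Π_J projects the output qubits and the t magic qubits J onto 0 (`mass_baseGates`).
Pulled back through V, the operator Z_j becomes a Pauli operator R_j = V† Z_j V, and Π_J becomes the
product of the (1 + R_j)/2. The rest is linear algebra over 𝔽₂ on these commuting rows, together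
with their phases.

Three freedoms are available: rows may be multiplied with each other, by CNOTs between measured
qubits after V (`mass_cnot`); a Clifford circuit on the magic qubits is absorbed into the magic
state (`exists_preimage`); a Clifford circuit on the witness qubits is the W of the theorem.

A row with an X part at an ancilla anticommutes with the Z there, which stabilises the input. Once
that column is cleared in the other rows, the row contributes a factor 1/2 whatever ψ is, and it can
be dropped (`mass_insert_of_anticomm`, `dropRows_spec`). The remaining rows have no X on ancillas,
so for any two of them the commutation signs on the witness and on the magic qubits agree.
Symplectic Gram-Schmidt on the t magic qubits (`magicRows_spec`) leaves μ ≤ t pairs, with magic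
parts Z_ν and possibly X_ν, and rows without magic part.

The rows without magic part commute with all remaining rows on the witness. They can be turned into
Z on the last witness qubits, up to Z factors on qubits that are 0 anyway, and force these bits to 0
(`stabRows_spec`). The witness parts of a pair are concentrated on at most one new qubit:
commutation makes them Z there, and X for the partner (`pairRows_spec`). Hence the pairs use ℓ ≤ t
witness qubits, and between these and the forced qubits no row acts at all, so these bits may be set
to 0 by convexity (`exists_zero_bit`). This is assembled in `exists_zeroFrom_ge`; an optimum exists
by compactness (`exists_isOptimal`).

For the running time, m and k are not bounded by n + s. The program therefore never loops over the
ancillas: it stores gate lists only, recomputes each row in untouched memory, and looks for X parts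
only at qubits named by gates. An output register with more than n + 2s qubits contains an ancilla
on which no gate acts, so nothing is ever accepted and the register can be discarded
(`accProb_eq_zero`). The step count follows from the shape of the program alone (`exec_run`,
`polyBdd_cost`). -/

@[simp] theorem Mem.setReg_reg (σ : Mem) (i v j : ℕ) :
    (σ.setReg i v).reg j = if j = i then v else σ.reg j := by
  simp [Mem.setReg, Function.update_apply]

@[simp] theorem Mem.setReg_arr (σ : Mem) (i v : ℕ) : (σ.setReg i v).arr = σ.arr := rfl

@[simp] theorem Mem.setCell_reg (σ : Mem) (i j v : ℕ) : (σ.setCell i j v).reg = σ.reg := rfl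

@[simp] theorem Mem.setCell_arr (σ : Mem) (i j v a b : ℕ) :
    (σ.setCell i j v).arr a b = if a = i ∧ b = j then v else σ.arr a b := by
  by_cases h : a = i
  · subst h; simp [Mem.setCell, Function.update_apply]
  · simp [Mem.setCell, h]

theorem Mem.setCell_arr_ne (σ : Mem) {i j v a : ℕ} (h : a ≠ i) :
    (σ.setCell i j v).arr a = σ.arr a := by
  simp [Mem.setCell, h]

/-- Programs whose loops run over a counter `i` from `0` to the value of a register `r`.
In `forC` the bound is a parameter that stays fixed, in `forV` it is a counter that grows by
`incr` commands outside the loop. -/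
inductive CProg : Type
  | skip : CProg
  | assign (i : ℕ) (e : Expr) : CProg
  | incr (i : ℕ) : CProg
  | store (i : ℕ) (e₁ e₂ : Expr) : CProg
  | seq (p q : CProg) : CProg
  | ite (e : Expr) (p q : CProg) : CProg
  | forC (i r : ℕ) (p : CProg) : CProg
  | forV (i r : ℕ) (p : CProg) : CProg

/-- `k` iterations of a loop body with loop counter `i`. -/
def iter (i : ℕ) (f : Mem → Mem) : ℕ → Mem → Mem
  | 0, σ => σ.setReg i 0
  | k + 1, σ => (f (iter i f k σ)).setReg i (k + 1)

namespace CProg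

/-- The `while` loop that implements a counted loop. -/
def compileLoop (i r : ℕ) (p : Prog) : Prog :=
  .seq (.assign i (.const 0))
    (.loop (.sub (.reg r) (.reg i)) (.seq p (.assign i (.add (.reg i) (.const 1)))))

/-- Translation to the machine. -/
def compile : CProg → Prog
  | skip => .skip
  | assign i e => .assign i e
  | incr i => .assign i (.add (.reg i) (.const 1))
  | store i e₁ e₂ => .store i e₁ e₂
  | seq p q => .seq p.compile q.compile
  | ite e p q => .ite e p.compile q.compile
  | forC i r p => compileLoop i r p.compile
  | forV i r p => compileLoop i r p.compile

/-- The memory transformation that a program computes. -/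
def run : CProg → Mem → Mem
  | skip, σ => σ
  | assign i e, σ => σ.setReg i (e.eval σ)
  | incr i, σ => σ.setReg i (σ.reg i + 1)
  | store i e₁ e₂, σ => σ.setCell i (e₁.eval σ) (e₂.eval σ)
  | seq p q, σ => q.run (p.run σ)
  | ite e p q, σ => if e.eval σ ≠ 0 then p.run σ else q.run σ
  | forC i r p, σ => iter i p.run (σ.reg r) σ
  | forV i r p, σ => iter i p.run (σ.reg r) σ

/-- The registers that a program may write. -/
def wr : CProg → List ℕ
  | skip => []
  | assign i _ => [i]
  | incr i => [i]
  | store _ _ _ => []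
  | seq p q => p.wr ++ q.wr
  | ite _ p q => p.wr ++ q.wr
  | forC i _ p => i :: p.wr
  | forV i _ p => i :: p.wr

/-- The arrays that a program may write. -/
def wa : CProg → List ℕ
  | skip => []
  | assign _ _ => []
  | incr _ => []
  | store i _ _ => [i]
  | seq p q => p.wa ++ q.wa
  | ite _ p q => p.wa ++ q.wa
  | forC _ _ p => p.wa
  | forV _ _ p => p.wa

theorem iter_reg_of_frame {i r : ℕ} {f : Mem → Mem} (hf : ∀ σ, (f σ).reg r = σ.reg r)
    (hi : r ≠ i) (k : ℕ) (σ : Mem) : (iter i f k σ).reg r = σ.reg r := by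
  induction k with
  | zero => simp [iter, hi]
  | succ k ih => simp [iter, hi, hf, ih]

theorem iter_arr_of_frame {i a : ℕ} {f : Mem → Mem} (hf : ∀ σ, (f σ).arr a = σ.arr a)
    (k : ℕ) (σ : Mem) : (iter i f k σ).arr a = σ.arr a := by
  induction k with
  | zero => simp [iter]
  | succ k ih => simp [iter, hf, ih]

theorem iter_reg_self (i k : ℕ) (f : Mem → Mem) (σ : Mem) : (iter i f k σ).reg i = k := by
  cases k <;> simp [iter]

/-- Registers that are not written keep their values. -/
theorem run_reg {p : CProg} {r : ℕ} (h : r ∉ p.wr) (σ : Mem) : (p.run σ).reg r = σ.reg r := by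
  induction p generalizing σ with
  | skip => rfl
  | assign i e => simp_all [run, wr]
  | incr i => simp_all [run, wr]
  | store i e₁ e₂ => rfl
  | seq p q ihp ihq =>
    simp only [wr, List.mem_append, not_or] at h
    simp [run, ihp h.1, ihq h.2]
  | ite e p q ihp ihq =>
    simp only [wr, List.mem_append, not_or] at h
    simp only [run]; split
    · exact ihp h.1 σ
    · exact ihq h.2 σ
  | forC i b p ih =>
    simp only [wr, List.mem_cons, not_or] at h
    exact iter_reg_of_frame (ih h.2) h.1 _ _
  | forV i b p ih =>
    simp only [wr, List.mem_cons, not_or] at h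
    exact iter_reg_of_frame (ih h.2) h.1 _ _

/-- Arrays that are not written keep their contents. -/
theorem run_arr {p : CProg} {a : ℕ} (h : a ∉ p.wa) (σ : Mem) : (p.run σ).arr a = σ.arr a := by
  induction p generalizing σ with
  | skip => rfl
  | assign i e => rfl
  | incr i => rfl
  | store i e₁ e₂ =>
    simp only [wa, List.mem_singleton] at h
    exact Mem.setCell_arr_ne _ h
  | seq p q ihp ihq =>
    simp only [wa, List.mem_append, not_or] at h
    simp [run, ihp h.1, ihq h.2]
  | ite e p q ihp ihq =>
    simp only [wa, List.mem_append, not_or] at h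
    simp only [run]; split
    · exact ihp h.1 σ
    · exact ihq h.2 σ
  | forC i b p ih => exact iter_arr_of_frame (ih h) _ _
  | forV i b p ih => exact iter_arr_of_frame (ih h) _ _

theorem iter_invariant {i : ℕ} {f : Mem → Mem} {R : ℕ} (I : ℕ → Mem → Prop) {σ : Mem}
    (h0 : I 0 (σ.setReg i 0))
    (hs : ∀ k < R, ∀ τ, τ.reg i = k → I k τ → I (k + 1) ((f τ).setReg i (k + 1))) :
    I R (iter i f R σ) := by
  have : ∀ k ≤ R, I k (iter i f k σ) := by
    intro k hk
    induction k with
    | zero => exact h0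
    | succ k ih => exact hs k hk _ (iter_reg_self _ _ _ _) (ih (by omega))
  exact this R le_rfl

/-! ### Step counts -/

/-- Loop counters and bounds are not overwritten, and the counters in `cs` change by `incr`
only. -/
def WF (cs : List ℕ) : CProg → Prop
  | skip => True
  | assign i _ => i ∉ cs
  | incr _ => True
  | store _ _ _ => True
  | seq p q => p.WF cs ∧ q.WF cs
  | ite _ p q => p.WF cs ∧ q.WF cs
  | forC i r p => p.WF cs ∧ i ∉ p.wr ∧ r ∉ p.wr ∧ i ≠ r ∧ i ∉ cs
  | forV i r p => p.WF cs ∧ i ∉ p.wr ∧ r ∉ p.wr ∧ i ≠ r ∧ i ∉ cs ∧ (∀ c ∈ cs, c ∉ p.wr) ∧ r ∈ cs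

instance WF.decidable (cs : List ℕ) : (p : CProg) → Decidable (p.WF cs)
  | skip => .isTrue trivial
  | assign i _ => inferInstanceAs (Decidable (i ∉ cs))
  | incr _ => .isTrue trivial
  | store _ _ _ => .isTrue trivial
  | seq p q => @instDecidableAnd _ _ (decidable cs p) (decidable cs q)
  | ite _ p q => @instDecidableAnd _ _ (decidable cs p) (decidable cs q)
  | forC i r p =>
    have := decidable cs p
    inferInstanceAs (Decidable (p.WF cs ∧ i ∉ p.wr ∧ r ∉ p.wr ∧ i ≠ r ∧ i ∉ cs))
  | forV i r p =>
    have := decidable cs p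
    inferInstanceAs (Decidable (p.WF cs ∧ i ∉ p.wr ∧ r ∉ p.wr ∧ i ≠ r ∧ i ∉ cs ∧
      (∀ c ∈ cs, c ∉ p.wr) ∧ r ∈ cs))

/-- The bounds of the loops of type `forC`. -/
def bounds : CProg → List ℕ
  | seq p q => p.bounds ++ q.bounds
  | ite _ p q => p.bounds ++ q.bounds
  | forC _ r p => r :: p.bounds
  | forV _ _ p => p.bounds
  | _ => []

/-- How much a counter grows at most, if the parameters are at most `D`. -/
def weight (D : ℕ) : CProg → ℕ
  | incr _ => 1
  | seq p q => p.weight D + q.weight D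
  | ite _ p q => p.weight D + q.weight D
  | forC _ _ p => D * p.weight D
  | forV _ _ p => p.weight D
  | _ => 0

/-- A bound on the number of steps, if the parameters are at most `D` and the counters stay at
most `V`. -/
def cost (D V : ℕ) : CProg → ℕ
  | skip => 1
  | assign _ e => e.cost + 1
  | incr _ => 4
  | store _ e₁ e₂ => e₁.cost + e₂.cost + 1
  | seq p q => p.cost D V + q.cost D V
  | ite e p q => e.cost + 1 + (p.cost D V + q.cost D V)
  | forC _ _ p => 6 + D * (p.cost D V + 8)
  | forV _ _ p => 6 + V * (p.cost D V + 8)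

/-- Resetting the counter costs 2 steps, each pass costs 4 for the test and 4 for the increment
besides the body, and the failing test at the end costs 4. The test is `R - i`, so the loop stops
exactly when the counter reaches `R`. -/
theorem exec_compileLoop {i r : ℕ} {p : Prog} {f : Mem → Mem} {σ : Mem} {R c : ℕ}
    (hR : σ.reg r = R) (hir : i ≠ r)
    (hi : ∀ τ, (f τ).reg i = τ.reg i) (hr : ∀ τ, (f τ).reg r = τ.reg r)
    (hb : ∀ k < R, ∃ T, Exec p (iter i f k σ) T (f (iter i f k σ)) ∧ T ≤ c) :
    ∃ T, Exec (compileLoop i r p) σ T (iter i f R σ) ∧ T ≤ 6 + R * (c + 8) := by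
  -- `d` passes remain when the counter is `k`, so a `while` loop can be treated by induction on
  -- `d`.
  have key : ∀ d k, k + d = R → ∃ T, Exec (.loop (.sub (.reg r) (.reg i))
      (.seq p (.assign i (.add (.reg i) (.const 1))))) (iter i f k σ) T (iter i f R σ) ∧
      T ≤ 4 + d * (c + 8) := by
    intro d
    induction d with
    | zero =>
      intro k hk
      obtain rfl : k = R := by omega
      refine ⟨_, Exec.loop_done ?_, ?_⟩
      · simp [Expr.eval, iter_reg_self, iter_reg_of_frame hr hir.symm, hR]
      · simp [Expr.cost]
    | succ d ih =>
      intro k hk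
      obtain ⟨T, hT, hTc⟩ := hb k (by omega)
      obtain ⟨T', hT', hTc'⟩ := ih (k + 1) (by omega)
      have hE : Exec (.assign i (.add (.reg i) (.const 1))) (f (iter i f k σ)) 4
          (iter i f (k + 1) σ) := by
        have := Exec.assign i (.add (.reg i) (.const 1)) (f (iter i f k σ))
        simpa [Expr.eval, Expr.cost, hi, iter_reg_self, iter] using this
      refine ⟨_, Exec.loop_step ?_ (Exec.seq hT hE) hT', ?_⟩
      · simp only [Expr.eval, iter_reg_self, iter_reg_of_frame hr hir.symm, hR]; omega
      · simp only [Expr.cost]; nlinarith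
  obtain ⟨T, hT, hTc⟩ := key R 0 (by omega)
  refine ⟨2 + T, Exec.seq (Exec.assign i (.const 0) σ) hT, by omega⟩

/-- Time and counter growth have to be bounded together: a `forV` loop runs up to a counter, and a
counter is controlled only through the number of increments executed so far. -/
theorem exec_run {cs : List ℕ} {D V : ℕ} {p : CProg} (hw : p.WF cs)
    (hc : ∀ r ∈ p.bounds, r ∉ p.wr) {σ : Mem} (hD : ∀ r ∈ p.bounds, σ.reg r ≤ D)
    (hV : ∀ c ∈ cs, σ.reg c + p.weight D ≤ V) :
    (∃ T, Exec p.compile σ T (p.run σ) ∧ T ≤ p.cost D V) ∧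
      ∀ c ∈ cs, (p.run σ).reg c ≤ σ.reg c + p.weight D := by
  induction p generalizing σ with
  | skip => exact ⟨⟨_, .skip σ, le_rfl⟩, fun c _ => by simp [run]⟩
  | assign i e =>
    refine ⟨⟨_, .assign i e σ, le_rfl⟩, fun c h => ?_⟩
    have : c ≠ i := fun h' => hw (h' ▸ h)
    simp [run, this]
  | incr i =>
    refine ⟨⟨_, .assign i _ σ, by simp [Expr.cost, cost]⟩, fun c h => ?_⟩
    by_cases hci : c = i <;> simp [run, hci, weight]
  | store i e₁ e₂ => exact ⟨⟨_, .store i e₁ e₂ σ, le_rfl⟩, fun c _ => by simp [run]⟩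
  | seq p q ihp ihq =>
    simp only [bounds, wr, List.mem_append, weight, not_or] at hc hD hV
    obtain ⟨⟨T₁, h₁, l₁⟩, w₁⟩ := ihp hw.1 (fun r h => (hc r (.inl h)).1)
      (fun r h => hD r (.inl h)) (fun c h => by have := hV c h; omega)
    obtain ⟨⟨T₂, h₂, l₂⟩, w₂⟩ := ihq (σ := p.run σ) hw.2 (fun r h => (hc r (.inr h)).2)
      (fun r h => by rw [run_reg (hc r (.inr h)).1]; exact hD r (.inr h))
      (fun c h => by have := hV c h; have := w₁ c h; omega)
    refine ⟨⟨_, .seq h₁ h₂, by simp only [cost]; omega⟩, fun c h => ?_⟩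
    have := w₁ c h; have := w₂ c h
    simp only [run, weight]; omega
  | ite e p q ihp ihq =>
    simp only [bounds, wr, List.mem_append, weight, not_or] at hc hD hV
    by_cases he : e.eval σ ≠ 0
    · obtain ⟨⟨T₁, h₁, l₁⟩, w₁⟩ := ihp hw.1 (fun r h => (hc r (.inl h)).1)
        (fun r h => hD r (.inl h)) (fun c h => by have := hV c h; omega)
      refine ⟨⟨_, by simpa [run, he, compile] using Exec.ite_true (p₂ := q.compile) he h₁,
        by simp only [cost]; omega⟩, fun c h => ?_⟩
      have := w₁ c h
      simp only [run, weight, he, if_true, ne_eq, not_false_eq_true]; omega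
    · obtain ⟨⟨T₁, h₁, l₁⟩, w₁⟩ := ihq hw.2 (fun r h => (hc r (.inr h)).2)
        (fun r h => hD r (.inr h)) (fun c h => by have := hV c h; omega)
      refine ⟨⟨_, by simpa [run, he, compile] using Exec.ite_false (p₁ := p.compile) (not_not.1 he) h₁,
        by simp only [cost]; omega⟩, fun c h => ?_⟩
      have := w₁ c h
      simp only [run, weight, he, if_false]; omega
  | forC i r p ih =>
    obtain ⟨hw, hi, hr, hir, hics⟩ := hw
    simp only [bounds, wr, List.mem_cons, weight, not_or] at hc hD hV
    have hRD : σ.reg r ≤ D := hD r (.inl rfl)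
    have hstep : ∀ k < σ.reg r, (∀ c ∈ cs, (iter i p.run k σ).reg c ≤ σ.reg c + k * p.weight D) →
        (∃ T, Exec p.compile (iter i p.run k σ) T (p.run (iter i p.run k σ)) ∧ T ≤ p.cost D V) ∧
        ∀ c ∈ cs, (p.run (iter i p.run k σ)).reg c ≤
          (iter i p.run k σ).reg c + p.weight D := by
      intro k hk hcs
      refine ih hw (fun s h => (hc s (.inr h)).2) (fun s h => ?_) (fun c h => ?_)
      · have hs := hc s (.inr h)
        rw [iter_reg_of_frame (fun τ => run_reg hs.2 τ) hs.1]
        exact hD s (.inr h)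
      · have h1 := hcs c h
        have h2 := hV c h
        -- At most `k` passes have used up their share of the growth; since `k < σ.reg r ≤ D`, one
        -- more share still fits below `V`.
        have h3 : (k + 1) * p.weight D ≤ D * p.weight D :=
          Nat.mul_le_mul_right _ (by omega)
        rw [add_mul, one_mul] at h3
        omega
    have hcs : ∀ k ≤ σ.reg r, ∀ c ∈ cs, (iter i p.run k σ).reg c ≤ σ.reg c + k * p.weight D := by
      intro k
      induction k with
      | zero =>
        intro _ c h
        have : c ≠ i := fun h' => hics (h' ▸ h)
        simp [iter, this]
      | succ k ihk =>
        intro hk c h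
        have : c ≠ i := fun h' => hics (h' ▸ h)
        have h1 := ihk (by omega)
        have h2 := (hstep k (by omega) h1).2 c h
        have h3 := h1 c h
        simp only [iter, Mem.setReg_reg, this, if_false]
        rw [add_mul, one_mul]; omega
    refine ⟨?_, fun c h => ?_⟩
    · obtain ⟨T, hT, hl⟩ := exec_compileLoop (p := p.compile) rfl hir (fun τ => run_reg hi τ)
        (fun τ => run_reg hr τ) (fun k hk => (hstep k hk (hcs k hk.le)).1)
      refine ⟨T, hT, hl.trans ?_⟩
      simp only [cost]; gcongr
    · refine (hcs _ le_rfl c h).trans ?_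
      simp only [weight]; gcongr
  | forV i r p ih =>
    obtain ⟨hw, hi, hr, hir, hics, hcs, hrcs⟩ := hw
    simp only [bounds, wr, List.mem_cons, weight, not_or] at hc hD hV
    -- Counters are frozen inside a `forV` loop, so all passes together add nothing to them and the
    -- loop bound is constant.
    have hreg : ∀ k, ∀ c ∈ cs, (iter i p.run k σ).reg c = σ.reg c := by
      intro k c h
      have : c ≠ i := fun h' => hics (h' ▸ h)
      exact iter_reg_of_frame (fun τ => run_reg (hcs c h) τ) this _ _
    have hRV : σ.reg r ≤ V := (Nat.le_add_right _ _).trans (hV r hrcs)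
    refine ⟨?_, fun c h => by simp only [run]; rw [hreg _ c h]; exact Nat.le_add_right _ _⟩
    obtain ⟨T, hT, hl⟩ := exec_compileLoop (p := p.compile) (c := p.cost D V) rfl hir
      (fun τ => run_reg hi τ) (fun τ => run_reg hr τ) (fun k hk => by
        refine (ih hw (fun s h => (hc s h).2) (fun s h => ?_) (fun c h => ?_)).1
        · have hs := hc s h
          rw [iter_reg_of_frame (fun τ => run_reg hs.2 τ) hs.1]
          exact hD s h
        · rw [hreg k c h]
          exact hV c h)
    refine ⟨T, hT, hl.trans ?_⟩
    simp only [cost]; gcongr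

/-! ### Polynomial bounds -/

/-- Functions of natural numbers that are bounded by a polynomial. -/
def PolyBdd (f : ℕ → ℕ) : Prop := ∃ c, ∀ X, f X ≤ c * (X + 1) ^ c

theorem PolyBdd.mono {f g : ℕ → ℕ} (hg : PolyBdd g) (h : ∀ X, f X ≤ g X) : PolyBdd f := by
  obtain ⟨c, hc⟩ := hg
  exact ⟨c, fun X => (h X).trans (hc X)⟩

theorem PolyBdd.const (a : ℕ) : PolyBdd fun _ => a :=
  ⟨a, fun X => Nat.le_mul_of_pos_right _ (by positivity)⟩

theorem PolyBdd.id : PolyBdd fun X => X := ⟨1, fun X => by simp⟩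

theorem PolyBdd.add {f g : ℕ → ℕ} (hf : PolyBdd f) (hg : PolyBdd g) :
    PolyBdd fun X => f X + g X := by
  obtain ⟨a, ha⟩ := hf
  obtain ⟨b, hb⟩ := hg
  refine ⟨a + b, fun X => ?_⟩
  have h1 : (X + 1) ^ a ≤ (X + 1) ^ (a + b) := Nat.pow_le_pow_right (by omega) (by omega)
  have h2 : (X + 1) ^ b ≤ (X + 1) ^ (a + b) := Nat.pow_le_pow_right (by omega) (by omega)
  calc f X + g X ≤ a * (X + 1) ^ a + b * (X + 1) ^ b := add_le_add (ha X) (hb X)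
    _ ≤ a * (X + 1) ^ (a + b) + b * (X + 1) ^ (a + b) := by gcongr
    _ = _ := by ring

/-- Exponents multiply, because `g X + 1` is at most `(b + 1) * (X + 1) ^ b`. A single constant has
to serve as factor and as exponent, whence the sum. -/
theorem PolyBdd.comp {f g : ℕ → ℕ} (hf : PolyBdd f) (hg : PolyBdd g) :
    PolyBdd fun X => f (g X) := by
  obtain ⟨a, ha⟩ := hf
  obtain ⟨b, hb⟩ := hg
  refine ⟨a * (b + 1) ^ a + b * a, fun X => ?_⟩
  have h1 : g X + 1 ≤ (b + 1) * (X + 1) ^ b := by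
    have : 1 ≤ (X + 1) ^ b := Nat.one_le_pow _ _ (by omega)
    have := hb X
    nlinarith
  calc f (g X) ≤ a * (g X + 1) ^ a := ha _
    _ ≤ a * ((b + 1) * (X + 1) ^ b) ^ a := by gcongr
    _ = a * (b + 1) ^ a * (X + 1) ^ (b * a) := by rw [mul_pow, ← pow_mul]; ring
    _ ≤ (a * (b + 1) ^ a + b * a) * (X + 1) ^ (a * (b + 1) ^ a + b * a) := by
        gcongr <;> omega

/-- A product is at most the square of the sum, so squaring and composition suffice. -/
theorem PolyBdd.mul {f g : ℕ → ℕ} (hf : PolyBdd f) (hg : PolyBdd g) :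
    PolyBdd fun X => f X * g X := by
  have sq : PolyBdd fun X => X ^ 2 := ⟨2, fun X => by
    change X ^ 2 ≤ 2 * (X + 1) ^ 2
    have := Nat.pow_le_pow_left (Nat.le_add_right X 1) 2
    omega⟩
  exact (sq.comp (hf.add hg)).mono fun X => by nlinarith [Nat.zero_le (f X * g X), sq_nonneg (f X)]

theorem polyBdd_weight (p : CProg) : PolyBdd fun X => p.weight X := by
  induction p with
  | skip => exact .const _
  | assign => exact .const _
  | incr => exact .const _
  | store => exact .const _
  | seq p q ihp ihq => exact ihp.add ihq
  | ite e p q ihp ihq => exact ihp.add ihq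
  | forC i r p ih => exact PolyBdd.id.mul ih
  | forV i r p ih => exact ih

/-- The program is fixed, so the nesting depth of its loops is a constant that bounds the degree.
Parameters and counters share one bound. -/
theorem polyBdd_cost (p : CProg) : PolyBdd fun X => p.cost X X := by
  induction p with
  | skip => exact .const _
  | assign => exact .const _
  | incr => exact .const _
  | store => exact .const _
  | seq p q ihp ihq => exact ihp.add ihq
  | ite e p q ihp ihq => exact (PolyBdd.const _).add (ihp.add ihq)
  | forC i r p ih => exact (PolyBdd.const _).add (PolyBdd.id.mul (ih.add (.const _)))
  | forV i r p ih => exact (PolyBdd.const _).add (PolyBdd.id.mul (ih.add (.const _)))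

theorem cost_mono (p : CProg) {D D' V V' : ℕ} (h : D ≤ D') (h' : V ≤ V') :
    p.cost D V ≤ p.cost D' V' := by
  induction p <;> simp only [cost] <;> gcongr

end CProg
end RAM

/-! ### Pauli tableaux over 𝔽₂ and their invariants -/

namespace QCSAT

/-! ### Pauli rows and their pull-back through Clifford gates -/

/-- The Pauli operator `i^p X^x Z^z`, on qubits indexed by natural numbers. -/
@[ext] structure Row : Type where
  x : ℕ → ZMod 2
  z : ℕ → ZMod 2
  p : ℕ

namespace Row

theorem zmod2_cases (a : ZMod 2) : a = 0 ∨ a = 1 := by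
  revert a; decide

theorem zmod2_add_self (a : ZMod 2) : a + a = 0 := by
  revert a; decide

/-- The row of `Z` on the qubit `q`. -/
def single (q : ℕ) : Row := ⟨0, Pi.single q 1, 0⟩

/-- Conjugation `g† r g` of a row by the gate with code `g`. -/
def pull : ℕ × ℕ × ℕ → Row → Row
  -- The phases come from restoring the order X before Z: Z^x X^z = (-1)^{xz} X^z Z^x for H, and S†
  -- X S = -i X Z for S. A CNOT maps X parts to X parts and Z parts to Z parts, so it needs no
  -- correction.
  | (0, a, _), r => ⟨Function.update r.x a (r.z a), Function.update r.z a (r.x a),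
      (r.p + 2 * ((r.x a).val * (r.z a).val)) % 4⟩
  | (1, a, _), r => ⟨r.x, Function.update r.z a (r.z a + r.x a), (r.p + 3 * (r.x a).val) % 4⟩
  | (_ + 2, a, b), r => ⟨Function.update r.x b (r.x b + r.x a),
      Function.update r.z a (r.z a + r.z b), r.p⟩

/-- Pull-back through a list of gates, the first one first. -/
def pullList (l : List (ℕ × ℕ × ℕ)) (r : Row) : Row := l.foldl (fun r g => pull g r) r

@[simp] theorem pullList_nil (r : Row) : pullList [] r = r := rfl

@[simp] theorem pullList_cons (g : ℕ × ℕ × ℕ) (l : List (ℕ × ℕ × ℕ)) (r : Row) :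
    pullList (g :: l) r = pullList l (pull g r) := rfl

theorem pullList_append (l l' : List (ℕ × ℕ × ℕ)) (r : Row) :
    pullList (l ++ l') r = pullList l' (pullList l r) := by
  simp [pullList]

/-- The codes of gates on qubits that satisfy `P`. -/
def GateIn (P : ℕ → Prop) (g : ℕ × ℕ × ℕ) : Prop :=
  P g.2.1 ∧ ((g.1 < 2 ∧ g.2.2 = 0) ∨ (g.1 = 2 ∧ P g.2.2 ∧ g.2.1 ≠ g.2.2))

theorem GateIn.mono {P P' : ℕ → Prop} {g : ℕ × ℕ × ℕ} (h : GateIn P g) (hP : ∀ q, P q → P' q) :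
    GateIn P' g :=
  ⟨hP _ h.1, h.2.imp id fun h => ⟨h.1, hP _ h.2.1, h.2.2⟩⟩

/-- An induction principle for gates. -/
theorem GateIn.cases {P : ℕ → Prop} {g : ℕ × ℕ × ℕ} (h : GateIn P g) {C : ℕ × ℕ × ℕ → Prop}
    (hH : ∀ a, P a → C (0, a, 0)) (hS : ∀ a, P a → C (1, a, 0))
    (hC : ∀ a b, P a → P b → a ≠ b → C (2, a, b)) : C g := by
  obtain ⟨k, a, b⟩ := g
  obtain ⟨ha, ⟨hk, hb⟩ | ⟨hk, hb, hab⟩⟩ := h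
  · simp only at hk hb ha
    subst hb
    interval_cases k
    · exact hH a ha
    · exact hS a ha
  · simp only at hk hb hab ha
    subst hk
    exact hC a b ha hb hab

theorem pull_of_not {P : ℕ → Prop} {g : ℕ × ℕ × ℕ} (h : GateIn P g) (r : Row) {q : ℕ}
    (hq : ¬ P q) : (pull g r).x q = r.x q ∧ (pull g r).z q = r.z q := by
  revert r
  refine h.cases (C := fun g => ∀ r, (pull g r).x q = r.x q ∧ (pull g r).z q = r.z q) ?_ ?_ ?_
  · intro a ha r
    have : q ≠ a := fun h => hq (h ▸ ha)
    simp [pull, this]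
  · intro a ha r
    have : q ≠ a := fun h => hq (h ▸ ha)
    simp [pull, this]
  · intro a b ha hb hab r
    have h1 : q ≠ a := fun h => hq (h ▸ ha)
    have h2 : q ≠ b := fun h => hq (h ▸ hb)
    simp [pull, h1, h2]

theorem pullList_of_not {P : ℕ → Prop} {l : List (ℕ × ℕ × ℕ)} (h : ∀ g ∈ l, GateIn P g)
    (r : Row) {q : ℕ} (hq : ¬ P q) :
    (pullList l r).x q = r.x q ∧ (pullList l r).z q = r.z q := by
  induction l generalizing r with
  | nil => simp
  | cons g l ih =>
    have h1 := pull_of_not (h g (by simp)) r hq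
    have h2 := ih (fun g' hg' => h g' (by simp [hg'])) (pull g r)
    simp [h1, h2]

theorem pull_p_lt {g : ℕ × ℕ × ℕ} {r : Row} (h : r.p < 4) : (pull g r).p < 4 := by
  unfold pull
  split <;> simp only <;> omega

theorem pullList_p_lt {l : List (ℕ × ℕ × ℕ)} {r : Row} (h : r.p < 4) :
    (pullList l r).p < 4 := by
  induction l generalizing r with
  | nil => simpa
  | cons g l ih => exact ih (pull_p_lt h)

/-- The phase must already be reduced, because `pull` takes it modulo 4. The equality includes the
phase, which lets finished rows survive later gates unchanged. -/
theorem pull_of_trivial {P : ℕ → Prop} {g : ℕ × ℕ × ℕ} (h : GateIn P g) {r : Row} (hp : r.p < 4)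
    (hr : ∀ q, P q → r.x q = 0 ∧ r.z q = 0) : pull g r = r := by
  refine h.cases (C := fun g => pull g r = r) ?_ ?_ ?_
  · intro a ha
    ext q
    · by_cases hq : q = a <;> simp [pull, hr a ha, hq]
    · by_cases hq : q = a <;> simp [pull, hr a ha, hq]
    · simp [pull, hr a ha, Nat.mod_eq_of_lt hp]
  · intro a ha
    ext q
    · simp [pull]
    · by_cases hq : q = a <;> simp [pull, hr a ha, hq]
    · simp [pull, hr a ha, Nat.mod_eq_of_lt hp]
  · intro a b ha hb _
    ext q
    · by_cases hq : q = b <;> simp [pull, hr a ha, hr b hb, hq]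
    · by_cases hq : q = a <;> simp [pull, hr a ha, hr b hb, hq]
    · simp [pull]

theorem pullList_of_trivial {P : ℕ → Prop} {l : List (ℕ × ℕ × ℕ)} (h : ∀ g ∈ l, GateIn P g)
    {r : Row} (hp : r.p < 4) (hr : ∀ q, P q → r.x q = 0 ∧ r.z q = 0) : pullList l r = r := by
  induction l with
  | nil => rfl
  | cons g l ih =>
    rw [pullList_cons, pull_of_trivial (h g (by simp)) hp hr]
    exact ih fun g' hg' => h g' (by simp [hg'])

/-- `r₃` is the product of `r₁` and `r₂`, up to a phase. -/
def IsSum (r₁ r₂ r₃ : Row) : Prop := (∀ q, r₃.x q = r₁.x q + r₂.x q) ∧ ∀ q, r₃.z q = r₁.z q + r₂.z q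

/-- The bits transform linearly; only the phase is quadratic. Phases matter just for the rows that
force witness bits to 0, and there they are read off the exact row. -/
theorem IsSum.pull {r₁ r₂ r₃ : Row} (h : IsSum r₁ r₂ r₃) (g : ℕ × ℕ × ℕ) :
    IsSum (pull g r₁) (pull g r₂) (pull g r₃) := by
  obtain ⟨hx, hz⟩ := h
  obtain ⟨k, a, b⟩ := g
  match k with
  | 0 =>
    constructor <;> intro q <;> by_cases hq : q = a <;>
      simp [Row.pull, hq, hx, hz]
  | 1 =>
    constructor <;> intro q <;> by_cases hq : q = a <;>
      simp [Row.pull, hq, hx, hz]; ring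
  | k + 2 =>
    constructor <;> intro q <;>
      simp only [Row.pull, Function.update_apply, hx, hz] <;> (split_ifs <;> ring)

theorem IsSum.pullList {r₁ r₂ r₃ : Row} (h : IsSum r₁ r₂ r₃) (l : List (ℕ × ℕ × ℕ)) :
    IsSum (pullList l r₁) (pullList l r₂) (pullList l r₃) := by
  induction l generalizing r₁ r₂ r₃ with
  | nil => exact h
  | cons g l ih => exact ih (h.pull g)

/-- The symplectic form on the qubits in `T`. -/
def form (T : Finset ℕ) (r r' : Row) : ZMod 2 := ∑ q ∈ T, (r.x q * r'.z q + r.z q * r'.x q)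

/-- Conjugation preserves commutation. The set `T` only has to contain the qubits of the gate, so
the invariance holds on the whole register and also on a block of magic qubits. -/
theorem form_pull {P : ℕ → Prop} {T : Finset ℕ} (hT : ∀ q, P q → q ∈ T) {g : ℕ × ℕ × ℕ}
    (h : GateIn P g) (r r' : Row) : form T (pull g r) (pull g r') = form T r r' := by
  refine h.cases (C := fun g => form T (pull g r) (pull g r') = form T r r') ?_ ?_ ?_
  · intro a ha
    refine Finset.sum_congr rfl fun q _ => ?_
    by_cases hq : q = a
    · subst hq; simp [pull]; ring
    · simp [pull, hq]
  · intro a ha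
    refine Finset.sum_congr rfl fun q _ => ?_
    by_cases hq : q = a
    · subst hq
      simp only [pull, Function.update_self]
      linear_combination zmod2_add_self (r.x q * r'.x q)
    · simp [pull, hq]
  · intro a b ha hb hab
    -- The CNOT adds the same term `c` at both of its qubits, and the two cancel modulo 2.
    set c := r.x a * r'.z b + r.z b * r'.x a with hc
    have : ∀ q ∈ T, (pull (2, a, b) r).x q * (pull (2, a, b) r').z q +
        (pull (2, a, b) r).z q * (pull (2, a, b) r').x q =
        (r.x q * r'.z q + r.z q * r'.x q) + (if q = a then c else 0) + (if q = b then c else 0) := by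
      intro q _
      by_cases h1 : q = a
      · subst h1
        simp [pull, hab, hc]; ring
      · by_cases h2 : q = b
        · subst h2
          simp [pull, h1, hc]; ring
        · simp [pull, h1, h2]
    rw [form, Finset.sum_congr rfl this, Finset.sum_add_distrib, Finset.sum_add_distrib,
      Finset.sum_ite_eq', Finset.sum_ite_eq', if_pos (hT a ha), if_pos (hT b hb), add_assoc,
      zmod2_add_self, add_zero, form]

theorem form_pullList {P : ℕ → Prop} {T : Finset ℕ} (hT : ∀ q, P q → q ∈ T)
    {l : List (ℕ × ℕ × ℕ)} (h : ∀ g ∈ l, GateIn P g) (r r' : Row) :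
    form T (pullList l r) (pullList l r') = form T r r' := by
  induction l generalizing r r' with
  | nil => rfl
  | cons g l ih =>
    rw [pullList_cons, pullList_cons, ih (fun g' hg' => h g' (by simp [hg'])),
      form_pull hT (h g (by simp))]

/-- The parity of the phase that makes a row Hermitian. -/
def parity (T : Finset ℕ) (r : Row) : ZMod 2 := r.p + ∑ q ∈ T, r.x q * r.z q

theorem natCast_mod_four (k : ℕ) : ((k % 4 : ℕ) : ZMod 2) = k := by
  rw [ZMod.natCast_eq_natCast_iff']; omega

/-- Conjugation preserves being Hermitian. For a row without X part this says that its phase is 1 or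
-1, a sign that a Pauli X can repair. -/
theorem parity_pull {P : ℕ → Prop} {T : Finset ℕ} (hT : ∀ q, P q → q ∈ T) {g : ℕ × ℕ × ℕ}
    (h : GateIn P g) (r : Row) : parity T (pull g r) = parity T r := by
  have two : (2 : ZMod 2) = 0 := rfl
  have three : (3 : ZMod 2) = 1 := rfl
  refine h.cases (C := fun g => parity T (pull g r) = parity T r) ?_ ?_ ?_
  · intro a ha
    have : ∀ q ∈ T, (pull (0, a, 0) r).x q * (pull (0, a, 0) r).z q = r.x q * r.z q := by
      intro q _
      by_cases hq : q = a
      · subst hq; simp [pull]; ring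
      · simp [pull, hq]
    rw [parity, Finset.sum_congr rfl this, parity]
    simp [pull, natCast_mod_four, two]
  · intro a ha
    have : ∀ q ∈ T, (pull (1, a, 0) r).x q * (pull (1, a, 0) r).z q =
        r.x q * r.z q + if q = a then r.x a else 0 := by
      intro q _
      by_cases hq : q = a
      · subst hq
        rcases zmod2_cases (r.x q) with h | h <;> simp [pull, h]
      · simp [pull, hq]
    rw [parity, Finset.sum_congr rfl this, Finset.sum_add_distrib, Finset.sum_ite_eq',
      if_pos (hT a ha), parity]
    simp only [pull, natCast_mod_four, Nat.cast_add, Nat.cast_mul, ZMod.natCast_val,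
      Nat.cast_ofNat, three, ZMod.cast_id', id]
    linear_combination zmod2_add_self (r.x a)
  · intro a b ha hb hab
    have : ∀ q ∈ T, (pull (2, a, b) r).x q * (pull (2, a, b) r).z q =
        r.x q * r.z q + (if q = a then r.x a * r.z b else 0) +
          (if q = b then r.x a * r.z b else 0) := by
      intro q _
      by_cases h1 : q = a
      · subst h1
        simp [pull, hab]; ring
      · by_cases h2 : q = b
        · subst h2
          simp [pull, h1]; ring
        · simp [pull, h1, h2]
    rw [parity, Finset.sum_congr rfl this, Finset.sum_add_distrib, Finset.sum_add_distrib,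
      Finset.sum_ite_eq', Finset.sum_ite_eq', if_pos (hT a ha), if_pos (hT b hb), add_assoc,
      zmod2_add_self, add_zero, parity]
    simp [pull]

theorem parity_pullList {P : ℕ → Prop} {T : Finset ℕ} (hT : ∀ q, P q → q ∈ T)
    {l : List (ℕ × ℕ × ℕ)} (h : ∀ g ∈ l, GateIn P g) (r : Row) :
    parity T (pullList l r) = parity T r := by
  induction l generalizing r with
  | nil => rfl
  | cons g l ih =>
    rw [pullList_cons, ih (fun g' hg' => h g' (by simp [hg'])), parity_pull hT (h g (by simp))]

theorem single_p (q : ℕ) : (single q).p = 0 := rfl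

theorem form_single (T : Finset ℕ) (q q' : ℕ) : form T (single q) (single q') = 0 := by
  simp [form, single]

theorem parity_single (T : Finset ℕ) (q : ℕ) : parity T (single q) = 0 := by
  simp [parity, single]

/-- The `x` bits of a pulled back row live on the qubits of the gates. -/
theorem pullList_x_support (l : List (ℕ × ℕ × ℕ)) (r : Row) {q : ℕ} (hr : r.x q = 0)
    (h : (pullList l r).x q ≠ 0) : ∃ g ∈ l, q = g.2.1 ∨ q = g.2.2 := by
  induction l generalizing r with
  | nil => exact absurd hr h
  | cons g l ih =>
    by_cases hg : q = g.2.1 ∨ q = g.2.2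
    · exact ⟨g, by simp, hg⟩
    · rw [not_or] at hg
      have : (pull g r).x q = 0 := by
        unfold pull
        split <;> simp_all
      obtain ⟨g', hg', h'⟩ := ih _ this h
      exact ⟨g', by simp [hg'], h'⟩

end Row
end QCSAT

/-! ### Action of rows and gates on vectors; Clifford unitaries -/

namespace QCSAT
open Row

/-! ### The action of gates on vectors -/

section action
variable {N : ℕ}

theorem oneQubit_mulVec (A : Matrix Bool Bool ℂ) (q : Fin N) (Ψ : Bits N → ℂ) (u : Bits N) :
    (oneQubit A q *ᵥ Ψ) u = A (u q) false * Ψ (Function.update u q false) +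
      A (u q) true * Ψ (Function.update u q true) := by
  have h : ∀ y : Bits N, (if ∀ r, r ≠ q → u r = y r then A (u q) (y q) else 0) * Ψ y =
      (if y = Function.update u q false then A (u q) false * Ψ y else 0) +
      (if y = Function.update u q true then A (u q) true * Ψ y else 0) := by
    intro y
    have key : ∀ b, y = Function.update u q b ↔ (∀ r, r ≠ q → u r = y r) ∧ y q = b := by
      intro b
      constructor
      · rintro rfl
        exact ⟨fun r hr => by simp [hr], by simp⟩
      · rintro ⟨h, rfl⟩
        ext r
        by_cases hr : r = q
        · subst hr; simp
        · simp [hr, h r hr]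
    simp only [key]
    by_cases h : ∀ r, r ≠ q → u r = y r
    · cases hy : y q <;> simp
    · simp [h]
  simp only [Matrix.mulVec, dotProduct, oneQubit, Matrix.of_apply]
  rw [Finset.sum_congr rfl fun y _ => h y, Finset.sum_add_distrib, Finset.sum_ite_eq',
    Finset.sum_ite_eq']
  simp

theorem cnotOp_mulVec {a b : Fin N} (hab : a ≠ b) (Ψ : Bits N → ℂ) (u : Bits N) :
    (cnotOp a b *ᵥ Ψ) u = Ψ (Function.update u b (xor (u a) (u b))) := by
  have h : ∀ y : Bits N, (u = Function.update y b (xor (y a) (y b))) ↔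
      y = Function.update u b (xor (u a) (u b)) := by
    intro y
    constructor <;> rintro rfl <;> ext r <;> by_cases hr : r = b <;> simp [hr, hab]
  simp only [Matrix.mulVec, dotProduct, cnotOp, Matrix.of_apply, h]
  simp

/-- The sign `(-1)^{ab}`. -/
def bsign (a : ZMod 2) (b : Bool) : ℂ := if a = 1 ∧ b = true then -1 else 1

theorem bsign_add (a a' : ZMod 2) (b : Bool) : bsign (a + a') b = bsign a b * bsign a' b := by
  rcases zmod2_cases a with rfl | rfl <;> rcases zmod2_cases a' with rfl | rfl <;> cases b <;>
    simp [bsign, zmod2_add_self]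

theorem bsign_xor (a : ZMod 2) (b b' : Bool) : bsign a (xor b b') = bsign a b * bsign a b' := by
  rcases zmod2_cases a with rfl | rfl <;> cases b <;> cases b' <;> simp [bsign]

theorem bsign_zero (b : Bool) : bsign 0 b = 1 := by simp [bsign]

/-- Shifting a label by the `x` bits of a row. -/
def Row.shift (r : Row) (u : Bits N) : Bits N := fun q => xor (u q) (decide (r.x q = 1))

/-- The sign that the `z` bits of a row give to a label. -/
def Row.sign (r : Row) (u : Bits N) : ℂ := ∏ q : Fin N, bsign (r.z q) (u q)

/-- The action of the Pauli operator of a row. -/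
def Row.act (r : Row) (Ψ : Bits N → ℂ) (u : Bits N) : ℂ :=
  Complex.I ^ r.p * (r.sign (r.shift u) * Ψ (r.shift u))

theorem I_pow_mod (k : ℕ) : Complex.I ^ (k % 4) = Complex.I ^ k := by
  conv_rhs => rw [← Nat.div_add_mod k 4, pow_add, pow_mul, Complex.I_pow_four, one_pow, one_mul]

theorem Row.sign_eq (r : Row) (q : Fin N) (u : Bits N) :
    r.sign u = bsign (r.z q) (u q) * ∏ q' ∈ Finset.univ.erase q, bsign (r.z q') (u q') :=
  (Finset.mul_prod_erase _ _ (Finset.mem_univ q)).symm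

/-- A diagonal gate or Hadamard gate on one qubit, and pull-back of rows. -/
theorem Row.act_oneQubit_aux (r r' : Row) (q : Fin N) (A : Matrix Bool Bool ℂ)
    (hx : ∀ q' : Fin N, q' ≠ q → r'.x q' = r.x q') (hz : ∀ q' : Fin N, q' ≠ q → r'.z q' = r.z q')
    (h : ∀ b c : Bool,
      A b c * (Complex.I ^ r'.p * bsign (r'.z q) (xor c (decide (r'.x q = 1)))) =
      Complex.I ^ r.p * (bsign (r.z q) (xor b (decide (r.x q = 1)))) *
        A (xor b (decide (r.x q = 1))) (xor c (decide (r'.x q = 1))))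
    (Ψ : Bits N → ℂ) : oneQubit A q *ᵥ (r'.act Ψ) = r.act (oneQubit A q *ᵥ Ψ) := by
  ext u
  have hs : ∀ b, r'.shift (Function.update u q b) =
      Function.update (r.shift u) q (xor b (decide (r'.x q = 1))) := by
    intro b; ext q'
    by_cases hq : q' = q
    · subst hq; simp [Row.shift]
    · simp [Row.shift, hq, hx q' hq]
  have hp : ∀ b, ∏ q' ∈ Finset.univ.erase q, bsign (r'.z q') (Function.update (r.shift u) q b q') =
      ∏ q' ∈ Finset.univ.erase q, bsign (r.z q') (r.shift u q') := by
    intro b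
    refine Finset.prod_congr rfl fun q' hq => ?_
    have hq := Finset.ne_of_mem_erase hq
    simp [hq, hz q' hq]
  rw [oneQubit_mulVec]
  simp only [Row.act, hs, oneQubit_mulVec]
  rw [Row.sign_eq r' q, Row.sign_eq r' q, Row.sign_eq r q]
  simp only [hp, Function.update_self]
  set E := ∏ q' ∈ Finset.univ.erase q, bsign (r.z q') (r.shift u q')
  have e : r.shift u q = xor (u q) (decide (r.x q = 1)) := rfl
  have h0 := h (u q) false
  have h1 := h (u q) true
  rw [e]
  -- If `r'` flips the qubit, the two summands of the matrix product change places.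
  by_cases hd : r'.x q = 1
  · simp only [hd, decide_true, Bool.false_xor, Bool.true_xor, Bool.not_true] at h0 h1 ⊢
    linear_combination (E * Ψ (Function.update (r.shift u) q true)) * h0 +
      (E * Ψ (Function.update (r.shift u) q false)) * h1
  · simp only [hd, decide_false, Bool.xor_false] at h0 h1 ⊢
    linear_combination (E * Ψ (Function.update (r.shift u) q false)) * h0 +
      (E * Ψ (Function.update (r.shift u) q true)) * h1

theorem Row.act_H (r : Row) (q : Fin N) (Ψ : Bits N → ℂ) :
    oneQubit hMat q *ᵥ ((pull (0, q, 0) r).act Ψ) = r.act (oneQubit hMat q *ᵥ Ψ) := by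
  refine Row.act_oneQubit_aux _ _ _ _ (fun q' hq => ?_) (fun q' hq => ?_) ?_ Ψ
  · simp [pull, Fin.val_injective.ne hq]
  · simp [pull, Fin.val_injective.ne hq]
  · intro b c
    simp only [pull, Function.update_self, I_pow_mod, pow_add, hMat, Matrix.of_apply]
    rcases zmod2_cases (r.x q) with h | h <;> rcases zmod2_cases (r.z q) with h' | h' <;>
      cases b <;> cases c <;> simp [h, h', bsign, ZMod.val_one] <;> ring

theorem Row.act_S (r : Row) (q : Fin N) (Ψ : Bits N → ℂ) :
    oneQubit sMat q *ᵥ ((pull (1, q, 0) r).act Ψ) = r.act (oneQubit sMat q *ᵥ Ψ) := by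
  refine Row.act_oneQubit_aux _ _ _ _ (fun q' hq => ?_) (fun q' hq => ?_) ?_ Ψ
  · simp [pull]
  · simp [pull, Fin.val_injective.ne hq]
  · intro b c
    have I3 : Complex.I ^ 3 = -Complex.I := by rw [pow_succ, Complex.I_sq]; ring
    have I2 : Complex.I * Complex.I = -1 := Complex.I_mul_I
    simp only [pull, Function.update_self, I_pow_mod, pow_add, sMat, Matrix.diagonal_apply]
    rcases zmod2_cases (r.x q) with h | h <;> rcases zmod2_cases (r.z q) with h' | h' <;>
      cases b <;> cases c <;> simp [h, h', bsign, ZMod.val_one, zmod2_add_self, I3] <;>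
      first | ring1 | linear_combination (Complex.I ^ r.p) * I2 |
        linear_combination (-Complex.I ^ r.p) * I2

theorem Row.act_CNOT (r : Row) {a b : Fin N} (hab : a ≠ b) (Ψ : Bits N → ℂ) :
    cnotOp a b *ᵥ ((pull (2, a, b) r).act Ψ) = r.act (cnotOp a b *ᵥ Ψ) := by
  ext u
  have hab' : (a : ℕ) ≠ b := Fin.val_injective.ne hab
  rw [cnotOp_mulVec hab]
  simp only [Row.act, cnotOp_mulVec hab]
  have hs : (pull (2, a, b) r).shift (Function.update u b (xor (u a) (u b))) =
      Function.update (r.shift u) b (xor (r.shift u a) (r.shift u b)) := by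
    ext q
    by_cases hq : q = b
    · subst hq
      simp only [Row.shift, pull, Function.update_self]
      rcases zmod2_cases (r.x q) with h | h <;> rcases zmod2_cases (r.x a) with h' | h' <;>
        simp [h, h', zmod2_add_self]
    · have : (q : ℕ) ≠ b := Fin.val_injective.ne hq
      simp [Row.shift, pull, hq, this]
  rw [hs]
  set v := r.shift u
  -- A CNOT acts on labels by a linear map and on `z` bits by the transpose, so the pairing of the
  -- two is unchanged.
  have key : (pull (2, a, b) r).sign (Function.update v b (xor (v a) (v b))) = r.sign v := by
    have hb : b ∈ Finset.univ.erase a := by simp [hab.symm]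
    rw [Row.sign_eq _ a, Row.sign_eq _ a, ← Finset.mul_prod_erase _ _ hb,
      ← Finset.mul_prod_erase _ _ hb]
    have : ∏ q ∈ (Finset.univ.erase a).erase b, bsign ((pull (2, ↑a, ↑b) r).z q)
        (Function.update v b (xor (v a) (v b)) q) =
        ∏ q ∈ (Finset.univ.erase a).erase b, bsign (r.z q) (v q) := by
      refine Finset.prod_congr rfl fun q hq => ?_
      have h1 := Finset.ne_of_mem_erase hq
      have h2 : (q : ℕ) ≠ a :=
        Fin.val_injective.ne (Finset.ne_of_mem_erase (Finset.mem_of_mem_erase hq))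
      simp [pull, h1, h2]
    rw [this]
    simp only [pull, Function.update_self, Function.update_of_ne hab,
      Function.update_of_ne hab'.symm, bsign_add, bsign_xor]
    have sq : bsign (r.z b) (v a) * bsign (r.z b) (v a) = 1 := by
      simp only [bsign]; split <;> simp
    linear_combination (bsign (r.z a) (v a) * bsign (r.z b) (v b) *
      ∏ q ∈ (Finset.univ.erase a).erase b, bsign (r.z q) (v q)) * sq
  rw [key]
  rfl

theorem Row.act_gate (g : CliffordGate N) (r : Row) (Ψ : Bits N → ℂ) :
    g.op *ᵥ ((pull g.code r).act Ψ) = r.act (g.op *ᵥ Ψ) := by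
  cases g with
  | H q => exact Row.act_H r q Ψ
  | S q => exact Row.act_S r q Ψ
  | CNOT a b hab => exact Row.act_CNOT r hab Ψ

/-- The product of the operators of a list of gates; the last gate of the list acts first. -/
noncomputable def prodOp (l : List (CliffordGate N)) : Op N := (l.map CliffordGate.op).prod

@[simp] theorem prodOp_nil : prodOp ([] : List (CliffordGate N)) = 1 := rfl

@[simp] theorem prodOp_cons (g : CliffordGate N) (l : List (CliffordGate N)) :
    prodOp (g :: l) = g.op * prodOp l := by simp [prodOp]

theorem prodOp_append (l l' : List (CliffordGate N)) :
    prodOp (l ++ l') = prodOp l * prodOp l' := by simp [prodOp]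

theorem circuitOp_eq (l : List (Gate N)) : circuitOp l = ((l.map Gate.op).reverse).prod := by
  induction l with
  | nil => rfl
  | cons g l ih => simp [circuitOp, ih]

theorem cliffordOp_reverse (l : List (CliffordGate N)) : cliffordOp l.reverse = prodOp l := by
  simp only [cliffordOp, circuitOp_eq, prodOp, List.map_reverse, List.reverse_reverse,
    List.map_map]
  rfl

/-- In `prodOp` the first gate of the list acts last, so a row that is pulled back from the output
meets it first. The list order is thus the same on both sides. -/
theorem Row.act_prodOp (l : List (CliffordGate N)) (r : Row) (Ψ : Bits N → ℂ) :
    prodOp l *ᵥ ((pullList (l.map CliffordGate.code) r).act Ψ) = r.act (prodOp l *ᵥ Ψ) := by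
  induction l generalizing r with
  | nil => simp
  | cons g l ih =>
    rw [List.map_cons, pullList_cons, prodOp_cons, ← Matrix.mulVec_mulVec, ih,
      ← Matrix.mulVec_mulVec, Row.act_gate]

end action

/-! ### Clifford unitaries -/

section clifford
variable {N : ℕ}

theorem mulVec_ext {A B : Op N} (h : ∀ Ψ : Bits N → ℂ, A *ᵥ Ψ = B *ᵥ Ψ) : A = B :=
  Matrix.mulVec_injective (funext h)

theorem hMat_real (b c : Bool) : star (hMat b c) = hMat c b := by
  cases b <;> cases c <;> simp [hMat]

theorem oneQubit_conjTranspose (A : Matrix Bool Bool ℂ) (q : Fin N) :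
    (oneQubit A q)ᴴ = oneQubit Aᴴ q := by
  ext x y
  simp only [oneQubit, Matrix.conjTranspose_apply, Matrix.of_apply]
  by_cases h : ∀ r, r ≠ q → y r = x r
  · rw [if_pos h, if_pos fun r hr => (h r hr).symm]
  · rw [if_neg h, if_neg fun h' => h fun r hr => (h' r hr).symm, star_zero]

theorem oneQubit_mul (A B : Matrix Bool Bool ℂ) (q : Fin N) :
    oneQubit A q * oneQubit B q = oneQubit (A * B) q := by
  refine mulVec_ext fun Ψ => ?_
  ext u
  rw [← Matrix.mulVec_mulVec, oneQubit_mulVec, oneQubit_mulVec, oneQubit_mulVec, oneQubit_mulVec]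
  simp [Matrix.mul_apply]
  ring

theorem oneQubit_one (q : Fin N) : oneQubit (1 : Matrix Bool Bool ℂ) q = 1 := by
  refine mulVec_ext fun Ψ => ?_
  ext u
  rw [oneQubit_mulVec]
  cases h : u q <;> simp [← h]

theorem sqrt_two_sq : (Real.sqrt 2 : ℂ) * (Real.sqrt 2 : ℂ) = 2 := by
  rw [← Complex.ofReal_mul, Real.mul_self_sqrt (by norm_num)]; norm_num

theorem sqrt_two_ne : (Real.sqrt 2 : ℂ) ≠ 0 := by
  intro h; have := sqrt_two_sq; rw [h] at this; norm_num at this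

theorem hMat_mul_self : hMat * hMat = 1 := by
  ext b c
  have := sqrt_two_sq
  have h0 := sqrt_two_ne
  cases b <;> cases c <;> simp [Matrix.mul_apply, hMat] <;> field_simp <;>
    first | linear_combination -this | ring

theorem hMat_conjTranspose : hMatᴴ = hMat := by
  ext b c; exact hMat_real c b

theorem sMat_conjTranspose_mul : sMatᴴ * sMat = 1 := by
  ext b c
  cases b <;> cases c <;> simp [sMat, Matrix.diagonal_conjTranspose]

theorem cnotOp_mul_self {a b : Fin N} (hab : a ≠ b) : cnotOp a b * cnotOp a b = 1 := by
  refine mulVec_ext fun Ψ => ?_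
  ext u
  rw [← Matrix.mulVec_mulVec, cnotOp_mulVec hab, cnotOp_mulVec hab]
  simp [hab]

theorem cnotOp_conjTranspose {a b : Fin N} (hab : a ≠ b) : (cnotOp a b)ᴴ = cnotOp a b := by
  ext x y
  have : (y = Function.update x b (xor (x a) (x b))) ↔
      x = Function.update y b (xor (y a) (y b)) := by
    constructor <;> rintro rfl <;> ext r <;> by_cases hr : r = b <;> simp [hr, hab]
  simp only [cnotOp, Matrix.conjTranspose_apply, Matrix.of_apply, this]
  split <;> simp

theorem CliffordGate.conjTranspose_mul_op (g : CliffordGate N) : g.opᴴ * g.op = 1 := by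
  cases g with
  | H q =>
    simp only [CliffordGate.op]
    rw [oneQubit_conjTranspose, oneQubit_mul, hMat_conjTranspose, hMat_mul_self, oneQubit_one]
  | S q =>
    simp only [CliffordGate.op]
    rw [oneQubit_conjTranspose, oneQubit_mul, sMat_conjTranspose_mul, oneQubit_one]
  | CNOT a b hab =>
    simp only [CliffordGate.op]
    rw [cnotOp_conjTranspose hab, cnotOp_mul_self hab]

theorem prodOp_conjTranspose_mul (l : List (CliffordGate N)) : (prodOp l)ᴴ * prodOp l = 1 := by
  induction l with
  | nil => simp
  | cons g l ih =>
    rw [prodOp_cons, Matrix.conjTranspose_mul, Matrix.mul_assoc, ← Matrix.mul_assoc g.opᴴ,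
      g.conjTranspose_mul_op, one_mul, ih]

/-- The inverse of a gate is therefore its cube, and what the gates preserve is also preserved by
their inverses. -/
theorem CliffordGate.op_pow_four (g : CliffordGate N) : g.op * (g.op * (g.op * g.op)) = 1 := by
  cases g with
  | H q => simp only [CliffordGate.op, oneQubit_mul, hMat_mul_self, mul_one, oneQubit_one]
  | S q =>
    simp only [CliffordGate.op, oneQubit_mul]
    rw [show sMat * (sMat * (sMat * sMat)) = 1 by
      ext b c
      cases b <;> cases c <;> simp [sMat], oneQubit_one]
  | CNOT a b hab => simp only [CliffordGate.op, cnotOp_mul_self hab, mul_one]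

/-- The generators of the Pauli group lie in it. -/
theorem xOp_mem (q : Fin N) : oneQubit xMat q ∈ pauliGroup N :=
  Submonoid.subset_closure (.inl (.inr ⟨q, rfl⟩))

theorem zOp_mem (q : Fin N) : oneQubit zMat q ∈ pauliGroup N :=
  Submonoid.subset_closure (.inr ⟨q, rfl⟩)

theorem iOp_mem : Complex.I • (1 : Op N) ∈ pauliGroup N :=
  Submonoid.subset_closure (.inl (.inl rfl))

theorem zOp_mulVec (q : Fin N) (Ψ : Bits N → ℂ) (u : Bits N) :
    (oneQubit zMat q *ᵥ Ψ) u = (if u q = true then -1 else 1) * Ψ u := by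
  rw [oneQubit_mulVec]
  cases h : u q <;> simp [zMat, ← h]

/-- Generators suffice: H exchanges X and Z, S sends X to iXZ, and CNOT spreads X from the control
and Z from the target; every other generator commutes with the gate. The form `g P = Q g` avoids
inverses and composes along a circuit. -/
theorem exists_pauli_comm (g : CliffordGate N) {P : Op N} (hP : P ∈ pauliGroup N) :
    ∃ Q ∈ pauliGroup N, g.op * P = Q * g.op := by
  have I2 : Complex.I * Complex.I = -1 := Complex.I_mul_I
  induction hP using Submonoid.closure_induction with
  | one => exact ⟨1, Submonoid.one_mem _, by simp⟩
  | mul P P' _ _ ih ih' =>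
    obtain ⟨Q, hQ, h⟩ := ih
    obtain ⟨Q', hQ', h'⟩ := ih'
    exact ⟨Q * Q', Submonoid.mul_mem _ hQ hQ', by
      rw [← mul_assoc, h, mul_assoc, h', mul_assoc]⟩
  | mem P hP =>
    rcases hP with (rfl | ⟨q, rfl⟩) | ⟨q, rfl⟩
    · exact ⟨_, iOp_mem, by simp⟩
    · cases g with
      | H a =>
        by_cases hq : a = q
        · subst hq
          refine ⟨_, zOp_mem a, ?_⟩
          simp only [CliffordGate.op, oneQubit_mul]
          congr 1; ext b c
          cases b <;> cases c <;> simp [hMat, xMat, zMat, Matrix.mul_apply, neg_div]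
        · refine ⟨_, xOp_mem q, mulVec_ext fun Ψ => funext fun u => ?_⟩
          simp only [CliffordGate.op, ← Matrix.mulVec_mulVec, oneQubit_mulVec]
          simp [Function.update_of_ne hq, Function.update_of_ne (Ne.symm hq),
            Function.update_comm hq]
          ring
      | S a =>
        by_cases hq : a = q
        · subst hq
          refine ⟨_, Submonoid.mul_mem _ iOp_mem (Submonoid.mul_mem _ (xOp_mem a) (zOp_mem a)), ?_⟩
          simp only [CliffordGate.op, oneQubit_mul, Algebra.smul_mul_assoc, one_mul]
          refine mulVec_ext fun Ψ => funext fun u => ?_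
          rw [Matrix.smul_mulVec]
          simp only [Pi.smul_apply, oneQubit_mulVec]
          cases u a <;> simp [sMat, xMat, zMat, Matrix.mul_apply]
          linear_combination (Ψ (Function.update u a true)) * I2
        · refine ⟨_, xOp_mem q, mulVec_ext fun Ψ => funext fun u => ?_⟩
          simp only [CliffordGate.op, ← Matrix.mulVec_mulVec, oneQubit_mulVec]
          simp [Function.update_of_ne hq, Function.update_of_ne (Ne.symm hq),
            Function.update_comm hq]
          ring
      | CNOT a b hab =>
        by_cases hq : a = q
        · subst hq
          refine ⟨_, Submonoid.mul_mem _ (xOp_mem a) (xOp_mem b),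
            mulVec_ext fun Ψ => funext fun u => ?_⟩
          simp only [CliffordGate.op, ← Matrix.mulVec_mulVec, oneQubit_mulVec, cnotOp_mulVec hab]
          cases h1 : u a <;> cases h2 : u b <;>
            simp [xMat, h1, h2, Function.update_of_ne hab, Function.update_of_ne hab.symm,
              Function.update_comm hab]
        · refine ⟨_, xOp_mem q, mulVec_ext fun Ψ => funext fun u => ?_⟩
          simp only [CliffordGate.op, ← Matrix.mulVec_mulVec, oneQubit_mulVec, cnotOp_mulVec hab]
          by_cases hq' : b = q
          · subst hq'
            cases h1 : u a <;> cases h2 : u b <;>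
              simp [xMat, h1, Function.update_of_ne hq]
          · simp [Function.update_of_ne hq', Function.update_of_ne (Ne.symm hq'),
              Function.update_of_ne hq, Function.update_comm hq']
    · cases g with
      | H a =>
        by_cases hq : a = q
        · subst hq
          refine ⟨_, xOp_mem a, ?_⟩
          simp only [CliffordGate.op, oneQubit_mul]
          congr 1; ext b c
          cases b <;> cases c <;> simp [hMat, xMat, zMat, Matrix.mul_apply, neg_div]
        · refine ⟨_, zOp_mem q, mulVec_ext fun Ψ => funext fun u => ?_⟩
          simp only [CliffordGate.op, ← Matrix.mulVec_mulVec, oneQubit_mulVec]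
          simp [Function.update_of_ne hq, Function.update_of_ne (Ne.symm hq),
            Function.update_comm hq]
          ring
      | S a =>
        by_cases hq : a = q
        · subst hq
          refine ⟨_, zOp_mem a, ?_⟩
          simp only [CliffordGate.op, oneQubit_mul]
          congr 1; ext b c
          cases b <;> cases c <;> simp [sMat, zMat]
        · refine ⟨_, zOp_mem q, mulVec_ext fun Ψ => funext fun u => ?_⟩
          simp only [CliffordGate.op, ← Matrix.mulVec_mulVec, oneQubit_mulVec]
          simp [Function.update_of_ne hq, Function.update_of_ne (Ne.symm hq),
            Function.update_comm hq]
          ring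
      | CNOT a b hab =>
        by_cases hq : b = q
        · subst hq
          refine ⟨_, Submonoid.mul_mem _ (zOp_mem a) (zOp_mem b),
            mulVec_ext fun Ψ => funext fun u => ?_⟩
          simp only [CliffordGate.op, ← Matrix.mulVec_mulVec, zOp_mulVec, cnotOp_mulVec hab]
          cases h1 : u a <;> cases h2 : u b <;> simp
        · refine ⟨_, zOp_mem q, mulVec_ext fun Ψ => funext fun u => ?_⟩
          simp only [CliffordGate.op, ← Matrix.mulVec_mulVec, zOp_mulVec, cnotOp_mulVec hab]
          simp [Function.update_of_ne (Ne.symm hq)]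

theorem isClifford_prodOp (l : List (CliffordGate N)) : IsClifford (prodOp l) := by
  have hu := prodOp_conjTranspose_mul l
  refine ⟨Matrix.mem_unitaryGroup_iff'.2 hu, fun P hP => ?_⟩
  have : ∃ Q ∈ pauliGroup N, prodOp l * P = Q * prodOp l := by
    clear hu
    induction l with
    | nil => exact ⟨P, hP, by simp⟩
    | cons g l ih =>
      obtain ⟨Q, hQ, h⟩ := ih
      obtain ⟨Q', hQ', h'⟩ := exists_pauli_comm g hQ
      exact ⟨Q', hQ', by rw [prodOp_cons, mul_assoc, h, ← mul_assoc, h', mul_assoc]⟩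
  obtain ⟨Q, hQ, h⟩ := this
  have hu' : prodOp l * (prodOp l)ᴴ = 1 := mul_eq_one_comm.1 hu
  rw [h, mul_assoc, hu', mul_one]
  exact hQ

end clifford

end QCSAT

/-! ### Measurement outcomes as pulled-back projectors -/

namespace QCSAT
open Row

/-! ### Masses of measurement outcomes -/

section mass
variable {N : ℕ}

/-- The labels whose bits in `J` vanish. -/
def zeroOn (J : Finset (Fin N)) : Finset (Bits N) :=
  Finset.univ.filter fun u => ∀ j ∈ J, u j = false

/-- The overlap of `V A` and `V B` on the labels that vanish on `J`. -/
noncomputable def overlap (V : Op N) (J : Finset (Fin N)) (A B : Bits N → ℂ) : ℂ :=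
  ∑ u ∈ zeroOn J, star ((V *ᵥ A) u) * (V *ᵥ B) u

/-- The squared norm of the projection of `V Ψ` to the labels that vanish on `J`. -/
noncomputable def mass (V : Op N) (J : Finset (Fin N)) (Ψ : Bits N → ℂ) : ℝ :=
  ∑ u ∈ zeroOn J, ‖(V *ᵥ Ψ) u‖ ^ 2

theorem overlap_self (V : Op N) (J : Finset (Fin N)) (Ψ : Bits N → ℂ) :
    overlap V J Ψ Ψ = (mass V J Ψ : ℂ) := by
  simp only [overlap, mass, Complex.ofReal_sum]
  refine Finset.sum_congr rfl fun u _ => ?_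
  rw [Complex.star_def, ← Complex.normSq_eq_conj_mul_self, Complex.normSq_eq_norm_sq]

theorem mass_nonneg (V : Op N) (J : Finset (Fin N)) (Ψ : Bits N → ℂ) : 0 ≤ mass V J Ψ :=
  Finset.sum_nonneg fun _ _ => by positivity

theorem mass_smul (V : Op N) (J : Finset (Fin N)) (c : ℂ) (Ψ : Bits N → ℂ) :
    mass V J (c • Ψ) = ‖c‖ ^ 2 * mass V J Ψ := by
  simp only [mass, Matrix.mulVec_smul, Pi.smul_apply, smul_eq_mul, norm_mul, mul_pow,
    Finset.mul_sum]

theorem overlap_add_right (V : Op N) (J : Finset (Fin N)) (A B C : Bits N → ℂ) :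
    overlap V J A (B + C) = overlap V J A B + overlap V J A C := by
  simp only [overlap, Matrix.mulVec_add, Pi.add_apply, mul_add, Finset.sum_add_distrib]

theorem overlap_add_left (V : Op N) (J : Finset (Fin N)) (A B C : Bits N → ℂ) :
    overlap V J (A + B) C = overlap V J A C + overlap V J B C := by
  simp only [overlap, Matrix.mulVec_add, Pi.add_apply, star_add, add_mul, Finset.sum_add_distrib]

theorem overlap_neg_right (V : Op N) (J : Finset (Fin N)) (A B : Bits N → ℂ) :
    overlap V J A (-B) = -overlap V J A B := by
  simp only [overlap, Matrix.mulVec_neg, Pi.neg_apply, mul_neg, Finset.sum_neg_distrib]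

/-- The action of `Z` on qubit `w`. -/
def zAct (w : Fin N) (Ψ : Bits N → ℂ) (u : Bits N) : ℂ := bsign 1 (u w) * Ψ u

/-- The action of `X` on qubit `w`. -/
def xAct (w : Fin N) (Ψ : Bits N → ℂ) (u : Bits N) : ℂ := Ψ (Function.update u w (!u w))

theorem act_single (w : Fin N) (Ψ : Bits N → ℂ) : (single w).act Ψ = zAct w Ψ := by
  ext u
  have hs : (single w).shift u = u := by ext q; simp [Row.shift, single]
  have : (single w).sign u = bsign 1 (u w) := by
    rw [Row.sign, Finset.prod_eq_single w]
    · simp [single]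
    · intro q _ hq
      have : (q : ℕ) ≠ w := Fin.val_injective.ne hq
      simp [single, this, bsign_zero]
    · simp
  simp only [Row.act, hs, this, zAct, single_p, pow_zero, one_mul]

theorem act_zAct (r : Row) (w : Fin N) (Ψ : Bits N → ℂ) :
    r.act (zAct w Ψ) = (if r.x w = 1 then (-1 : ℂ) else 1) • zAct w (r.act Ψ) := by
  ext u
  simp only [Row.act, zAct, Pi.smul_apply, smul_eq_mul]
  have : bsign 1 (r.shift u w) = (if r.x w = 1 then (-1 : ℂ) else 1) * bsign 1 (u w) := by
    rw [Row.shift, bsign_xor, mul_comm]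
    by_cases h : r.x w = 1 <;> simp [h, bsign]
  rw [this]; ring

theorem act_xAct (r : Row) (w : Fin N) (hz : r.z w = 0) (Ψ : Bits N → ℂ) :
    r.act (xAct w Ψ) = xAct w (r.act Ψ) := by
  ext u
  have hs : r.shift (Function.update u w (!u w)) =
      Function.update (r.shift u) w (!r.shift u w) := by
    ext q
    by_cases hq : q = w
    · subst hq; simp [Row.shift]
    · simp [Row.shift, hq]
  have hsign : r.sign (Function.update (r.shift u) w (!r.shift u w)) = r.sign (r.shift u) := by
    refine Finset.prod_congr rfl fun q _ => ?_
    by_cases hq : q = w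
    · subst hq; simp [hz, bsign_zero]
    · simp [hq]
  simp only [Row.act, xAct, hs, hsign]

theorem sum_star_unitary {V : Op N} (hV : Vᴴ * V = 1) (A B : Bits N → ℂ) :
    ∑ u, star ((V *ᵥ A) u) * (V *ᵥ B) u = ∑ u, star (A u) * B u := by
  change star (V *ᵥ A) ⬝ᵥ (V *ᵥ B) = star A ⬝ᵥ B
  rw [Matrix.star_mulVec, Matrix.dotProduct_mulVec, Matrix.vecMul_vecMul, hV, Matrix.vecMul_one]

theorem overlap_empty {V : Op N} (hV : Vᴴ * V = 1) (A B : Bits N → ℂ) :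
    overlap V ∅ A B = ∑ u, star (A u) * B u := by
  rw [← sum_star_unitary hV]; simp [overlap, zeroOn]

/-- The row `R j` is `V† Z_j V`. -/
def Pulled (V : Op N) (R : Fin N → Row) : Prop :=
  ∀ j Ψ, V *ᵥ ((R j).act Ψ) = zAct j (V *ᵥ Ψ)

/-- The projector onto `u j = false` is (1 + Z_j)/2, and Z_j V = V R_j. -/
theorem overlap_insert {V : Op N} {R : Fin N → Row} (hR : Pulled V R) {J : Finset (Fin N)}
    (j : Fin N) (A B : Bits N → ℂ) :
    overlap V (insert j J) A B = (overlap V J A B + overlap V J A ((R j).act B)) / 2 := by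
  have : zeroOn (insert j J) = (zeroOn J).filter fun u => u j = false := by
    ext u; simp [zeroOn, and_comm]
  rw [overlap, this, Finset.sum_filter, overlap, overlap, ← Finset.sum_add_distrib,
    Finset.sum_div]
  refine Finset.sum_congr rfl fun u _ => ?_
  rw [hR j, zAct]
  cases h : u j <;> simp [bsign]

/-- By `overlap_insert` the overlap is built from the inner product and the rows of `J` alone, so an
isometry that commutes with these rows cannot change it. -/
theorem overlap_comm {V : Op N} (hV : Vᴴ * V = 1) {R : Fin N → Row} (hR : Pulled V R)
    (P : (Bits N → ℂ) → Bits N → ℂ)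
    (hP : ∀ A B : Bits N → ℂ, ∑ u, star (P A u) * P B u = ∑ u, star (A u) * B u)
    (J : Finset (Fin N)) (hJ : ∀ j ∈ J, ∀ A, (R j).act (P A) = P ((R j).act A))
    (A B : Bits N → ℂ) : overlap V J (P A) (P B) = overlap V J A B := by
  induction J using Finset.induction_on generalizing A B with
  | empty => rw [overlap_empty hV, overlap_empty hV, hP]
  | insert j J _ ih =>
    have ih := ih fun j' hj' => hJ j' (by simp [hj'])
    rw [overlap_insert hR, overlap_insert hR, hJ j (by simp), ih, ih]

theorem zAct_isometry (w : Fin N) (A B : Bits N → ℂ) :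
    ∑ u, star (zAct w A u) * zAct w B u = ∑ u, star (A u) * B u := by
  refine Finset.sum_congr rfl fun u _ => ?_
  cases h : u w <;> simp [zAct, bsign, h]

theorem flip_involutive (w : Fin N) :
    Function.Involutive fun u : Bits N => Function.update u w (!u w) := by
  intro u; simp

theorem xAct_isometry (w : Fin N) (A B : Bits N → ℂ) :
    ∑ u, star (xAct w A u) * xAct w B u = ∑ u, star (A u) * B u :=
  (flip_involutive w).bijective.sum_comp fun u => star (A u) * B u

theorem overlap_zAct {V : Op N} (hV : Vᴴ * V = 1) {R : Fin N → Row} (hR : Pulled V R)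
    {J : Finset (Fin N)} {w : Fin N} (hJ : ∀ j ∈ J, (R j).x w = 0) (A B : Bits N → ℂ) :
    overlap V J (zAct w A) (zAct w B) = overlap V J A B := by
  refine overlap_comm hV hR _ (zAct_isometry w) J (fun j hj A => ?_) A B
  rw [act_zAct, hJ j hj]; simp

/-- A measurement with a uniformly random outcome halves the mass. -/
theorem mass_insert_of_anticomm {V : Op N} (hV : Vᴴ * V = 1) {R : Fin N → Row} (hR : Pulled V R)
    {J : Finset (Fin N)} {j w : Fin N} (hj : (R j).x w = 1) (hJ : ∀ j ∈ J, (R j).x w = 0)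
    {Ψ : Bits N → ℂ} (hΨ : zAct w Ψ = Ψ) : mass V (insert j J) Ψ = mass V J Ψ / 2 := by
  -- Insert Z_w on both sides: it fixes `Ψ`, commutes with the rows of `J`, and picks up a sign when
  -- it passes `R j`.
  have h1 : overlap V J Ψ ((R j).act Ψ) = -overlap V J Ψ ((R j).act Ψ) := by
    conv_lhs => rw [← overlap_zAct hV hR hJ, hΨ]
    conv_rhs => rw [← hΨ, act_zAct, hj]
    rw [← overlap_neg_right, hΨ]
    simp
  have h2 : overlap V J Ψ ((R j).act Ψ) = 0 := by
    have : (2 : ℂ) * overlap V J Ψ ((R j).act Ψ) = 0 := by linear_combination h1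
    simpa using this
  have h3 := overlap_insert hR (J := J) j Ψ Ψ
  rw [h2, add_zero, overlap_self, overlap_self] at h3
  exact_mod_cast h3

/-- The head is removed first. Its ancilla must be unseen by all rows that are still present, while
the ancilla of a later row may meet earlier rows; hence the one-sided pairwise condition. -/
theorem mass_drop_list {V : Op N} (hV : Vᴴ * V = 1) {R : Fin N → Row} (hR : Pulled V R)
    (J : Finset (Fin N)) (l : List (Fin N × Fin N))
    (hl : l.Pairwise fun e e' => (R e'.1).x e.2 = 0) (h1 : ∀ e ∈ l, (R e.1).x e.2 = 1)
    (hJ : ∀ e ∈ l, ∀ j ∈ J, (R j).x e.2 = 0) {Ψ : Bits N → ℂ}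
    (hΨ : ∀ e ∈ l, zAct e.2 Ψ = Ψ) :
    mass V ((l.map Prod.fst).toFinset ∪ J) Ψ = mass V J Ψ / 2 ^ l.length := by
  induction l with
  | nil => simp
  | cons e l ih =>
    rw [List.pairwise_cons] at hl
    rw [List.map_cons, List.toFinset_cons, Finset.insert_union,
      mass_insert_of_anticomm hV hR (h1 e (by simp)) ?_ (hΨ e (by simp)),
      ih hl.2 (fun e' h => h1 e' (by simp [h])) (fun e' h => hJ e' (by simp [h]))
        (fun e' h => hΨ e' (by simp [h])), List.length_cons, pow_succ, div_div]
    intro j hj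
    rw [Finset.mem_union, List.mem_toFinset, List.mem_map] at hj
    rcases hj with ⟨e', he', rfl⟩ | hj
    · exact hl.1 e' he'
    · exact hJ e (by simp) j hj

/-- The part of a vector where the bit `w` is `b`. -/
def bitPart (w : Fin N) (b : Bool) (Ψ : Bits N → ℂ) (u : Bits N) : ℂ := if u w = b then Ψ u else 0

theorem bitPart_add (w : Fin N) (Ψ : Bits N → ℂ) :
    bitPart w false Ψ + bitPart w true Ψ = Ψ := by
  ext u; cases h : u w <;> simp [bitPart, h]

theorem zAct_eq_sub (w : Fin N) (Ψ : Bits N → ℂ) :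
    zAct w Ψ = bitPart w false Ψ - bitPart w true Ψ := by
  ext u; cases h : u w <;> simp [bitPart, h, zAct, bsign]

theorem zAct_bitPart (w : Fin N) (b : Bool) (Ψ : Bits N → ℂ) :
    zAct w (bitPart w b Ψ) = (if b then (-1 : ℂ) else 1) • bitPart w b Ψ := by
  ext u; cases b <;> cases h : u w <;> simp [bitPart, h, zAct, bsign]

/-- The two parts belong to different eigenvalues of Z_w, and Z_w preserves the overlap, so each
cross term equals its own negative. -/
theorem mass_eq_add_of_comm {V : Op N} (hV : Vᴴ * V = 1) {R : Fin N → Row} (hR : Pulled V R)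
    {J : Finset (Fin N)} {w : Fin N} (hJ : ∀ j ∈ J, (R j).x w = 0) (Ψ : Bits N → ℂ) :
    mass V J Ψ = mass V J (bitPart w false Ψ) + mass V J (bitPart w true Ψ) := by
  have c1 : overlap V J (bitPart w false Ψ) (bitPart w true Ψ) = 0 := by
    have := overlap_zAct hV hR hJ (bitPart w false Ψ) (bitPart w true Ψ)
    rw [zAct_bitPart, zAct_bitPart] at this
    simp only [Bool.false_eq_true, if_false, if_true, one_smul, neg_smul, overlap_neg_right] at this
    have : (2 : ℂ) * overlap V J (bitPart w false Ψ) (bitPart w true Ψ) = 0 := by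
      linear_combination -this
    simpa using this
  have c2 : overlap V J (bitPart w true Ψ) (bitPart w false Ψ) = 0 := by
    have := congrArg star c1
    simp only [overlap, star_sum, star_mul', star_star, star_zero] at this ⊢
    rw [← this]
    exact Finset.sum_congr rfl fun u _ => mul_comm _ _
  have : overlap V J Ψ Ψ = overlap V J (bitPart w false Ψ) (bitPart w false Ψ) +
      overlap V J (bitPart w true Ψ) (bitPart w true Ψ) := by
    conv_lhs => rw [← bitPart_add w Ψ, overlap_add_left, overlap_add_right, overlap_add_right,
      c1, c2, add_zero, zero_add]
  rw [overlap_self, overlap_self, overlap_self] at this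
  exact_mod_cast this

/-- Without `z` bits at `w` the rows commute with X_w, which therefore is a symmetry of the mass. -/
theorem mass_xAct {V : Op N} (hV : Vᴴ * V = 1) {R : Fin N → Row} (hR : Pulled V R)
    {J : Finset (Fin N)} {w : Fin N} (hJ : ∀ j ∈ J, (R j).z w = 0) (Ψ : Bits N → ℂ) :
    mass V J (xAct w Ψ) = mass V J Ψ := by
  have := overlap_comm hV hR _ (xAct_isometry w) J (fun j hj A => act_xAct _ _ (hJ j hj) A) Ψ Ψ
  rw [overlap_self, overlap_self] at this
  exact_mod_cast this

/-- On labels with `u j = false`, V Z_w Ψ = V R_j Ψ = Z_j V Ψ = V Ψ. Thus the sum and the difference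
of the images of the two parts agree, and the second image vanishes. -/
theorem mulVec_bitPart_true {V : Op N} {R : Fin N → Row} (hR : Pulled V R)
    {J : Finset (Fin N)} {j w : Fin N} (hj : j ∈ J) {Ψ : Bits N → ℂ}
    (h : (R j).act Ψ = zAct w Ψ) {u : Bits N} (hu : u ∈ zeroOn J) :
    (V *ᵥ bitPart w true Ψ) u = 0 := by
  have huj : u j = false := (Finset.mem_filter.1 hu).2 j hj
  have h1 := congrFun (hR j Ψ) u
  rw [h, zAct_eq_sub, Matrix.mulVec_sub] at h1
  have h2 : (V *ᵥ Ψ) u = (V *ᵥ bitPart w false Ψ) u + (V *ᵥ bitPart w true Ψ) u := by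
    rw [← Pi.add_apply, ← Matrix.mulVec_add, bitPart_add]
  simp only [Pi.sub_apply, zAct, bsign, huj, Bool.false_eq_true, and_false, if_false, one_mul,
    h2] at h1
  have : (2 : ℂ) * (V *ᵥ bitPart w true Ψ) u = 0 := by linear_combination -h1
  simpa using this

theorem mass_bitPart_of_stabilizer {V : Op N} {R : Fin N → Row} (hR : Pulled V R)
    {J : Finset (Fin N)} {j w : Fin N} (hj : j ∈ J) {Ψ : Bits N → ℂ}
    (h : (R j).act Ψ = zAct w Ψ) :
    mass V J Ψ = mass V J (bitPart w false Ψ) ∧ mass V J (bitPart w true Ψ) = 0 := by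
  have key := fun u => mulVec_bitPart_true hR hj h (u := u)
  constructor
  · refine Finset.sum_congr rfl fun u hu => ?_
    conv_lhs => rw [← bitPart_add w Ψ, Matrix.mulVec_add, Pi.add_apply, key u hu, add_zero]
  · refine Finset.sum_eq_zero fun u hu => ?_
    rw [key u hu]; simp

/-- A CNOT inside `J` fixes every label that vanishes on `J`. Composing V with it replaces the row
of the target by its product with the row of the control, so rows may be multiplied freely. -/
theorem mass_cnot {V : Op N} {J : Finset (Fin N)} {a b : Fin N} (hab : a ≠ b) (ha : a ∈ J)
    (hb : b ∈ J) (Ψ : Bits N → ℂ) : mass (cnotOp a b * V) J Ψ = mass V J Ψ := by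
  refine Finset.sum_congr rfl fun u hu => ?_
  have h := (Finset.mem_filter.1 hu).2
  rw [← Matrix.mulVec_mulVec, cnotOp_mulVec hab, h a ha, h b hb]
  congr 3
  ext q
  by_cases hq : q = b
  · subst hq; simp [h q hb]
  · simp [hq]

end mass

end QCSAT

/-! ### Gates on blocks of qubits and the magic state gadget -/

namespace QCSAT
open Row

/-! ### Gates on some of the qubits -/

section embed
variable {a b : ℕ}

/-- A gate on the first `a` of `b` qubits. -/
def CliffordGate.embed (h : a ≤ b) : CliffordGate a → CliffordGate b
  | .H q => .H (q.castLE h)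
  | .S q => .S (q.castLE h)
  | .CNOT c d hcd => .CNOT (c.castLE h) (d.castLE h) fun e => hcd (Fin.castLE_injective h e)

theorem CliffordGate.embed_code (h : a ≤ b) (g : CliffordGate a) : (g.embed h).code = g.code := by
  cases g <;> rfl

/-- The labels of the first `a` qubits. -/
def restrictBits (h : a ≤ b) (u : Bits b) : Bits a := fun q => u (q.castLE h)

/-- Replace the labels of the first `a` qubits. -/
def glue (y : Bits a) (u : Bits b) : Bits b := fun q => if h : q.val < a then y ⟨q, h⟩ else u q

theorem glue_restrictBits (h : a ≤ b) (u : Bits b) : glue (restrictBits h u) u = u := by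
  ext q; by_cases hq : q.val < a <;> simp [glue, restrictBits, hq]

theorem restrictBits_glue (h : a ≤ b) (y : Bits a) (u : Bits b) :
    restrictBits h (glue y u) = y := by
  ext q; simp [glue, restrictBits]

theorem glue_update (h : a ≤ b) (y : Bits a) (u : Bits b) (q : Fin a) (v : Bool) :
    Function.update (glue y u) (q.castLE h) v = glue (Function.update y q v) u := by
  ext r
  by_cases hr : r = q.castLE h
  · subst hr; simp [glue]
  · by_cases hra : r.val < a
    · have : (⟨r, hra⟩ : Fin a) ≠ q := by rintro rfl; exact hr rfl
      simp [glue, hr, hra, this]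
    · simp [glue, hr, hra]

theorem glue_castLE (h : a ≤ b) (y : Bits a) (u : Bits b) (q : Fin a) :
    glue y u (q.castLE h) = y q := by simp [glue]

theorem CliffordGate.embed_op_glue (h : a ≤ b) (g : CliffordGate a) (Φ : Bits b → ℂ)
    (y : Bits a) (u : Bits b) :
    ((g.embed h).op *ᵥ Φ) (glue y u) = (g.op *ᵥ fun y' => Φ (glue y' u)) y := by
  cases g with
  | H q => simp only [embed, op, oneQubit_mulVec, glue_update, glue_castLE]
  | S q => simp only [embed, op, oneQubit_mulVec, glue_update, glue_castLE]
  | CNOT c d hcd =>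
    simp only [embed, op]
    rw [cnotOp_mulVec hcd, cnotOp_mulVec fun e => hcd (Fin.castLE_injective h e), glue_update,
      glue_castLE, glue_castLE]

/-- A function that does not depend on the qubits in `P`. -/
def IndepOf (P : ℕ → Prop) (α : Bits b → ℂ) : Prop :=
  ∀ q : Fin b, P q → ∀ u v, α (Function.update u q v) = α u

theorem IndepOf.mul {P : ℕ → Prop} {α β : Bits b → ℂ} (hα : IndepOf P α) (hβ : IndepOf P β) :
    IndepOf P (fun u => α u * β u) := fun q hq u v => by simp only [hα q hq, hβ q hq]

/-- A factor that ignores the qubits of the gate is a scalar for it. This is the tensor product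
structure, without naming tensor products. -/
theorem op_mul_of_indep {P : ℕ → Prop} {g : CliffordGate b} (hg : GateIn P g.code)
    {A : Bits b → ℂ} (hA : IndepOf P A) (α : Bits b → ℂ) :
    g.op *ᵥ (fun u => A u * α u) = fun u => A u * (g.op *ᵥ α) u := by
  ext u
  cases g with
  | H q =>
    have := hA q hg.1
    simp only [CliffordGate.op, oneQubit_mulVec, this]; ring
  | S q =>
    have := hA q hg.1
    simp only [CliffordGate.op, oneQubit_mulVec, this]; ring
  | CNOT c d hcd =>
    have := hA d (hg.2.elim (fun h => absurd h.1 (by simp [CliffordGate.code])) fun h => h.2.1)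
    simp only [CliffordGate.op, cnotOp_mulVec hcd, this]

theorem prodOp_mul_of_indep {P : ℕ → Prop} {l : List (CliffordGate b)}
    (hl : ∀ g ∈ l, GateIn P g.code) {A : Bits b → ℂ} (hA : IndepOf P A) (α : Bits b → ℂ) :
    prodOp l *ᵥ (fun u => A u * α u) = fun u => A u * (prodOp l *ᵥ α) u := by
  induction l with
  | nil => simp
  | cons g l ih =>
    rw [prodOp_cons, ← Matrix.mulVec_mulVec, ih fun g' h => hl g' (by simp [h]),
      op_mul_of_indep (hl g (by simp)) hA]
    simp only [← Matrix.mulVec_mulVec]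

theorem IndepOf.op {P P' : ℕ → Prop} {g : CliffordGate b} (hg : GateIn P g.code)
    (hP : ∀ q, P' q → ¬ P q) {α : Bits b → ℂ} (hα : IndepOf P' α) : IndepOf P' (g.op *ᵥ α) := by
  intro q hq u v
  have ne : ∀ r : Fin b, P r → r ≠ q := fun r hr e => hP q hq (e ▸ hr)
  cases g with
  | H c =>
    have := ne c hg.1
    simp only [CliffordGate.op, oneQubit_mulVec, Function.update_comm this.symm, hα q hq,
      Function.update_of_ne this]
  | S c =>
    have := ne c hg.1
    simp only [CliffordGate.op, oneQubit_mulVec, Function.update_comm this.symm, hα q hq,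
      Function.update_of_ne this]
  | CNOT c d hcd =>
    have h1 := ne c hg.1
    have h2 := ne d (hg.2.elim (fun h => absurd h.1 (by simp [CliffordGate.code])) fun h => h.2.1)
    simp only [CliffordGate.op, cnotOp_mulVec hcd, Function.update_comm h2.symm, hα q hq,
      Function.update_of_ne h1, Function.update_of_ne h2]

/-- Each gate is inverted by its cube, which keeps a vector independent of the qubits in `P'`.
Applied to the magic state, this moves a circuit on the magic qubits from the input vector into the
operator. -/
theorem exists_preimage {P P' : ℕ → Prop} {l : List (CliffordGate b)}
    (hl : ∀ g ∈ l, GateIn P g.code) (hP : ∀ q, P' q → ¬ P q) {α : Bits b → ℂ}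
    (hα : IndepOf P' α) : ∃ α', IndepOf P' α' ∧ prodOp l *ᵥ α' = α := by
  induction l generalizing α with
  | nil => exact ⟨α, hα, by simp⟩
  | cons g l ih =>
    have hg := hl g (by simp)
    have h1 := ((hα.op hg hP).op hg hP).op hg hP
    obtain ⟨α', h', e⟩ := ih (fun g' h => hl g' (by simp [h])) h1
    refine ⟨α', h', ?_⟩
    rw [prodOp_cons, ← Matrix.mulVec_mulVec, e, Matrix.mulVec_mulVec, Matrix.mulVec_mulVec,
      Matrix.mulVec_mulVec, mul_assoc, mul_assoc, g.op_pow_four, Matrix.one_mulVec]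

/-- A vector on the first `a` of `b` qubits, times a function of the labels. -/
def extend (h : a ≤ b) (ψ : Bits a → ℂ) (β : Bits b → ℂ) (u : Bits b) : ℂ :=
  ψ (restrictBits h u) * β u

theorem IndepOf.glue {β : Bits b → ℂ} (hβ : IndepOf (· < a) β) (y : Bits a) (u : Bits b) :
    β (QCSAT.glue y u) = β u := by
  have key : ∀ (s : Finset (Fin b)) (u u' : Bits b), (∀ q ∈ s, q.val < a) →
      (∀ q, q ∉ s → u q = u' q) → β u = β u' := by
    intro s
    induction s using Finset.induction_on with
    | empty =>
      intro u u' _ h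
      rw [show u = u' from funext fun q => h q (by simp)]
    | insert q s hq ih =>
      intro u u' hs h
      rw [← hβ q (hs q (by simp)) u (u' q)]
      refine ih _ _ (fun q' h' => hs q' (by simp [h'])) fun q' h' => ?_
      by_cases e : q' = q
      · subst e; simp
      · rw [Function.update_of_ne e, h q' (by simp [e, h'])]
  refine key (Finset.univ.filter fun q => q.val < a) _ _ (by simp) fun q hq => ?_
  have : ¬ q.val < a := by simpa using hq
  simp [QCSAT.glue, this]

theorem embed_op_extend (h : a ≤ b) (g : CliffordGate a) (ψ : Bits a → ℂ) {β : Bits b → ℂ}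
    (hβ : IndepOf (· < a) β) :
    (g.embed h).op *ᵥ extend h ψ β = extend h (g.op *ᵥ ψ) β := by
  ext u
  conv_lhs => rw [← glue_restrictBits h u]
  rw [CliffordGate.embed_op_glue]
  have : (fun y' => extend h ψ β (glue y' u)) = β u • ψ := by
    ext y'
    simp only [extend, restrictBits_glue, hβ.glue, Pi.smul_apply, smul_eq_mul]; ring
  rw [this, Matrix.mulVec_smul]
  simp only [extend, Pi.smul_apply, smul_eq_mul]; ring

theorem embed_prodOp_extend (h : a ≤ b) (l : List (CliffordGate a)) (ψ : Bits a → ℂ)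
    {β : Bits b → ℂ} (hβ : IndepOf (· < a) β) :
    prodOp (l.map (CliffordGate.embed h)) *ᵥ extend h ψ β = extend h (prodOp l *ᵥ ψ) β := by
  induction l with
  | nil => simp
  | cons g l ih =>
    rw [List.map_cons, prodOp_cons, ← Matrix.mulVec_mulVec, ih, embed_op_extend h g _ hβ,
      Matrix.mulVec_mulVec, prodOp_cons]

/-- Every valid code describes a gate. -/
theorem exists_gate {N : ℕ} {g : ℕ × ℕ × ℕ} (hg : GateIn (· < N) g) :
    ∃ g' : CliffordGate N, g'.code = g := by
  refine hg.cases (C := fun g => ∃ g' : CliffordGate N, g'.code = g) ?_ ?_ ?_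
  · exact fun a ha => ⟨.H ⟨a, ha⟩, rfl⟩
  · exact fun a ha => ⟨.S ⟨a, ha⟩, rfl⟩
  · exact fun a b ha hb hab => ⟨.CNOT ⟨a, ha⟩ ⟨b, hb⟩ (by simpa using hab), rfl⟩

theorem exists_gates {N : ℕ} {l : List (ℕ × ℕ × ℕ)} (hl : ∀ g ∈ l, GateIn (· < N) g) :
    ∃ l' : List (CliffordGate N), l'.map CliffordGate.code = l := by
  induction l with
  | nil => exact ⟨[], rfl⟩
  | cons g l ih =>
    obtain ⟨g', h⟩ := exists_gate (hl g (by simp))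
    obtain ⟨l', h'⟩ := ih fun g' h => hl g' (by simp [h])
    exact ⟨g' :: l', by simp [h, h']⟩

theorem CliffordGate.code_gateIn {N : ℕ} (g : CliffordGate N) : GateIn (· < N) g.code := by
  cases g with
  | H q => exact ⟨q.2, .inl ⟨by simp [code], rfl⟩⟩
  | S q => exact ⟨q.2, .inl ⟨by simp [code], rfl⟩⟩
  | CNOT c d h => exact ⟨c.2, .inr ⟨rfl, d.2, Fin.val_injective.ne h⟩⟩

end embed

/-! ### The gadget for the T gates -/

section gadget
variable {N t : ℕ}

/-- A gate, where a T gate becomes a CNOT whose target is the magic qubit number `c`. -/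
def gadgetGate (t c : ℕ) : Gate N → CliffordGate (N + t)
  | .clifford g => g.embed (Nat.le_add_right N t)
  | .T q => if h : c < t then
      .CNOT (q.castLE (Nat.le_add_right N t)) ⟨N + c, by omega⟩ (by simp [Fin.ext_iff]; omega)
    -- A filler that makes the map total; a circuit with at most `t` T gates never gets here.
    else .S (q.castLE (Nat.le_add_right N t))

/-- A circuit, where the T gates become CNOTs on magic qubits. -/
def gadget (t : ℕ) : List (Gate N) → List (CliffordGate (N + t))
  | [] => []
  -- A T gate uses the magic qubit whose number is the count of T gates after it. The qubits are
  -- thus used up from the highest number down, which suits induction on the list.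
  | g :: l => gadgetGate t (l.countP Gate.isT) g :: gadget t l

/-- The amplitudes of the magic state. -/
noncomputable def magicAmp (b : Bool) : ℂ :=
  if b then Complex.exp (Complex.I * (Real.pi / 4)) else 1

/-- The product of the amplitudes of the first `c` magic qubits. -/
noncomputable def magic (c : ℕ) (u : Bits (N + t)) : ℂ :=
  ∏ i : Fin t, if i.val < c then magicAmp (u (Fin.natAdd N i)) else 1

theorem magic_update {c : ℕ} {q : Fin (N + t)} (hq : q.val < N) (u : Bits (N + t)) (b : Bool) :
    magic c (Function.update u q b) = magic c u := by
  refine Finset.prod_congr rfl fun i _ => ?_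
  have : Fin.natAdd N i ≠ q := by intro h; rw [Fin.ext_iff, Fin.val_natAdd] at h; omega
  simp [this]

theorem magic_indep (c : ℕ) : IndepOf (· < N) (magic c : Bits (N + t) → ℂ) :=
  fun _ hq u v => magic_update hq u v

/-- Projecting the target of the CNOT onto 0 forces its original bit to equal the bit of the
control, which leaves the amplitude 1 or exp(iπ/4), the action of T. Only labels that vanish on the
spent magic qubits survive, so nothing is assumed about `Φ` on other labels. -/
theorem gadget_spec (l : List (Gate N)) (hl : l.countP Gate.isT ≤ t) (ψ : Bits N → ℂ)
    (Φ : Bits (N + t) → ℂ)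
    (hΦ : ∀ u, (∀ i : Fin t, l.countP Gate.isT ≤ i.val → u (Fin.natAdd N i) = false) →
      Φ u = ψ (restrictBits (Nat.le_add_right N t) u) * magic (l.countP Gate.isT) u)
    (u : Bits (N + t)) (hu : ∀ i : Fin t, u (Fin.natAdd N i) = false) :
    (prodOp (gadget t l).reverse *ᵥ Φ) u =
      (circuitOp l *ᵥ ψ) (restrictBits (Nat.le_add_right N t) u) := by
  induction l generalizing ψ Φ with
  | nil =>
    simp only [gadget, List.reverse_nil, prodOp_nil, Matrix.one_mulVec, circuitOp]
    rw [hΦ u fun i _ => hu i]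
    simp [magic]
  | cons g l ih =>
    simp only [gadget, List.reverse_cons, prodOp_append, prodOp_cons, prodOp_nil, mul_one,
      circuitOp, ← Matrix.mulVec_mulVec]
    cases g with
    | clifford g =>
      simp only [List.countP_cons, Gate.isT, Bool.false_eq_true, if_false, add_zero] at hl hΦ
      refine ih hl _ _ fun u hu => ?_
      conv_lhs => rw [← glue_restrictBits (Nat.le_add_right N t) u]
      simp only [gadgetGate, Gate.op]
      rw [CliffordGate.embed_op_glue]
      have : (fun y' => Φ (glue y' u)) = magic (l.countP Gate.isT) u • ψ := by
        ext y'
        rw [hΦ, restrictBits_glue, (magic_indep _).glue, Pi.smul_apply, smul_eq_mul, mul_comm]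
        intro i hi
        simp [glue, hu i hi]
      rw [this, Matrix.mulVec_smul, Pi.smul_apply, smul_eq_mul, mul_comm]
    | T q =>
      simp only [List.countP_cons, Gate.isT, if_true] at hl hΦ
      set c := l.countP Gate.isT with hc
      have hct : c < t := by omega
      refine ih (by omega) _ _ fun u hu => ?_
      set qc : Fin (N + t) := ⟨N + c, by omega⟩ with hqc
      set q' := q.castLE (Nat.le_add_right N t) with hq'
      have hne : q' ≠ qc := by simp only [hq', hqc, ne_eq, Fin.ext_iff, Fin.val_castLE]; omega
      have hqc' : qc = Fin.natAdd N ⟨c, hct⟩ := rfl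
      simp only [gadgetGate, hct, dif_pos, CliffordGate.op]
      rw [cnotOp_mulVec hne, hqc', hu ⟨c, hct⟩ le_rfl, ← hqc', Bool.xor_false, hΦ]
      · have h1 : restrictBits (Nat.le_add_right N t) (Function.update u qc (u q')) =
            restrictBits (Nat.le_add_right N t) u := by
          ext r
          have : r.castLE (Nat.le_add_right N t) ≠ qc := by
            simp only [hqc, ne_eq, Fin.ext_iff, Fin.val_castLE]; omega
          simp [restrictBits, this]
        have h2 : magic (c + 1) (Function.update u qc (u q')) = magicAmp (u q') * magic c u := by
          rw [magic, magic, ← Finset.mul_prod_erase _ _ (Finset.mem_univ (⟨c, hct⟩ : Fin t)),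
            ← Finset.mul_prod_erase _ _ (Finset.mem_univ (⟨c, hct⟩ : Fin t))]
          simp only [← hqc', Function.update_self, lt_add_iff_pos_right, Nat.one_pos, if_true,
            lt_irrefl, if_false, one_mul]
          congr 1
          refine Finset.prod_congr rfl fun i hi => ?_
          have hi := Finset.ne_of_mem_erase hi
          have h3 : Fin.natAdd N i ≠ qc := by
            rw [hqc']; intro e
            exact hi (by simpa [Fin.ext_iff] using e)
          have h4 : (i : ℕ) ≠ c := by intro e; exact hi (Fin.ext e)
          have h5 : ((i : ℕ) < c + 1) ↔ (i : ℕ) < c := by omega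
          simp [h3, h5]
        rw [h1, h2]
        simp only [Gate.op, oneQubit_mulVec]
        have h3 : restrictBits (Nat.le_add_right N t) u q = u q' := rfl
        rw [h3]
        have h4 : Function.update (restrictBits (Nat.le_add_right N t) u) q (u q') =
            restrictBits (Nat.le_add_right N t) u := by rw [← h3]; simp
        cases h : u q' <;> rw [h] at h4 <;> simp [tMat, h4, magicAmp] <;> ring
      · intro i hi
        have h3 : Fin.natAdd N i ≠ qc := by
          rw [hqc']; intro e
          simp [Fin.ext_iff] at e; omega
        rw [Function.update_of_ne h3]
        exact hu i (by omega)

end gadget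

end QCSAT

/-! ### From rows to optimal witness states -/

namespace QCSAT
open Row

/-! ### Optimal witnesses from rows -/

/-- The squared norm. -/
noncomputable def normSum {n : ℕ} (ψ : Bits n → ℂ) : ℝ := ∑ y, ‖ψ y‖ ^ 2

theorem normSum_nonneg {n : ℕ} (ψ : Bits n → ℂ) : 0 ≤ normSum ψ :=
  Finset.sum_nonneg fun _ _ => by positivity

theorem normSum_smul {n : ℕ} (c : ℂ) (ψ : Bits n → ℂ) :
    normSum (c • ψ) = ‖c‖ ^ 2 * normSum ψ := by
  simp only [normSum, Pi.smul_apply, smul_eq_mul, norm_mul, mul_pow, Finset.mul_sum]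

theorem normSum_eq_zero {n : ℕ} {ψ : Bits n → ℂ} (h : normSum ψ = 0) : ψ = 0 := by
  ext y
  have := (Finset.sum_eq_zero_iff_of_nonneg (fun _ _ => by positivity)).1 h y (Finset.mem_univ y)
  simpa using this

theorem normSum_bitPart {n : ℕ} (w : Fin n) (ψ : Bits n → ℂ) :
    normSum (bitPart w false ψ) + normSum (bitPart w true ψ) = normSum ψ := by
  simp only [normSum, ← Finset.sum_add_distrib]
  refine Finset.sum_congr rfl fun y _ => ?_
  cases h : y w <;> simp [bitPart, h]

theorem normSum_xAct {n : ℕ} (w : Fin n) (ψ : Bits n → ℂ) : normSum (xAct w ψ) = normSum ψ :=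
  (flip_involutive w).bijective.sum_comp fun u => ‖ψ u‖ ^ 2

/-- The vector has the bits from `w` on equal to `0`. -/
def ZeroFrom {n : ℕ} (w : ℕ) (ψ : Bits n → ℂ) : Prop :=
  ∀ y, (∃ q : Fin n, w ≤ q.val ∧ y q = true) → ψ y = 0

theorem ZeroFrom.smul {n w : ℕ} {ψ : Bits n → ℂ} (h : ZeroFrom w ψ) (c : ℂ) :
    ZeroFrom w (c • ψ) := fun y hy => by simp [h y hy]

theorem ZeroFrom.bitPart_false {n : ℕ} {w : Fin n} {ψ : Bits n → ℂ}
    (h : ZeroFrom (w.val + 1) ψ) : ZeroFrom w.val (bitPart w false ψ) := by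
  rintro y ⟨q, hq, hy⟩
  by_cases e : q = w
  · subst e; simp [bitPart, hy]
  · have : w.val ≠ q.val := fun h => e (Fin.ext h.symm)
    simp [bitPart, h y ⟨q, by omega, hy⟩]

theorem ZeroFrom.xAct_bitPart_true {n : ℕ} {w : Fin n} {ψ : Bits n → ℂ}
    (h : ZeroFrom (w.val + 1) ψ) : ZeroFrom w.val (xAct w (bitPart w true ψ)) := by
  rintro y ⟨q, hq, hy⟩
  by_cases e : q = w
  · subst e; simp [bitPart, xAct, hy]
  · have hne : w.val ≠ q.val := fun h => e (Fin.ext h.symm)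
    simp only [xAct, bitPart]
    rw [h _ ⟨q, by omega, by simp [e, hy]⟩]
    simp

theorem exists_unit {n : ℕ} {w : ℕ} {μ : (Bits n → ℂ) → ℝ} (hμ : ∀ (c : ℂ) ψ, μ (c • ψ) = ‖c‖ ^ 2 * μ ψ)
    {ψ : Bits n → ℂ} (h : ZeroFrom w ψ) (h0 : normSum ψ ≠ 0) :
    ∃ ψ', normSum ψ' = 1 ∧ ZeroFrom w ψ' ∧ μ ψ = normSum ψ * μ ψ' := by
  have hpos : 0 < normSum ψ := lt_of_le_of_ne (normSum_nonneg _) (Ne.symm h0)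
  set c : ℂ := (((Real.sqrt (normSum ψ))⁻¹ : ℝ) : ℂ)
  have hc : ‖c‖ ^ 2 = (normSum ψ)⁻¹ := by
    rw [Complex.norm_real, Real.norm_eq_abs, sq_abs, inv_pow, Real.sq_sqrt hpos.le]
  refine ⟨c • ψ, ?_, h.smul c, ?_⟩
  · rw [normSum_smul, hc, inv_mul_cancel₀ h0]
  · rw [hμ, hc, mul_inv_cancel_left₀ h0]

theorem exists_zeroFrom_unit (n w : ℕ) : ∃ ψ : Bits n → ℂ, normSum ψ = 1 ∧ ZeroFrom w ψ := by
  refine ⟨Pi.single (fun _ => false) 1, ?_, ?_⟩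
  · rw [normSum, Finset.sum_eq_single fun _ => false] <;> simp +contextual
  · rintro y ⟨q, -, hq⟩
    rw [Pi.single_eq_of_ne]
    rintro rfl
    simp at hq

/-- Setting one bit to `0` without decreasing the value. -/
theorem exists_zero_bit {n : ℕ} {w : Fin n} {μ : (Bits n → ℂ) → ℝ} (h0 : ∀ ψ, 0 ≤ μ ψ)
    (hμ : ∀ (c : ℂ) ψ, μ (c • ψ) = ‖c‖ ^ 2 * μ ψ) {ψ : Bits n → ℂ} (hz : ZeroFrom (w.val + 1) ψ)
    (h1 : normSum ψ = 1) (hadd : μ ψ = μ (bitPart w false ψ) + μ (bitPart w true ψ))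
    (hb : μ (bitPart w true ψ) = 0 ∨ μ (xAct w (bitPart w true ψ)) = μ (bitPart w true ψ)) :
    ∃ ψ', normSum ψ' = 1 ∧ ZeroFrom w.val ψ' ∧ μ ψ ≤ μ ψ' := by
  have hn := normSum_bitPart w ψ
  set a := normSum (bitPart w false ψ)
  set b := normSum (bitPart w true ψ) with hbdef
  rw [h1] at hn
  have ha0 : 0 ≤ a := normSum_nonneg _
  have hb0 : 0 ≤ b := normSum_nonneg _
  have hμ0 : μ (0 : Bits n → ℂ) = 0 := by have := hμ 0 0; simpa using this
  -- The value of `ψ` is at most `a * μ χ₀ + b * μ χ₁` with `a + b = 1` and unit vectors `χ₀`, `χ₁`,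
  -- so the better of the two will do. If a part vanishes or has value 0, any unit vector takes its
  -- place; otherwise the part with bit 1 is first flipped by X.
  obtain ⟨χ₀, n₀, z₀, e₀⟩ : ∃ χ, normSum χ = 1 ∧ ZeroFrom w.val χ ∧
      μ (bitPart w false ψ) ≤ a * μ χ := by
    by_cases ha : a = 0
    · obtain ⟨χ, h, h'⟩ := exists_zeroFrom_unit n w.val
      refine ⟨χ, h, h', ?_⟩
      rw [normSum_eq_zero ha, hμ0, ha, zero_mul]
    · obtain ⟨χ, h, h', e⟩ := exists_unit hμ hz.bitPart_false ha
      exact ⟨χ, h, h', e.le⟩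
  obtain ⟨χ₁, n₁, z₁, e₁⟩ : ∃ χ, normSum χ = 1 ∧ ZeroFrom w.val χ ∧
      μ (bitPart w true ψ) ≤ b * μ χ := by
    rcases hb with hb | hb
    · obtain ⟨χ, h, h'⟩ := exists_zeroFrom_unit n w.val
      exact ⟨χ, h, h', by rw [hb]; exact mul_nonneg hb0 (h0 _)⟩
    · by_cases hb' : b = 0
      · obtain ⟨χ, h, h'⟩ := exists_zeroFrom_unit n w.val
        refine ⟨χ, h, h', ?_⟩
        rw [normSum_eq_zero hb', hμ0, hb', zero_mul]
      · have hx : normSum (xAct w (bitPart w true ψ)) = b := normSum_xAct _ _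
        obtain ⟨χ, h, h', e⟩ := exists_unit hμ hz.xAct_bitPart_true (by rwa [hx])
        exact ⟨χ, h, h', by rw [← hb, e, hx]⟩
  rcases le_total (μ χ₀) (μ χ₁) with h | h
  · exact ⟨χ₁, n₁, z₁, by
      have := mul_le_mul_of_nonneg_left h ha0
      have : μ χ₁ = a * μ χ₁ + b * μ χ₁ := by rw [← add_mul, hn, one_mul]
      linarith⟩
  · exact ⟨χ₀, n₀, z₀, by
      have := mul_le_mul_of_nonneg_left h hb0
      have : μ χ₀ = a * μ χ₀ + b * μ χ₀ := by rw [← add_mul, hn, one_mul]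
      linarith⟩

section semantics
variable {n m t : ℕ}

theorem le_total_qubits (n m t : ℕ) : n ≤ n + m + t := by omega

/-- `X` gates on the qubits of a list. -/
def xGates (t : ℕ) (outs : List (Fin (n + m))) : List (CliffordGate (n + m + t)) :=
  outs.flatMap fun q =>
    [.H (q.castLE (Nat.le_add_right _ t)), .S (q.castLE (Nat.le_add_right _ t)),
      .S (q.castLE (Nat.le_add_right _ t)), .H (q.castLE (Nat.le_add_right _ t))]

/-- The Clifford part of the circuit, in the order of pull-backs. -/
def baseGates (t : ℕ) (circ : List (Gate (n + m))) (outs : List (Fin (n + m))) :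
    List (CliffordGate (n + m + t)) :=
  xGates t outs ++ (gadget t circ).reverse

/-- The measured qubits: the output qubits and the magic qubits. -/
def rowQubits (t : ℕ) (outs : List (Fin (n + m))) : List (Fin (n + m + t)) :=
  outs.map (Fin.castLE (Nat.le_add_right _ t)) ++ (List.finRange t).map (Fin.natAdd (n + m))

/-- The witness followed by zeros. -/
def pad (ψ : Bits n → ℂ) (x : Bits (n + m)) : ℂ :=
  if ∀ i : Fin (n + m), n ≤ i.val → x i = false then ψ (restrictBits (Nat.le_add_right n m) x)
  else 0

/-- The acceptance probability, on functions. -/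
noncomputable def accProb (circ : List (Gate (n + m))) (outs : List (Fin (n + m)))
    (ψ : Bits n → ℂ) : ℝ :=
  ∑ x : Bits (n + m) with ∀ q ∈ outs, x q = true, ‖(circuitOp circ *ᵥ pad ψ) x‖ ^ 2

/-- S² = Z and H Z H = X. -/
theorem xGate_mulVec {N : ℕ} (q : Fin N) (Ψ : Bits N → ℂ) :
    prodOp [.H q, .S q, .S q, .H q] *ᵥ Ψ = xAct q Ψ := by
  have : prodOp [.H q, .S q, .S q, .H q] = oneQubit (hMat * (sMat * (sMat * hMat))) q := by
    simp only [prodOp_cons, prodOp_nil, mul_one, CliffordGate.op, oneQubit_mul]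
  have hx : hMat * (sMat * (sMat * hMat)) = xMat := by
    have s2 : sMat * (sMat * hMat) = zMat * hMat := by
      rw [← mul_assoc]; congr 1
      ext b c
      cases b <;> cases c <;> simp [sMat, zMat]
    rw [s2]
    have hz : zMat * hMat = hMat * xMat := by
      ext b c
      cases b <;> cases c <;> simp [zMat, xMat, hMat, Matrix.mul_apply, neg_div]
    rw [hz, ← mul_assoc, hMat_mul_self, one_mul]
  rw [this, hx]
  ext u
  rw [oneQubit_mulVec]
  cases h : u q <;> simp [xMat, xAct, h]

theorem xGates_mulVec (outs : List (Fin (n + m))) (hn : outs.Nodup)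
    (Ψ : Bits (n + m + t) → ℂ) (u : Bits (n + m + t)) :
    (prodOp (xGates t outs) *ᵥ Ψ) u = Ψ fun q =>
      if ∃ q' ∈ outs, q = q'.castLE (Nat.le_add_right _ t) then !u q else u q := by
  induction outs generalizing u with
  | nil => simp [xGates]
  | cons q outs ih =>
    rw [List.nodup_cons] at hn
    have : xGates t (q :: outs) = [.H (q.castLE (Nat.le_add_right _ t)),
        .S (q.castLE (Nat.le_add_right _ t)), .S (q.castLE (Nat.le_add_right _ t)),
        .H (q.castLE (Nat.le_add_right _ t))] ++ xGates t outs := rfl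
    rw [this, prodOp_append, ← Matrix.mulVec_mulVec, xGate_mulVec, xAct, ih hn.2]
    congr 1
    ext r
    by_cases hr : r = q.castLE (Nat.le_add_right _ t)
    · subst hr
      have : ¬ ∃ q' ∈ outs, q.castLE (Nat.le_add_right (n + m) t) =
          q'.castLE (Nat.le_add_right _ t) := by
        rintro ⟨q', hq', e⟩
        exact hn.1 ((Fin.castLE_injective _ e) ▸ hq')
      simp [hn.1]
    · simp [hr]

theorem mem_rowQubits {outs : List (Fin (n + m))} {q : Fin (n + m + t)} :
    q ∈ rowQubits t outs ↔
      (∃ q' ∈ outs, q'.castLE (Nat.le_add_right _ t) = q) ∨ ∃ i, Fin.natAdd (n + m) i = q := by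
  simp [rowQubits]

theorem rowQubits_nodup {outs : List (Fin (n + m))} (h : outs.Nodup) :
    (rowQubits t outs).Nodup := by
  refine List.Nodup.append (h.map (Fin.castLE_injective _))
    ((List.nodup_finRange t).map (Fin.natAdd_injective _ _)) ?_
  rintro q h1 h2
  simp only [List.mem_map, List.mem_finRange, true_and] at h1 h2
  obtain ⟨a, -, rfl⟩ := h1
  obtain ⟨b, hb⟩ := h2
  simp [Fin.ext_iff] at hb
  omega

/-- The acceptance probability as the mass of the measurement outcome `0` for the gadget
circuit. -/
theorem mass_baseGates (circ : List (Gate (n + m))) (ht : circ.countP Gate.isT = t)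
    (outs : List (Fin (n + m))) (hn : outs.Nodup) (ψ : Bits n → ℂ) :
    mass (prodOp (baseGates t circ outs)) (rowQubits t outs).toFinset
      (extend (Nat.le_add_right (n + m) t) (pad ψ) (magic t)) = accProb circ outs ψ := by
  set Φ := extend (Nat.le_add_right (n + m) t) (pad ψ) (magic t) with hΦdef
  set flip : Bits (n + m + t) → Bits (n + m + t) := fun u q =>
      if ∃ q' ∈ outs, q = q'.castLE (Nat.le_add_right _ t) then !u q else u q with hflip
  have hΦ : ∀ u : Bits (n + m + t), (∀ i : Fin t, u (Fin.natAdd (n + m) i) = false) →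
      (prodOp (gadget t circ).reverse *ᵥ Φ) u =
        (circuitOp circ *ᵥ pad ψ) (restrictBits (Nat.le_add_right _ t) u) := by
    intro u hu
    refine gadget_spec circ ht.le (pad ψ) Φ (fun u _ => ?_) u hu
    rw [ht]; rfl
  have hmem : ∀ u : Bits (n + m + t), u ∈ zeroOn (rowQubits t outs).toFinset ↔
      (∀ q ∈ outs, u (q.castLE (Nat.le_add_right _ t)) = false) ∧
        ∀ i : Fin t, u (Fin.natAdd (n + m) i) = false := by
    intro u
    simp only [zeroOn, Finset.mem_filter, Finset.mem_univ, true_and, List.mem_toFinset,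
      mem_rowQubits]
    constructor
    · exact fun h => ⟨fun q hq => h _ (.inl ⟨q, hq, rfl⟩), fun i => h _ (.inr ⟨i, rfl⟩)⟩
    · rintro ⟨h1, h2⟩ j (⟨q, hq, rfl⟩ | ⟨i, rfl⟩)
      · exact h1 q hq
      · exact h2 i
  have hmagic : ∀ (u : Bits (n + m + t)) (i : Fin t),
      flip u (Fin.natAdd (n + m) i) = u (Fin.natAdd (n + m) i) := by
    intro u i
    simp only [hflip]
    rw [if_neg]
    rintro ⟨q', -, e⟩
    simp [Fin.ext_iff] at e; omega
  have hflip2 : ∀ u (q : Fin (n + m)), flip u (q.castLE (Nat.le_add_right _ t)) =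
      if q ∈ outs then !u (q.castLE (Nat.le_add_right _ t))
      else u (q.castLE (Nat.le_add_right _ t)) := by
    intro u q
    simp only [hflip]
    congr 1
    simp only [eq_iff_iff]
    constructor
    · rintro ⟨q', h, e⟩; exact (Fin.castLE_injective _ e) ▸ h
    · exact fun h => ⟨q, h, rfl⟩
  have hinv : ∀ u, flip (flip u) = u := by
    intro u; ext q; simp only [hflip]; split <;> simp
  rw [mass, accProb]
  -- Flipping the output bits and forgetting the magic bits matches the labels that vanish on the
  -- measured qubits with the accepted labels.
  refine Finset.sum_bij' (fun u _ => restrictBits (Nat.le_add_right _ t) (flip u))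
    (fun x _ => flip (glue x fun _ => false)) ?_ ?_ ?_ ?_ ?_
  · intro u hu
    rw [hmem] at hu
    simp only [Finset.mem_filter, Finset.mem_univ, true_and, restrictBits]
    intro q hq
    rw [hflip2, if_pos hq, hu.1 q hq]; rfl
  · intro x hx
    rw [hmem]
    simp only [Finset.mem_filter, Finset.mem_univ, true_and] at hx
    refine ⟨fun q hq => ?_, fun i => ?_⟩
    · rw [hflip2, if_pos hq, glue_castLE, hx q hq]; rfl
    · rw [hmagic]; simp [glue]
  · intro u hu
    rw [hmem] at hu
    conv_rhs => rw [← hinv u]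
    congr 1
    ext q
    by_cases hq : q.val < n + m
    · simp [glue, hq, restrictBits]
    · obtain ⟨i, rfl⟩ : ∃ i, q = Fin.natAdd (n + m) i :=
        ⟨⟨q.val - (n + m), by omega⟩, by ext; simp; omega⟩
      rw [hmagic, hu.2 i]; simp [glue]
  · intro x _
    rw [hinv, restrictBits_glue]
  · intro u hu
    rw [hmem] at hu
    rw [baseGates, prodOp_append, ← Matrix.mulVec_mulVec, xGates_mulVec outs hn]
    rw [← hΦ (flip u) fun i => by rw [hmagic, hu.2 i]]

/-- The indicator that the ancillas are `0`. -/
def ancZero (n m t : ℕ) (u : Bits (n + m + t)) : ℂ :=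
  if ∀ i : Fin (n + m + t), n ≤ i.val → i.val < n + m → u i = false then 1 else 0

theorem ancZero_indep : IndepOf (fun q => q < n) (ancZero n m t) := by
  intro q hq u v
  simp only [ancZero]
  congr 1
  simp only [eq_iff_iff]
  refine forall_congr' fun i => ?_
  by_cases h : i = q
  · subst h
    exact ⟨fun _ h => absurd hq (by omega), fun _ h => absurd hq (by omega)⟩
  · simp [h]

theorem ancZero_indep' : IndepOf (fun q => n + m ≤ q) (ancZero n m t) := by
  intro q hq u v
  simp only [ancZero]
  congr 1
  simp only [eq_iff_iff]
  refine forall_congr' fun i => ?_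
  by_cases h : i = q
  · subst h
    exact ⟨fun _ _ h => absurd hq (by omega), fun _ _ h => absurd hq (by omega)⟩
  · simp [h]

theorem extend_pad (ψ : Bits n → ℂ) (α : Bits (n + m + t) → ℂ) :
    extend (Nat.le_add_right (n + m) t) (pad ψ) α =
      extend (le_total_qubits n m t) ψ (fun u => ancZero n m t u * α u) := by
  ext u
  have : (∀ i : Fin (n + m), n ≤ i.val → restrictBits (Nat.le_add_right (n + m) t) u i = false) ↔
      ∀ i : Fin (n + m + t), n ≤ i.val → i.val < n + m → u i = false :=
    ⟨fun h i h1 h2 => h ⟨i, h2⟩ h1, fun h i h1 => h (i.castLE (Nat.le_add_right _ t)) h1 i.2⟩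
  simp only [extend, pad, ancZero, this]
  split
  · rw [one_mul]; rfl
  · simp

theorem zAct_anc {α : Bits (n + m + t) → ℂ} (ψ : Bits n → ℂ) {a : Fin (n + m + t)}
    (h1 : n ≤ a.val) (h2 : a.val < n + m) :
    zAct a (extend (le_total_qubits n m t) ψ fun u => ancZero n m t u * α u) =
      extend (le_total_qubits n m t) ψ fun u => ancZero n m t u * α u := by
  ext u
  cases h : u a
  · simp [zAct, h, bsign]
  · have : ancZero n m t u = 0 := by
      rw [ancZero, if_neg]
      intro h'; rw [h' a h1 h2] at h; simp at h
    simp [zAct, extend, this]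

theorem extend_bitPart (w : Fin n) (b : Bool) (ψ : Bits n → ℂ) (β : Bits (n + m + t) → ℂ) :
    extend (le_total_qubits n m t) (bitPart w b ψ) β =
      bitPart (w.castLE (le_total_qubits n m t)) b (extend (le_total_qubits n m t) ψ β) := by
  ext u
  simp only [extend, bitPart]
  rw [show restrictBits (le_total_qubits n m t) u w = u (w.castLE (le_total_qubits n m t)) from rfl]
  split_ifs <;> simp

theorem extend_xAct (w : Fin n) (ψ : Bits n → ℂ) {β : Bits (n + m + t) → ℂ}
    (hβ : IndepOf (· < n) β) :
    extend (le_total_qubits n m t) (xAct w ψ) β =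
      xAct (w.castLE (le_total_qubits n m t)) (extend (le_total_qubits n m t) ψ β) := by
  ext u
  simp only [extend, xAct]
  rw [hβ _ (by simp)]
  congr 2
  ext q
  by_cases h : q = w
  · subst h; simp [restrictBits]
  · have : q.castLE (le_total_qubits n m t) ≠ w.castLE (le_total_qubits n m t) :=
      fun e => h (Fin.castLE_injective _ e)
    simp [restrictBits, h, this]

theorem extend_smul (c : ℂ) (ψ : Bits n → ℂ) (β : Bits (n + m + t) → ℂ) :
    extend (le_total_qubits n m t) (c • ψ) β = c • extend (le_total_qubits n m t) ψ β := by
  ext u; simp [extend, mul_assoc]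

/-- The row of the measured qubit `q`, for the output side list `L` and the input side list
`F`. -/
def rowOf (t : ℕ) (circ : List (Gate (n + m))) (outs : List (Fin (n + m)))
    (L F : List (ℕ × ℕ × ℕ)) (q : ℕ) : Row :=
  pullList (L.reverse ++ ((baseGates t circ outs).map CliffordGate.code ++ F)) (single q)

/-- The row may have further Z factors on ancillas and on witness qubits after `w`. All of these
bits are 0 wherever the vector does not vanish, so only Z on `w` is felt. -/
theorem act_of_zRow {r : Row} {w : Fin n} {α : Bits (n + m + t) → ℂ} {ψ : Bits n → ℂ}
    (hx : ∀ q < n + m + t, r.x q = 0) (hz : ∀ q < w.val, r.z q = 0) (hw : r.z w = 1)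
    (hmag : ∀ q, n + m ≤ q → q < n + m + t → r.z q = 0) (hp : r.p = 0)
    (hψ : ZeroFrom (w.val + 1) ψ) :
    r.act (extend (le_total_qubits n m t) ψ fun u => ancZero n m t u * α u) =
      zAct (w.castLE (le_total_qubits n m t))
        (extend (le_total_qubits n m t) ψ fun u => ancZero n m t u * α u) := by
  set Ψ := extend (le_total_qubits n m t) ψ fun u => ancZero n m t u * α u with hΨ
  ext u
  have hs : r.shift u = u := by ext q; simp [Row.shift, hx q q.2]
  simp only [Row.act, hs, hp, pow_zero, one_mul, zAct]
  by_cases h0 : Ψ u = 0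
  · simp [h0]
  congr 1
  rw [Row.sign, Finset.prod_eq_single (w.castLE (le_total_qubits n m t))]
  · simp [hw]
  · intro q _ hq
    have hqw : q.val ≠ w.val := fun e => hq (Fin.ext e)
    by_cases h1 : q.val < w.val
    · rw [hz q h1, bsign_zero]
    by_cases h2 : n + m ≤ q.val
    · rw [hmag q h2 q.2, bsign_zero]
    have : u q = false := by
      by_contra hu
      rw [Bool.not_eq_false] at hu
      apply h0
      by_cases h3 : q.val < n
      · rw [hΨ, extend, hψ, zero_mul]
        exact ⟨⟨q, h3⟩, by simp only; omega, hu⟩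
      · have : ancZero n m t u = 0 := by
          rw [ancZero, if_neg]
          intro h'; rw [h' q (by omega) (by omega)] at hu; simp at hu
        simp [hΨ, extend, this]
    simp [this, bsign]
  · simp

/-- If the rows of the measurements have the right shape, then some witness state of maximal
acceptance probability has its last qubits equal to `0`. -/
theorem exists_zeroFrom_ge (circ : List (Gate (n + m))) (ht : circ.countP Gate.isT = t)
    (outs : List (Fin (n + m))) (hn : outs.Nodup) (L Fm Fw : List (ℕ × ℕ × ℕ))
    (hL : ∀ g ∈ L, GateIn (· ∈ (rowQubits t outs).map Fin.val) g ∧ g.1 = 2)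
    (hFm : ∀ g ∈ Fm, GateIn (fun q => n + m ≤ q ∧ q < n + m + t) g)
    (hFw : ∀ g ∈ Fw, GateIn (· < n) g) (R : ℕ → Row)
    (hR : ∀ i, R i = rowOf t circ outs L (Fm ++ Fw) (((rowQubits t outs).map Fin.val).getD i 0))
    (A : ℕ → ℕ)
    (hA : ∀ i < (rowQubits t outs).length, A i ≠ 0 → n ≤ A i - 1 ∧ A i - 1 < n + m ∧
      (R i).x (A i - 1) = 1 ∧ ∀ i' < (rowQubits t outs).length, (i < i' ∨ A i' = 0) →
        (R i').x (A i - 1) = 0)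
    (l p : ℕ)
    (hfree : ∀ i < (rowQubits t outs).length, A i = 0 → ∀ q, l ≤ q → q < p →
      (R i).x q = 0 ∧ (R i).z q = 0)
    (hzero : ∀ w, p ≤ w → w < n → ∃ i < (rowQubits t outs).length, A i = 0 ∧
      (∀ q < n + m + t, (R i).x q = 0) ∧ (∀ q < w, (R i).z q = 0) ∧ (R i).z w = 1 ∧
      (∀ q, n + m ≤ q → q < n + m + t → (R i).z q = 0) ∧ (R i).p = 0) :
    ∃ W : List (CliffordGate n), W.map CliffordGate.code = Fw ∧
      ∀ ψ : Bits n → ℂ, normSum ψ = 1 → ∃ ψ', normSum ψ' = 1 ∧ ZeroFrom l ψ' ∧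
        accProb circ outs (prodOp W *ᵥ ψ) ≤ accProb circ outs (prodOp W *ᵥ ψ') := by
  obtain ⟨W, hW⟩ := exists_gates hFw
  obtain ⟨Fm', hFm'⟩ := exists_gates fun g hg => (hFm g hg).mono fun q hq => hq.2
  obtain ⟨L', hL'⟩ := exists_gates (N := n + m + t) (l := L) fun g hg =>
    (hL g hg).1.mono fun q hq => by
      obtain ⟨q', -, rfl⟩ := List.mem_map.1 hq; exact q'.2
  refine ⟨W, hW, ?_⟩
  set base := baseGates t circ outs with hbase
  set Fw' := W.map (CliffordGate.embed (le_total_qubits n m t)) with hFw'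
  -- From right to left, in the order of action: witness gates, magic gates, the circuit, and the
  -- CNOTs that multiply rows.
  set V := prodOp (L'.reverse ++ (base ++ (Fm' ++ Fw'))) with hVdef
  have hV : Vᴴ * V = 1 := prodOp_conjTranspose_mul _
  set J := (rowQubits t outs).toFinset with hJ
  have hcodes : (L'.reverse ++ (base ++ (Fm' ++ Fw'))).map CliffordGate.code =
      L.reverse ++ (base.map CliffordGate.code ++ (Fm ++ Fw)) := by
    simp only [List.map_append, List.map_reverse, hL', hFm', hFw', List.map_map]
    congr 3
    rw [← hW]
    exact List.map_congr_left fun g _ => g.embed_code _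
  set R' : Fin (n + m + t) → Row := fun q => rowOf t circ outs L (Fm ++ Fw) q with hR'
  have hPulled : Pulled V R' := by
    intro j Ψ
    rw [hR']
    simp only [rowOf]
    rw [← hcodes, Row.act_prodOp, act_single]
  -- the vectors
  obtain ⟨α, hα, hαm⟩ := exists_preimage (b := n + m + t) (l := Fm')
    (P := fun q => n + m ≤ q ∧ q < n + m + t) (P' := fun q => q < n + m)
    (fun g hg => hFm _ (by rw [← hFm']; exact List.mem_map_of_mem hg)) (fun q h h' => by omega)
    (magic_indep t)
  -- The fixed factor of the input: ancillas equal to 0 and the magic state pulled back through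
  -- `Fm'`.
  set β : Bits (n + m + t) → ℂ := fun u => ancZero n m t u * α u with hβ
  have hβi : IndepOf (· < n) β :=
    ancZero_indep.mul fun q hq => hα q (by have : q.val < n := hq; omega)
  set E := fun ψ : Bits n → ℂ => extend (le_total_qubits n m t) ψ β with hE
  -- The CNOTs of `L` do not change the mass, the gates of `Fm` restore the magic state, and the
  -- gates of `Fw` apply W to the witness.
  have hacc : ∀ ψ : Bits n → ℂ, accProb circ outs (prodOp W *ᵥ ψ) = mass V J (E ψ) := by
    intro ψ
    have step : ∀ (l : List (CliffordGate (n + m + t))) (M : Op (n + m + t)) (Ψ : Bits _ → ℂ),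
        (∀ g ∈ l, g.code ∈ L) → mass (prodOp l * M) J Ψ = mass M J Ψ := by
      intro l M Ψ hl
      induction l with
      | nil => simp
      | cons g l ih =>
        have hg := hL _ (hl g (by simp))
        rw [prodOp_cons, mul_assoc, ← ih fun g' h => hl g' (by simp [h])]
        cases g with
        | H q => simp [CliffordGate.code] at hg
        | S q => simp [CliffordGate.code] at hg
        | CNOT a b hab =>
          have h1 : a ∈ J := by
            obtain ⟨q, hq, e⟩ := List.mem_map.1 hg.1.1
            rw [hJ, List.mem_toFinset, ← (Fin.ext e : q = a)]; exact hq
          have h2 : b ∈ J := by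
            have := hg.1.2.elim (fun h => absurd h.1 (by simp [CliffordGate.code])) fun h => h.2.1
            obtain ⟨q, hq, e⟩ := List.mem_map.1 this
            rw [hJ, List.mem_toFinset, ← (Fin.ext e : q = b)]; exact hq
          exact mass_cnot hab h1 h2 Ψ
    rw [← mass_baseGates circ ht outs hn, hVdef, prodOp_append, step, prodOp_append]
    · have : prodOp (Fm' ++ Fw') *ᵥ E ψ =
          extend (Nat.le_add_right (n + m) t) (pad (prodOp W *ᵥ ψ)) (magic t) := by
        rw [prodOp_append, ← Matrix.mulVec_mulVec, hFw', hE]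
        simp only
        rw [embed_prodOp_extend _ _ _ hβi, extend_pad]
        have e1 : extend (le_total_qubits n m t) (prodOp W *ᵥ ψ) β = fun u =>
            (fun u => (prodOp W *ᵥ ψ) (restrictBits (le_total_qubits n m t) u) *
              ancZero n m t u) u * α u := by
          ext u; simp only [extend, hβ]; ring
        rw [e1, prodOp_mul_of_indep (P := fun q => n + m ≤ q ∧ q < n + m + t)
          (fun g hg => hFm _ (by rw [← hFm']; exact List.mem_map_of_mem hg)), hαm]
        · ext u; simp only [extend]; ring
        · refine IndepOf.mul (fun q hq u v => ?_) fun q hq => ancZero_indep' q hq.1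
          congr 1
          ext r
          have : r.castLE (le_total_qubits n m t) ≠ q := by
            intro e; have := congrArg Fin.val e; simp at this; omega
          simp [restrictBits, this]
      rw [← this]
      simp only [mass, Matrix.mulVec_mulVec]
      rfl
    · intro g hg
      rw [← hL']
      exact List.mem_map_of_mem (List.mem_reverse.1 hg)
  -- dropping
  set K := (rowQubits t outs).length with hK
  have hnod := rowQubits_nodup (t := t) hn
  have hQ : ∀ i (hi : i < K), R i = R' ((rowQubits t outs)[i]) := by
    intro i hi
    rw [hR, hR']
    congr 1
    rw [List.getD_eq_getElem _ _ (by simpa using hi)]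
    simp
  have hcastA : ∀ i < K, A i ≠ 0 → A i - 1 < n + m + t := fun i hi h => by
    have := (hA i hi h).2.1; omega
  set J₀ : Finset (Fin (n + m + t)) := J.filter fun q => ∃ i, ∃ hi : i < K,
    A i = 0 ∧ (rowQubits t outs)[i] = q with hJ₀
  have hmemJ₀ : ∀ q ∈ J₀, ∃ i, i < K ∧ A i = 0 ∧ R i = R' q := by
    intro q hq
    obtain ⟨-, i, hi, h, rfl⟩ := Finset.mem_filter.1 hq
    exact ⟨i, hi, h, hQ i hi⟩
  have hmemJ₀' : ∀ i (hi : i < K), A i = 0 → (rowQubits t outs)[i] ∈ J₀ := fun i hi h =>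
    Finset.mem_filter.2 ⟨by simp [hJ], i, hi, h, rfl⟩
  -- The dropped rows in increasing order, each with its ancilla `A i - 1`. The alternative of the
  -- `if` does not occur, as `A i - 1 < n + m`.
  set dl : List (Fin (n + m + t) × Fin (n + m + t)) :=
    ((List.finRange K).filter fun i => A i.val ≠ 0).map fun i => ((rowQubits t outs)[i.val],
      if h : A i.val - 1 < n + m + t then ⟨A i.val - 1, h⟩ else (rowQubits t outs)[i.val]) with hdl
  have hdl_mem : ∀ e ∈ dl, ∃ i, ∃ hi : i < K, A i ≠ 0 ∧ e.1 = (rowQubits t outs)[i] ∧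
      e.2.val = A i - 1 := by
    intro e he
    obtain ⟨i, hi, rfl⟩ := List.mem_map.1 he
    have hi : A i.val ≠ 0 := by simpa using (List.mem_filter.1 hi).2
    refine ⟨i, i.2, hi, rfl, ?_⟩
    simp only [dif_pos (hcastA i i.2 hi)]
  have hJeq : (dl.map Prod.fst).toFinset ∪ J₀ = J := by
    ext q
    simp only [Finset.mem_union, List.mem_toFinset, List.mem_map]
    constructor
    · rintro (⟨e, he, rfl⟩ | h)
      · obtain ⟨i, hi, -, e1, -⟩ := hdl_mem e he
        rw [e1, hJ, List.mem_toFinset]; exact List.getElem_mem _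
      · exact (Finset.mem_filter.1 h).1
    · intro h
      rw [hJ, List.mem_toFinset] at h
      obtain ⟨i, hi, rfl⟩ := List.getElem_of_mem h
      by_cases h0 : A i = 0
      · exact .inr (hmemJ₀' i hi h0)
      · refine .inl ⟨_, List.mem_map.2 ⟨⟨i, hi⟩, ?_, rfl⟩, rfl⟩
        simp [h0]
  -- The factor is the same for every `ψ`, so the dropped rows play no part in the comparison of
  -- witnesses.
  have hmass : ∀ ψ, mass V J (E ψ) = mass V J₀ (E ψ) / 2 ^ dl.length := by
    intro ψ
    rw [← hJeq]
    refine mass_drop_list hV hPulled J₀ dl ?_ ?_ ?_ ?_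
    · rw [hdl, List.pairwise_map]
      refine ((List.pairwise_lt_finRange K).filter _).imp_of_mem ?_
      intro i i' hi hi' hlt
      have h1 : A i.val ≠ 0 := by simpa using (List.mem_filter.1 hi).2
      simp only [dif_pos (hcastA i i.2 h1)]
      rw [← hQ i'.val i'.2]
      exact (hA i i.2 h1).2.2.2 i' i'.2 (.inl hlt)
    · intro e he
      obtain ⟨i, hi, h0, e1, e2⟩ := hdl_mem e he
      rw [e1, e2, ← hQ i hi]
      exact (hA i hi h0).2.2.1
    · intro e he q hq
      obtain ⟨i, hi, h0, e1, e2⟩ := hdl_mem e he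
      obtain ⟨i', hi', h0', e'⟩ := hmemJ₀ q hq
      rw [← e', e2]
      exact (hA i hi h0).2.2.2 i' hi' (.inr h0')
    · intro e he
      obtain ⟨i, hi, h0, e1, e2⟩ := hdl_mem e he
      have := hA i hi h0
      exact zAct_anc ψ (by omega) (by omega)
  set μ : (Bits n → ℂ) → ℝ := fun ψ => mass V J₀ (E ψ) with hμ
  suffices h : ∀ ψ : Bits n → ℂ, normSum ψ = 1 → ∃ ψ', normSum ψ' = 1 ∧ ZeroFrom l ψ' ∧
      μ ψ ≤ μ ψ' by
    intro ψ hψ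
    obtain ⟨ψ', h1, h2, h3⟩ := h ψ hψ
    refine ⟨ψ', h1, h2, ?_⟩
    rw [hacc, hacc, hmass, hmass]
    exact div_le_div_of_nonneg_right h3 (by positivity)
  have hμs : ∀ (c : ℂ) ψ, μ (c • ψ) = ‖c‖ ^ 2 * μ ψ := fun c ψ => by
    simp only [hμ, hE, extend_smul, mass_smul]
  have hμ0 : ∀ ψ, 0 ≤ μ ψ := fun ψ => mass_nonneg _ _ _
  have hbp : ∀ (w : Fin n) b ψ, E (bitPart w b ψ) =
      bitPart (w.castLE (le_total_qubits n m t)) b (E ψ) := fun w b ψ => extend_bitPart w b ψ β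
  -- Bits are cleared from the last to the first, because the row that forces bit `w` to 0 may have
  -- Z factors on later witness qubits. Below `p` no remaining row acts on the qubit; from `p` on
  -- there is such a row.
  have step : ∀ w : Fin n, l ≤ w.val → ∀ ψ : Bits n → ℂ, normSum ψ = 1 →
      ZeroFrom (w.val + 1) ψ → ∃ ψ', normSum ψ' = 1 ∧ ZeroFrom w.val ψ' ∧ μ ψ ≤ μ ψ' := by
    intro w hlw ψ h1 hz
    by_cases hwp : w.val < p
    · have htriv : ∀ q ∈ J₀, (R' q).x w = 0 ∧ (R' q).z w = 0 := by
        intro q hq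
        obtain ⟨i, hi, h0, e⟩ := hmemJ₀ q hq
        rw [← e]; exact hfree i hi h0 w hlw hwp
      refine exists_zero_bit hμ0 hμs hz h1 ?_ (.inr ?_)
      · simp only [hμ, hbp]
        exact mass_eq_add_of_comm hV hPulled (fun q hq => (htriv q hq).1) _
      · simp only [hμ, hE]
        rw [extend_xAct _ _ hβi]
        exact mass_xAct hV hPulled (fun q hq => (htriv q hq).2) _
    · obtain ⟨i, hi, h0, hx, hz1, hz2, hz3, hp⟩ := hzero w (by omega) w.2
      have hst : (R' (rowQubits t outs)[i]).act (E ψ) =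
          zAct (w.castLE (le_total_qubits n m t)) (E ψ) := by
        rw [← hQ i hi]
        exact act_of_zRow hx hz1 hz2 hz3 hp hz
      have key := mass_bitPart_of_stabilizer hPulled (hmemJ₀' i hi h0) hst
      refine exists_zero_bit hμ0 hμs hz h1 ?_ (.inl ?_)
      · simp only [hμ, hbp, key.2, add_zero]; exact key.1
      · simp only [hμ, hbp]; exact key.2
  have all : ∀ d w, w = l + d → w ≤ n → ∀ ψ : Bits n → ℂ, normSum ψ = 1 → ZeroFrom w ψ →
      ∃ ψ', normSum ψ' = 1 ∧ ZeroFrom l ψ' ∧ μ ψ ≤ μ ψ' := by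
    intro d
    induction d with
    | zero => rintro w rfl _ ψ h1 h2; exact ⟨ψ, h1, h2, le_rfl⟩
    | succ d ih =>
      intro w hw hwn ψ h1 h2
      obtain ⟨ψ₁, a1, a2, a3⟩ := step ⟨l + d, by omega⟩ (by simp) ψ h1 (by
        subst hw; exact h2)
      obtain ⟨ψ₂, b1, b2, b3⟩ := ih (l + d) rfl (by omega) ψ₁ a1 a2
      exact ⟨ψ₂, b1, b2, a3.trans b3⟩
  intro ψ h1
  by_cases hln : l ≤ n
  · exact all (n - l) n (by omega) le_rfl ψ h1 fun y ⟨q, hq, _⟩ => absurd q.2 (by omega)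
  · exact ⟨ψ, h1, fun y ⟨q, hq, _⟩ => absurd q.2 (by omega), le_rfl⟩

end semantics

end QCSAT

/-! ### The machine program -/

namespace QCSAT

/-! ### The program -/

namespace Synth
open RAM RAM.CProg RAM.Expr

/-- Sequential composition. -/
infixr:60 " ;; " => CProg.seq

/-- A conditional without alternative. -/
def cond (e : Expr) (p : CProg) : CProg := .ite e p .skip

/-- Exclusive or of two bits. -/
def xorE (a b : Expr) : Expr := .add (.sub a b) (.sub b a)

/-- The `x` bit of the current row at a qubit. -/
def xAt (q : Expr) : Expr := .cell 9 (.add (.reg 11) q)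

/-- The `z` bit of the current row at a qubit. -/
def zAt (q : Expr) : Expr := .cell 10 (.add (.reg 11) q)

/-- Writing an `x` bit of the current row. -/
def setX (q e : Expr) : CProg := .store 9 (.add (.reg 11) q) e

/-- Writing a `z` bit of the current row. -/
def setZ (q e : Expr) : CProg := .store 10 (.add (.reg 11) q) e

/-- Pulls the current row back through the gate in registers 14 to 16. -/
def applyGate : CProg :=
  .ite (.reg 14)
    (.ite (.sub (.reg 14) (.const 1))
      (setX (.reg 16) (xorE (xAt (.reg 16)) (xAt (.reg 15))) ;;
        setZ (.reg 15) (xorE (zAt (.reg 15)) (zAt (.reg 16))))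
      (.assign 12 (.add (.reg 12) (.add (xAt (.reg 15)) (.add (xAt (.reg 15)) (xAt (.reg 15))))) ;;
        cond (.sub (.reg 12) (.const 3)) (.assign 12 (.sub (.reg 12) (.const 4))) ;;
        setZ (.reg 15) (xorE (zAt (.reg 15)) (xAt (.reg 15)))))
    -- For bits, the truncated `x + z - 1` is the product `x z`. As the phase was below 4,
    -- subtracting 4 at most once reduces it.
    (.assign 18 (.sub (.add (xAt (.reg 15)) (zAt (.reg 15))) (.const 1)) ;;
      .assign 12 (.add (.reg 12) (.add (.reg 18) (.reg 18))) ;;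
      cond (.sub (.reg 12) (.const 3)) (.assign 12 (.sub (.reg 12) (.const 4))) ;;
      .assign 18 (xAt (.reg 15)) ;;
      setX (.reg 15) (zAt (.reg 15)) ;;
      setZ (.reg 15) (.reg 18))

/-- Computes the row whose number is in register 13 in a fresh region of memory. -/
def pullRow : CProg :=
  -- Moving on by the number of qubits reaches cells that are still 0. Clearing the old row instead
  -- could take time proportional to `m`.
  .assign 11 (.add (.reg 11) (.reg 8)) ;;
  .assign 12 (.const 0) ;;
  setZ (.cell 14 (.reg 13)) (.const 1) ;;
  .forV 17 9 (.assign 14 (.const 2) ;;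
    -- The list is read from its end: the CNOT that was appended last acts last, so the pull-back
    -- meets it first.
    .assign 15 (.cell 7 (.sub (.sub (.reg 9) (.const 1)) (.reg 17))) ;;
    .assign 16 (.cell 8 (.sub (.sub (.reg 9) (.const 1)) (.reg 17))) ;;
    applyGate) ;;
  .forV 17 10 (.assign 14 (.cell 4 (.reg 17)) ;;
    .assign 15 (.cell 5 (.reg 17)) ;;
    .assign 16 (.cell 6 (.reg 17)) ;;
    applyGate)

/-- Appends the gate in registers 14 to 16 to the input side list. -/
def pushG : CProg :=
  .store 4 (.reg 10) (.reg 14) ;; .store 5 (.reg 10) (.reg 15) ;; .store 6 (.reg 10) (.reg 16) ;;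
  .incr 10

/-- Appends a gate to the input side list. -/
def gateG (k : ℕ) (a b : Expr) : CProg :=
  .assign 14 (.const k) ;; .assign 15 a ;; .assign 16 b ;; pushG

/-- Appends a CNOT gate to the output side list. -/
def gateL (a b : Expr) : CProg :=
  .assign 15 a ;; .assign 16 b ;; .store 7 (.reg 9) (.reg 15) ;; .store 8 (.reg 9) (.reg 16) ;;
  .incr 9

/-- Multiplies the live rows that have a bit (of the array `arr`) at the qubit in register 31 by
the row in register 30. -/
def elim (arr : ℕ) : CProg :=
  .forC 32 6 (.ite (.cell 11 (.reg 32)) .skip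
    (.assign 13 (.reg 32) ;; pullRow ;;
      cond (.cell arr (.add (.reg 11) (.reg 31)))
        (gateL (.cell 14 (.reg 30)) (.cell 14 (.reg 32)))))

/-- A loop over the qubits from `lo` (register 21) to `hi` (register 22). -/
def forRange (p : CProg) : CProg :=
  -- With truncated subtraction, `k + 1 - lo ≠ 0` means `lo ≤ k`, and `hi - k ≠ 0` means `k < hi`.
  .forC 24 7 (cond (.sub (.add (.reg 24) (.const 1)) (.reg 21)) (cond (.sub (.reg 22) (.reg 24)) p))

/-- The qubit with relative index in register `i`. -/
def qbit (i : ℕ) : Expr := .add (.reg 20) (.reg i)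

/-- Turns the part of the row in register 29 on a range of qubits into `X` on the qubit with
relative index in register 23. Register 25 tells if that part was nontrivial. -/
def reduce : CProg :=
  .assign 13 (.reg 29) ;; pullRow ;;
  -- S turns Y into X, and H turns Z into X. The row in memory is not updated during the loop, which
  -- is harmless since each pass touches only its own qubit.
  forRange (cond (zAt (qbit 24))
    (.ite (xAt (qbit 24)) (gateG 1 (qbit 24) (.const 0)) (gateG 0 (qbit 24) (.const 0)))) ;;
  .assign 13 (.reg 29) ;; pullRow ;;
  .assign 25 (.const 0) ;;
  forRange (cond (xAt (qbit 24)) (.assign 25 (.add (.reg 24) (.const 1)))) ;;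
  cond (.reg 25)
    (.ite (xAt (qbit 23)) .skip
        (gateG 2 (.add (.reg 20) (.sub (.reg 25) (.const 1))) (qbit 23)) ;;
      .assign 13 (.reg 29) ;; pullRow ;;
      forRange (cond (xorE (.reg 24) (.reg 23)) (cond (xAt (qbit 24))
        (gateG 2 (qbit 23) (qbit 24)))))

/-- Looks for a live row with an `X` part at the qubit in register 31; its number plus one goes to
register 33. -/
def findRow : CProg :=
  .assign 33 (.const 0) ;;
  .forC 32 6 (.ite (.cell 11 (.reg 32)) .skip
    (.assign 13 (.reg 32) ;; pullRow ;;
      cond (xAt (.reg 31)) (.assign 33 (.add (.reg 32) (.const 1)))))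

/-- Checks if the qubit in register 43 is an ancilla where the current row has an `X` part. -/
def checkAncilla : CProg :=
  cond (.sub (.add (.reg 43) (.const 1)) (.reg 0)) (cond (.sub (.reg 4) (.reg 43))
    (cond (xAt (.reg 43)) (.assign 42 (.add (.reg 43) (.const 1)))))

/-- Removes the measurements with random outcomes because of an ancilla. -/
def dropRows : CProg :=
  .forC 40 6 (.assign 13 (.reg 40) ;; pullRow ;; .assign 42 (.const 0) ;;
    -- The ancillas are too many to be visited one by one; X parts occur only at qubits named by
    -- gates of the list.
    .forV 41 10 (.assign 43 (.cell 5 (.reg 41)) ;; checkAncilla ;;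
      .assign 43 (.cell 6 (.reg 41)) ;; checkAncilla) ;;
    cond (.reg 42)
      (.store 11 (.reg 40) (.const 1) ;;
        .assign 30 (.reg 40) ;; .assign 31 (.sub (.reg 42) (.const 1)) ;; elim 9))

/-- Brings the magic parts of the rows into normal form. Register 44 counts the magic qubits that
are used. -/
def magicRows : CProg :=
  .assign 44 (.const 0) ;; .assign 20 (.reg 4) ;; .assign 22 (.reg 5) ;;
  .forC 40 6 (.ite (.cell 11 (.reg 40)) .skip
    (.assign 21 (.reg 44) ;; .assign 23 (.reg 44) ;; .assign 29 (.reg 40) ;; reduce ;;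
      cond (.reg 25)
        (gateG 0 (qbit 44) (.const 0) ;;
          .store 11 (.reg 40) (.const 2) ;; .store 12 (.reg 44) (.add (.reg 40) (.const 1)) ;;
          .assign 31 (qbit 44) ;; findRow ;;
          cond (.reg 33)
            (.assign 29 (.sub (.reg 33) (.const 1)) ;;
              .store 11 (.reg 29) (.const 2) ;; .store 13 (.reg 44) (.reg 33) ;;
              reduce ;;
              .assign 30 (.reg 29) ;; elim 9) ;;
          .assign 30 (.reg 40) ;; elim 10 ;;
          .assign 44 (.add (.reg 44) (.const 1)))))

/-- Maps the rows without magic part to `Z` on the last qubits. The qubits before the one in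
register 45 are not used yet. -/
def stabRows : CProg :=
  .assign 45 (.reg 0) ;; .assign 20 (.const 0) ;; .assign 21 (.const 0) ;;
  .forC 40 6 (.ite (.cell 11 (.reg 40)) .skip
    (.assign 22 (.reg 45) ;; .assign 23 (.sub (.reg 45) (.const 1)) ;; .assign 29 (.reg 40) ;;
      reduce ;;
      cond (.reg 25)
        (gateG 0 (.reg 23) (.const 0) ;;
          .assign 13 (.reg 40) ;; pullRow ;;
          cond (.reg 12) (gateG 0 (.reg 23) (.const 0) ;; gateG 1 (.reg 23) (.const 0) ;;
            gateG 1 (.reg 23) (.const 0) ;; gateG 0 (.reg 23) (.const 0)) ;;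
          .assign 45 (.reg 23))))

/-- Concentrates the rows with magic part on the first qubits. The qubits before the one in
register 46 are used. -/
def pairRows : CProg :=
  .assign 46 (.const 0) ;; .assign 22 (.reg 45) ;;
  .forC 40 5 (cond (.cell 12 (.reg 40))
    (.assign 21 (.reg 46) ;; .assign 23 (.reg 46) ;;
      .assign 29 (.sub (.cell 12 (.reg 40)) (.const 1)) ;; reduce ;;
      cond (.reg 25)
        (gateG 0 (.reg 46) (.const 0) ;;
          cond (.cell 13 (.reg 40))
            (.assign 29 (.sub (.cell 13 (.reg 40)) (.const 1)) ;; reduce) ;;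
          .assign 46 (.add (.reg 46) (.const 1)))))

/-- The main part of the program. -/
def mainProg : CProg :=
  -- Register 47 records where the gates on the witness qubits begin; only these are output.
  dropRows ;; magicRows ;; .assign 47 (.reg 10) ;; stabRows ;; pairRows

/-- Computes the number of qubits and discards the output register if it is too large. -/
def initRegs : CProg :=
  .assign 4 (.add (.reg 0) (.reg 1)) ;;
  -- With more than n + 2s output qubits the acceptance probability is identically 0, every state is
  -- optimal, and the register may be taken to be empty.
  cond (.sub (.reg 3) (.add (.reg 0) (.add (.reg 2) (.reg 2)))) (.assign 3 (.const 0))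

/-- Reads the instance. -/
def readInstance : CProg :=
  .forC 40 3 (.assign 41 (.cell 3 (.reg 40)) ;;
    gateG 0 (.reg 41) (.const 0) ;; gateG 1 (.reg 41) (.const 0) ;;
    gateG 1 (.reg 41) (.const 0) ;; gateG 0 (.reg 41) (.const 0) ;;
    .store 14 (.reg 40) (.reg 41)) ;;
  .assign 5 (.const 0) ;;
  -- Going backwards through the circuit gives the order of pull-backs and makes register 5 the
  -- number of T gates after the current one, which is the number of its magic qubit.
  .forC 40 2 (.assign 42 (.sub (.sub (.reg 2) (.const 1)) (.reg 40)) ;;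
    .assign 14 (.cell 0 (.reg 42)) ;; .assign 15 (.cell 1 (.reg 42)) ;;
    .assign 16 (.cell 2 (.reg 42)) ;;
    cond (.sub (.reg 14) (.const 2))
      (.assign 14 (.const 2) ;; .assign 16 (.add (.reg 4) (.reg 5)) ;;
        .store 14 (.add (.reg 3) (.reg 5)) (.reg 16) ;; .assign 5 (.add (.reg 5) (.const 1))) ;;
    pushG) ;;
  .assign 6 (.add (.reg 3) (.reg 5)) ;;
  .assign 7 (.add (.reg 0) (.reg 5)) ;;
  .assign 8 (.add (.reg 4) (.reg 5))

/-- Computes the number of gates of the output. -/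
def countGates : CProg := .assign 48 (.sub (.reg 10) (.reg 47))

/-- Writes the circuit. -/
def writeCircuit : CProg :=
  -- The stored list has the gate that acts first at its end, whereas a circuit starts with that
  -- gate; hence the reversal.
  .forC 40 48 (.assign 42 (.sub (.sub (.reg 10) (.const 1)) (.reg 40)) ;;
    .store 0 (.reg 40) (.cell 4 (.reg 42)) ;; .store 1 (.reg 40) (.cell 5 (.reg 42)) ;;
    .store 2 (.reg 40) (.cell 6 (.reg 42))) ;;
  .assign 0 (.reg 48)

set_option maxRecDepth 10000 in
theorem mainProg_wf : mainProg.WF [9, 10] := by decide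

set_option maxRecDepth 10000 in
theorem mainProg_bounds : ∀ r ∈ mainProg.bounds, r ∉ mainProg.wr := by decide

theorem readInstance_wf : readInstance.WF [9, 10] := by decide

theorem readInstance_bounds : ∀ r ∈ readInstance.bounds, r ∉ readInstance.wr := by decide

theorem writeCircuit_wf : writeCircuit.WF [] := by decide

theorem writeCircuit_bounds : ∀ r ∈ writeCircuit.bounds, r ∉ writeCircuit.wr := by decide

theorem mainProg_bounds_mem : ∀ r ∈ mainProg.bounds, r = 5 ∨ r = 6 ∨ r = 7 := by decide

end Synth
end QCSAT

/-! ### Correctness of the row computations -/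

namespace QCSAT

namespace Synth
open RAM RAM.CProg RAM.Expr Row

/-! ### Rows in memory -/

/-- The memory holds the row `r` on the first `W` qubits, and nothing behind it. -/
structure RowMem (W : ℕ) (σ : Mem) (r : Row) : Prop where
  x : ∀ q < W, σ.arr 9 (σ.reg 11 + q) = (r.x q).val
  z : ∀ q < W, σ.arr 10 (σ.reg 11 + q) = (r.z q).val
  p : σ.reg 12 = r.p
  zero : ∀ a, σ.reg 11 + W ≤ a → σ.arr 9 a = 0 ∧ σ.arr 10 a = 0

theorem RowMem.congr {W : ℕ} {σ τ : Mem} {r : Row} (h : RowMem W σ r)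
    (h11 : τ.reg 11 = σ.reg 11) (h12 : τ.reg 12 = σ.reg 12) (h9 : τ.arr 9 = σ.arr 9)
    (h10 : τ.arr 10 = σ.arr 10) : RowMem W τ r :=
  ⟨by rw [h11, h9]; exact h.x, by rw [h11, h10]; exact h.z, by rw [h12]; exact h.p,
    by rw [h11, h9, h10]; exact h.zero⟩

theorem RowMem.setReg {W : ℕ} {σ : Mem} {r : Row} (h : RowMem W σ r) {i : ℕ} (v : ℕ)
    (hi : i ≠ 11 ∧ i ≠ 12) : RowMem W (σ.setReg i v) r :=
  h.congr (by simp [hi.1.symm]) (by simp [hi.2.symm]) rfl rfl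

theorem xor_val : ∀ a b : ZMod 2, a.val - b.val + (b.val - a.val) = (a + b).val := by decide

theorem and_val : ∀ a b : ZMod 2, a.val + b.val - 1 = a.val * b.val := by decide

theorem val_lt_two (a : ZMod 2) : a.val < 2 := ZMod.val_lt a

theorem applyGate_spec {W : ℕ} {σ : Mem} {r : Row}
    (hg : GateIn (· < W) (σ.reg 14, σ.reg 15, σ.reg 16)) (h : RowMem W σ r) (hp : r.p < 4) :
    RowMem W (applyGate.run σ) (pull (σ.reg 14, σ.reg 15, σ.reg 16) r) := by
  obtain ⟨ha, ⟨hk, hb⟩ | ⟨hk, hb, hab⟩⟩ := hg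
  · simp only at ha hk hb
    have ax := h.x _ ha
    have az := h.z _ ha
    have bx := val_lt_two (r.x (σ.reg 15))
    interval_cases h14 : σ.reg 14
    · -- Hadamard gate
      have hw := and_val (r.x (σ.reg 15)) (r.z (σ.reg 15))
      have hle : (r.x (σ.reg 15)).val * (r.z (σ.reg 15)).val < 2 := by
        have := val_lt_two (r.z (σ.reg 15)); nlinarith
      set w := (r.x (σ.reg 15)).val * (r.z (σ.reg 15)).val with hwdef
      -- The two alternatives differ only by the intermediate write of the unreduced phase.
      have hrun : ∀ v, (r.p + 2 * w) % 4 = v →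
          applyGate.run σ = (((((σ.setReg 18 w).setReg 12 v).setReg 18 (r.x (σ.reg 15)).val).setCell
            9 (σ.reg 11 + σ.reg 15) (r.z (σ.reg 15)).val).setCell
            10 (σ.reg 11 + σ.reg 15) (r.x (σ.reg 15)).val) ∨
          applyGate.run σ = ((((((σ.setReg 18 w).setReg 12 (r.p + (w + w))).setReg 12 v).setReg
            18 (r.x (σ.reg 15)).val).setCell 9 (σ.reg 11 + σ.reg 15) (r.z (σ.reg 15)).val).setCell
            10 (σ.reg 11 + σ.reg 15) (r.x (σ.reg 15)).val) := by
        intro v hv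
        by_cases h4 : r.p + (w + w) - 3 = 0
        · left
          have : v = r.p + (w + w) := by omega
          subst this
          simp [applyGate, run, Expr.eval, h14, xAt, zAt, setX, setZ, cond, ax, az, hw, h.p, h4]
        · right
          have : v = r.p + (w + w) - 4 := by omega
          subst this
          simp [applyGate, run, Expr.eval, h14, xAt, zAt, setX, setZ, cond, ax, az, hw, h.p, h4]
      have hx : ∀ q < W, (applyGate.run σ).arr 9 ((applyGate.run σ).reg 11 + q) =
          ((pull (0, σ.reg 15, σ.reg 16) r).x q).val := by
        intro q hq
        rcases hrun _ rfl with e | e <;> rw [e] <;> by_cases hqa : q = σ.reg 15 <;>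
          simp [pull, hqa, h.x q hq]
      have hz : ∀ q < W, (applyGate.run σ).arr 10 ((applyGate.run σ).reg 11 + q) =
          ((pull (0, σ.reg 15, σ.reg 16) r).z q).val := by
        intro q hq
        rcases hrun _ rfl with e | e <;> rw [e] <;> by_cases hqa : q = σ.reg 15 <;>
          simp [pull, hqa, h.z q hq]
      refine ⟨hx, hz, ?_, ?_⟩
      · rcases hrun _ rfl with e | e <;> rw [e] <;> simp [pull, hwdef]
      · intro a haW
        have h0 := h.zero a
        rcases hrun _ rfl with e | e <;> rw [e] at haW ⊢ <;> simp at haW <;>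
          have hne : a ≠ σ.reg 11 + σ.reg 15 := (by omega) <;> simp [hne, h0 haW]
    · -- phase gate
      have hx3 : applyGate.run σ = (((σ.setReg 12 (r.p + ((r.x (σ.reg 15)).val +
            ((r.x (σ.reg 15)).val + (r.x (σ.reg 15)).val)))).setReg 12
            ((r.p + 3 * (r.x (σ.reg 15)).val) % 4)).setCell
            10 (σ.reg 11 + σ.reg 15) (r.z (σ.reg 15) + r.x (σ.reg 15)).val) ∨
          applyGate.run σ = ((σ.setReg 12 ((r.p + 3 * (r.x (σ.reg 15)).val) % 4)).setCell
            10 (σ.reg 11 + σ.reg 15) (r.z (σ.reg 15) + r.x (σ.reg 15)).val) := by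
        by_cases h4 : r.p + ((r.x (σ.reg 15)).val +
            ((r.x (σ.reg 15)).val + (r.x (σ.reg 15)).val)) - 3 = 0
        · right
          have : (r.p + 3 * (r.x (σ.reg 15)).val) % 4 = r.p + ((r.x (σ.reg 15)).val +
            ((r.x (σ.reg 15)).val + (r.x (σ.reg 15)).val)) := by omega
          rw [this]
          simp [applyGate, run, Expr.eval, h14, xAt, zAt, setX, setZ, cond, xorE, ax, az, h.p, h4,
            xor_val]
        · left
          have : (r.p + 3 * (r.x (σ.reg 15)).val) % 4 = r.p + ((r.x (σ.reg 15)).val +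
            ((r.x (σ.reg 15)).val + (r.x (σ.reg 15)).val)) - 4 := by omega
          rw [this]
          simp [applyGate, run, Expr.eval, h14, xAt, zAt, setX, setZ, cond, xorE, ax, az, h.p, h4,
            xor_val]
      refine ⟨?_, ?_, ?_, ?_⟩
      · intro q hq
        rcases hx3 with e | e <;> rw [e] <;> simp [pull, h.x q hq]
      · intro q hq
        rcases hx3 with e | e <;> rw [e] <;> by_cases hqa : q = σ.reg 15 <;>
          simp [pull, hqa, h.z q hq]
      · rcases hx3 with e | e <;> rw [e] <;> simp [pull]
      · intro a haW
        have h0 := h.zero a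
        rcases hx3 with e | e <;> rw [e] at haW ⊢ <;> simp at haW <;>
          have hne : a ≠ σ.reg 11 + σ.reg 15 := (by omega) <;> simp [hne, h0 haW]
  · simp only at ha hk hb hab
    have hrun : applyGate.run σ = (σ.setCell 9 (σ.reg 11 + σ.reg 16)
        (r.x (σ.reg 16) + r.x (σ.reg 15)).val).setCell 10 (σ.reg 11 + σ.reg 15)
        (r.z (σ.reg 15) + r.z (σ.reg 16)).val := by
      simp [applyGate, run, Expr.eval, hk, xAt, zAt, setX, setZ, xorE, h.x _ ha, h.x _ hb,
        h.z _ ha, h.z _ hb, xor_val]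
    rw [hrun, hk]
    refine ⟨?_, ?_, ?_, ?_⟩
    · intro q hq
      by_cases hqa : q = σ.reg 16 <;> simp [pull, hqa, h.x q hq]
    · intro q hq
      by_cases hqa : q = σ.reg 15 <;> simp [pull, hqa, h.z q hq]
    · simpa [pull] using h.p
    · intro a haW
      simp at haW
      have h1 : a ≠ σ.reg 11 + σ.reg 15 := by omega
      have h2 : a ≠ σ.reg 11 + σ.reg 16 := by omega
      simp [h1, h2, h.zero a haW]

/-! ### The state of the algorithm -/

/-- The parameters: `n` witness qubits, `N` qubits, `t` magic qubits, and `K` rows that start as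
`Z` on the qubits `Q j`. -/
structure Ctx : Type where
  n : ℕ
  N : ℕ
  t : ℕ
  K : ℕ
  Q : ℕ → ℕ
  hnN : n ≤ N
  hQ : ∀ j < K, Q j < N + t
  inj : ∀ i < K, ∀ j < K, Q i = Q j → i = j

/-- The number of all qubits. -/
def Ctx.W (c : Ctx) : ℕ := c.N + c.t

/-- The memory holds the lists `L` and `G`. -/
structure Rep (c : Ctx) (σ : Mem) (L G : List (ℕ × ℕ × ℕ)) : Prop where
  r0 : σ.reg 0 = c.n
  r4 : σ.reg 4 = c.N
  r5 : σ.reg 5 = c.t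
  r6 : σ.reg 6 = c.K
  r7 : σ.reg 7 = c.n + c.t
  r8 : σ.reg 8 = c.W
  rL : σ.reg 9 = L.length
  rG : σ.reg 10 = G.length
  aL : ∀ i (h : i < L.length), (σ.arr 7 i, σ.arr 8 i) = L[i].2
  aG : ∀ i (h : i < G.length), (σ.arr 4 i, σ.arr 5 i, σ.arr 6 i) = G[i]
  aQ : ∀ j < c.K, σ.arr 14 j = c.Q j
  okL : ∀ g ∈ L, ∃ a b, a < c.K ∧ b < c.K ∧ a ≠ b ∧ g = (2, c.Q a, c.Q b)
  okG : ∀ g ∈ G, GateIn (· < c.W) g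
  -- The row arrays behind the current region are untouched, so the next row can be built there
  -- without clearing.
  zero : ∀ a, σ.reg 11 + c.W ≤ a → σ.arr 9 a = 0 ∧ σ.arr 10 a = 0

variable {c : Ctx} {σ : Mem} {L G : List (ℕ × ℕ × ℕ)}

theorem Rep.congr {τ : Mem} (h : Rep c σ L G)
    (hr : ∀ r ∈ [0, 4, 5, 6, 7, 8, 9, 10, 11], τ.reg r = σ.reg r)
    (ha : ∀ a ∈ [4, 5, 6, 7, 8, 9, 10, 14], τ.arr a = σ.arr a) : Rep c τ L G := by
  simp only [List.mem_cons, List.not_mem_nil, or_false, forall_eq_or_imp, forall_eq] at hr ha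
  obtain ⟨h0, h4, h5, h6, h7, h8, h9, h10, h11⟩ := hr
  obtain ⟨a4, a5, a6, a7, a8, a9, a10, a14⟩ := ha
  constructor
  · rw [h0]; exact h.r0
  · rw [h4]; exact h.r4
  · rw [h5]; exact h.r5
  · rw [h6]; exact h.r6
  · rw [h7]; exact h.r7
  · rw [h8]; exact h.r8
  · rw [h9]; exact h.rL
  · rw [h10]; exact h.rG
  · rw [a7, a8]; exact h.aL
  · rw [a4, a5, a6]; exact h.aG
  · rw [a14]; exact h.aQ
  · exact h.okL
  · exact h.okG
  · rw [h11, a9, a10]; exact h.zero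

theorem Rep.setReg (h : Rep c σ L G) {i : ℕ} (v : ℕ) (hi : i ∉ [0, 4, 5, 6, 7, 8, 9, 10, 11]) :
    Rep c (σ.setReg i v) L G := by
  refine h.congr (fun r hr => ?_) fun _ _ => rfl
  have : r ≠ i := fun e => hi (e ▸ hr)
  simp [this]

theorem Rep.setCell (h : Rep c σ L G) {i : ℕ} (j v : ℕ) (hi : i ∉ [4, 5, 6, 7, 8, 9, 10, 14]) :
    Rep c (σ.setCell i j v) L G := by
  refine h.congr (fun _ _ => rfl) fun r hr => ?_
  have : r ≠ i := fun e => hi (e ▸ hr)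
  exact Mem.setCell_arr_ne _ this

theorem Rep.okL' (h : Rep c σ L G) : ∀ g ∈ L, GateIn (· < c.W) g := by
  intro g hg
  obtain ⟨a, b, ha, hb, hab, rfl⟩ := h.okL g hg
  exact ⟨c.hQ a ha, .inr ⟨rfl, c.hQ b hb, fun e => hab (c.inj a ha b hb e)⟩⟩

/-- The current rows. -/
def tab (c : Ctx) (L G : List (ℕ × ℕ × ℕ)) (j : ℕ) : Row :=
  pullList (L.reverse ++ G) (single (c.Q j))

theorem tab_p_lt (j : ℕ) : (tab c L G j).p < 4 :=
  pullList_p_lt (by simp [single_p])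

theorem tab_append (G' : List (ℕ × ℕ × ℕ)) (j : ℕ) :
    tab c L (G ++ G') j = pullList G' (tab c L G j) := by
  rw [tab, tab, ← List.append_assoc, pullList_append]

theorem single_rowMem {W : ℕ} {τ : Mem} {q : ℕ}
    (h9 : ∀ a, τ.reg 11 ≤ a → τ.arr 9 a = 0)
    (h10 : ∀ a, τ.reg 11 ≤ a → τ.arr 10 a = if a = τ.reg 11 + q then 1 else 0)
    (h12 : τ.reg 12 = 0) (hq : q < W) : RowMem W τ (single q) := by
  refine ⟨fun q' _ => ?_, fun q' _ => ?_, by simpa [single] using h12, fun a ha => ⟨?_, ?_⟩⟩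
  · rw [h9 _ (by omega)]; simp [single]
  · rw [h10 _ (by omega)]
    by_cases e : q' = q
    · subst e; simp [single, ZMod.val_one]
    · simp [single, e]
  · exact h9 a (by omega)
  · rw [h10 a (by omega), if_neg (by omega)]

/-- A row is rebuilt from its initial Z by running through both lists. No table of rows has to be
kept up to date, so appending a gate updates all rows at once. -/
theorem pullRow_spec (h : Rep c σ L G) (hj : σ.reg 13 < c.K) :
    Rep c (pullRow.run σ) L G ∧ RowMem c.W (pullRow.run σ) (tab c L G (σ.reg 13)) := by
  set σ₁ := ((σ.setReg 11 (σ.reg 11 + σ.reg 8)).setReg 12 0).setCell 10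
    (σ.reg 11 + σ.reg 8 + c.Q (σ.reg 13)) 1 with hσ₁
  set body₁ : CProg := (.assign 14 (.const 2) ;;
    .assign 15 (.cell 7 (.sub (.sub (.reg 9) (.const 1)) (.reg 17))) ;;
    .assign 16 (.cell 8 (.sub (.sub (.reg 9) (.const 1)) (.reg 17))) ;;
    applyGate) with hbody₁
  set body₂ : CProg := (.assign 14 (.cell 4 (.reg 17)) ;;
    .assign 15 (.cell 5 (.reg 17)) ;;
    .assign 16 (.cell 6 (.reg 17)) ;;
    applyGate) with hbody₂
  have hrun : pullRow.run σ = (CProg.forV 17 10 body₂).run ((CProg.forV 17 9 body₁).run σ₁) := by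
    have e : (setZ (.cell 14 (.reg 13)) (.const 1)).run
        ((σ.setReg 11 (σ.reg 11 + σ.reg 8)).setReg 12 0) = σ₁ := by
      simp [run, Expr.eval, setZ, hσ₁, h.aQ _ hj]
    rw [← e]
    rfl
  have hQ := c.hQ _ hj
  set q := c.Q (σ.reg 13) with hq
  have hrow₁ : RowMem c.W σ₁ (single q) := by
    refine single_rowMem (q := q) (fun a ha => ?_) (fun a ha => ?_) ?_ hQ
    · simp [hσ₁, h.r8] at ha ⊢; exact (h.zero a (by omega)).1
    · simp only [hσ₁, h.r8, Mem.setCell_reg, Mem.setReg_reg] at ha ⊢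
      simp only [Mem.setCell_arr, Mem.setReg_arr] at ha ⊢
      norm_num at ha ⊢
      split
      · rfl
      · exact (h.zero a (by omega)).2
    · simp [hσ₁]
  -- the memory apart from the row
  let Same (τ : Mem) : Prop := (∀ r ∈ [0, 4, 5, 6, 7, 8, 9, 10], τ.reg r = σ.reg r) ∧
    ∀ a ∈ [4, 5, 6, 7, 8, 14], τ.arr a = σ.arr a
  have same₁ : Same σ₁ := by
    constructor
    · intro r hr
      simp only [List.mem_cons, List.not_mem_nil, or_false] at hr
      rcases hr with rfl | rfl | rfl | rfl | rfl | rfl | rfl | rfl <;> simp [hσ₁]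
    · intro a ha
      have : a ≠ 10 := by
        intro e; subst e; simp at ha
      rw [hσ₁, Mem.setCell_arr_ne _ this]; rfl
  have same_run : ∀ {p : CProg} {τ : Mem}, (∀ r ∈ [0, 4, 5, 6, 7, 8, 9, 10], r ∉ p.wr) →
      (∀ a ∈ [4, 5, 6, 7, 8, 14], a ∉ p.wa) → Same τ → Same (p.run τ) := by
    intro p τ hr ha hs
    exact ⟨fun r h => (run_reg (hr r h) τ).trans (hs.1 r h),
      fun a h => (run_arr (ha a h) τ).trans (hs.2 a h)⟩
  have same_set : ∀ {τ : Mem} {i v : ℕ}, i ∉ [0, 4, 5, 6, 7, 8, 9, 10] → Same τ →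
      Same (τ.setReg i v) := by
    intro τ i v hi hs
    refine ⟨fun r hr => ?_, hs.2⟩
    have : r ≠ i := fun e => hi (e ▸ hr)
    simp [this, hs.1 r hr]
  -- the first loop
  have loop₁ : RowMem c.W ((CProg.forV 17 9 body₁).run σ₁) (pullList L.reverse (single q)) ∧
      Same ((CProg.forV 17 9 body₁).run σ₁) := by
    have key := iter_invariant (i := 17) (f := body₁.run) (R := L.length) (σ := σ₁)
      (fun k τ => RowMem c.W τ (pullList (L.reverse.take k) (single q)) ∧ Same τ)
      ⟨by simpa using hrow₁.setReg 0 (by decide), same_set (by decide) same₁⟩ ?_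
    · have e : σ₁.reg 9 = L.length := by rw [same₁.1 9 (by decide), h.rL]
      rw [List.take_of_length_le (by simp)] at key
      simpa only [run, e] using key
    · intro k hk τ h17 ⟨hrow, hs⟩
      have h9 : τ.reg 9 = L.length := by rw [hs.1 9 (by decide), h.rL]
      have hk' : L.length - 1 - k < L.length := by omega
      have hget : L.reverse[k]'(by simpa using hk) = L[L.length - 1 - k] := by
        simp [List.getElem_reverse]
      have haL := h.aL _ hk'
      have hmem := h.okL' _ (List.getElem_mem hk')
      obtain ⟨a, b, -, -, -, hL2⟩ := h.okL _ (List.getElem_mem hk')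
      set τ₁ := ((τ.setReg 14 2).setReg 15 (L[L.length - 1 - k].2.1)).setReg 16
        (L[L.length - 1 - k].2.2) with hτ₁
      have hb : body₁.run τ = applyGate.run τ₁ := by
        have a7 : τ.arr 7 = σ.arr 7 := hs.2 7 (by decide)
        have a8 : τ.arr 8 = σ.arr 8 := hs.2 8 (by decide)
        have e1 : σ.arr 7 (L.length - 1 - k) = L[L.length - 1 - k].2.1 := by rw [← haL]
        have e2 : σ.arr 8 (L.length - 1 - k) = L[L.length - 1 - k].2.2 := by rw [← haL]
        simp [hbody₁, run, Expr.eval, h9, h17, a7, a8, e1, e2, hτ₁]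
      have hg : (τ₁.reg 14, τ₁.reg 15, τ₁.reg 16) = L[L.length - 1 - k] := by
        simp [hτ₁]
        rw [hL2]
      have hrow' : RowMem c.W τ₁ (pullList (L.reverse.take k) (single q)) :=
        ((hrow.setReg _ (by decide)).setReg _ (by decide)).setReg _ (by decide)
      have := applyGate_spec (by rw [hg]; exact hmem) hrow' (pullList_p_lt (by simp [single_p]))
      rw [hg, ← hget] at this
      rw [hb]
      refine ⟨?_, same_set (by decide) (same_run (by decide) (by decide)
        (same_set (by decide) (same_set (by decide) (same_set (by decide) hs))))⟩
      rw [List.take_add_one, pullList_append, List.getElem?_eq_getElem (by simpa using hk)]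
      exact this.setReg _ (by decide)
  obtain ⟨hrow₂, same₂⟩ := loop₁
  set σ₂ := (CProg.forV 17 9 body₁).run σ₁
  have loop₂ : RowMem c.W ((CProg.forV 17 10 body₂).run σ₂) (tab c L G (σ.reg 13)) ∧
      Same ((CProg.forV 17 10 body₂).run σ₂) := by
    have key := iter_invariant (i := 17) (f := body₂.run) (R := G.length) (σ := σ₂)
      (fun k τ => RowMem c.W τ (pullList (G.take k) (pullList L.reverse (single q))) ∧ Same τ)
      ⟨by simpa using hrow₂.setReg 0 (by decide), same_set (by decide) same₂⟩ ?_
    · have e : σ₂.reg 10 = G.length := by rw [same₂.1 10 (by decide), h.rG]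
      rw [List.take_of_length_le le_rfl, ← pullList_append] at key
      simpa only [run, e, tab] using key
    · intro k hk τ h17 ⟨hrow, hs⟩
      have haG := h.aG _ hk
      have hmem := h.okG _ (List.getElem_mem hk)
      set τ₁ := ((τ.setReg 14 (G[k].1)).setReg 15 (G[k].2.1)).setReg 16 (G[k].2.2) with hτ₁
      have hb : body₂.run τ = applyGate.run τ₁ := by
        have a4 : τ.arr 4 = σ.arr 4 := hs.2 4 (by decide)
        have a5 : τ.arr 5 = σ.arr 5 := hs.2 5 (by decide)
        have a6 : τ.arr 6 = σ.arr 6 := hs.2 6 (by decide)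
        have e0 : σ.arr 4 k = G[k].1 := by rw [← haG]
        have e1 : σ.arr 5 k = G[k].2.1 := by rw [← haG]
        have e2 : σ.arr 6 k = G[k].2.2 := by rw [← haG]
        simp [hbody₂, run, Expr.eval, h17, a4, a5, a6, e0, e1, e2, hτ₁]
      have hg : (τ₁.reg 14, τ₁.reg 15, τ₁.reg 16) = G[k] := by simp [hτ₁]
      have hrow' : RowMem c.W τ₁ (pullList (G.take k) (pullList L.reverse (single q))) :=
        ((hrow.setReg _ (by decide)).setReg _ (by decide)).setReg _ (by decide)
      have := applyGate_spec (by rw [hg]; exact hmem) hrow'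
        (pullList_p_lt (pullList_p_lt (by simp [single_p])))
      rw [hg] at this
      rw [hb]
      refine ⟨?_, same_set (by decide) (same_run (by decide) (by decide)
        (same_set (by decide) (same_set (by decide) (same_set (by decide) hs))))⟩
      rw [List.take_add_one, pullList_append, List.getElem?_eq_getElem hk]
      exact this.setReg _ (by decide)
  rw [hrun]
  set σ₃ := (CProg.forV 17 10 body₂).run σ₂
  obtain ⟨hrow₃, same₃⟩ := loop₂
  refine ⟨?_, hrow₃⟩
  obtain ⟨sr, sa⟩ := same₃
  simp only [List.mem_cons, List.not_mem_nil, or_false, forall_eq_or_imp, forall_eq] at sr sa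
  obtain ⟨h0, h4, h5, h6, h7, h8, h9, h10⟩ := sr
  obtain ⟨a4, a5, a6, a7, a8, a14⟩ := sa
  constructor
  · rw [h0]; exact h.r0
  · rw [h4]; exact h.r4
  · rw [h5]; exact h.r5
  · rw [h6]; exact h.r6
  · rw [h7]; exact h.r7
  · rw [h8]; exact h.r8
  · rw [h9]; exact h.rL
  · rw [h10]; exact h.rG
  · rw [a7, a8]; exact h.aL
  · rw [a4, a5, a6]; exact h.aG
  · rw [a14]; exact h.aQ
  · exact h.okL
  · exact h.okG
  · exact hrow₃.zero

/-! ### Appending gates -/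

theorem pushG_spec (h : Rep c σ L G) (hg : GateIn (· < c.W) (σ.reg 14, σ.reg 15, σ.reg 16)) :
    Rep c (pushG.run σ) L (G ++ [(σ.reg 14, σ.reg 15, σ.reg 16)]) := by
  have hrun : pushG.run σ = (((σ.setCell 4 G.length (σ.reg 14)).setCell 5 G.length
      (σ.reg 15)).setCell 6 G.length (σ.reg 16)).setReg 10 (G.length + 1) := by
    simp [pushG, run, Expr.eval, h.rG]
  rw [hrun]
  constructor
  · simp [h.r0]
  · simp [h.r4]
  · simp [h.r5]
  · simp [h.r6]
  · simp [h.r7]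
  · simp [h.r8]
  · simp [h.rL]
  · simp
  · simpa using h.aL
  · intro i hi
    rw [List.getElem_append]
    split
    · have := h.aG i (by assumption)
      have hne : i ≠ G.length := by omega
      simpa [hne] using this
    · have : i = G.length := by simp at hi; omega
      simp [this]
  · simpa using h.aQ
  · exact h.okL
  · intro g hgm
    rcases List.mem_append.1 hgm with hgm | hgm
    · exact h.okG g hgm
    · rw [List.mem_singleton.1 hgm]; exact hg
  · simpa using h.zero

theorem gateG_spec (h : Rep c σ L G) {k a b : ℕ} {ea eb : Expr}
    (ha : ea.eval (σ.setReg 14 k) = a)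
    (hb : eb.eval ((σ.setReg 14 k).setReg 15 a) = b) (hg : GateIn (· < c.W) (k, a, b)) :
    Rep c ((gateG k ea eb).run σ) L (G ++ [(k, a, b)]) := by
  have hrun : (gateG k ea eb).run σ =
      pushG.run (((σ.setReg 14 k).setReg 15 a).setReg 16 b) := by
    have e : Expr.eval σ (.const k) = k := rfl
    simp only [gateG, run, e, ha, hb]
  rw [hrun]
  have := pushG_spec (((h.setReg (i := 14) k (by decide)).setReg (i := 15) a (by decide)).setReg
    (i := 16) b (by decide)) (by simpa using hg)
  simpa using this

theorem gateL_spec (h : Rep c σ L G) {a b : ℕ} {ea eb : Expr}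
    (hea : ea.eval σ = c.Q a) (heb : eb.eval (σ.setReg 15 (c.Q a)) = c.Q b)
    (ha : a < c.K) (hb : b < c.K) (hab : a ≠ b) :
    Rep c ((gateL ea eb).run σ) (L ++ [(2, c.Q a, c.Q b)]) G := by
  have hrun : (gateL ea eb).run σ = ((((σ.setReg 15 (c.Q a)).setReg 16 (c.Q b)).setCell 7 L.length
      (c.Q a)).setCell 8 L.length (c.Q b)).setReg 9 (L.length + 1) := by
    simp [gateL, run, hea, heb]
    simp [Expr.eval, h.rL]
  rw [hrun]
  constructor
  · simp [h.r0]
  · simp [h.r4]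
  · simp [h.r5]
  · simp [h.r6]
  · simp [h.r7]
  · simp [h.r8]
  · simp
  · simp [h.rG]
  · intro i hi
    rw [List.getElem_append]
    split
    · have := h.aL i (by assumption)
      have hne : i ≠ L.length := by omega
      simpa [hne] using this
    · have : i = L.length := by simp at hi; omega
      simp [this]
  · simpa using h.aG
  · simpa using h.aQ
  · intro g hgm
    rcases List.mem_append.1 hgm with hgm | hgm
    · exact h.okL g hgm
    · rw [List.mem_singleton.1 hgm]; exact ⟨a, b, ha, hb, hab, rfl⟩
  · exact h.okG
  · simpa using h.zero

/-- The appended CNOT acts after everything else and is pulled back first: it sends Z on the target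
to the product of Z on control and target, and fixes Z on all other measured qubits. Injectivity of
`c.Q` keeps the other rows out. -/
theorem tab_append_L {a b : ℕ} (hb : b < c.K) {j : ℕ} (hj : j < c.K) :
    (j = b → IsSum (tab c L G a) (tab c L G b) (tab c (L ++ [(2, c.Q a, c.Q b)]) G j)) ∧
    (j ≠ b → tab c (L ++ [(2, c.Q a, c.Q b)]) G j = tab c L G j) := by
  have e : ∀ j, tab c (L ++ [(2, c.Q a, c.Q b)]) G j =
      pullList (L.reverse ++ G) (pull (2, c.Q a, c.Q b) (single (c.Q j))) := by
    intro j; simp [tab]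
  constructor
  · rintro rfl
    rw [e]
    refine IsSum.pullList ⟨fun q => ?_, fun q => ?_⟩ _
    · simp [single, pull]
    · by_cases hq : q = c.Q a
      · subst hq; simp [single, pull, add_comm]
      · simp [single, pull, hq]
  · intro hjb
    rw [e, tab]
    congr 1
    have : c.Q j ≠ c.Q b := fun h => hjb (c.inj j hj b hb h)
    ext q
    · simp [single, pull]
    · by_cases hq : q = c.Q a
      · subst hq; simp [single, pull, this.symm]
      · simp [single, pull, hq]
    · rfl

end Synth
end QCSAT

namespace RAM.CProg

/-- Invariants of loops. Registers and arrays that the body does not write are unchanged. -/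
theorem forC_invariant {i b : ℕ} {p : CProg} {σ : Mem} (I : ℕ → Mem → Prop)
    (h0 : I 0 (σ.setReg i 0))
    (hs : ∀ k < σ.reg b, ∀ τ, τ.reg i = k → (∀ r, r ≠ i → r ∉ p.wr → τ.reg r = σ.reg r) →
      (∀ a, a ∉ p.wa → τ.arr a = σ.arr a) → I k τ → I (k + 1) ((p.run τ).setReg i (k + 1))) :
    I (σ.reg b) ((forC i b p).run σ) := by
  have key := iter_invariant (i := i) (f := p.run) (R := σ.reg b) (σ := σ)
    (fun k τ => (∀ r, r ≠ i → r ∉ p.wr → τ.reg r = σ.reg r) ∧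
      (∀ a, a ∉ p.wa → τ.arr a = σ.arr a) ∧ I k τ)
    ⟨fun r hr _ => by simp [hr], fun a _ => rfl, h0⟩
    (fun k hk τ hi ⟨hr, ha, hI⟩ => ⟨fun r h h' => by simp [h, run_reg h', hr r h h'],
      fun a h => by simp [run_arr h, ha a h], hs k hk τ hi hr ha hI⟩)
  exact key.2.2

theorem forV_invariant {i b : ℕ} {p : CProg} {σ : Mem} (I : ℕ → Mem → Prop)
    (h0 : I 0 (σ.setReg i 0))
    (hs : ∀ k < σ.reg b, ∀ τ, τ.reg i = k → (∀ r, r ≠ i → r ∉ p.wr → τ.reg r = σ.reg r) →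
      (∀ a, a ∉ p.wa → τ.arr a = σ.arr a) → I k τ → I (k + 1) ((p.run τ).setReg i (k + 1))) :
    I (σ.reg b) ((forV i b p).run σ) :=
  forC_invariant I h0 hs

end RAM.CProg

/-! ### Row elimination and reduction of a row on a block of qubits -/

namespace QCSAT

namespace Synth
open RAM RAM.CProg RAM.Expr Row

variable {c : Ctx} {σ : Mem} {L G : List (ℕ × ℕ × ℕ)}

theorem cond_run_pos {e : Expr} {p : CProg} {σ : Mem} (h : e.eval σ ≠ 0) :
    (cond e p).run σ = p.run σ := by
  simp [cond, run, h]

theorem cond_run_neg {e : Expr} {p : CProg} {σ : Mem} (h : e.eval σ = 0) :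
    (cond e p).run σ = σ := by
  simp [cond, run, h]

theorem seq_run (p q : CProg) (σ : Mem) : (p ;; q).run σ = q.run (p.run σ) := rfl

theorem assign_run (i : ℕ) (e : Expr) (σ : Mem) :
    (CProg.assign i e).run σ = σ.setReg i (e.eval σ) := rfl

theorem val_ne_zero {a : ZMod 2} : a.val ≠ 0 ↔ a = 1 := by revert a; decide

/-! ### Row operations -/

/-- Loading a row. -/
theorem load_spec (h : Rep c σ L G) {e : Expr} {j : ℕ} (he : e.eval σ = j) (hj : j < c.K) :
    Rep c ((CProg.assign 13 e ;; pullRow).run σ) L G ∧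
      RowMem c.W ((CProg.assign 13 e ;; pullRow).run σ) (tab c L G j) := by
  rw [seq_run, assign_run, he]
  have := pullRow_spec (h.setReg (i := 13) j (by decide)) (by simpa using hj)
  simpa using this

/-- Multiplication of the live rows that have a bit in some column by a fixed row. -/
theorem elim_spec {arr i₀ col : ℕ} {f : Row → ZMod 2}
    (hf : ∀ τ r, RowMem c.W τ r → τ.arr arr (τ.reg 11 + col) = (f r).val)
    (h : Rep c σ L G) (h30 : σ.reg 30 = i₀) (h31 : σ.reg 31 = col) (hi₀ : i₀ < c.K)
    (hdead : σ.arr 11 i₀ ≠ 0) :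
    ∃ L', Rep c ((elim arr).run σ) L' G ∧ ∀ j < c.K,
      (σ.arr 11 j = 0 → f (tab c L G j) = 1 →
        IsSum (tab c L G i₀) (tab c L G j) (tab c L' G j)) ∧
      ((σ.arr 11 j = 0 → f (tab c L G j) = 1 → False) → tab c L' G j = tab c L G j) := by
  set body : CProg := .ite (.cell 11 (.reg 32)) .skip
    (.assign 13 (.reg 32) ;; pullRow ;;
      cond (.cell arr (.add (.reg 11) (.reg 31)))
        (gateL (.cell 14 (.reg 30)) (.cell 14 (.reg 32)))) with hbody
  have hwr : ∀ r, r ∉ (elim 9).wr → r ≠ 32 ∧ r ∉ body.wr := fun r h =>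
    ⟨fun e => h (List.mem_cons.2 (.inl e)), fun e => h (List.mem_cons_of_mem _ e)⟩
  have hwa : ∀ r, r ∉ (elim 9).wa → r ∉ body.wa := fun r h => h
  have key := forC_invariant (i := 32) (b := 6) (p := body) (σ := σ)
    (fun k τ => ∃ L', Rep c τ L' G ∧ ∀ j < c.K,
      (j < k → σ.arr 11 j = 0 → f (tab c L G j) = 1 →
        IsSum (tab c L G i₀) (tab c L G j) (tab c L' G j)) ∧
      ((j < k → σ.arr 11 j = 0 → f (tab c L G j) = 1 → False) → tab c L' G j = tab c L G j))
    ⟨L, h.setReg 0 (by decide), fun j _ => ⟨fun h => absurd h (by omega), fun _ => rfl⟩⟩ ?_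
  · obtain ⟨L', hL', hj⟩ := key
    refine ⟨L', hL', fun j hjK => ?_⟩
    have := hj j hjK
    rw [h.r6] at this
    exact ⟨this.1 hjK, fun h => this.2 fun _ => h⟩
  · rintro k hk τ h32 hreg harr ⟨L', hR, hj⟩
    rw [h.r6] at hk
    have a11 : τ.arr 11 = σ.arr 11 := harr 11 (hwa _ (by decide))
    by_cases hlive : σ.arr 11 k = 0
    · set τ₁ := (CProg.assign 13 (.reg 32) ;; pullRow).run τ with hτ₁
      obtain ⟨R₁, M₁⟩ := load_spec (e := .reg 32) hR (j := k) h32 hk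
      rw [← hτ₁] at R₁ M₁
      have r30 : τ₁.reg 30 = i₀ := by
        rw [hτ₁, run_reg (by decide), hreg 30 (hwr _ (by decide)).1 (hwr _ (by decide)).2, h30]
      have r31 : τ₁.reg 31 = col := by
        rw [hτ₁, run_reg (by decide), hreg 31 (hwr _ (by decide)).1 (hwr _ (by decide)).2, h31]
      have r32 : τ₁.reg 32 = k := by rw [hτ₁, run_reg (by decide), h32]
      have hrun : body.run τ = (cond (.cell arr (.add (.reg 11) (.reg 31)))
        (gateL (.cell 14 (.reg 30)) (.cell 14 (.reg 32)))).run τ₁ := by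
        have e : ¬ (Expr.cell 11 (.reg 32)).eval τ ≠ 0 := by
          simp [Expr.eval, h32, a11, hlive]
        rw [hbody, run, if_neg e]
        rfl
      have hval : (Expr.cell arr (.add (.reg 11) (.reg 31))).eval τ₁ = (f (tab c L G k)).val := by
        have := hf _ _ M₁
        rw [(hj k hk).2 fun h => absurd h (by omega)] at this
        rw [← this]
        simp [Expr.eval, r31]
      rw [hrun]
      by_cases hbit : f (tab c L G k) = 1
      · rw [cond_run_pos (by rw [hval, val_ne_zero]; exact hbit)]
        -- Row `i₀` is not live and thus never a target, so every addition uses its original value.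
        have hne : i₀ ≠ k := fun e => hdead (e ▸ hlive)
        refine ⟨L' ++ [(2, c.Q i₀, c.Q k)], (gateL_spec R₁ (by simp [Expr.eval, r30, R₁.aQ _ hi₀])
          (by simp [Expr.eval, r32, R₁.aQ _ hk]) hi₀ hk hne).setReg _ (by decide), fun j hjK => ?_⟩
        obtain ⟨s1, s2⟩ := tab_append_L (c := c) (L := L') (G := G) (a := i₀) hk hjK
        by_cases hjk : j = k
        · subst hjk
          have e1 : tab c L' G j = tab c L G j := (hj j hjK).2 fun h => absurd h (by omega)
          have e2 : tab c L' G i₀ = tab c L G i₀ := (hj i₀ hi₀).2 fun _ h => absurd h hdead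
          have := s1 rfl
          rw [e1, e2] at this
          exact ⟨fun _ _ _ => this, fun h => (h (by omega) hlive hbit).elim⟩
        · rw [s2 hjk]
          refine ⟨fun h1 h2 h3 => (hj j hjK).1 (by omega) h2 h3, fun h => (hj j hjK).2 ?_⟩
          exact fun h1 => h (by omega)
      · rw [cond_run_neg (by rw [hval, ← not_not (a := _ = 0)]; exact fun h => hbit (val_ne_zero.1 h))]
        refine ⟨L', R₁.setReg _ (by decide), fun j hjK => ⟨fun h1 h2 h3 => ?_, fun h => ?_⟩⟩
        · refine (hj j hjK).1 ?_ h2 h3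
          have : j ≠ k := by rintro rfl; exact hbit h3
          omega
        · exact (hj j hjK).2 fun h1 => h (by omega)
    · have hrun : body.run τ = τ := by
        have e : (Expr.cell 11 (.reg 32)).eval τ ≠ 0 := by
          simp [Expr.eval, h32, a11, hlive]
        rw [hbody, run, if_pos e]
        rfl
      rw [hrun]
      refine ⟨L', hR.setReg _ (by decide), fun j hjK => ⟨fun h1 h2 h3 => ?_, fun h => ?_⟩⟩
      · refine (hj j hjK).1 ?_ h2 h3
        have : j ≠ k := by rintro rfl; exact hlive h2
        omega
      · exact (hj j hjK).2 fun h1 => h (by omega)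

/-- The written registers do not depend on `arr`, so membership can be decided for one concrete
array. -/
theorem elim_reg {arr r : ℕ} (h : r ∉ (elim 9).wr) (σ : Mem) :
    ((elim arr).run σ).reg r = σ.reg r :=
  run_reg (p := elim arr) h σ

theorem elim_arr {arr a : ℕ} (h : a ∉ (elim 9).wa) (σ : Mem) :
    ((elim arr).run σ).arr a = σ.arr a :=
  run_arr (p := elim arr) h σ

/-- Looking for a live row with an `X` part at a qubit. -/
theorem findRow_spec (h : Rep c σ L G) {col : ℕ} (h31 : σ.reg 31 = col) (hcol : col < c.W) :
    Rep c (findRow.run σ) L G ∧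
      (((findRow.run σ).reg 33 = 0 ∧ ∀ j < c.K, σ.arr 11 j = 0 → (tab c L G j).x col = 0) ∨
        ∃ j < c.K, (findRow.run σ).reg 33 = j + 1 ∧ σ.arr 11 j = 0 ∧
          (tab c L G j).x col = 1) := by
  set body : CProg := .ite (.cell 11 (.reg 32)) .skip
    (.assign 13 (.reg 32) ;; pullRow ;;
      cond (xAt (.reg 31)) (.assign 33 (.add (.reg 32) (.const 1)))) with hbody
  have key := forC_invariant (i := 32) (b := 6) (p := body) (σ := σ.setReg 33 0)
    (fun k τ => Rep c τ L G ∧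
      ((τ.reg 33 = 0 ∧ ∀ j < k, σ.arr 11 j = 0 → (tab c L G j).x col = 0) ∨
        ∃ j < c.K, τ.reg 33 = j + 1 ∧ σ.arr 11 j = 0 ∧ (tab c L G j).x col = 1))
    ⟨(h.setReg 0 (by decide)).setReg 0 (by decide), .inl ⟨by simp, fun j h => absurd h (by omega)⟩⟩ ?_
  · have e : (σ.setReg 33 0).reg 6 = c.K := by simp [h.r6]
    rw [e] at key
    exact key
  · rintro k hk τ h32 hreg harr ⟨hR, hj⟩
    have hk : k < c.K := by simpa [h.r6] using hk
    have a11 : τ.arr 11 = σ.arr 11 := harr 11 (by decide)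
    by_cases hlive : σ.arr 11 k = 0
    · set τ₁ := (CProg.assign 13 (.reg 32) ;; pullRow).run τ with hτ₁
      obtain ⟨R₁, M₁⟩ := load_spec (e := .reg 32) hR (j := k) h32 hk
      rw [← hτ₁] at R₁ M₁
      have r31 : τ₁.reg 31 = col := by
        rw [hτ₁, run_reg (by decide), hreg 31 (by decide) (by decide)]; simpa using h31
      have r32 : τ₁.reg 32 = k := by rw [hτ₁, run_reg (by decide), h32]
      have r33 : τ₁.reg 33 = τ.reg 33 := by rw [hτ₁, run_reg (by decide)]
      have hrun : body.run τ = (cond (xAt (.reg 31)) (.assign 33 (.add (.reg 32) (.const 1)))).run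
          τ₁ := by
        have e : ¬ (Expr.cell 11 (.reg 32)).eval τ ≠ 0 := by
          simp [Expr.eval, h32, a11, hlive]
        rw [hbody, run, if_neg e]
        rfl
      have hval : (xAt (.reg 31)).eval τ₁ = ((tab c L G k).x col).val := by
        rw [← M₁.x _ hcol]
        simp [xAt, Expr.eval, r31]
      rw [hrun]
      by_cases hbit : (tab c L G k).x col = 1
      · rw [cond_run_pos (by rw [hval, val_ne_zero]; exact hbit), assign_run]
        refine ⟨(R₁.setReg _ (by decide)).setReg _ (by decide), .inr ⟨k, hk, ?_, hlive, hbit⟩⟩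
        simp [Expr.eval, r32]
      · rw [cond_run_neg (by rw [hval, ← not_not (a := _ = 0)]; exact fun h => hbit (val_ne_zero.1 h))]
        refine ⟨R₁.setReg _ (by decide), ?_⟩
        simp only [Mem.setReg_reg, show ¬ (33 = 32) by decide, if_false, r33]
        refine hj.imp (fun ⟨h1, h2⟩ => ⟨h1, fun j hjk hl => ?_⟩) id
        rcases Nat.lt_succ_iff_lt_or_eq.1 hjk with h' | rfl
        · exact h2 j h' hl
        · exact (zmod2_cases _).resolve_right hbit
    · have hrun : body.run τ = τ := by
        have e : (Expr.cell 11 (.reg 32)).eval τ ≠ 0 := by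
          simp [Expr.eval, h32, a11, hlive]
        rw [hbody, run, if_pos e]
        rfl
      rw [hrun]
      refine ⟨hR.setReg _ (by decide), ?_⟩
      simp only [Mem.setReg_reg, show ¬ (33 = 32) by decide, if_false]
      refine hj.imp (fun ⟨h1, h2⟩ => ⟨h1, fun j hjk hl => ?_⟩) id
      rcases Nat.lt_succ_iff_lt_or_eq.1 hjk with h' | rfl
      · exact h2 j h' hl
      · exact absurd hl hlive

/-! ### Reduction of a row on a range of qubits -/

theorem forRange_invariant {p : CProg} {σ : Mem} {lo hi : ℕ} (I : ℕ → Mem → Prop)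
    (hp : 21 ∉ p.wr ∧ 22 ∉ p.wr) (h21 : σ.reg 21 = lo) (h22 : σ.reg 22 = hi)
    (h0 : I 0 (σ.setReg 24 0))
    (hskip : ∀ k τ, ¬ (lo ≤ k ∧ k < hi) → I k τ → I (k + 1) (τ.setReg 24 (k + 1)))
    (hs : ∀ k τ, lo ≤ k → k < hi → τ.reg 24 = k →
      (∀ r, r ≠ 24 → r ∉ p.wr → τ.reg r = σ.reg r) →
      I k τ → I (k + 1) ((p.run τ).setReg 24 (k + 1))) :
    I (σ.reg 7) ((forRange p).run σ) := by
  have hw : ∀ r, r ∉ p.wr → r ∉ (cond (.sub (.add (.reg 24) (.const 1)) (.reg 21))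
      (cond (.sub (.reg 22) (.reg 24)) p)).wr := by
    intro r hr
    simpa [cond, wr] using hr
  refine forC_invariant I h0 fun k _ τ h24 hreg _ hI => ?_
  have r21 : τ.reg 21 = lo := by rw [hreg 21 (by decide) (hw _ hp.1), h21]
  have r22 : τ.reg 22 = hi := by rw [hreg 22 (by decide) (hw _ hp.2), h22]
  by_cases hlo : lo ≤ k
  · rw [cond_run_pos (by simp [Expr.eval, r21, h24]; omega)]
    by_cases hhi : k < hi
    · rw [cond_run_pos (by simp [Expr.eval, r22, h24]; omega)]
      exact hs k τ hlo hhi h24 (fun r h h' => hreg r h (hw _ h')) hI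
    · rw [cond_run_neg (by simp [Expr.eval, r22, h24]; omega)]
      exact hskip k τ (by omega) hI
  · rw [cond_run_neg (by simp [Expr.eval, r21, h24]; omega)]
    exact hskip k τ (by omega) hI

/-- The qubits of a range. -/
def InRange (bs lo hi q : ℕ) : Prop := bs + lo ≤ q ∧ q < bs + hi

/-- Gates that preserve the row `Z` on the qubit `u`. -/
def Mild (u : ℕ) (g : ℕ × ℕ × ℕ) : Prop :=
  (g.1 = 0 → g.2.1 ≠ u) ∧ (g.1 = 2 → g.2.1 = u)

/-- S fixes Z; H off `u` meets a trivial qubit; a CNOT with control `u` could only import Z from its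
target or export X from `u`, and neither is there. So the first row of a pair stays Z while its
partner is being reduced. -/
theorem pull_of_mild {P : ℕ → Prop} {u : ℕ} {g : ℕ × ℕ × ℕ} (hg : GateIn P g) (hm : Mild u g)
    {r : Row} (hr : ∀ q, P q → r.x q = 0 ∧ r.z q = if q = u then 1 else 0) :
    ∀ q, P q → (pull g r).x q = 0 ∧ (pull g r).z q = if q = u then 1 else 0 := by
  revert hm
  refine hg.cases (C := fun g => Mild u g → ∀ q, P q →
    (pull g r).x q = 0 ∧ (pull g r).z q = if q = u then 1 else 0) ?_ ?_ ?_
  · intro a ha hm q hq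
    have hau : a ≠ u := hm.1 rfl
    by_cases e : q = a
    · subst e; simp [pull, hr q hq, hau]
    · simp [pull, e, hr q hq]
  · intro a ha hm q hq
    by_cases e : q = a
    · subst e; simp [pull, hr q hq]
    · simp [pull, e, hr q hq]
  · intro a b ha hb hab hm q hq
    have hau : a = u := hm.2 rfl
    subst hau
    constructor
    · by_cases e : q = b
      · subst e; simp [pull, hr q hq, hr a ha]
      · simp [pull, e, hr q hq]
    · by_cases e : q = a
      · subst e; simp [pull, hr q hq, hr b hb, hab.symm]
      · simp [pull, e, hr q hq]

theorem pullList_of_mild {P : ℕ → Prop} {u : ℕ} {gl : List (ℕ × ℕ × ℕ)}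
    (hg : ∀ g ∈ gl, GateIn P g) (hm : ∀ g ∈ gl, Mild u g)
    {r : Row} (hr : ∀ q, P q → r.x q = 0 ∧ r.z q = if q = u then 1 else 0) :
    ∀ q, P q → (pullList gl r).x q = 0 ∧ (pullList gl r).z q = if q = u then 1 else 0 := by
  induction gl generalizing r with
  | nil => exact hr
  | cons g gl ih =>
    exact ih (fun g' h => hg g' (by simp [h])) (fun g' h => hm g' (by simp [h]))
      (pull_of_mild (hg g (by simp)) (hm g (by simp)) hr)

theorem gateG_reg {k r : ℕ} {a b : Expr} (h : r ∉ (gateG 0 (.const 0) (.const 0)).wr) (σ : Mem) :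
    ((gateG k a b).run σ).reg r = σ.reg r :=
  run_reg (p := gateG k a b) h σ

theorem gateG_arr {k r : ℕ} {a b : Expr} (h : r ∉ (gateG 0 (.const 0) (.const 0)).wa) (σ : Mem) :
    ((gateG k a b).run σ).arr r = σ.arr r :=
  run_arr (p := gateG k a b) h σ

theorem gateG_row {W k : ℕ} {a b : Expr} {r : Row} (h : RowMem W σ r) :
    RowMem W ((gateG k a b).run σ) r :=
  h.congr (gateG_reg (by decide) σ) (gateG_reg (by decide) σ) (gateG_arr (by decide) σ)
    (gateG_arr (by decide) σ)

end Synth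
end QCSAT

namespace QCSAT

namespace Synth
open RAM RAM.CProg RAM.Expr Row

variable {c : Ctx} {σ : Mem} {L G : List (ℕ × ℕ × ℕ)}

/-- The first stage of the reduction: no `Z` part remains. -/
def clearZ : CProg :=
  forRange (cond (zAt (qbit 24))
    (.ite (xAt (qbit 24)) (gateG 1 (qbit 24) (.const 0)) (gateG 0 (qbit 24) (.const 0))))

/-- The second stage of the reduction: looking for a qubit with an `X` part. -/
def findX : CProg :=
  forRange (cond (xAt (qbit 24)) (.assign 25 (.add (.reg 24) (.const 1))))

/-- The third stage of the reduction: only one `X` remains. -/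
def clearX : CProg :=
  forRange (cond (xorE (.reg 24) (.reg 23)) (cond (xAt (qbit 24))
    (gateG 2 (qbit 23) (qbit 24))))

theorem reduce_run (σ : Mem) : reduce.run σ =
    (cond (.reg 25)
      (.ite (xAt (qbit 23)) .skip
          (gateG 2 (.add (.reg 20) (.sub (.reg 25) (.const 1))) (qbit 23)) ;;
        .assign 13 (.reg 29) ;; pullRow ;; clearX)).run
    (findX.run ((CProg.assign 25 (.const 0)).run ((CProg.assign 13 (.reg 29) ;; pullRow).run
      (clearZ.run ((CProg.assign 13 (.reg 29) ;; pullRow).run σ))))) := rfl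

/-- The only gate here that could spoil a Z on `u` is H, and H is applied only where the row has no
X part. This is why an X part at `u` makes all gates mild. -/
theorem clearZ_spec {r : Row} {bs lo hi u : ℕ} (h : Rep c σ L G) (hM : RowMem c.W σ r)
    (h20 : σ.reg 20 = bs) (h21 : σ.reg 21 = lo) (h22 : σ.reg 22 = hi) (hW : bs + hi ≤ c.W)
    (hD : hi ≤ σ.reg 7) :
    ∃ gl, Rep c (clearZ.run σ) L (G ++ gl) ∧ (∀ g ∈ gl, GateIn (InRange bs lo hi) g) ∧
      (∀ q, InRange bs lo hi q → (pullList gl r).z q = 0) ∧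
      (r.x (bs + u) = 1 → (∀ g ∈ gl, Mild (bs + u) g) ∧ (pullList gl r).x (bs + u) = 1) := by
  have key := forRange_invariant (p := cond (zAt (qbit 24))
      (.ite (xAt (qbit 24)) (gateG 1 (qbit 24) (.const 0)) (gateG 0 (qbit 24) (.const 0))))
    (σ := σ) (lo := lo) (hi := hi) (fun k τ => ∃ gl, Rep c τ L (G ++ gl) ∧ RowMem c.W τ r ∧
      (∀ g ∈ gl, GateIn (fun q => InRange bs lo hi q ∧ q < bs + k) g) ∧
      (∀ q, InRange bs lo hi q → q < bs + k → (pullList gl r).z q = 0) ∧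
      (r.x (bs + u) = 1 → (∀ g ∈ gl, Mild (bs + u) g) ∧ (pullList gl r).x (bs + u) = 1))
    (by decide) h21 h22
    ⟨[], by simpa using h.setReg 0 (by decide), hM.setReg 0 (by decide), by simp,
      fun q h1 h2 => absurd h1.1 (by omega), fun h => by simpa using h⟩ ?_ ?_
  · obtain ⟨gl, a1, a2, a3, a4, a5⟩ := key
    exact ⟨gl, a1, fun g hg => (a3 g hg).mono fun q h => h.1,
      fun q hq => a4 q hq (by have := hq.2; omega), a5⟩
  · rintro k τ hk ⟨gl, b1, b2, b3, b4, b5⟩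
    refine ⟨gl, b1.setReg _ (by decide), b2.setReg _ (by decide), fun g hg => (b3 g hg).mono
      fun q h => ⟨h.1, by have := h.2; omega⟩, fun q h1 h2 => b4 q h1 ?_, b5⟩
    have : q ≠ bs + k := by
      rintro rfl
      have h3 := h1.1; have h4 := h1.2
      omega
    omega
  · rintro k τ hlo hhi h24 hreg ⟨gl, b1, b2, b3, b4, b5⟩
    have r20 : τ.reg 20 = bs := by rw [hreg 20 (by decide) (by decide), h20]
    have hin : InRange bs lo hi (bs + k) := ⟨by omega, by omega⟩
    have hWk : bs + k < c.W := by omega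
    obtain ⟨e1, e2⟩ := pullList_of_not b3 r (q := bs + k) (by simp)
    have vz : (zAt (qbit 24)).eval τ = (r.z (bs + k)).val := by
      rw [← b2.z _ hWk]; simp [zAt, qbit, Expr.eval, r20, h24]
    have vx : (xAt (qbit 24)).eval τ = (r.x (bs + k)).val := by
      rw [← b2.x _ hWk]; simp [xAt, qbit, Expr.eval, r20, h24]
    have old : ∀ g ∈ gl, GateIn (fun q => InRange bs lo hi q ∧ q < bs + (k + 1)) g :=
      fun g hg => (b3 g hg).mono fun q h => ⟨h.1, by have := h.2; omega⟩
    by_cases hz : r.z (bs + k) = 1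
    · rw [cond_run_pos (by rw [vz, val_ne_zero]; exact hz)]
      have step : ∀ κ, κ < 2 → (κ = 1 → r.x (bs + k) = 1) → (κ = 0 → r.x (bs + k) = 0) →
          ∃ gl', Rep c (((gateG κ (qbit 24) (.const 0)).run τ).setReg 24 (k + 1)) L (G ++ gl') ∧
            RowMem c.W (((gateG κ (qbit 24) (.const 0)).run τ).setReg 24 (k + 1)) r ∧
            (∀ g ∈ gl', GateIn (fun q => InRange bs lo hi q ∧ q < bs + (k + 1)) g) ∧
            (∀ q, InRange bs lo hi q → q < bs + (k + 1) → (pullList gl' r).z q = 0) ∧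
            (r.x (bs + u) = 1 → (∀ g ∈ gl', Mild (bs + u) g) ∧
              (pullList gl' r).x (bs + u) = 1) := by
        intro κ hκ hκ1 hκ0
        refine ⟨gl ++ [(κ, bs + k, 0)], ?_, (gateG_row b2).setReg _ (by decide), ?_, ?_, ?_⟩
        · rw [← List.append_assoc]
          refine (gateG_spec b1 (by simp [qbit, Expr.eval, r20, h24]) rfl ?_).setReg _ (by decide)
          exact ⟨hWk, .inl ⟨hκ, rfl⟩⟩
        · intro g hg
          rcases List.mem_append.1 hg with hg | hg
          · exact old g hg
          · rw [List.mem_singleton.1 hg]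
            exact ⟨⟨hin, by simp⟩, .inl ⟨hκ, rfl⟩⟩
        · intro q h1 h2
          rw [pullList_append]
          by_cases e : q = bs + k
          · subst e
            interval_cases κ
            · simp [pull, e1, hκ0 rfl]
            · simp [pull, e1, e2, hz, hκ1 rfl, zmod2_add_self]
          · have := b4 q h1 (by omega)
            interval_cases κ <;> simp [pull, e, this]
        · intro hu
          obtain ⟨c1, c2⟩ := b5 hu
          refine ⟨fun g hg => ?_, ?_⟩
          · rcases List.mem_append.1 hg with hg | hg
            · exact c1 g hg
            · rw [List.mem_singleton.1 hg]
              refine ⟨fun h0 e => ?_, fun h2 => ?_⟩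
              · simp only at h0 e
                have := hκ0 h0
                rw [e, hu] at this
                exact one_ne_zero this
              · simp only at h2; omega
          · rw [pullList_append]
            interval_cases κ
            · have : bs + u ≠ bs + k := by
                intro e; have := hκ0 rfl; rw [← e, hu] at this; exact one_ne_zero this
              simp [pull, Function.update_apply, c2]
              intro e; omega
            · simpa [pull] using c2
      by_cases hx : r.x (bs + k) = 1
      · have e : (xAt (qbit 24)).eval τ ≠ 0 := by rw [vx, val_ne_zero]; exact hx
        rw [run, if_pos e]
        exact step 1 (by norm_num) (fun _ => hx) (by simp)
      · have hx0 := (zmod2_cases _).resolve_right hx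
        have e : ¬ (xAt (qbit 24)).eval τ ≠ 0 := by rw [vx, hx0]; simp
        rw [run, if_neg e]
        exact step 0 (by norm_num) (by simp) (fun _ => hx0)
    · have hz0 := (zmod2_cases _).resolve_right hz
      rw [cond_run_neg (by rw [vz, hz0]; simp)]
      refine ⟨gl, b1.setReg _ (by decide), b2.setReg _ (by decide), old, fun q h1 h2 => ?_, b5⟩
      by_cases e : q = bs + k
      · rw [e, e2, hz0]
      · exact b4 q h1 (by omega)

theorem findX_spec {r : Row} {bs lo hi : ℕ} (h : Rep c σ L G) (hM : RowMem c.W σ r)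
    (h20 : σ.reg 20 = bs) (h21 : σ.reg 21 = lo) (h22 : σ.reg 22 = hi) (hW : bs + hi ≤ c.W)
    (hD : hi ≤ σ.reg 7) (h25 : σ.reg 25 = 0) :
    Rep c (findX.run σ) L G ∧ RowMem c.W (findX.run σ) r ∧
      (((findX.run σ).reg 25 = 0 ∧ ∀ q, InRange bs lo hi q → r.x q = 0) ∨
        ∃ f, (findX.run σ).reg 25 = f + 1 ∧ InRange bs lo hi (bs + f) ∧ r.x (bs + f) = 1) := by
  have key := forRange_invariant
    (p := cond (xAt (qbit 24)) (.assign 25 (.add (.reg 24) (.const 1))))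
    (σ := σ) (lo := lo) (hi := hi) (fun k τ => Rep c τ L G ∧ RowMem c.W τ r ∧
      ((τ.reg 25 = 0 ∧ ∀ q, InRange bs lo hi q → q < bs + k → r.x q = 0) ∨
        ∃ f, τ.reg 25 = f + 1 ∧ InRange bs lo hi (bs + f) ∧ r.x (bs + f) = 1))
    (by decide) h21 h22
    ⟨h.setReg 0 (by decide), hM.setReg 0 (by decide), .inl ⟨by simpa using h25,
      fun q h1 h2 => absurd h1.1 (by omega)⟩⟩ ?_ ?_
  · obtain ⟨a1, a2, a3⟩ := key
    exact ⟨a1, a2, a3.imp (fun h => ⟨h.1, fun q hq => h.2 q hq (by have := hq.2; omega)⟩) id⟩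
  · rintro k τ hk ⟨b1, b2, b3⟩
    refine ⟨b1.setReg _ (by decide), b2.setReg _ (by decide), ?_⟩
    simp only [Mem.setReg_reg, show ¬ (25 = 24) by decide, if_false]
    refine b3.imp (fun h => ⟨h.1, fun q h1 h2 => h.2 q h1 ?_⟩) id
    have : q ≠ bs + k := by
      rintro rfl
      have h3 := h1.1; have h4 := h1.2
      omega
    omega
  · rintro k τ hlo hhi h24 hreg ⟨b1, b2, b3⟩
    have r20 : τ.reg 20 = bs := by rw [hreg 20 (by decide) (by decide), h20]
    have hWk : bs + k < c.W := by omega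
    have vx : (xAt (qbit 24)).eval τ = (r.x (bs + k)).val := by
      rw [← b2.x _ hWk]; simp [xAt, qbit, Expr.eval, r20, h24]
    by_cases hx : r.x (bs + k) = 1
    · rw [cond_run_pos (by rw [vx, val_ne_zero]; exact hx), assign_run]
      refine ⟨(b1.setReg _ (by decide)).setReg _ (by decide),
        (b2.setReg _ (by decide)).setReg _ (by decide), .inr ⟨k, ?_, ⟨by omega, by omega⟩, hx⟩⟩
      simp [Expr.eval, h24]
    · have hx0 := (zmod2_cases _).resolve_right hx
      rw [cond_run_neg (by rw [vx, hx0]; simp)]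
      refine ⟨b1.setReg _ (by decide), b2.setReg _ (by decide), ?_⟩
      simp only [Mem.setReg_reg, show ¬ (25 = 24) by decide, if_false]
      refine b3.imp (fun h => ⟨h.1, fun q h1 h2 => ?_⟩) id
      by_cases e : q = bs + k
      · rw [e, hx0]
      · exact h.2 q h1 (by omega)

/-- CNOTs from `u` remove the other X bits. They could only send Z bits back to `u`, and the row has
none. -/
theorem clearX_spec {r : Row} {bs lo hi u : ℕ} (h : Rep c σ L G) (hM : RowMem c.W σ r)
    (h20 : σ.reg 20 = bs) (h21 : σ.reg 21 = lo) (h22 : σ.reg 22 = hi) (h23 : σ.reg 23 = u)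
    (hW : bs + hi ≤ c.W) (hD : hi ≤ σ.reg 7) (hu : InRange bs lo hi (bs + u))
    (hx : r.x (bs + u) = 1) (hz : ∀ q, InRange bs lo hi q → r.z q = 0) :
    ∃ gl, Rep c (clearX.run σ) L (G ++ gl) ∧ (∀ g ∈ gl, GateIn (InRange bs lo hi) g) ∧
      (∀ g ∈ gl, Mild (bs + u) g) ∧
      ∀ q, InRange bs lo hi q → (pullList gl r).x q = (if q = bs + u then 1 else 0) ∧
        (pullList gl r).z q = 0 := by
  have key := forRange_invariant
    (p := cond (xorE (.reg 24) (.reg 23)) (cond (xAt (qbit 24)) (gateG 2 (qbit 23) (qbit 24))))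
    (σ := σ) (lo := lo) (hi := hi) (fun k τ => ∃ gl, Rep c τ L (G ++ gl) ∧ RowMem c.W τ r ∧
      (∀ g ∈ gl, GateIn (fun q => InRange bs lo hi q ∧ (q < bs + k ∨ q = bs + u)) g) ∧
      (∀ g ∈ gl, Mild (bs + u) g) ∧ (pullList gl r).x (bs + u) = 1 ∧
      (∀ q, InRange bs lo hi q → (pullList gl r).z q = 0) ∧
      ∀ q, InRange bs lo hi q → q < bs + k → q ≠ bs + u → (pullList gl r).x q = 0)
    (by decide) h21 h22
    ⟨[], by simpa using h.setReg 0 (by decide), hM.setReg 0 (by decide), by simp, by simp,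
      hx, hz, fun q h1 h2 => absurd h1.1 (by omega)⟩ ?_ ?_
  · obtain ⟨gl, a1, a2, a3, a4, a5, a6, a7⟩ := key
    refine ⟨gl, a1, fun g hg => (a3 g hg).mono fun q h => h.1, a4, fun q hq => ⟨?_, a6 q hq⟩⟩
    split
    · rename_i e; rw [e, a5]
    · exact a7 q hq (by have := hq.2; omega) (by assumption)
  · rintro k τ hk ⟨gl, b1, b2, b3, b4, b5, b6, b7⟩
    refine ⟨gl, b1.setReg _ (by decide), b2.setReg _ (by decide), fun g hg => (b3 g hg).mono
      fun q h => ⟨h.1, by have := h.2; omega⟩, b4, b5, b6, fun q h1 h2 => b7 q h1 ?_⟩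
    have : q ≠ bs + k := by
      rintro rfl
      have h3 := h1.1; have h4 := h1.2
      omega
    omega
  · rintro k τ hlo hhi h24 hreg ⟨gl, b1, b2, b3, b4, b5, b6, b7⟩
    have r20 : τ.reg 20 = bs := by rw [hreg 20 (by decide) (by decide), h20]
    have r23 : τ.reg 23 = u := by rw [hreg 23 (by decide) (by decide), h23]
    have hin : InRange bs lo hi (bs + k) := ⟨by omega, by omega⟩
    have hWk : bs + k < c.W := by omega
    have hWu : bs + u < c.W := by have := hu.2; omega
    have old : ∀ g ∈ gl, GateIn (fun q => InRange bs lo hi q ∧ (q < bs + (k + 1) ∨ q = bs + u)) g :=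
      fun g hg => (b3 g hg).mono fun q h => ⟨h.1, by have := h.2; omega⟩
    have vx : (xAt (qbit 24)).eval τ = (r.x (bs + k)).val := by
      rw [← b2.x _ hWk]; simp [xAt, qbit, Expr.eval, r20, h24]
    have skip : (k ≠ u → (pullList gl r).x (bs + k) = 0) → ∃ gl,
        Rep c (τ.setReg 24 (k + 1)) L (G ++ gl) ∧ RowMem c.W (τ.setReg 24 (k + 1)) r ∧
        (∀ g ∈ gl, GateIn (fun q => InRange bs lo hi q ∧ (q < bs + (k + 1) ∨ q = bs + u)) g) ∧
        (∀ g ∈ gl, Mild (bs + u) g) ∧ (pullList gl r).x (bs + u) = 1 ∧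
        (∀ q, InRange bs lo hi q → (pullList gl r).z q = 0) ∧
        ∀ q, InRange bs lo hi q → q < bs + (k + 1) → q ≠ bs + u → (pullList gl r).x q = 0 := by
      intro h0
      refine ⟨gl, b1.setReg _ (by decide), b2.setReg _ (by decide), old, b4, b5, b6,
        fun q h1 h2 h3 => ?_⟩
      by_cases e : q = bs + k
      · rw [e]; exact h0 (by omega)
      · exact b7 q h1 (by omega) h3
    by_cases hku : k = u
    · rw [cond_run_neg (by simp [xorE, Expr.eval, r23, h24, hku])]
      exact skip fun h => absurd hku h
    · rw [cond_run_pos (by simp [xorE, Expr.eval, r23, h24]; omega)]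
      obtain ⟨e1, e2⟩ := pullList_of_not b3 r (q := bs + k) (by
        rintro ⟨-, h | h⟩ <;> omega)
      by_cases hxk : r.x (bs + k) = 1
      · rw [cond_run_pos (by rw [vx, val_ne_zero]; exact hxk)]
        have hne : bs + u ≠ bs + k := by omega
        refine ⟨gl ++ [(2, bs + u, bs + k)], ?_, (gateG_row b2).setReg _ (by decide), ?_, ?_, ?_,
          ?_, ?_⟩
        · rw [← List.append_assoc]
          refine (gateG_spec b1 (by simp [qbit, Expr.eval, r20, r23])
            (by simp [qbit, Expr.eval, r20, h24]) ?_).setReg _ (by decide)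
          exact ⟨hWu, .inr ⟨rfl, hWk, hne⟩⟩
        · intro g hg
          rcases List.mem_append.1 hg with hg | hg
          · exact old g hg
          · rw [List.mem_singleton.1 hg]
            exact ⟨⟨hu, .inr rfl⟩, .inr ⟨rfl, ⟨hin, .inl (by simp)⟩, hne⟩⟩
        · intro g hg
          rcases List.mem_append.1 hg with hg | hg
          · exact b4 g hg
          · rw [List.mem_singleton.1 hg]
            exact ⟨by simp, fun _ => rfl⟩
        · rw [pullList_append]
          simp [pull, b5, Ne.symm hku]
        · intro q hq
          rw [pullList_append]
          by_cases e : q = bs + u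
          · subst e; simp [pull, b6 _ hq, b6 _ hin]
          · simp [pull, e, b6 _ hq]
        · intro q h1 h2 h3
          rw [pullList_append]
          by_cases e : q = bs + k
          · subst e; simp [pull, e1, hxk, b5, zmod2_add_self]
          · simp [pull, e, b7 q h1 (by omega) h3]
      · have hx0 := (zmod2_cases _).resolve_right hxk
        rw [cond_run_neg (by rw [vx, hx0]; simp)]
        exact skip fun _ => by rw [e1, hx0]

/-- Reduction of a row on a range of qubits. -/
theorem reduce_spec {bs lo hi u j : ℕ} (h : Rep c σ L G)
    (h20 : σ.reg 20 = bs) (h21 : σ.reg 21 = lo) (h22 : σ.reg 22 = hi) (h23 : σ.reg 23 = u)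
    (h29 : σ.reg 29 = j) (hj : j < c.K) (hW : bs + hi ≤ c.W) (hD : hi ≤ c.n + c.t)
    (hu : lo < hi → lo ≤ u ∧ u < hi) :
    ∃ gl, Rep c (reduce.run σ) L (G ++ gl) ∧ (∀ g ∈ gl, GateIn (InRange bs lo hi) g) ∧
      ((tab c L G j).x (bs + u) = 1 → ∀ g ∈ gl, Mild (bs + u) g) ∧
      (((reduce.run σ).reg 25 = 0 ∧ ∀ q, InRange bs lo hi q →
          (tab c L (G ++ gl) j).x q = 0 ∧ (tab c L (G ++ gl) j).z q = 0) ∨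
        ((reduce.run σ).reg 25 ≠ 0 ∧ lo < hi ∧ ∀ q, InRange bs lo hi q →
          (tab c L (G ++ gl) j).x q = (if q = bs + u then 1 else 0) ∧
            (tab c L (G ++ gl) j).z q = 0)) := by
  rw [reduce_run]
  -- the first stage
  set σ₁ := (CProg.assign 13 (.reg 29) ;; pullRow).run σ with hσ₁
  obtain ⟨R₁, M₁⟩ := load_spec (e := .reg 29) h h29 hj
  rw [← hσ₁] at R₁ M₁
  have f₁ : ∀ r ∈ [20, 21, 22, 23, 29], σ₁.reg r = σ.reg r := fun r hr => by
    rw [hσ₁, run_reg]; revert r; decide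
  obtain ⟨gl₁, R₂, in₁, z₁, mild₁⟩ := clearZ_spec (u := u) R₁ M₁ (by rw [f₁ 20 (by decide), h20])
    (by rw [f₁ 21 (by decide), h21]) (by rw [f₁ 22 (by decide), h22]) hW (by rw [R₁.r7]; exact hD)
  set σ₂ := clearZ.run σ₁ with hσ₂
  have f₂ : ∀ r ∈ [20, 21, 22, 23, 29], σ₂.reg r = σ.reg r := fun r hr => by
    rw [← f₁ r hr, hσ₂, run_reg]; revert r; decide
  -- the second stage
  set σ₃ := (CProg.assign 13 (.reg 29) ;; pullRow).run σ₂ with hσ₃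
  obtain ⟨R₃, M₃⟩ := load_spec (e := .reg 29) R₂ (by rw [← h29, ← f₂ 29 (by decide)]; rfl) hj
  rw [← hσ₃] at R₃ M₃
  have f₃ : ∀ r ∈ [20, 21, 22, 23, 29], σ₃.reg r = σ.reg r := fun r hr => by
    rw [← f₂ r hr, hσ₃, run_reg]; revert r; decide
  rw [assign_run]
  set σ₄ := σ₃.setReg 25 ((Expr.const 0).eval σ₃) with hσ₄
  have f₄ : ∀ r ∈ [20, 21, 22, 23, 29], σ₄.reg r = σ.reg r := fun r hr => by
    have : r ≠ 25 := by rintro rfl; revert hr; decide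
    rw [← f₃ r hr, hσ₄]; simp [this]
  have R₄ : Rep c σ₄ L (G ++ gl₁) := R₃.setReg _ (by decide)
  obtain ⟨R₅, M₅, h25⟩ := findX_spec R₄ (M₃.setReg _ (by decide)) (by rw [f₄ 20 (by decide), h20])
    (by rw [f₄ 21 (by decide), h21]) (by rw [f₄ 22 (by decide), h22]) hW (by rw [R₄.r7]; exact hD)
    (by simp [hσ₄, Expr.eval])
  set σ₅ := findX.run σ₄ with hσ₅
  have f₅ : ∀ r ∈ [20, 21, 22, 23, 29], σ₅.reg r = σ.reg r := fun r hr => by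
    rw [← f₄ r hr, hσ₅, run_reg]; revert r; decide
  have tz : ∀ q, InRange bs lo hi q → (tab c L (G ++ gl₁) j).z q = 0 := by
    intro q hq; rw [tab_append]; exact z₁ q hq
  rcases h25 with ⟨h25, hx⟩ | ⟨f, h25, hf, hxf⟩
  · rw [cond_run_neg (by simpa [Expr.eval] using h25)]
    exact ⟨gl₁, R₅, in₁, fun h => (mild₁ h).1, .inl ⟨h25, fun q hq => ⟨hx q hq, tz q hq⟩⟩⟩
  · rw [cond_run_pos (by simp [Expr.eval, h25])]
    have hlh : lo < hi := by have := hf.1; have := hf.2; omega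
    have hu' : InRange bs lo hi (bs + u) := by have := hu hlh; exact ⟨by omega, by omega⟩
    have hWu : bs + u < c.W := by have := hu'.2; omega
    have hWf : bs + f < c.W := by have := hf.2; omega
    rw [seq_run]
    -- moving the bit to its place
    obtain ⟨gl₂, σ₆, hσ₆, R₆, f₆, h25₆, in₂, mild₂, x₂, z₂⟩ : ∃ gl₂ σ₆,
        σ₆ = (CProg.ite (xAt (qbit 23)) .skip
          (gateG 2 (.add (.reg 20) (.sub (.reg 25) (.const 1))) (qbit 23))).run σ₅ ∧
        Rep c σ₆ L (G ++ gl₁ ++ gl₂) ∧ (∀ r ∈ [20, 21, 22, 23, 29], σ₆.reg r = σ.reg r) ∧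
        σ₆.reg 25 = f + 1 ∧
        (∀ g ∈ gl₂, GateIn (InRange bs lo hi) g) ∧
        -- The CNOT that moves an X to `u` has `u` as target and is not mild; it is needed only if
        -- the X is missing there.
        ((tab c L (G ++ gl₁) j).x (bs + u) = 1 → gl₂ = []) ∧
        (tab c L (G ++ gl₁ ++ gl₂) j).x (bs + u) = 1 ∧
        ∀ q, InRange bs lo hi q → (tab c L (G ++ gl₁ ++ gl₂) j).z q = 0 := by
      have vx : (xAt (qbit 23)).eval σ₅ = ((tab c L (G ++ gl₁) j).x (bs + u)).val := by
        rw [← M₅.x _ hWu]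
        simp [xAt, qbit, Expr.eval, f₅, h20, h23]
      by_cases hxu : (tab c L (G ++ gl₁) j).x (bs + u) = 1
      · have e : (xAt (qbit 23)).eval σ₅ ≠ 0 := by rw [vx, val_ne_zero]; exact hxu
        exact ⟨[], σ₅, by rw [run, if_pos e]; rfl, by simpa using R₅, f₅, h25, by simp, by simp,
          by simpa using hxu, by simpa using tz⟩
      · have hx0 := (zmod2_cases _).resolve_right hxu
        have e : ¬ (xAt (qbit 23)).eval σ₅ ≠ 0 := by rw [vx, hx0]; simp
        have hfu : bs + f ≠ bs + u := fun e => hxu (e ▸ hxf)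
        refine ⟨[(2, bs + f, bs + u)], _, rfl, ?_, fun r hr => ?_, ?_, ?_, fun h => absurd h hxu,
          ?_, ?_⟩
        · rw [run, if_neg e]
          exact gateG_spec R₅ (by simp [Expr.eval, f₅, h20, h25])
            (by simp [qbit, Expr.eval, f₅, h20, h23]) ⟨hWf, .inr ⟨rfl, hWu, hfu⟩⟩
        · rw [← f₅ r hr, run_reg]; revert r; decide
        · rw [← h25, run_reg (by decide)]
        · intro g hg
          rw [List.mem_singleton.1 hg]
          exact ⟨hf, .inr ⟨rfl, hu', hfu⟩⟩
        · rw [tab_append]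
          simp [pull, hx0, hxf]
        · intro q hq
          rw [tab_append]
          by_cases e : q = bs + f
          · subst e; simp [pull, tz _ hq, tz _ hu']
          · simp [pull, e, tz _ hq]
    rw [← hσ₆]
    -- the third stage
    have hseq : (CProg.assign 13 (.reg 29) ;; pullRow ;; clearX).run σ₆ =
      clearX.run ((CProg.assign 13 (.reg 29) ;; pullRow).run σ₆) := rfl
    rw [hseq]
    set σ₇ := (CProg.assign 13 (.reg 29) ;; pullRow).run σ₆ with hσ₇
    obtain ⟨R₇, M₇⟩ := load_spec (e := .reg 29) R₆ (by rw [← h29, ← f₆ 29 (by decide)]; rfl) hj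
    rw [← hσ₇] at R₇ M₇
    have f₇ : ∀ r ∈ [20, 21, 22, 23, 29], σ₇.reg r = σ.reg r := fun r hr => by
      rw [← f₆ r hr, hσ₇, run_reg]; revert r; decide
    obtain ⟨gl₃, R₈, in₃, mild₃, xz₃⟩ := clearX_spec R₇ M₇ (by rw [f₇ 20 (by decide), h20])
      (by rw [f₇ 21 (by decide), h21]) (by rw [f₇ 22 (by decide), h22])
      (by rw [f₇ 23 (by decide), h23]) hW (by rw [R₇.r7]; exact hD) hu' x₂ z₂
    refine ⟨gl₁ ++ gl₂ ++ gl₃, by simpa using R₈, ?_, ?_, .inr ⟨?_, hlh, ?_⟩⟩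
    · intro g hg
      rcases List.mem_append.1 hg with hg | hg
      · rcases List.mem_append.1 hg with hg | hg
        · exact in₁ g hg
        · exact in₂ g hg
      · exact in₃ g hg
    · intro hx1
      obtain ⟨m1, m2⟩ := mild₁ hx1
      have : gl₂ = [] := mild₂ (by rw [tab_append]; exact m2)
      intro g hg
      rw [this, List.append_nil] at hg
      rcases List.mem_append.1 hg with hg | hg
      · exact m1 g hg
      · exact mild₃ g hg
    · rw [run_reg (by decide), hσ₇, run_reg (by decide), h25₆]; omega
    · intro q hq
      have : G ++ (gl₁ ++ gl₂ ++ gl₃) = G ++ gl₁ ++ gl₂ ++ gl₃ := by simp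
      rw [this, tab_append]
      exact xz₃ q hq

end Synth
end QCSAT

/-! ### Correctness of the removal of random measurements -/

namespace QCSAT

namespace Synth
open RAM RAM.CProg RAM.Expr Row

variable {c : Ctx} {σ : Mem} {L L' G : List (ℕ × ℕ × ℕ)}

/-! ### Removing the random measurements of ancillas -/

theorem Rep.ok (h : Rep c σ L G) : ∀ g ∈ L.reverse ++ G, GateIn (· < c.W) g := by
  intro g hg
  rcases List.mem_append.1 hg with hg | hg
  · exact h.okL' g (List.mem_reverse.1 hg)
  · exact h.okG g hg

/-- The rows start as commuting Z operators, and conjugation preserves commutation. All later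
arguments about missing or forced X bits rest on this. -/
theorem Rep.form_tab (h : Rep c σ L G) (i j : ℕ) :
    form (Finset.range c.W) (tab c L G i) (tab c L G j) = 0 := by
  rw [tab, tab, form_pullList (P := (· < c.W)) (fun q hq => Finset.mem_range.2 hq) h.ok,
    form_single]

theorem Rep.parity_tab (h : Rep c σ L G) (j : ℕ) :
    parity (Finset.range c.W) (tab c L G j) = 0 := by
  rw [tab, parity_pullList (P := (· < c.W)) (fun q hq => Finset.mem_range.2 hq) h.ok,
    parity_single]

/-- The CNOTs of `L` keep Z-type rows of Z type, so X bits are created by gates of `G` only, at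
qubits of these gates. The ancillas can thus be searched in time independent of `m`. -/
theorem Rep.x_support (h : Rep c σ L G) {j q : ℕ} (hx : (tab c L G j).x q ≠ 0) :
    ∃ g ∈ G, q = g.2.1 ∨ q = g.2.2 := by
  rw [tab, pullList_append] at hx
  refine pullList_x_support _ _ ?_ hx
  have : ∀ l : List (ℕ × ℕ × ℕ), (∀ g ∈ l, g.1 = 2) → ∀ r : Row, (∀ q, r.x q = 0) →
      ∀ q, (pullList l r).x q = 0 := by
    intro l
    induction l with
    | nil => exact fun _ r hr => hr
    | cons g l ih =>
      intro hl r hr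
      refine ih (fun g' h => hl g' (by simp [h])) _ fun q => ?_
      obtain ⟨k, a, b⟩ := g
      obtain rfl : k = 2 := hl (k, a, b) (by simp)
      simp [pull, Function.update_apply, hr]
  refine this _ (fun g hg => ?_) _ (fun q => rfl) q
  obtain ⟨a, b, -, -, -, rfl⟩ := h.okL g (List.mem_reverse.1 hg)
  rfl

/-- The rows `i` with `A i ≠ 0` have an `X` part at the ancilla `A i - 1`, where later rows and the
remaining rows have none. -/
structure Drop (c : Ctx) (A : ℕ → ℕ) (L G : List (ℕ × ℕ × ℕ)) : Prop where
  pos : ∀ i < c.K, A i ≠ 0 → c.n ≤ A i - 1 ∧ A i - 1 < c.N ∧ (tab c L G i).x (A i - 1) = 1 ∧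
    ∀ i' < c.K, (i < i' ∨ A i' = 0) → (tab c L G i').x (A i - 1) = 0
  zero : ∀ i < c.K, A i = 0 → ∀ q, c.n ≤ q → q < c.N → (tab c L G i).x q = 0

theorem Drop.append {A : ℕ → ℕ} (h : Drop c A L G) {P : ℕ → Prop}
    (hP : ∀ q, P q → q < c.n ∨ c.N ≤ q) {gl : List (ℕ × ℕ × ℕ)} (hgl : ∀ g ∈ gl, GateIn P g) :
    Drop c A L (G ++ gl) := by
  have e : ∀ j q, c.n ≤ q → q < c.N → (tab c L (G ++ gl) j).x q = (tab c L G j).x q := by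
    intro j q h1 h2
    rw [tab_append]
    exact (pullList_of_not hgl _ fun hq => by have := hP q hq; omega).1
  refine ⟨fun i hi hA => ?_, fun i hi hA q h1 h2 => ?_⟩
  · obtain ⟨h1, h2, h3, h4⟩ := h.pos i hi hA
    refine ⟨h1, h2, by rw [e _ _ h1 h2, h3], fun i' hi' h' => ?_⟩
    rw [e _ _ h1 h2, h4 i' hi' h']
  · rw [e _ _ h1 h2, h.zero i hi hA q h1 h2]

/-- An undropped row `i₀` has no X on any ancilla, so adding it does not alter any bit that the
invariant mentions. -/
theorem Drop.add {A : ℕ → ℕ} (h : Drop c A L G) {i₀ : ℕ} (hi₀ : i₀ < c.K) (hA₀ : A i₀ = 0)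
    (hL : ∀ j < c.K, tab c L' G j = tab c L G j ∨
      (A j = 0 ∧ IsSum (tab c L G i₀) (tab c L G j) (tab c L' G j))) :
    Drop c A L' G := by
  refine ⟨fun i hi hA => ?_, fun i hi hA q h1 h2 => ?_⟩
  · obtain ⟨h1, h2, h3, h4⟩ := h.pos i hi hA
    refine ⟨h1, h2, ?_, fun i' hi' h' => ?_⟩
    · rw [(hL i hi).resolve_right fun h => hA h.1, h3]
    · rcases hL i' hi' with e | ⟨-, e⟩
      · rw [e, h4 i' hi' h']
      · rw [e.1, h4 i' hi' h', h4 i₀ hi₀ (.inr hA₀), add_zero]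
  · rcases hL i hi with e | ⟨-, e⟩
    · rw [e, h.zero i hi hA q h1 h2]
    · rw [e.1, h.zero i hi hA q h1 h2, h.zero i₀ hi₀ hA₀ q h1 h2, add_zero]

/-- The state of the search for an ancilla where the row `r` has an `X` part. -/
def Scan (c : Ctx) (L G : List (ℕ × ℕ × ℕ)) (r : Row) (S : ℕ → Prop) (τ : Mem) : Prop :=
  Rep c τ L G ∧ RowMem c.W τ r ∧
    ((τ.reg 42 = 0 ∧ ∀ q, S q → c.n ≤ q → q < c.N → r.x q = 0) ∨
      ∃ a, τ.reg 42 = a + 1 ∧ c.n ≤ a ∧ a < c.N ∧ r.x a = 1)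

theorem Scan.setReg {r : Row} {S : ℕ → Prop} (h : Scan c L G r S σ) {i : ℕ} (v : ℕ)
    (hi : i ∉ [0, 4, 5, 6, 7, 8, 9, 10, 11, 12, 42]) : Scan c L G r S (σ.setReg i v) := by
  simp only [List.mem_cons, List.not_mem_nil, or_false, not_or] at hi
  obtain ⟨h1, h2, h3⟩ := h
  refine ⟨h1.setReg _ (by simp [hi]), h2.setReg _ (by simp [hi]), ?_⟩
  have : (σ.setReg i v).reg 42 = σ.reg 42 := by simp [Ne.symm hi.2.2.2.2.2.2.2.2.2.2]
  rw [this]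
  exact h3

theorem checkAncilla_spec {r : Row} {S : ℕ → Prop} (h : Scan c L G r S σ) :
    Scan c L G r (fun q => S q ∨ q = σ.reg 43) (checkAncilla.run σ) := by
  obtain ⟨h1, h2, h3⟩ := h
  have skip : (c.n ≤ σ.reg 43 → σ.reg 43 < c.N → r.x (σ.reg 43) = 0) →
      Scan c L G r (fun q => S q ∨ q = σ.reg 43) σ := by
    intro h0
    refine ⟨h1, h2, h3.imp (fun h => ⟨h.1, ?_⟩) id⟩
    rintro q (hq | rfl) ha hb
    · exact h.2 q hq ha hb
    · exact h0 ha hb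
  rw [checkAncilla]
  by_cases hn : c.n ≤ σ.reg 43
  · rw [cond_run_pos (by simp [Expr.eval, h1.r0]; omega)]
    by_cases hN : σ.reg 43 < c.N
    · rw [cond_run_pos (by simp [Expr.eval, h1.r4]; omega)]
      have hv : (xAt (.reg 43)).eval σ = (r.x (σ.reg 43)).val := by
        rw [← h2.x _ (by rw [Ctx.W]; omega)]
        simp [xAt, Expr.eval]
      by_cases hx : r.x (σ.reg 43) = 1
      · rw [cond_run_pos (by rw [hv, val_ne_zero]; exact hx), assign_run]
        exact ⟨h1.setReg _ (by decide), h2.setReg _ (by decide),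
          .inr ⟨σ.reg 43, by simp [Expr.eval], hn, hN, hx⟩⟩
      · have hx0 := (zmod2_cases _).resolve_right hx
        rw [cond_run_neg (by rw [hv, hx0]; simp)]
        exact skip fun _ _ => hx0
    · rw [cond_run_neg (by simp [Expr.eval, h1.r4]; omega)]
      exact skip fun _ h => absurd h hN
  · rw [cond_run_neg (by simp [Expr.eval, h1.r0]; omega)]
    exact skip fun h => absurd h hn

theorem scan_spec {r : Row} (h : Rep c σ L G) (hM : RowMem c.W σ r) (h42 : σ.reg 42 = 0) :
    Scan c L G r (fun q => ∃ g ∈ G, q = g.2.1 ∨ q = g.2.2)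
      ((CProg.forV 41 10 (.assign 43 (.cell 5 (.reg 41)) ;; checkAncilla ;;
        .assign 43 (.cell 6 (.reg 41)) ;; checkAncilla)).run σ) := by
  have key := forV_invariant (i := 41) (b := 10) (p := .assign 43 (.cell 5 (.reg 41)) ;;
      checkAncilla ;; .assign 43 (.cell 6 (.reg 41)) ;; checkAncilla) (σ := σ)
    (fun k τ => Scan c L G r (fun q => ∃ g ∈ G.take k, q = g.2.1 ∨ q = g.2.2) τ)
    ⟨h.setReg _ (by decide), hM.setReg _ (by decide), .inl ⟨by simpa using h42, by simp⟩⟩ ?_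
  · rw [h.rG, List.take_of_length_le le_rfl] at key
    exact key
  · intro k hk τ h41 hreg harr hI
    rw [h.rG] at hk
    have hG := h.aG k hk
    have a5 : τ.arr 5 = σ.arr 5 := harr 5 (by decide)
    have a6 : τ.arr 6 = σ.arr 6 := harr 6 (by decide)
    have hrun : (CProg.assign 43 (.cell 5 (.reg 41)) ;; checkAncilla ;;
        .assign 43 (.cell 6 (.reg 41)) ;; checkAncilla).run τ =
        checkAncilla.run ((CProg.assign 43 (.cell 6 (.reg 41))).run
          (checkAncilla.run (τ.setReg 43 (τ.arr 5 (τ.reg 41))))) := rfl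
    rw [hrun]
    have s1 := checkAncilla_spec (hI.setReg (i := 43) (τ.arr 5 (τ.reg 41)) (by decide))
    set τ₁ := checkAncilla.run (τ.setReg 43 (τ.arr 5 (τ.reg 41))) with hτ₁
    have e41 : τ₁.reg 41 = k := by rw [hτ₁, run_reg (by decide)]; simpa using h41
    have e6 : τ₁.arr 6 = σ.arr 6 := by rw [hτ₁, run_arr (by decide), ← a6]; rfl
    rw [assign_run]
    have s2 := (checkAncilla_spec (s1.setReg (i := 43) ((Expr.cell 6 (.reg 41)).eval τ₁)
      (by decide))).setReg (i := 41) (k + 1) (by decide)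
    obtain ⟨t1, t2, t3⟩ := s2
    refine ⟨t1, t2, t3.imp (fun h => ⟨h.1, ?_⟩) id⟩
    rintro q ⟨g, hg, hq⟩ hn hN
    refine h.2 q ?_ hn hN
    rw [List.take_add_one, List.getElem?_eq_getElem hk] at hg
    simp only [Option.toList_some, List.mem_append, List.mem_singleton] at hg
    rcases hg with hg | rfl
    · exact .inl (.inl ⟨g, hg, hq⟩)
    · rw [← hG] at hq
      simp only [Mem.setReg_reg, if_true, Expr.eval, e41, e6, h41, a5]
      rcases hq with hq | hq
      · exact .inl (.inr hq)
      · exact .inr hq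

/-- Clearing the column of a new ancilla does not undo earlier work: live rows already processed
have no X on ancillas and stay as they are, dropped rows are not targets, and the added row has no X
at the ancillas used before. -/
theorem dropRows_spec (h : Rep c σ L G) (h11 : ∀ i, σ.arr 11 i = 0) :
    ∃ L' A, Rep c (dropRows.run σ) L' G ∧ Drop c A L' G ∧
      ∀ i < c.K, (dropRows.run σ).arr 11 i = if A i = 0 then 0 else 1 := by
  set body : CProg := (.assign 13 (.reg 40) ;; pullRow ;; .assign 42 (.const 0) ;;
    .forV 41 10 (.assign 43 (.cell 5 (.reg 41)) ;; checkAncilla ;;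
      .assign 43 (.cell 6 (.reg 41)) ;; checkAncilla) ;;
    cond (.reg 42)
      (.store 11 (.reg 40) (.const 1) ;;
        .assign 30 (.reg 40) ;; .assign 31 (.sub (.reg 42) (.const 1)) ;; elim 9)) with hbody
  have key := forC_invariant (i := 40) (b := 6) (p := body) (σ := σ)
    (fun k τ => ∃ L' A, Rep c τ L' G ∧
      (∀ i < c.K, τ.arr 11 i = if A i = 0 then 0 else 1) ∧ (∀ i < c.K, k ≤ i → A i = 0) ∧
      (∀ i < c.K, A i ≠ 0 → c.n ≤ A i - 1 ∧ A i - 1 < c.N ∧ (tab c L' G i).x (A i - 1) = 1 ∧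
        ∀ i' < c.K, (i < i' ∨ A i' = 0) → (tab c L' G i').x (A i - 1) = 0) ∧
      ∀ i < c.K, i < k → A i = 0 → ∀ q, c.n ≤ q → q < c.N → (tab c L' G i).x q = 0)
    ⟨L, fun _ => 0, h.setReg 0 (by decide), by simp [h11], by simp, by simp, by simp⟩ ?_
  · obtain ⟨L', A, k1, k2, k3, k4, k5⟩ := key
    rw [h.r6] at k5
    exact ⟨L', A, k1, ⟨k4, fun i hi => k5 i hi hi⟩, k2⟩
  · rintro k hk τ h40 - - ⟨L', A, b1, b2, b3, b4, b5⟩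
    rw [h.r6] at hk
    obtain ⟨R₁, M₁⟩ := load_spec (e := .reg 40) b1 (j := k) h40 hk
    set τ₁ := (CProg.assign 13 (.reg 40) ;; pullRow).run τ with hτ₁
    have s := scan_spec (R₁.setReg (i := 42) 0 (by decide)) (M₁.setReg (i := 42) 0 (by decide))
      (by simp)
    set τ₂ := (CProg.forV 41 10 (.assign 43 (.cell 5 (.reg 41)) ;; checkAncilla ;;
      .assign 43 (.cell 6 (.reg 41)) ;; checkAncilla)).run (τ₁.setReg 42 0) with hτ₂
    have hrun : body.run τ = (cond (.reg 42)
      (.store 11 (.reg 40) (.const 1) ;;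
        .assign 30 (.reg 40) ;; .assign 31 (.sub (.reg 42) (.const 1)) ;; elim 9)).run τ₂ := rfl
    have e40 : τ₂.reg 40 = k := by
      rw [hτ₂, run_reg (by decide), Mem.setReg_reg, if_neg (by decide), hτ₁, run_reg (by decide),
        h40]
    have e11 : τ₂.arr 11 = τ.arr 11 := by
      rw [hτ₂, run_arr (by decide), Mem.setReg_arr, hτ₁, run_arr (by decide)]
    rw [hrun]
    obtain ⟨R₂, M₂, ⟨h42, hx⟩ | ⟨a, h42, hna, haN, hx⟩⟩ := s
    · rw [cond_run_neg (by simpa [Expr.eval] using h42)]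
      refine ⟨L', A, R₂.setReg _ (by decide), by simpa [e11] using b2,
        fun i hi hik => b3 i hi (by omega), b4, fun i hi hik hA q hn hN => ?_⟩
      rcases Nat.lt_succ_iff_lt_or_eq.1 hik with hik | rfl
      · exact b5 i hi hik hA q hn hN
      · by_contra hq
        -- An X part at an ancilla would sit at a qubit of some gate, and all of these have been
        -- scanned.
        exact hq (hx q (b1.x_support hq) hn hN)
    · rw [cond_run_pos (by simp [Expr.eval, h42])]
      set τ₃ := (((τ₂.setCell 11 k 1).setReg 30 k).setReg 31 a) with hτ₃
      have hrun' : (CProg.store 11 (.reg 40) (.const 1) ;; .assign 30 (.reg 40) ;;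
          .assign 31 (.sub (.reg 42) (.const 1)) ;; elim 9).run τ₂ = (elim 9).run τ₃ := by
        simp only [seq_run]
        congr 1
        simp [run, Expr.eval, e40, h42, hτ₃]
      rw [hrun']
      have R₃ : Rep c τ₃ L' G :=
        ((R₂.setCell _ _ (by decide)).setReg _ (by decide)).setReg _ (by decide)
      have c11 : ∀ i, τ₃.arr 11 i = if i = k then 1 else τ.arr 11 i := by
        intro i; simp [hτ₃, e11]
      have hAk : A k = 0 := b3 k hk le_rfl
      obtain ⟨L₂, R₄, hL₂⟩ := elim_spec (arr := 9) (i₀ := k) (col := a) (f := fun r => r.x a)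
        (fun τ r hM => hM.x a (by rw [Ctx.W]; omega)) R₃ (by simp [hτ₃]) (by simp [hτ₃]) hk
        (by simp [c11])
      have live : ∀ j < c.K, τ₃.arr 11 j = 0 ↔ (j ≠ k ∧ A j = 0) := by
        intro j hj
        rw [c11, b2 j hj]
        by_cases e1 : j = k <;> by_cases e2 : A j = 0 <;> simp [e1, e2]
      have same : ∀ j < c.K, (j = k ∨ A j ≠ 0) → tab c L₂ G j = tab c L' G j := by
        intro j hj hjk
        refine (hL₂ j hj).2 fun h0 _ => ?_
        have := (live j hj).1 h0
        tauto
      have old : ∀ j < c.K, j < k → A j = 0 → tab c L₂ G j = tab c L' G j := by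
        intro j hj hjk hA
        refine (hL₂ j hj).2 fun _ h1 => ?_
        rw [b5 j hj hjk hA a hna haN] at h1
        exact zero_ne_one h1
      refine ⟨L₂, Function.update A k (a + 1), R₄.setReg _ (by decide), ?_, ?_, ?_, ?_⟩
      · intro i hi
        rw [Mem.setReg_arr, elim_arr (by decide), c11, b2 i hi]
        by_cases e : i = k <;> simp [e]
      · intro i hi hki
        rw [Function.update_of_ne (by omega)]
        exact b3 i hi (by omega)
      · intro i hi hA
        by_cases e : i = k
        · subst e
          rw [Function.update_self, Nat.add_sub_cancel]
          refine ⟨hna, haN, by rw [same i hi (.inl rfl)]; exact hx, fun i' hi' h' => ?_⟩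
          have hne : i' ≠ i := by
            rintro rfl
            simp at h'
          have hA' : A i' = 0 := by
            rcases h' with h' | h'
            · exact b3 i' hi' (by omega)
            · rwa [Function.update_of_ne hne] at h'
          obtain ⟨s1, s2⟩ := hL₂ i' hi'
          have hl := (live i' hi').2 ⟨hne, hA'⟩
          rcases zmod2_cases ((tab c L' G i').x a) with h0 | h1
          · rw [s2 fun _ h1 => by rw [h0] at h1; exact zero_ne_one h1, h0]
          · rw [(s1 hl h1).1 a, hx, h1, zmod2_add_self]
        · rw [Function.update_of_ne e] at hA ⊢
          obtain ⟨h1, h2, h3, h4⟩ := b4 i hi hA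
          have hik : i < k := by
            by_contra hik
            exact hA (b3 i hi (by omega))
          refine ⟨h1, h2, by rw [same i hi (.inr hA), h3], fun i' hi' h' => ?_⟩
          have h'' : i < i' ∨ A i' = 0 := by
            rcases h' with h' | h'
            · exact .inl h'
            · by_cases e' : i' = k
              · subst e'; exact .inl hik
              · rw [Function.update_of_ne e'] at h'; exact .inr h'
          have hz := h4 i' hi' h''
          obtain ⟨s1, s2⟩ := hL₂ i' hi'
          by_cases hc : τ₃.arr 11 i' = 0 ∧ (tab c L' G i').x a = 1
          · rw [(s1 hc.1 hc.2).1, hz, h4 k hk (.inl hik), add_zero]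
          · rw [s2 fun h h' => hc ⟨h, h'⟩, hz]
      · intro i hi hik hA q hn hN
        have hne : i ≠ k := by
          rintro rfl
          simp at hA
        rw [Function.update_of_ne hne] at hA
        rw [old i hi (by omega) hA]
        exact b5 i hi (by omega) hA q hn hN

end Synth
end QCSAT

/-! ### Correctness of the symplectic normal form on the magic qubits -/

namespace QCSAT

namespace Synth
open RAM RAM.CProg RAM.Expr Row

variable {c : Ctx} {σ : Mem} {L L' G : List (ℕ × ℕ × ℕ)}

/-! ### Normal form of the magic parts -/

/-- The row has no part on the qubits in `P`. -/
def Trivial (P : ℕ → Prop) (r : Row) : Prop := ∀ q, P q → r.x q = 0 ∧ r.z q = 0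

theorem Trivial.mono {P P' : ℕ → Prop} {r : Row} (h : Trivial P r) (hP : ∀ q, P' q → P q) :
    Trivial P' r := fun q hq => h q (hP q hq)

theorem Trivial.tab_append {P : ℕ → Prop} {gl : List (ℕ × ℕ × ℕ)} {j : ℕ}
    (h : Trivial P (tab c L G j)) (hgl : ∀ g ∈ gl, GateIn P g) :
    tab c L (G ++ gl) j = tab c L G j := by
  rw [Synth.tab_append]
  exact pullList_of_trivial hgl (tab_p_lt j) h

theorem Trivial.append_of_disjoint {P P' : ℕ → Prop} {gl : List (ℕ × ℕ × ℕ)} {j : ℕ}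
    (h : Trivial P' (tab c L G j)) (hgl : ∀ g ∈ gl, GateIn P g) (hd : ∀ q, P' q → ¬ P q) :
    Trivial P' (tab c L (G ++ gl) j) := by
  intro q hq
  obtain ⟨e1, e2⟩ := pullList_of_not hgl (tab c L G j) (hd q hq)
  rw [Synth.tab_append, e1, e2]
  exact h q hq

/-- The magic qubits from number `μ` on. -/
def magicFrom (c : Ctx) (μ q : ℕ) : Prop := c.N + μ ≤ q ∧ q < c.W

/-- The first `μ` magic qubits. -/
def magicTo (c : Ctx) (μ q : ℕ) : Prop := c.N ≤ q ∧ q < c.N + μ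

/-- The state after the first `k` rows have been processed. Here `cl` tells if a row is live (`0`),
dropped (`1`) or has a magic part (`2`), and `PX` and `PZ` hold the rows with magic parts. -/
structure Magic (c : Ctx) (A cl PX PZ : ℕ → ℕ) (μ k : ℕ) (L G : List (ℕ × ℕ × ℕ)) : Prop where
  drop : Drop c A L G
  le : μ ≤ c.t
  cl_pos : ∀ i < c.K, A i ≠ 0 → cl i = 1
  cl_zero : ∀ i < c.K, A i = 0 → cl i = 0 ∨ cl i = 2
  px : ∀ ν < μ, ∃ j < c.K, PX ν = j + 1 ∧ cl j = 2 ∧ ∀ q, magicFrom c 0 q →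
    (tab c L G j).x q = 0 ∧ (tab c L G j).z q = if q = c.N + ν then 1 else 0
  pz : ∀ ν < μ, PZ ν ≠ 0 → ∃ j < c.K, PZ ν = j + 1 ∧ cl j = 2 ∧ ∀ q, magicFrom c 0 q →
    (tab c L G j).x q = (if q = c.N + ν then 1 else 0) ∧ (tab c L G j).z q = 0
  out : ∀ ν, μ ≤ ν → PX ν = 0 ∧ PZ ν = 0
  cover : ∀ i < c.K, cl i = 2 → ∃ ν < μ, PX ν = i + 1 ∨ PZ ν = i + 1
  live : ∀ i < c.K, cl i = 0 → Trivial (magicTo c μ) (tab c L G i)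
  done : ∀ i < c.K, i < k → cl i = 0 → Trivial (magicFrom c 0) (tab c L G i)

variable {A cl PX PZ : ℕ → ℕ} {μ k : ℕ}

theorem Magic.A_eq_zero (h : Magic c A cl PX PZ μ k L G) {i : ℕ} (hi : i < c.K)
    (hl : cl i ≠ 1) : A i = 0 := by
  by_contra hA
  exact hl (h.cl_pos i hi hA)

theorem Magic.succ (h : Magic c A cl PX PZ μ k L G)
    (hk : k < c.K → cl k = 0 → Trivial (magicFrom c 0) (tab c L G k)) :
    Magic c A cl PX PZ μ (k + 1) L G :=
  { h with
    done := fun i hi hik hl => by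
      rcases Nat.lt_succ_iff_lt_or_eq.1 hik with hik | rfl
      · exact h.done i hi hik hl
      · exact hk hi hl }

theorem trivial_full {r : Row} (h1 : Trivial (magicTo c μ) r) (h2 : Trivial (magicFrom c μ) r) :
    Trivial (magicFrom c 0) r := by
  intro q hq
  have a := hq.1
  have b := hq.2
  by_cases hlt : q < c.N + μ
  · exact h1 q ⟨by omega, hlt⟩
  · exact h2 q ⟨by omega, b⟩

/-- Rows of complete pairs and finished live rows are trivial on the magic qubits from `μ` on, so
these gates fix them. -/
theorem Magic.append (h : Magic c A cl PX PZ μ k L G) {gl : List (ℕ × ℕ × ℕ)}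
    (hgl : ∀ g ∈ gl, GateIn (magicFrom c μ) g) : Magic c A cl PX PZ μ k L (G ++ gl) := by
  have sub : ∀ q, magicFrom c μ q → magicFrom c 0 q := fun q hq => ⟨by have := hq.1; omega, hq.2⟩
  refine { h with
    drop := h.drop.append (fun q hq => .inr (by have := hq.1; omega)) hgl
    px := fun ν hν => ?_
    pz := fun ν hν hP => ?_
    live := fun i hi hl => (h.live i hi hl).append_of_disjoint hgl fun q hq hq' => by
      have := hq.2; have := hq'.1; omega
    done := fun i hi hik hl => by
      rw [((h.done i hi hik hl).mono sub).tab_append hgl]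
      exact h.done i hi hik hl }
  · obtain ⟨j, hj, e, hc, hr⟩ := h.px ν hν
    have ht : Trivial (magicFrom c μ) (tab c L G j) := fun q hq => by
      have := hr q (sub q hq)
      have := hq.1
      rw [if_neg (by omega)] at *
      assumption
    exact ⟨j, hj, e, hc, by rw [ht.tab_append hgl]; exact hr⟩
  · obtain ⟨j, hj, e, hc, hr⟩ := h.pz ν hν hP
    have ht : Trivial (magicFrom c μ) (tab c L G j) := fun q hq => by
      have := hr q (sub q hq)
      have := hq.1
      rw [if_neg (by omega)] at *
      assumption
    exact ⟨j, hj, e, hc, by rw [ht.tab_append hgl]; exact hr⟩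

/-- A new magic qubit is used. -/
theorem Magic.pair (h : Magic c A cl PX PZ μ k L G) (hμ : μ < c.t) (hk : k < c.K) (hlk : cl k = 0)
    (hrow : ∀ q, magicFrom c μ q →
      (tab c L G k).x q = 0 ∧ (tab c L G k).z q = if q = c.N + μ then 1 else 0)
    {cl' : ℕ → ℕ} {v : ℕ}
    (hv : v = 0 ∧ cl' = Function.update cl k 2 ∨ ∃ j < c.K, j ≠ k ∧ cl j = 0 ∧ v = j + 1 ∧
      cl' = Function.update (Function.update cl k 2) j 2 ∧ ∀ q, magicFrom c μ q →
        (tab c L G j).x q = (if q = c.N + μ then 1 else 0) ∧ (tab c L G j).z q = 0)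
    (hdrop : Drop c A L' G)
    (hsame : ∀ j < c.K, (cl' j ≠ 0 ∨ j < k) → tab c L' G j = tab c L G j)
    (hlive : ∀ j < c.K, cl' j = 0 → Trivial (magicTo c (μ + 1)) (tab c L' G j)) :
    Magic c A cl' (Function.update PX μ (k + 1)) (Function.update PZ μ v) (μ + 1) (k + 1) L' G := by
  have sub : ∀ j, cl' j = 0 → cl j = 0 ∧ j ≠ k := by
    intro j hj
    rcases hv with ⟨-, e⟩ | ⟨j', -, -, -, -, e, -⟩
    · rw [e, Function.update_apply] at hj
      split at hj
      · omega
      · exact ⟨hj, by assumption⟩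
    · rw [e, Function.update_apply, Function.update_apply] at hj
      split at hj
      · omega
      · split at hj
        · omega
        · exact ⟨hj, by assumption⟩
  have two : ∀ j, cl j ≠ 0 → cl' j = cl j := by
    intro j hj
    have e1 : j ≠ k := by rintro rfl; exact hj hlk
    rcases hv with ⟨-, e⟩ | ⟨j', -, -, hc, -, e, -⟩
    · rw [e, Function.update_of_ne e1]
    · have e2 : j ≠ j' := by rintro rfl; exact hj hc
      rw [e, Function.update_of_ne e2, Function.update_of_ne e1]
  have ck : cl' k = 2 := by
    rcases hv with ⟨-, e⟩ | ⟨j', -, hne, -, -, e, -⟩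
    · rw [e, Function.update_self]
    · rw [e, Function.update_of_ne (Ne.symm hne), Function.update_self]
  -- A live row vanishes on the first `μ` magic qubits, so its part from `μ` on is its whole magic
  -- part.
  have full : ∀ (i : ℕ) (a b : ℕ → ZMod 2), i < c.K → cl i = 0 →
      (∀ q, magicFrom c μ q → (tab c L G i).x q = a q ∧ (tab c L G i).z q = b q) →
      (∀ q, q < c.N + μ → a q = 0 ∧ b q = 0) → ∀ q, magicFrom c 0 q →
        (tab c L G i).x q = a q ∧ (tab c L G i).z q = b q := by
    intro i a b hi hl h1 h2 q hq
    by_cases hlt : q < c.N + μ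
    · rw [(h2 q hlt).1, (h2 q hlt).2]
      exact h.live i hi hl q ⟨by have := hq.1; omega, hlt⟩
    · exact h1 q ⟨by omega, hq.2⟩
  refine ⟨hdrop, hμ, ?_, ?_, ?_, ?_, ?_, ?_, hlive, ?_⟩
  · intro i hi hA
    have := h.cl_pos i hi hA
    rw [two i (by omega), this]
  · intro i hi hA
    by_cases h0 : cl' i = 0
    · exact .inl h0
    · right
      rcases h.cl_zero i hi hA with h1 | h1
      · rcases hv with ⟨-, e⟩ | ⟨j', -, -, -, -, e, -⟩
        · rw [e, Function.update_apply] at h0 ⊢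
          split at h0
          · rw [if_pos (by assumption)]
          · omega
        · rw [e, Function.update_apply, Function.update_apply] at h0 ⊢
          split_ifs at h0 ⊢ <;> omega
      · rw [two i (by omega), h1]
  · intro ν hν
    by_cases e : ν = μ
    · subst e
      refine ⟨k, hk, Function.update_self .., ck, ?_⟩
      rw [hsame k hk (.inl (by omega))]
      exact full k _ _ hk hlk hrow fun q hq => ⟨rfl, if_neg (by omega)⟩
    · obtain ⟨j, hj, e1, e2, e3⟩ := h.px ν (by omega)
      refine ⟨j, hj, by rw [Function.update_of_ne e, e1], by rw [two j (by omega), e2], ?_⟩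
      rw [hsame j hj (.inl (by rw [two j (by omega)]; omega))]
      exact e3
  · intro ν hν hP
    by_cases e : ν = μ
    · subst e
      rw [Function.update_self] at hP ⊢
      rcases hv with ⟨e, -⟩ | ⟨j, hj, hne, hc, ev, e, hr⟩
      · exact absurd e hP
      · have cj : cl' j = 2 := by rw [e, Function.update_self]
        refine ⟨j, hj, ev, cj, ?_⟩
        rw [hsame j hj (.inl (by omega))]
        exact full j _ _ hj hc hr fun q hq => ⟨if_neg (by omega), rfl⟩
    · rw [Function.update_of_ne e] at hP ⊢
      obtain ⟨j, hj, e1, e2, e3⟩ := h.pz ν (by omega) hP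
      refine ⟨j, hj, e1, by rw [two j (by omega), e2], ?_⟩
      rw [hsame j hj (.inl (by rw [two j (by omega)]; omega))]
      exact e3
  · intro ν hν
    rw [Function.update_of_ne (by omega), Function.update_of_ne (by omega)]
    exact h.out ν (by omega)
  · intro i hi h2
    by_cases hc : cl i = 2
    · obtain ⟨ν, hν, e⟩ := h.cover i hi hc
      refine ⟨ν, by omega, ?_⟩
      rwa [Function.update_of_ne (by omega), Function.update_of_ne (by omega)]
    · refine ⟨μ, by omega, ?_⟩
      rw [Function.update_self, Function.update_self]
      rcases hv with ⟨-, e⟩ | ⟨j', -, -, -, ev, e, -⟩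
      · rw [e, Function.update_apply] at h2
        split at h2
        · left; omega
        · exact absurd h2 hc
      · rw [e, Function.update_apply, Function.update_apply] at h2
        split_ifs at h2
        · right; omega
        · left; omega
        · exact absurd h2 hc
  · intro i hi hik hl
    obtain ⟨h0, hne⟩ := sub i hl
    rw [hsame i hi (.inr (by omega))]
    exact h.done i hi (by omega) h0

end Synth
end QCSAT

namespace QCSAT

namespace Synth
open RAM RAM.CProg RAM.Expr Row

variable {c : Ctx} {σ : Mem} {L L' G : List (ℕ × ℕ × ℕ)} {A cl PX PZ : ℕ → ℕ} {μ k : ℕ}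

/-- Commutation with Z on one qubit is a statement about a single X bit. This is how commutation of
rows turns into zeros and ones of the tableau. -/
theorem form_of_Z {T : Finset ℕ} {u : ℕ} (hu : u ∈ T) {r r' : Row}
    (hr : ∀ q ∈ T, r.x q = 0 ∧ r.z q = if q = u then 1 else 0) : form T r r' = r'.x u := by
  rw [form, Finset.sum_eq_single u]
  · simp [hr u hu]
  · intro q hq hqu
    simp [hr q hq, hqu]
  · exact fun h => absurd hu h

theorem form_of_trivial {T : Finset ℕ} {r r' : Row} (hr : Trivial (· ∈ T) r') :
    form T r r' = 0 :=
  Finset.sum_eq_zero fun q hq => by rw [(hr q hq).1, (hr q hq).2]; ring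

theorem form_of_x {T : Finset ℕ} {r r' : Row} (hr : ∀ q ∈ T, r.x q = 0)
    (hr' : ∀ q ∈ T, r'.x q = 0) : form T r r' = 0 :=
  Finset.sum_eq_zero fun q hq => by rw [hr q hq, hr' q hq]; ring

theorem setCell_arr_self (σ : Mem) (i j v : ℕ) :
    (σ.setCell i j v).arr i = Function.update (σ.arr i) j v := by
  simp [Mem.setCell]

/-- The partner of a row with magic part. -/
def partner : CProg :=
  cond (.reg 33)
    (.assign 29 (.sub (.reg 33) (.const 1)) ;;
      .store 11 (.reg 29) (.const 2) ;; .store 13 (.reg 44) (.reg 33) ;;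
      reduce ;;
      .assign 30 (.reg 29) ;; elim 9)

/-- A live row with X at the new qubit anticommutes there with row `k`, which is Z. It is reduced to
X by mild gates, so row `k` stays Z, and then clears the X column of the live rows. If no such row
exists, the column is already clear. -/
theorem partner_spec (h : Rep c σ L G) (hM : Magic c A cl PX PZ μ k L G) (hμ : μ < c.t)
    (hrow : ∀ q, magicFrom c μ q →
      (tab c L G k).x q = 0 ∧ (tab c L G k).z q = if q = c.N + μ then 1 else 0)
    (h11 : σ.arr 11 = Function.update cl k 2) (h13 : σ.arr 13 = PZ)
    (h20 : σ.reg 20 = c.N) (h21 : σ.reg 21 = μ) (h22 : σ.reg 22 = c.t) (h23 : σ.reg 23 = μ)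
    (h44 : σ.reg 44 = μ) (h31 : σ.reg 31 = c.N + μ)
    (h33 : (σ.reg 33 = 0 ∧ ∀ j < c.K, σ.arr 11 j = 0 → (tab c L G j).x (c.N + μ) = 0) ∨
      ∃ j < c.K, σ.reg 33 = j + 1 ∧ σ.arr 11 j = 0 ∧ (tab c L G j).x (c.N + μ) = 1) :
    ∃ L' gl v, Rep c (partner.run σ) L' (G ++ gl) ∧ (∀ g ∈ gl, GateIn (magicFrom c μ) g) ∧
      (partner.run σ).arr 13 = Function.update PZ μ v ∧
      (∀ q, magicFrom c μ q → (tab c L (G ++ gl) k).x q = 0 ∧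
        (tab c L (G ++ gl) k).z q = if q = c.N + μ then 1 else 0) ∧
      (v = 0 ∧ (partner.run σ).arr 11 = Function.update cl k 2 ∨
        ∃ j < c.K, j ≠ k ∧ cl j = 0 ∧ v = j + 1 ∧
          (partner.run σ).arr 11 = Function.update (Function.update cl k 2) j 2 ∧
          ∀ q, magicFrom c μ q → (tab c L (G ++ gl) j).x q = (if q = c.N + μ then 1 else 0) ∧
            (tab c L (G ++ gl) j).z q = 0) ∧
      Drop c A L' (G ++ gl) ∧
      (∀ j < c.K, ((partner.run σ).arr 11 j ≠ 0 ∨ j < k) →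
        tab c L' (G ++ gl) j = tab c L (G ++ gl) j) ∧
      ∀ j < c.K, (partner.run σ).arr 11 j = 0 → Trivial (magicTo c μ) (tab c L' (G ++ gl) j) ∧
        (tab c L' (G ++ gl) j).x (c.N + μ) = 0 := by
  have hW : c.N + μ < c.W := by rw [Ctx.W]; omega
  have hu : magicFrom c μ (c.N + μ) := ⟨le_rfl, hW⟩
  have lk : ∀ j, σ.arr 11 j = 0 → cl j = 0 ∧ j ≠ k := by
    intro j hj
    rw [h11, Function.update_apply] at hj
    split at hj
    · omega
    · exact ⟨hj, by assumption⟩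
  rcases h33 with ⟨h33, hx⟩ | ⟨i, hi, h33, hli, hxi⟩
  · have hrun : partner.run σ = σ := cond_run_neg (by simpa [Expr.eval] using h33)
    rw [hrun]
    refine ⟨L, [], 0, by simpa using h, by simp, ?_, by simpa using hrow, .inl ⟨rfl, h11⟩,
      by simpa using hM.drop, fun _ _ _ => rfl, fun j hj h0 => ?_⟩
    · rw [h13, ← (hM.out μ le_rfl).2, Function.update_eq_self]
    · rw [List.append_nil]
      exact ⟨hM.live j hj (lk j h0).1, hx j hj h0⟩
  · obtain ⟨hci, hik⟩ := lk i hli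
    set σ₁ := ((σ.setReg 29 i).setCell 11 i 2).setCell 13 μ (i + 1) with hσ₁
    have hrun : partner.run σ =
        (elim 9).run ((CProg.assign 30 (.reg 29)).run (reduce.run σ₁)) := by
      rw [partner, cond_run_pos (by simp [Expr.eval, h33])]
      simp only [seq_run]
      congr 3
      simp [run, Expr.eval, h33, h44, hσ₁]
    have R₁ : Rep c σ₁ L G := ((h.setReg _ (by decide)).setCell _ _ (by decide)).setCell _ _
      (by decide)
    obtain ⟨gl, R₂, in₂, mild₂, hred⟩ := reduce_spec (bs := c.N) (lo := μ) (hi := c.t) (u := μ)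
      (j := i) R₁ (by simpa [hσ₁] using h20) (by simpa [hσ₁] using h21)
      (by simpa [hσ₁] using h22) (by simpa [hσ₁] using h23) (by simp [hσ₁]) hi le_rfl (by omega)
      (by omega)
    set σ₂ := reduce.run σ₁ with hσ₂
    have hrow₂ : ∀ q, magicFrom c μ q → (tab c L (G ++ gl) k).x q = 0 ∧
        (tab c L (G ++ gl) k).z q = if q = c.N + μ then 1 else 0 := by
      rw [tab_append]
      exact pullList_of_mild in₂ (mild₂ hxi) hrow
    have hrowi : ∀ q, magicFrom c μ q →
        (tab c L (G ++ gl) i).x q = (if q = c.N + μ then 1 else 0) ∧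
          (tab c L (G ++ gl) i).z q = 0 := by
      rcases hred with ⟨-, ht⟩ | ⟨-, -, hr⟩
      · exfalso
        have hmem : ∀ q, q ∈ Finset.Ico (c.N + μ) c.W ↔ magicFrom c μ q := fun q =>
          Finset.mem_Ico
        -- The reduction cannot make the row trivial: on this block its form with row `k` was 1, and
        -- the gates preserve the form.
        have f1 := form_pullList (T := Finset.Ico (c.N + μ) c.W) (fun q hq => (hmem q).2 hq)
          in₂ (tab c L G k) (tab c L G i)
        rw [← tab_append, ← tab_append, form_of_trivial (fun q hq => ht q ((hmem q).1 hq)),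
          form_of_Z ((hmem _).2 hu) (fun q hq => hrow q ((hmem q).1 hq)), hxi] at f1
        exact zero_ne_one f1
      · exact hr
    have hM₂ := hM.append in₂
    have e29 : σ₂.reg 29 = i := by rw [hσ₂, run_reg (by decide)]; simp [hσ₁]
    have e11 : σ₂.arr 11 = Function.update (Function.update cl k 2) i 2 := by
      rw [hσ₂, run_arr (by decide), hσ₁, Mem.setCell_arr_ne _ (by decide), setCell_arr_self,
        Mem.setReg_arr, h11]
    have e13 : σ₂.arr 13 = Function.update PZ μ (i + 1) := by
      rw [hσ₂, run_arr (by decide), hσ₁, setCell_arr_self, Mem.setCell_arr_ne _ (by decide),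
        Mem.setReg_arr, h13]
    rw [hrun, assign_run]
    set σ₃ := σ₂.setReg 30 (Expr.eval σ₂ (.reg 29)) with hσ₃
    have R₃ : Rep c σ₃ L (G ++ gl) := R₂.setReg _ (by decide)
    have l11 : ∀ j, σ₃.arr 11 j = 0 → cl j = 0 ∧ j ≠ k ∧ j ≠ i := by
      intro j hj
      rw [hσ₃, Mem.setReg_arr, e11, Function.update_apply, Function.update_apply] at hj
      split_ifs at hj with h1 h2
      · exact ⟨hj, h2, h1⟩
    obtain ⟨L', R₄, hL'⟩ := elim_spec (arr := 9) (i₀ := i) (col := c.N + μ)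
      (f := fun r => r.x (c.N + μ)) (fun τ r hM => hM.x _ hW) R₃
      (by simpa [hσ₃, Expr.eval] using e29)
      (by rw [hσ₃, Mem.setReg_reg, if_neg (by decide), hσ₂, run_reg (by decide)]
          simpa [hσ₁] using h31) hi
      (by rw [hσ₃, Mem.setReg_arr, e11, Function.update_self]; omega)
    have e11' : ((elim 9).run σ₃).arr 11 = Function.update (Function.update cl k 2) i 2 := by
      rw [elim_arr (by decide), hσ₃, Mem.setReg_arr, e11]
    have hAi : A i = 0 := hM.A_eq_zero hi (by omega)
    have sum : ∀ j < c.K, tab c L' (G ++ gl) j = tab c L (G ++ gl) j ∨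
        (σ₃.arr 11 j = 0 ∧ (tab c L (G ++ gl) j).x (c.N + μ) = 1 ∧
          IsSum (tab c L (G ++ gl) i) (tab c L (G ++ gl) j) (tab c L' (G ++ gl) j)) := by
      intro j hj
      obtain ⟨s1, s2⟩ := hL' j hj
      by_cases hc : σ₃.arr 11 j = 0 ∧ (tab c L (G ++ gl) j).x (c.N + μ) = 1
      · exact .inr ⟨hc.1, hc.2, s1 hc.1 hc.2⟩
      · exact .inl (s2 fun h h' => hc ⟨h, h'⟩)
    refine ⟨L', gl, i + 1, R₄, in₂, ?_, hrow₂, .inr ⟨i, hi, hik, hci, rfl, e11', hrowi⟩, ?_, ?_, ?_⟩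
    · rw [elim_arr (by decide), hσ₃, Mem.setReg_arr, e13]
    · refine hM₂.drop.add hi hAi fun j hj => (sum j hj).imp id fun h => ⟨?_, h.2.2⟩
      exact hM.A_eq_zero hj (by have := (l11 j h.1).1; omega)
    · intro j hj h'
      refine (sum j hj).resolve_right fun ⟨h0, h1, _⟩ => ?_
      rcases h' with h' | h'
      · exact h' (by rw [elim_arr (by decide)]; exact h0)
      · have := hM₂.done j hj h' (l11 j h0).1 (c.N + μ) ⟨by omega, hW⟩
        rw [this.1] at h1
        exact zero_ne_one h1
    · intro j hj h0
      rw [elim_arr (by decide)] at h0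
      have hlj := hM₂.live j hj (l11 j h0).1
      have hli := hM₂.live i hi hci
      obtain ⟨s1, s2⟩ := hL' j hj
      rcases zmod2_cases ((tab c L (G ++ gl) j).x (c.N + μ)) with hx | hx
      · rw [s2 fun _ h1 => by rw [hx] at h1; exact zero_ne_one h1]
        exact ⟨hlj, hx⟩
      · have hs := s1 h0 hx
        refine ⟨fun q hq => ?_, ?_⟩
        · rw [hs.1, hs.2, (hlj q hq).1, (hlj q hq).2, (hli q hq).1, (hli q hq).2]
          simp
        · rw [hs.1, hx, (hrowi _ hu).1, if_pos rfl, zmod2_add_self]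

/-- The treatment of a row with a magic part. -/
def usePair : CProg :=
  gateG 0 (qbit 44) (.const 0) ;;
  .store 11 (.reg 40) (.const 2) ;; .store 12 (.reg 44) (.add (.reg 40) (.const 1)) ;;
  .assign 31 (qbit 44) ;; findRow ;; partner ;;
  .assign 30 (.reg 40) ;; elim 10 ;;
  .assign 44 (.add (.reg 44) (.const 1))

/-- H turns the X of row `k` into Z. The partner clears the X column and row `k` the Z column, so
the live rows become trivial on the new magic qubit. The partner's own Z bit is 0 and the X bit of
row `k` is 0, so the two eliminations do not interfere. -/
theorem usePair_spec (h : Rep c σ L G)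
    (hM : Magic c A (σ.arr 11) (σ.arr 12) (σ.arr 13) μ k L G) (hμ : μ < c.t)
    (hk : k < c.K) (hlk : σ.arr 11 k = 0)
    (hrow : ∀ q, magicFrom c μ q →
      (tab c L G k).x q = (if q = c.N + μ then 1 else 0) ∧ (tab c L G k).z q = 0)
    (h20 : σ.reg 20 = c.N) (h21 : σ.reg 21 = μ) (h22 : σ.reg 22 = c.t) (h23 : σ.reg 23 = μ)
    (h40 : σ.reg 40 = k) (h44 : σ.reg 44 = μ) :
    ∃ L' gl, Rep c (usePair.run σ) L' (G ++ gl) ∧ (∀ g ∈ gl, GateIn (magicFrom c 0) g) ∧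
      Magic c A ((usePair.run σ).arr 11) ((usePair.run σ).arr 12) ((usePair.run σ).arr 13)
        ((usePair.run σ).reg 44) (k + 1) L' (G ++ gl) := by
  have hW : c.N + μ < c.W := by rw [Ctx.W]; omega
  have hu : magicFrom c μ (c.N + μ) := ⟨le_rfl, hW⟩
  have sub : ∀ q, magicFrom c μ q → magicFrom c 0 q := fun q hq => ⟨by have := hq.1; omega, hq.2⟩
  set cl := σ.arr 11 with hcl
  set PX := σ.arr 12 with hPX
  set PZ := σ.arr 13 with hPZ
  -- the Hadamard gate
  have R₁ := gateG_spec (k := 0) (a := c.N + μ) (b := 0) (ea := qbit 44) (eb := .const 0) h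
    (by simp [qbit, Expr.eval, h20, h44]) rfl ⟨hW, .inl ⟨by norm_num, rfl⟩⟩
  set σ₁ := (gateG 0 (qbit 44) (.const 0)).run σ with hσ₁
  have f₁ : ∀ r, r ∉ (gateG 0 (.const 0) (.const 0)).wr → σ₁.reg r = σ.reg r :=
    fun r hr => gateG_reg hr σ
  have a₁ : ∀ r, r ∉ (gateG 0 (.const 0) (.const 0)).wa → σ₁.arr r = σ.arr r :=
    fun r hr => gateG_arr hr σ
  have inH : ∀ g ∈ [((0, c.N + μ, 0) : ℕ × ℕ × ℕ)], GateIn (magicFrom c μ) g := by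
    intro g hg
    rw [List.mem_singleton.1 hg]
    exact ⟨hu, .inl ⟨by norm_num, rfl⟩⟩
  have hM₁ := hM.append inH
  have hrow₁ : ∀ q, magicFrom c μ q → (tab c L (G ++ [(0, c.N + μ, 0)]) k).x q = 0 ∧
      (tab c L (G ++ [(0, c.N + μ, 0)]) k).z q = if q = c.N + μ then 1 else 0 := by
    intro q hq
    rw [tab_append]
    by_cases e : q = c.N + μ
    · subst e; simp [pull, hrow _ hu]
    · have := hrow q hq
      rw [if_neg e] at this
      simp [pull, e, this]
  set G₁ := G ++ [(0, c.N + μ, 0)] with hG₁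
  set σ₂ := ((σ₁.setCell 11 k 2).setCell 12 μ (k + 1)).setReg 31 (c.N + μ) with hσ₂
  have R₂ : Rep c σ₂ L G₁ :=
    ((R₁.setCell _ _ (by decide)).setCell _ _ (by decide)).setReg _ (by decide)
  have hrun : usePair.run σ = (CProg.assign 44 (.add (.reg 44) (.const 1))).run ((elim 10).run
      ((CProg.assign 30 (.reg 40)).run (partner.run (findRow.run σ₂)))) := by
    have e : (CProg.store 11 (.reg 40) (.const 2) ;; .store 12 (.reg 44) (.add (.reg 40) (.const 1))
        ;; .assign 31 (qbit 44)).run σ₁ = σ₂ := by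
      simp [run, Expr.eval, qbit, f₁ 40 (by decide), f₁ 44 (by decide), f₁ 20 (by decide), h40,
        h44, h20, hσ₂]
    rw [← e]
    rfl
  rw [hrun]
  have hs11 : σ₂.arr 11 = Function.update cl k 2 := by
    rw [hσ₂, Mem.setReg_arr, Mem.setCell_arr_ne _ (by decide), setCell_arr_self, a₁ 11 (by decide)]
  have hs12 : σ₂.arr 12 = Function.update PX μ (k + 1) := by
    rw [hσ₂, Mem.setReg_arr, setCell_arr_self, Mem.setCell_arr_ne _ (by decide), a₁ 12 (by decide)]
  have hs13 : σ₂.arr 13 = PZ := by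
    rw [hσ₂, Mem.setReg_arr, Mem.setCell_arr_ne _ (by decide), Mem.setCell_arr_ne _ (by decide),
      a₁ 13 (by decide)]
  have f₂ : ∀ r, r ∉ (gateG 0 (.const 0) (.const 0)).wr → r ≠ 31 → σ₂.reg r = σ.reg r := by
    intro r hr h31
    rw [← f₁ r hr]; simp [hσ₂, h31]
  -- the partner
  obtain ⟨R₃, h33⟩ := findRow_spec R₂ (col := c.N + μ) (by simp [hσ₂]) hW
  set σ₃ := findRow.run σ₂ with hσ₃
  have f₃ : ∀ r ∈ [20, 21, 22, 23, 40, 44], σ₃.reg r = σ.reg r := by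
    intro r hr
    rw [hσ₃, run_reg (by revert r; decide), f₂ r (by revert r; decide) (by revert r; decide)]
  have a₃ : ∀ a ∈ [11, 12, 13], σ₃.arr a = σ₂.arr a := by
    intro a ha
    rw [hσ₃, run_arr (by revert a; decide)]
  obtain ⟨L', gl, v, R₄, in₄, h13₄, hrow₄, hv, hdrop, hsame, hlive⟩ := partner_spec R₃ hM₁ hμ
    hrow₁ (by rw [a₃ 11 (by decide), hs11]) (by rw [a₃ 13 (by decide), hs13])
    (by rw [f₃ 20 (by decide), h20]) (by rw [f₃ 21 (by decide), h21])
    (by rw [f₃ 22 (by decide), h22]) (by rw [f₃ 23 (by decide), h23])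
    (by rw [f₃ 44 (by decide), h44]) (by rw [hσ₃, run_reg (by decide)]; simp [hσ₂])
    (by rw [a₃ 11 (by decide)]; exact h33)
  set σ₄ := partner.run σ₃ with hσ₄
  have h12₄ : σ₄.arr 12 = Function.update PX μ (k + 1) := by
    rw [hσ₄, run_arr (by decide), a₃ 12 (by decide), hs12]
  have f₄ : ∀ r ∈ [40, 44], σ₄.reg r = σ.reg r := by
    intro r hr
    rw [hσ₄, run_reg (by revert r; decide), f₃ r (by revert r; decide)]
  have h31₄ : σ₄.reg 31 = c.N + μ := by
    rw [hσ₄, run_reg (by decide), hσ₃, run_reg (by decide)]; simp [hσ₂]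
  rw [assign_run, assign_run]
  set σ₅ := σ₄.setReg 30 (Expr.eval σ₄ (.reg 40)) with hσ₅
  have R₅ : Rep c σ₅ L' (G₁ ++ gl) := R₄.setReg _ (by decide)
  have ck : σ₄.arr 11 k ≠ 0 := by
    rcases hv with ⟨-, e⟩ | ⟨j, -, hne, -, -, e, -⟩
    · rw [e, Function.update_self]; omega
    · rw [e, Function.update_of_ne (Ne.symm hne), Function.update_self]; omega
  have hsub : ∀ j, σ₄.arr 11 j = 0 → cl j = 0 := by
    intro j hj
    rcases hv with ⟨-, e⟩ | ⟨j', -, -, -, -, e, -⟩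
    · rw [e, Function.update_apply] at hj
      split at hj
      · omega
      · exact hj
    · rw [e, Function.update_apply, Function.update_apply] at hj
      split_ifs at hj
      exact hj
  obtain ⟨L₂, R₆, hL₂⟩ := elim_spec (arr := 10) (i₀ := k) (col := c.N + μ)
    (f := fun r => r.z (c.N + μ)) (fun τ r hM => hM.z _ hW) R₅
    (by simp [hσ₅, Expr.eval, f₄ 40 (by decide), h40]) (by simpa [hσ₅] using h31₄) hk
    (by rw [hσ₅, Mem.setReg_arr]; exact ck)
  have sum : ∀ j < c.K, tab c L₂ (G₁ ++ gl) j = tab c L' (G₁ ++ gl) j ∨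
      (σ₄.arr 11 j = 0 ∧ (tab c L' (G₁ ++ gl) j).z (c.N + μ) = 1 ∧
        IsSum (tab c L' (G₁ ++ gl) k) (tab c L' (G₁ ++ gl) j) (tab c L₂ (G₁ ++ gl) j)) := by
    intro j hj
    obtain ⟨s1, s2⟩ := hL₂ j hj
    by_cases hc : σ₄.arr 11 j = 0 ∧ (tab c L' (G₁ ++ gl) j).z (c.N + μ) = 1
    · exact .inr ⟨hc.1, hc.2, s1 hc.1 hc.2⟩
    · exact .inl (s2 fun h h' => hc ⟨h, h'⟩)
  have hM₄ := hM₁.append in₄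
  have fin := hM₄.pair (L' := L₂) hμ hk hlk hrow₄ hv (hdrop.add hk
      (hM.A_eq_zero hk (by omega)) fun j hj => (sum j hj).imp id fun h =>
        ⟨hM.A_eq_zero hj (by have := hsub j h.1; omega), h.2.2⟩)
    (fun j hj h' => by
      rw [← hsame j hj h']
      refine (sum j hj).resolve_right fun ⟨h0, h1, _⟩ => ?_
      rcases h' with h' | h'
      · exact h' h0
      · have := hM₄.done j hj h' (hsub j h0) (c.N + μ) ⟨by omega, hW⟩
        rw [hsame j hj (.inr h'), this.2] at h1
        exact zero_ne_one h1)
    (fun j hj h0 q hq => by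
      obtain ⟨ht, hx⟩ := hlive j hj h0
      have hkrow : tab c L' (G₁ ++ gl) k = tab c L (G₁ ++ gl) k := hsame k hk (.inl ck)
      have hkt := hM₄.live k hk hlk
      obtain ⟨s1, s2⟩ := hL₂ j hj
      by_cases hz : (tab c L' (G₁ ++ gl) j).z (c.N + μ) = 1
      · have hs := s1 h0 hz
        rw [hkrow] at hs
        by_cases e : q = c.N + μ
        · rw [e, hs.1, hs.2, (hrow₄ _ hu).1, (hrow₄ _ hu).2, if_pos rfl, hx, hz, zmod2_add_self]
          exact ⟨rfl, rfl⟩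
        · have hq' : magicTo c μ q := ⟨hq.1, by have := hq.2; omega⟩
          rw [hs.1, hs.2, (ht q hq').1, (ht q hq').2, (hkt q hq').1, (hkt q hq').2]
          simp
      · rw [s2 fun _ h => hz h]
        by_cases e : q = c.N + μ
        · rw [e]
          exact ⟨hx, (zmod2_cases _).resolve_right hz⟩
        · exact ht q ⟨hq.1, by have := hq.2; omega⟩)
  refine ⟨L₂, [(0, c.N + μ, 0)] ++ gl, ?_, ?_, ?_⟩
  · rw [← List.append_assoc]
    exact R₆.setReg _ (by decide)
  · intro g hg
    rcases List.mem_append.1 hg with hg | hg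
    · exact (inH g hg).mono sub
    · exact (in₄ g hg).mono sub
  · rw [← List.append_assoc, Mem.setReg_arr, elim_arr (by decide), elim_arr (by decide),
      elim_arr (by decide), hσ₅, Mem.setReg_arr, h12₄, h13₄]
    have e44 : (((elim 10).run (σ₄.setReg 30 (Expr.eval σ₄ (.reg 40)))).setReg 44 (Expr.eval
        ((elim 10).run (σ₄.setReg 30 (Expr.eval σ₄ (.reg 40)))) (.add (.reg 44) (.const 1)))).reg 44
        = μ + 1 := by
      simp [Expr.eval, elim_reg (arr := 10) (r := 44) (by decide), f₄ 44 (by decide), h44]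
    rw [e44]
    exact fin

-- Symplectic Gram-Schmidt: after reduction a live row has either no magic part left or a new one,
-- which consumes a magic qubit. The reduction reports a nonempty range in the latter case, which is
-- why `μ` never exceeds the number of magic qubits.
set_option maxHeartbeats 1000000 in
theorem magicRows_spec (h : Rep c σ L G) (hA : Drop c A L G)
    (h11 : ∀ i < c.K, σ.arr 11 i = if A i = 0 then 0 else 1) (h12 : ∀ i, σ.arr 12 i = 0)
    (h13 : ∀ i, σ.arr 13 i = 0) :
    ∃ L' gl, Rep c (magicRows.run σ) L' (G ++ gl) ∧ (∀ g ∈ gl, GateIn (magicFrom c 0) g) ∧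
      Magic c A ((magicRows.run σ).arr 11) ((magicRows.run σ).arr 12) ((magicRows.run σ).arr 13)
        ((magicRows.run σ).reg 44) c.K L' (G ++ gl) := by
  set body : CProg := .ite (.cell 11 (.reg 40)) .skip
    (.assign 21 (.reg 44) ;; .assign 23 (.reg 44) ;; .assign 29 (.reg 40) ;; reduce ;;
      cond (.reg 25) usePair) with hbody
  set σ₀ := ((σ.setReg 44 0).setReg 20 c.N).setReg 22 c.t with hσ₀
  have hrun : magicRows.run σ = (CProg.forC 40 6 body).run σ₀ := by
    have e : (CProg.assign 44 (.const 0) ;; .assign 20 (.reg 4) ;; .assign 22 (.reg 5)).run σ =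
        σ₀ := by
      simp [run, Expr.eval, hσ₀, h.r4, h.r5]
    rw [← e]
    rfl
  have R₀ : Rep c σ₀ L G :=
    ((h.setReg _ (by decide)).setReg _ (by decide)).setReg _ (by decide)
  have key := forC_invariant (i := 40) (b := 6) (p := body) (σ := σ₀)
    (fun k τ => ∃ L' gl, Rep c τ L' (G ++ gl) ∧ (∀ g ∈ gl, GateIn (magicFrom c 0) g) ∧
      Magic c A (τ.arr 11) (τ.arr 12) (τ.arr 13) (τ.reg 44) k L' (G ++ gl))
    ⟨L, [], by simpa using R₀.setReg (i := 40) 0 (by decide), by simp, ?_⟩ ?_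
  · rw [R₀.r6, ← hrun] at key
    exact key
  · have e44 : (σ₀.setReg 40 0).reg 44 = 0 := by simp [hσ₀]
    rw [e44, List.append_nil]
    change Magic c A (σ.arr 11) (σ.arr 12) (σ.arr 13) 0 0 L G
    refine ⟨hA, Nat.zero_le _, fun i hi h0 => by rw [h11 i hi, if_neg h0],
      fun i hi h0 => .inl (by rw [h11 i hi, if_pos h0]), fun ν hν => absurd hν (by omega),
      fun ν hν => absurd hν (by omega), fun ν _ => ⟨h12 ν, h13 ν⟩, fun i hi h2 => ?_,
      fun i _ _ q hq => ?_, fun i _ hi => absurd hi (by omega)⟩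
    · rw [h11 i hi] at h2
      split at h2 <;> omega
    · have := hq.1; have := hq.2; omega
  · rintro k hk τ h40 hreg - ⟨L', gl, b1, b2, b3⟩
    rw [R₀.r6] at hk
    set μ := τ.reg 44 with hμ
    by_cases hl : τ.arr 11 k = 0
    · have e : ¬ (Expr.cell 11 (.reg 40)).eval τ ≠ 0 := by simp [Expr.eval, h40, hl]
      set τ₁ := ((τ.setReg 21 μ).setReg 23 μ).setReg 29 k with hτ₁
      have hrun : body.run τ = (cond (.reg 25) usePair).run (reduce.run τ₁) := by
        rw [hbody, run, if_neg e]
        simp only [seq_run]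
        congr 2
        simp [run, Expr.eval, h40, hτ₁, ← hμ]
      have R₁ : Rep c τ₁ L' (G ++ gl) :=
        ((b1.setReg _ (by decide)).setReg _ (by decide)).setReg _ (by decide)
      have e20 : τ₁.reg 20 = c.N := by
        simp only [hτ₁, Mem.setReg_reg]
        norm_num
        rw [hreg 20 (by decide) (by decide)]; simp [hσ₀]
      have e22 : τ₁.reg 22 = c.t := by
        simp only [hτ₁, Mem.setReg_reg]
        norm_num
        rw [hreg 22 (by decide) (by decide)]; simp [hσ₀]
      obtain ⟨gl₂, R₂, in₂, -, hred⟩ := reduce_spec (bs := c.N) (lo := μ) (hi := c.t) (u := μ)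
        (j := k) R₁ e20 (by simp [hτ₁]) e22 (by simp [hτ₁]) (by simp [hτ₁]) hk le_rfl (by omega)
        (by omega)
      rw [hrun]
      set τ₂ := reduce.run τ₁ with hτ₂
      have M₂ := b3.append in₂
      have in₀ : ∀ g ∈ gl ++ gl₂, GateIn (magicFrom c 0) g := by
        intro g hg
        rcases List.mem_append.1 hg with hg | hg
        · exact b2 g hg
        · exact (in₂ g hg).mono fun q hq => ⟨by have := hq.1; omega, hq.2⟩
      have f₂ : ∀ r ∈ [20, 21, 22, 23, 40, 44], τ₂.reg r = τ₁.reg r := fun r hr => by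
        rw [hτ₂, run_reg]; revert r; decide
      have a₂ : ∀ r ∈ [11, 12, 13], τ₂.arr r = τ.arr r := fun r hr => by
        rw [hτ₂, run_arr]
        · rfl
        · revert r; decide
      have e44 : τ₂.reg 44 = μ := by rw [f₂ 44 (by decide)]; simp [hτ₁, ← hμ]
      have M₂' : Magic c A (τ₂.arr 11) (τ₂.arr 12) (τ₂.arr 13) μ k L' (G ++ gl ++ gl₂) := by
        rw [a₂ 11 (by decide), a₂ 12 (by decide), a₂ 13 (by decide)]
        exact M₂
      rcases hred with ⟨h25, ht⟩ | ⟨h25, hlt, hr⟩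
      · rw [cond_run_neg (by simpa [Expr.eval] using h25)]
        refine ⟨L', gl ++ gl₂, by rw [← List.append_assoc]; exact R₂.setReg _ (by decide), in₀, ?_⟩
        rw [Mem.setReg_reg, if_neg (by decide), e44, ← List.append_assoc]
        exact M₂'.succ fun _ hl => trivial_full (M₂'.live k hk hl) ht
      · rw [cond_run_pos (by simpa [Expr.eval] using h25)]
        obtain ⟨L₃, gl₃, R₃, in₃, M₃⟩ := usePair_spec R₂ M₂' hlt hk
          (by rw [a₂ 11 (by decide), hl]) hr (by rw [f₂ 20 (by decide), e20])
          (by rw [f₂ 21 (by decide)]; simp [hτ₁]) (by rw [f₂ 22 (by decide), e22])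
          (by rw [f₂ 23 (by decide)]; simp [hτ₁])
          (by rw [f₂ 40 (by decide)]; simp [hτ₁, h40]) e44
        refine ⟨L₃, gl ++ gl₂ ++ gl₃, ?_, ?_, ?_⟩
        · rw [← List.append_assoc, ← List.append_assoc]
          exact R₃.setReg _ (by decide)
        · intro g hg
          rcases List.mem_append.1 hg with hg | hg
          · exact in₀ g hg
          · exact in₃ g hg
        · rw [Mem.setReg_reg, if_neg (by decide), ← List.append_assoc, ← List.append_assoc,
            Mem.setReg_arr]
          exact M₃
    · have e : (Expr.cell 11 (.reg 40)).eval τ ≠ 0 := by simpa [Expr.eval, h40] using hl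
      have hrun : body.run τ = τ := by rw [hbody, run, if_pos e]; rfl
      rw [hrun]
      refine ⟨L', gl, b1.setReg _ (by decide), b2, ?_⟩
      rw [Mem.setReg_reg, if_neg (by decide)]
      exact b3.succ fun _ h => absurd h hl

end Synth
end QCSAT

/-! ### Correctness of the normal form on the witness qubits -/

namespace QCSAT

namespace Synth
open RAM RAM.CProg RAM.Expr Row

variable {c : Ctx} {σ : Mem} {L L' G : List (ℕ × ℕ × ℕ)} {A cl PX PZ : ℕ → ℕ} {μ k p ℓ ν : ℕ}

/-! ### Normal form of the rows without magic part -/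

/-- The qubits from `lo` to `hi`. -/
def Btw (lo hi q : ℕ) : Prop := lo ≤ q ∧ q < hi

theorem inRange_zero (lo hi : ℕ) : InRange 0 lo hi = Btw lo hi := by
  funext q
  simp [InRange, Btw]

theorem reduce_witness_spec {lo hi u j : ℕ} (h : Rep c σ L G)
    (h20 : σ.reg 20 = 0) (h21 : σ.reg 21 = lo) (h22 : σ.reg 22 = hi) (h23 : σ.reg 23 = u)
    (h29 : σ.reg 29 = j) (hj : j < c.K) (hn : hi ≤ c.n) (hu : lo < hi → lo ≤ u ∧ u < hi) :
    ∃ gl, Rep c (reduce.run σ) L (G ++ gl) ∧ (∀ g ∈ gl, GateIn (Btw lo hi) g) ∧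
      ((tab c L G j).x u = 1 → ∀ g ∈ gl, Mild u g) ∧
      (((reduce.run σ).reg 25 = 0 ∧ Trivial (Btw lo hi) (tab c L (G ++ gl) j)) ∨
        ((reduce.run σ).reg 25 ≠ 0 ∧ lo < hi ∧ ∀ q, Btw lo hi q →
          (tab c L (G ++ gl) j).x q = (if q = u then 1 else 0) ∧
            (tab c L (G ++ gl) j).z q = 0)) := by
  have := reduce_spec h h20 h21 h22 h23 h29 hj (by have := c.hnN; rw [Ctx.W]; omega) (by omega) hu
  rwa [inRange_zero, zero_add] at this

/-- The symplectic form of two rows vanishes, and only the witness qubits before `p` and the magic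
qubits contribute. -/
theorem form_witness_add_magic (h : Rep c σ L G) (hD : Drop c A L G) (hp : p ≤ c.n)
    (hx : ∀ i < c.K, A i = 0 → ∀ q, Btw p c.n q → (tab c L G i).x q = 0) {i j : ℕ} (hi : i < c.K)
    (hj : j < c.K) (hAi : A i = 0) (hAj : A j = 0) :
    form (Finset.Ico 0 p) (tab c L G i) (tab c L G j) +
      form (Finset.Ico c.N c.W) (tab c L G i) (tab c L G j) = 0 := by
  have hN := c.hnN
  have hW : c.N ≤ c.W := by rw [Ctx.W]; omega
  -- From `p` to `c.N` lie the fixed witness qubits and the ancillas. Neither row has an X there, so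
  -- this block drops out of the symplectic form.
  have mid : ∀ i < c.K, A i = 0 → ∀ q ∈ Finset.Ico p c.N, (tab c L G i).x q = 0 := by
    intro i hi hA q hq
    rw [Finset.mem_Ico] at hq
    by_cases hqn : q < c.n
    · exact hx i hi hA q ⟨hq.1, hqn⟩
    · exact hD.zero i hi hA q (by omega) hq.2
  have h0 := h.form_tab i j
  have h1 := form_of_x (mid i hi hAi) (mid j hj hAj)
  rw [form, Finset.range_eq_Ico, ← Finset.sum_Ico_consecutive _ (Nat.zero_le p) (by omega : p ≤ c.W),
    ← Finset.sum_Ico_consecutive _ (by omega : p ≤ c.N) hW] at h0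
  rw [form] at h1
  rw [h1, zero_add] at h0
  exact h0

/-- The state after the first `k` rows have been processed; the witness qubits from `p` on are
fixed. -/
structure Stab (c : Ctx) (A cl : ℕ → ℕ) (p k : ℕ) (L G : List (ℕ × ℕ × ℕ)) : Prop where
  drop : Drop c A L G
  le : p ≤ c.n
  x_zero : ∀ i < c.K, A i = 0 → ∀ q, Btw p c.n q → (tab c L G i).x q = 0
  magic : ∀ i < c.K, cl i = 0 → Trivial (magicFrom c 0) (tab c L G i)
  A_zero : ∀ i < c.K, cl i = 0 → A i = 0
  done : ∀ i < c.K, i < k → cl i = 0 → Trivial (Btw 0 p) (tab c L G i)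
  fixed : ∀ w, p ≤ w → w < c.n → ∃ i < c.K, i < k ∧ cl i = 0 ∧
    (∀ q < c.W, (tab c L G i).x q = 0) ∧ (∀ q < w, (tab c L G i).z q = 0) ∧
    (tab c L G i).z w = 1 ∧ (∀ q, magicFrom c 0 q → (tab c L G i).z q = 0) ∧ (tab c L G i).p = 0

/-- Processed rows are trivial before `p`, so gates there fix them together with their phases; in
particular the signs already corrected stay correct. -/
theorem Stab.append (h : Stab c A cl p k L G) {gl : List (ℕ × ℕ × ℕ)}
    (hgl : ∀ g ∈ gl, GateIn (Btw 0 p) g) : Stab c A cl p k L (G ++ gl) := by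
  have hN := c.hnN
  have hle := h.le
  refine { h with
    drop := h.drop.append (fun q hq => .inl (by have := hq.2; omega)) hgl
    x_zero := fun i hi hA q hq => ?_
    magic := fun i hi hl => (h.magic i hi hl).append_of_disjoint hgl fun q hq hq' => by
      have := hq.1; have := hq'.2; omega
    done := fun i hi hik hl => by
      rw [(h.done i hi hik hl).tab_append hgl]
      exact h.done i hi hik hl
    fixed := fun w hw hwn => ?_ }
  · rw [tab_append, (pullList_of_not hgl _ fun hq' => by
      have := hq.1; have := hq'.2; omega).1]
    exact h.x_zero i hi hA q hq
  · obtain ⟨i, hi, hik, hl, hr⟩ := h.fixed w hw hwn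
    refine ⟨i, hi, hik, hl, ?_⟩
    rw [(h.done i hi hik hl).tab_append hgl]
    exact hr

theorem Stab.succ (h : Stab c A cl p k L G)
    (hk : k < c.K → cl k = 0 → Trivial (Btw 0 p) (tab c L G k)) :
    Stab c A cl p (k + 1) L G :=
  { h with
    done := fun i hi hik hl => by
      rcases Nat.lt_succ_iff_lt_or_eq.1 hik with hik | rfl
      · exact h.done i hi hik hl
      · exact hk hi hl
    fixed := fun w hw hwn => by
      obtain ⟨i, hi, hik, hr⟩ := h.fixed w hw hwn
      exact ⟨i, hi, by omega, hr⟩ }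

theorem Stab.x_eq_zero (h : Stab c A cl p k L G) {i : ℕ} (hi : i < c.K) (hl : cl i = 0)
    (hx : ∀ q, Btw 0 p q → (tab c L G i).x q = 0) {q : ℕ} (hq : q < c.W) :
    (tab c L G i).x q = 0 := by
  have hA := h.A_zero i hi hl
  by_cases h1 : q < p
  · exact hx q ⟨Nat.zero_le _, h1⟩
  · by_cases h2 : q < c.n
    · exact h.x_zero i hi hA q ⟨by omega, h2⟩
    · by_cases h3 : q < c.N
      · exact h.drop.zero i hi hA q (by omega) h3
      · exact (h.magic i hi hl q ⟨by omega, hq⟩).1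

/-- Before `p + 1` row `k` is Z on the qubit `p`, and it has no magic part. Every remaining row
commutes with it, hence has no X at `p`, and the qubit `p` joins the fixed ones. -/
theorem Stab.fix (h : Stab c A cl (p + 1) k L G) (hR : Rep c σ L G) (hk : k < c.K) (hl : cl k = 0)
    (hrow : ∀ q, Btw 0 (p + 1) q →
      (tab c L G k).x q = 0 ∧ (tab c L G k).z q = if q = p then 1 else 0)
    (hphase : (tab c L G k).p = 0) : Stab c A cl p (k + 1) L G := by
  have hle := h.le
  refine ⟨h.drop, by omega, fun i hi hA q hq => ?_, h.magic, h.A_zero, fun i hi hik hl' => ?_,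
    fun w hw hwn => ?_⟩
  · by_cases e : q = p
    · have f := form_witness_add_magic hR h.drop h.le h.x_zero hk hi (h.A_zero k hk hl) hA
      rw [form_of_Z (u := p) (Finset.mem_Ico.2 ⟨by omega, by omega⟩)
        fun q hq => hrow q (Finset.mem_Ico.1 hq)] at f
      have f2 : form (Finset.Ico c.N c.W) (tab c L G k) (tab c L G i) = 0 :=
        Finset.sum_eq_zero fun q hq => by
          have := h.magic k hk hl q (by simpa [magicFrom] using hq)
          rw [this.1, this.2]; ring
      rw [f2, add_zero] at f
      rw [e, f]
    · exact h.x_zero i hi hA q ⟨by have := hq.1; omega, hq.2⟩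
  · rcases Nat.lt_succ_iff_lt_or_eq.1 hik with hik | rfl
    · exact (h.done i hi hik hl').mono fun q hq => ⟨hq.1, by have := hq.2; omega⟩
    · intro q hq
      have h2 := hq.2
      have := hrow q ⟨hq.1, by omega⟩
      rwa [if_neg (by omega)] at this
  · by_cases e : w = p
    · subst e
      refine ⟨k, hk, by omega, hl, fun q hq => h.x_eq_zero hk hl (fun q hq => (hrow q hq).1) hq,
        fun q hq => ?_, ?_, fun q hq => (h.magic k hk hl q hq).2, hphase⟩
      · rw [(hrow q ⟨Nat.zero_le _, by omega⟩).2, if_neg (by omega)]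
      · rw [(hrow w ⟨Nat.zero_le _, by omega⟩).2, if_pos rfl]
    · obtain ⟨i, hi, hik, hr⟩ := h.fixed w (by omega) hwn
      exact ⟨i, hi, by omega, hr⟩

/-- The gates of a Pauli `X`. -/
def xCodes (a : ℕ) : List (ℕ × ℕ × ℕ) := [(0, a, 0), (1, a, 0), (1, a, 0), (0, a, 0)]

theorem xCodes_in {P : ℕ → Prop} {a : ℕ} (ha : P a) : ∀ g ∈ xCodes a, GateIn P g := by
  intro g hg
  simp only [xCodes, List.mem_cons, List.not_mem_nil, or_false] at hg
  rcases hg with rfl | rfl | rfl | rfl <;> exact ⟨ha, .inl ⟨by norm_num, rfl⟩⟩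

/-- Conjugation by X keeps all bits and negates Z, which adds 2 to the exponent of the phase. -/
theorem pullList_xCodes (a : ℕ) (r : Row) :
    (∀ q, (pullList (xCodes a) r).x q = r.x q) ∧ (∀ q, (pullList (xCodes a) r).z q = r.z q) ∧
      (r.x a = 0 → r.z a = 1 → (pullList (xCodes a) r).p = (r.p + 2) % 4) := by
  refine ⟨fun q => ?_, fun q => ?_, fun hx hz => ?_⟩
  · by_cases e : q = a
    · subst e
      simp only [xCodes, pullList, List.foldl, pull, Function.update_self]
      linear_combination zmod2_add_self (r.z q)
    · simp [xCodes, pull, e]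
  · by_cases e : q = a
    · subst e; simp [xCodes, pull]
    · simp [xCodes, pull]
  · simp [xCodes, pull, hx, hz, ZMod.val_one, zmod2_add_self]
    omega

/-- The correction of a sign. -/
def fixSign : CProg :=
  cond (.reg 12) (gateG 0 (.reg 23) (.const 0) ;; gateG 1 (.reg 23) (.const 0) ;;
    gateG 1 (.reg 23) (.const 0) ;; gateG 0 (.reg 23) (.const 0))

/-- Appending the gates of a Pauli `X`. -/
theorem gateX_spec (h : Rep c σ L G) {i a : ℕ} (hi : i ∉ [14, 15, 16, 10]) (ha : σ.reg i = a)
    (haW : a < c.W) :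
    Rep c ((gateG 0 (.reg i) (.const 0) ;; gateG 1 (.reg i) (.const 0) ;;
      gateG 1 (.reg i) (.const 0) ;; gateG 0 (.reg i) (.const 0)).run σ) L (G ++ xCodes a) := by
  have hi14 : i ≠ 14 := by rintro rfl; simp at hi
  simp only [seq_run]
  have step : ∀ {κ : ℕ} {τ : Mem} {G : List (ℕ × ℕ × ℕ)}, κ < 2 → Rep c τ L G → τ.reg i = a →
      Rep c ((gateG κ (.reg i) (.const 0)).run τ) L (G ++ [(κ, a, 0)]) ∧
        ((gateG κ (.reg i) (.const 0)).run τ).reg i = a := by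
    intro κ τ G hκ hR hτ
    exact ⟨gateG_spec hR (by simpa [Expr.eval, hi14] using hτ) rfl ⟨haW, .inl ⟨hκ, rfl⟩⟩,
      by rw [gateG_reg (by exact hi), hτ]⟩
  obtain ⟨R₁, e₁⟩ := step (κ := 0) (by norm_num) h ha
  obtain ⟨R₂, e₂⟩ := step (κ := 1) (by norm_num) R₁ e₁
  obtain ⟨R₃, e₃⟩ := step (κ := 1) (by norm_num) R₂ e₂
  obtain ⟨R₄, -⟩ := step (κ := 0) (by norm_num) R₃ e₃
  simpa [xCodes] using R₄

/-- The treatment of a row that is not yet trivial. -/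
def fixQubit : CProg :=
  gateG 0 (.reg 23) (.const 0) ;;
  .assign 13 (.reg 40) ;; pullRow ;;
  fixSign ;;
  .assign 45 (.reg 23)

/-- After the Hadamard gate the row has no X part at all. Being Hermitian it then has phase 1 or -1,
and X on the qubit `p`, where the row has its Z, repairs the sign. -/
theorem fixQubit_spec (h : Rep c σ L G) (hS : Stab c A cl (p + 1) k L G) (hk : k < c.K)
    (hl : cl k = 0)
    (hrow : ∀ q, Btw 0 (p + 1) q →
      (tab c L G k).x q = (if q = p then 1 else 0) ∧ (tab c L G k).z q = 0)
    (h23 : σ.reg 23 = p) (h40 : σ.reg 40 = k) :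
    ∃ gl, Rep c (fixQubit.run σ) L (G ++ gl) ∧ (∀ g ∈ gl, GateIn (Btw 0 (p + 1)) g) ∧
      (fixQubit.run σ).reg 45 = p ∧ Stab c A cl p (k + 1) L (G ++ gl) := by
  have hN := c.hnN
  have hle := hS.le
  have hpW : p < c.W := by rw [Ctx.W]; omega
  have hp : Btw 0 (p + 1) p := ⟨Nat.zero_le _, by omega⟩
  have R₁ := gateG_spec (k := 0) (a := p) (b := 0) (ea := .reg 23) (eb := .const 0) h
    (by simpa [Expr.eval] using h23) rfl ⟨hpW, .inl ⟨by norm_num, rfl⟩⟩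
  set σ₁ := (gateG 0 (.reg 23) (.const 0)).run σ with hσ₁
  have in₁ : ∀ g ∈ [((0, p, 0) : ℕ × ℕ × ℕ)], GateIn (Btw 0 (p + 1)) g := by
    intro g hg
    rw [List.mem_singleton.1 hg]
    exact ⟨hp, .inl ⟨by norm_num, rfl⟩⟩
  have S₁ := hS.append in₁
  set G₁ := G ++ [(0, p, 0)] with hG₁
  have hrow₁ : ∀ q, Btw 0 (p + 1) q →
      (tab c L G₁ k).x q = 0 ∧ (tab c L G₁ k).z q = if q = p then 1 else 0 := by
    intro q hq
    rw [hG₁, tab_append]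
    by_cases e : q = p
    · subst e; simp [pull, hrow _ hp]
    · have := hrow q hq
      rw [if_neg e] at this
      simp [pull, e, this]
  have e23₁ : σ₁.reg 23 = p := by rw [hσ₁, gateG_reg (by decide), h23]
  have e40₁ : σ₁.reg 40 = k := by rw [hσ₁, gateG_reg (by decide), h40]
  obtain ⟨R₂, M₂⟩ := load_spec (e := .reg 40) R₁ (j := k) e40₁ hk
  set σ₂ := (CProg.assign 13 (.reg 40) ;; pullRow).run σ₁ with hσ₂
  have e23₂ : σ₂.reg 23 = p := by rw [hσ₂, run_reg (by decide), e23₁]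
  have hrun : fixQubit.run σ = (CProg.assign 45 (.reg 23)).run (fixSign.run σ₂) := rfl
  have hpar : (tab c L G₁ k).p = 0 ∨ (tab c L G₁ k).p = 2 := by
    have hpar := R₁.parity_tab k
    rw [parity, Finset.sum_eq_zero fun q hq => by
      rw [S₁.x_eq_zero hk hl (fun q hq => (hrow₁ q hq).1) (Finset.mem_range.1 hq), zero_mul],
      add_zero, ZMod.natCast_eq_zero_iff] at hpar
    have := tab_p_lt (c := c) (L := L) (G := G₁) k
    omega
  rw [hrun, assign_run]
  by_cases h0 : (tab c L G₁ k).p = 0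
  · have e : fixSign.run σ₂ = σ₂ := cond_run_neg (by simpa [Expr.eval, M₂.p] using h0)
    rw [e]
    exact ⟨_, R₂.setReg _ (by decide), in₁, by simp [Expr.eval, e23₂], S₁.fix R₂ hk hl hrow₁ h0⟩
  · have e : fixSign.run σ₂ = (gateG 0 (.reg 23) (.const 0) ;; gateG 1 (.reg 23) (.const 0) ;;
        gateG 1 (.reg 23) (.const 0) ;; gateG 0 (.reg 23) (.const 0)).run σ₂ :=
      cond_run_pos (by simpa [Expr.eval, M₂.p] using h0)
    have R₃ := gateX_spec R₂ (i := 23) (by decide) e23₂ hpW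
    rw [← e] at R₃
    have e23 : (fixSign.run σ₂).reg 23 = p := by rw [run_reg (by decide), e23₂]
    have inX := xCodes_in (P := Btw 0 (p + 1)) hp
    obtain ⟨x1, x2, x3⟩ := pullList_xCodes p (tab c L G₁ k)
    refine ⟨[(0, p, 0)] ++ xCodes p, ?_, ?_, by simp [Expr.eval, e23], ?_⟩
    · rw [← List.append_assoc]
      exact R₃.setReg _ (by decide)
    · intro g hg
      rcases List.mem_append.1 hg with hg | hg
      · exact in₁ g hg
      · exact inX g hg
    · rw [← List.append_assoc]
      refine (S₁.append inX).fix R₃ hk hl (fun q hq => ?_) ?_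
      · rw [tab_append, x1, x2]
        exact hrow₁ q hq
      · rw [tab_append, x3 (hrow₁ p hp).1 (by rw [(hrow₁ p hp).2, if_pos rfl]),
          hpar.resolve_left h0]

theorem stabRows_spec (h : Rep c σ L G) (hS : Stab c A (σ.arr 11) c.n 0 L G) :
    ∃ gl p, Rep c (stabRows.run σ) L (G ++ gl) ∧ (∀ g ∈ gl, GateIn (Btw 0 c.n) g) ∧
      (stabRows.run σ).reg 45 = p ∧ (stabRows.run σ).reg 20 = 0 ∧
      Stab c A (σ.arr 11) p c.K L (G ++ gl) := by
  set body : CProg := .ite (.cell 11 (.reg 40)) .skip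
    (.assign 22 (.reg 45) ;; .assign 23 (.sub (.reg 45) (.const 1)) ;; .assign 29 (.reg 40) ;;
      reduce ;; cond (.reg 25) fixQubit) with hbody
  set σ₀ := ((σ.setReg 45 c.n).setReg 20 0).setReg 21 0 with hσ₀
  have hrun : stabRows.run σ = (CProg.forC 40 6 body).run σ₀ := by
    have e : (CProg.assign 45 (.reg 0) ;; .assign 20 (.const 0) ;; .assign 21 (.const 0)).run σ =
        σ₀ := by
      simp [run, Expr.eval, hσ₀, h.r0]
    rw [← e]
    rfl
  have R₀ : Rep c σ₀ L G :=
    ((h.setReg _ (by decide)).setReg _ (by decide)).setReg _ (by decide)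
  have e20 : (stabRows.run σ).reg 20 = 0 := by
    rw [hrun, run_reg (by decide)]; simp [hσ₀]
  have key := forC_invariant (i := 40) (b := 6) (p := body) (σ := σ₀)
    (fun k τ => ∃ gl, Rep c τ L (G ++ gl) ∧ (∀ g ∈ gl, GateIn (Btw 0 c.n) g) ∧
      Stab c A (σ.arr 11) (τ.reg 45) k L (G ++ gl))
    ⟨[], by simpa using R₀.setReg (i := 40) 0 (by decide), by simp, by simpa [hσ₀] using hS⟩ ?_
  · rw [R₀.r6, ← hrun] at key
    obtain ⟨gl, k1, k2, k3⟩ := key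
    exact ⟨gl, _, k1, k2, rfl, e20, k3⟩
  · rintro k hk τ h40 hreg harr ⟨gl, b1, b2, b3⟩
    rw [R₀.r6] at hk
    have a11 : τ.arr 11 = σ.arr 11 := harr 11 (by decide)
    set p := τ.reg 45 with hp
    have hle := b3.le
    by_cases hl : σ.arr 11 k = 0
    · have e : ¬ (Expr.cell 11 (.reg 40)).eval τ ≠ 0 := by simp [Expr.eval, h40, a11, hl]
      set τ₁ := ((τ.setReg 22 p).setReg 23 (p - 1)).setReg 29 k with hτ₁
      have hrun : body.run τ = (cond (.reg 25) fixQubit).run (reduce.run τ₁) := by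
        rw [hbody, run, if_neg e]
        simp only [seq_run]
        congr 2
        simp [run, Expr.eval, h40, hτ₁, ← hp]
      have R₁ : Rep c τ₁ L (G ++ gl) :=
        ((b1.setReg _ (by decide)).setReg _ (by decide)).setReg _ (by decide)
      have e20 : τ₁.reg 20 = 0 := by
        simp only [hτ₁, Mem.setReg_reg]
        norm_num
        rw [hreg 20 (by decide) (by decide)]; simp [hσ₀]
      have e21 : τ₁.reg 21 = 0 := by
        simp only [hτ₁, Mem.setReg_reg]
        norm_num
        rw [hreg 21 (by decide) (by decide)]; simp [hσ₀]
      obtain ⟨gl₂, R₂, in₂, -, hred⟩ := reduce_witness_spec (u := p - 1) (j := k) R₁ e20 e21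
        (hi := p) (by simp [hτ₁]) (by simp [hτ₁]) (by simp [hτ₁]) hk hle (by omega)
      rw [hrun]
      set τ₂ := reduce.run τ₁ with hτ₂
      have S₂ := b3.append in₂
      have in₀ : ∀ g ∈ gl ++ gl₂, GateIn (Btw 0 c.n) g := by
        intro g hg
        rcases List.mem_append.1 hg with hg | hg
        · exact b2 g hg
        · exact (in₂ g hg).mono fun q hq => ⟨hq.1, by have := hq.2; omega⟩
      have e45 : τ₂.reg 45 = p := by rw [hτ₂, run_reg (by decide)]; simp [hτ₁, ← hp]
      rcases hred with ⟨h25, ht⟩ | ⟨h25, hlt, hr⟩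
      · rw [cond_run_neg (by simpa [Expr.eval] using h25)]
        refine ⟨gl ++ gl₂, by rw [← List.append_assoc]; exact R₂.setReg _ (by decide), in₀, ?_⟩
        rw [Mem.setReg_reg, if_neg (by decide), e45, ← List.append_assoc]
        exact S₂.succ fun _ _ => ht
      · rw [cond_run_pos (by simpa [Expr.eval] using h25)]
        obtain ⟨p', hp'⟩ : ∃ p', p = p' + 1 := ⟨p - 1, by omega⟩
        rw [hp'] at S₂ hr
        obtain ⟨gl₃, R₃, in₃, e45', S₃⟩ := fixQubit_spec R₂ S₂ hk hl hr
          (by rw [hτ₂, run_reg (by decide)]; simp [hτ₁, hp'])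
          (by rw [hτ₂, run_reg (by decide)]; simp [hτ₁, h40])
        refine ⟨gl ++ gl₂ ++ gl₃, ?_, ?_, ?_⟩
        · rw [← List.append_assoc, ← List.append_assoc]
          exact R₃.setReg _ (by decide)
        · intro g hg
          rcases List.mem_append.1 hg with hg | hg
          · exact in₀ g hg
          · exact (in₃ g hg).mono fun q hq => ⟨hq.1, by have := hq.2; omega⟩
        · rw [Mem.setReg_reg, if_neg (by decide), e45', ← List.append_assoc, ← List.append_assoc]
          exact S₃
    · have e : (Expr.cell 11 (.reg 40)).eval τ ≠ 0 := by simpa [Expr.eval, h40, a11] using hl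
      have hrun : body.run τ = τ := by rw [hbody, run, if_pos e]; rfl
      rw [hrun]
      refine ⟨gl, b1.setReg _ (by decide), b2, ?_⟩
      rw [Mem.setReg_reg, if_neg (by decide)]
      exact b3.succ fun _ h => absurd h hl

end Synth
end QCSAT

/-! ### Correctness of the concentration of pairs -/

namespace QCSAT

namespace Synth
open RAM RAM.CProg RAM.Expr Row

variable {c : Ctx} {σ : Mem} {L L' G : List (ℕ × ℕ × ℕ)} {A cl PX PZ : ℕ → ℕ} {μ k p ℓ ν : ℕ}

/-! ### Concentrating the rows with magic part -/

/-- The state after `ν` pairs have been processed; they only use the witness qubits before `ℓ`. -/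
structure Conc (c : Ctx) (A cl PX PZ : ℕ → ℕ) (μ p ℓ ν : ℕ) (L G : List (ℕ × ℕ × ℕ)) : Prop where
  stab : Stab c A cl p c.K L G
  px : ∀ ν < μ, ∃ j < c.K, PX ν = j + 1 ∧ A j = 0 ∧ ∀ q, magicFrom c 0 q →
    (tab c L G j).x q = 0 ∧ (tab c L G j).z q = if q = c.N + ν then 1 else 0
  pz : ∀ ν < μ, PZ ν ≠ 0 → ∃ j < c.K, PZ ν = j + 1 ∧ A j = 0 ∧ ∀ q, magicFrom c 0 q →
    (tab c L G j).x q = (if q = c.N + ν then 1 else 0) ∧ (tab c L G j).z q = 0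
  out : ∀ ν, μ ≤ ν → PX ν = 0 ∧ PZ ν = 0
  cover : ∀ i < c.K, A i = 0 → cl i = 0 ∨ ∃ ν < μ, PX ν = i + 1 ∨ PZ ν = i + 1
  le_t : μ ≤ c.t
  le_ν : ℓ ≤ ν
  done : ∀ j < c.K, ∀ ν' < ν, (PX ν' = j + 1 ∨ PZ ν' = j + 1) → Trivial (Btw ℓ p) (tab c L G j)
  todo : ∀ j < c.K, ∀ ν', ν ≤ ν' → (PX ν' = j + 1 ∨ PZ ν' = j + 1) →
    ∀ q < ℓ, (tab c L G j).x q = 0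

theorem Conc.append (h : Conc c A cl PX PZ μ p ℓ ν L G) {gl : List (ℕ × ℕ × ℕ)}
    (hgl : ∀ g ∈ gl, GateIn (Btw ℓ p) g) : Conc c A cl PX PZ μ p ℓ ν L (G ++ gl) := by
  have hle := h.stab.le
  have hN := c.hnN
  have e : ∀ j q, magicFrom c 0 q → (tab c L (G ++ gl) j).x q = (tab c L G j).x q ∧
      (tab c L (G ++ gl) j).z q = (tab c L G j).z q := by
    intro j q hq
    rw [tab_append]
    exact pullList_of_not hgl _ fun hq' => by have := hq.1; have := hq'.2; omega
  refine { h with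
    stab := h.stab.append fun g hg => (hgl g hg).mono fun q hq => ⟨Nat.zero_le _, hq.2⟩
    px := fun ν hν => ?_
    pz := fun ν hν hP => ?_
    done := fun j hj ν' hν' hP => by
      rw [(h.done j hj ν' hν' hP).tab_append hgl]
      exact h.done j hj ν' hν' hP
    todo := fun j hj ν' hν' hP q hq => by
      rw [tab_append, (pullList_of_not hgl _ fun hq' => by have := hq'.1; omega).1]
      exact h.todo j hj ν' hν' hP q hq }
  · obtain ⟨j, hj, e1, e2, e3⟩ := h.px ν hν
    refine ⟨j, hj, e1, e2, fun q hq => ?_⟩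
    rw [(e j q hq).1, (e j q hq).2]
    exact e3 q hq
  · obtain ⟨j, hj, e1, e2, e3⟩ := h.pz ν hν hP
    refine ⟨j, hj, e1, e2, fun q hq => ?_⟩
    rw [(e j q hq).1, (e j q hq).2]
    exact e3 q hq

theorem Conc.succ (h : Conc c A cl PX PZ μ p ℓ ν L G)
    (hj : ∀ j < c.K, (PX ν = j + 1 ∨ PZ ν = j + 1) → Trivial (Btw ℓ p) (tab c L G j)) :
    Conc c A cl PX PZ μ p ℓ (ν + 1) L G :=
  { h with
    le_ν := by have := h.le_ν; omega
    done := fun j hjK ν' hν' hP => by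
      rcases Nat.lt_succ_iff_lt_or_eq.1 hν' with hν' | rfl
      · exact h.done j hjK ν' hν' hP
      · exact hj j hjK hP
    todo := fun j hjK ν' hν' hP => h.todo j hjK ν' (by omega) hP }

/-- Only the magic qubits and the witness qubits from `ℓ` to `p` contribute to the symplectic form
of two rows that have not been processed. -/
theorem Conc.form_add (h : Conc c A cl PX PZ μ p ℓ ν L G) (hR : Rep c σ L G) (hℓ : ℓ ≤ p)
    {i j : ℕ} (hi : i < c.K) (hj : j < c.K) (hAi : A i = 0) (hAj : A j = 0)
    (hxi : ∀ q < ℓ, (tab c L G i).x q = 0) (hxj : ∀ q < ℓ, (tab c L G j).x q = 0) :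
    form (Finset.Ico ℓ p) (tab c L G i) (tab c L G j) +
      form (Finset.Ico c.N c.W) (tab c L G i) (tab c L G j) = 0 := by
  have f := form_witness_add_magic hR h.stab.drop h.stab.le h.stab.x_zero hi hj hAi hAj
  have h1 : form (Finset.Ico 0 ℓ) (tab c L G i) (tab c L G j) = 0 :=
    form_of_x (fun q hq => hxi q (Finset.mem_Ico.1 hq).2) fun q hq => hxj q (Finset.mem_Ico.1 hq).2
  rw [form] at h1
  rwa [form, ← Finset.sum_Ico_consecutive _ (Nat.zero_le ℓ) hℓ, h1, zero_add] at f

theorem Conc.form_magic_left (h : Conc c A cl PX PZ μ p ℓ ν L G) (hν : ν < μ) {j : ℕ}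
    (hrow : ∀ q, magicFrom c 0 q →
      (tab c L G j).x q = 0 ∧ (tab c L G j).z q = if q = c.N + ν then 1 else 0) (r : Row) :
    form (Finset.Ico c.N c.W) (tab c L G j) r = r.x (c.N + ν) := by
  have := h.le_t
  refine form_of_Z (Finset.mem_Ico.2 ⟨by omega, by rw [Ctx.W]; omega⟩) fun q hq => ?_
  exact hrow q (by simpa [magicFrom] using hq)

/-- Rows of later pairs commute with row `j` on the magic qubits, hence also on the witness, where
row `j` is Z on `ℓ` in the open range. So they have no X at `ℓ`. Z bits at used qubits may remain
and do no harm. -/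
theorem Conc.advance (h : Conc c A cl PX PZ μ p ℓ ν L G) (hR : Rep c σ L G) (hℓ : ℓ < p)
    (hν : ν < μ) {j : ℕ} (hj : j < c.K) (hP : PX ν = j + 1)
    (hrow : ∀ q, Btw ℓ p q → (tab c L G j).x q = 0 ∧
      (tab c L G j).z q = if q = ℓ then 1 else 0)
    (hz : ∀ i < c.K, PZ ν = i + 1 → Trivial (Btw (ℓ + 1) p) (tab c L G i)) :
    Conc c A cl PX PZ μ p (ℓ + 1) (ν + 1) L G := by
  have hle := h.le_ν
  obtain ⟨j', hj', e, hAj, hm⟩ := h.px ν hν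
  obtain rfl : j' = j := by omega
  refine { h with le_ν := by omega, done := fun i hi ν' hν' hP' => ?_,
                  todo := fun i hi ν' hν' hP' q hq => ?_ }
  · rcases Nat.lt_succ_iff_lt_or_eq.1 hν' with hν' | rfl
    · exact (h.done i hi ν' hν' hP').mono fun q hq => ⟨by have := hq.1; omega, hq.2⟩
    · rcases hP' with hP' | hP'
      · obtain rfl : i = j' := by omega
        intro q hq
        have h1 := hq.1
        have := hrow q ⟨by omega, hq.2⟩
        rwa [if_neg (by omega)] at this
      · exact hz i hi hP'
  · have hxi := h.todo i hi ν' (by omega) hP'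
    by_cases hqℓ : q = ℓ
    · have hν'μ : ν' < μ := by
        by_contra hge
        have := h.out ν' (by omega)
        omega
      have hAi : A i = 0 ∧ (tab c L G i).x (c.N + ν) = 0 := by
        have hmem : magicFrom c 0 (c.N + ν) := ⟨by omega, by have := h.le_t; rw [Ctx.W]; omega⟩
        rcases hP' with hP' | hP'
        · obtain ⟨i', -, e', hA, hm'⟩ := h.px ν' hν'μ
          obtain rfl : i' = i := by omega
          exact ⟨hA, (hm' _ hmem).1⟩
        · obtain ⟨i', -, e', hA, hm'⟩ := h.pz ν' hν'μ (by omega)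
          obtain rfl : i' = i := by omega
          exact ⟨hA, by rw [(hm' _ hmem).1, if_neg (by omega)]⟩
      have f := h.form_add hR hℓ.le hj hi hAj hAi.1 (h.todo j' hj ν le_rfl (.inl hP)) hxi
      rw [h.form_magic_left hν hm, hAi.2, add_zero, form_of_Z (u := ℓ)
        (Finset.mem_Ico.2 ⟨le_rfl, hℓ⟩) fun q hq => hrow q (Finset.mem_Ico.1 hq)] at f
      rw [hqℓ, f]
    · exact hxi q (by omega)

/-- The treatment of a pair that is not yet trivial. -/
def concPair : CProg :=
  gateG 0 (.reg 46) (.const 0) ;;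
    cond (.cell 13 (.reg 40))
      (.assign 29 (.sub (.cell 13 (.reg 40)) (.const 1)) ;; reduce) ;;
    .assign 46 (.add (.reg 46) (.const 1))

/-- The partner anticommutes with row `j` on the magic qubits, so it must do so on the witness.
Hence it already has X at `ℓ`, and its reduction to that qubit is mild and keeps row `j` equal to Z
there: one witness qubit serves both rows. -/
theorem concPair_spec (h : Rep c σ L G) (hC : Conc c A cl PX PZ μ p ℓ ν L G) (hℓ : ℓ < p)
    (hν : ν < μ) {j : ℕ} (hj : j < c.K) (hP : PX ν = j + 1)
    (hrow : ∀ q, Btw ℓ p q → (tab c L G j).x q = (if q = ℓ then 1 else 0) ∧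
      (tab c L G j).z q = 0)
    (h13 : σ.arr 13 = PZ) (h20 : σ.reg 20 = 0) (h21 : σ.reg 21 = ℓ) (h22 : σ.reg 22 = p)
    (h23 : σ.reg 23 = ℓ) (h40 : σ.reg 40 = ν) (h46 : σ.reg 46 = ℓ) :
    ∃ gl, Rep c (concPair.run σ) L (G ++ gl) ∧ (∀ g ∈ gl, GateIn (Btw ℓ p) g) ∧
      (concPair.run σ).reg 46 = ℓ + 1 ∧ Conc c A cl PX PZ μ p (ℓ + 1) (ν + 1) L (G ++ gl) := by
  have hN := c.hnN
  have hle := hC.stab.le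
  have hℓW : ℓ < c.W := by rw [Ctx.W]; omega
  have hmem : Btw ℓ p ℓ := ⟨le_rfl, hℓ⟩
  have R₁ := gateG_spec (k := 0) (a := ℓ) (b := 0) (ea := .reg 46) (eb := .const 0) h
    (by simpa [Expr.eval] using h46) rfl ⟨hℓW, .inl ⟨by norm_num, rfl⟩⟩
  set σ₁ := (gateG 0 (.reg 46) (.const 0)).run σ with hσ₁
  have f₁ : ∀ r ∈ [20, 21, 22, 23, 40, 46], σ₁.reg r = σ.reg r := fun r hr =>
    gateG_reg (by revert r; decide) σ
  have in₁ : ∀ g ∈ [((0, ℓ, 0) : ℕ × ℕ × ℕ)], GateIn (Btw ℓ p) g := by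
    intro g hg
    rw [List.mem_singleton.1 hg]
    exact ⟨hmem, .inl ⟨by norm_num, rfl⟩⟩
  have C₁ := hC.append in₁
  set G₁ := G ++ [(0, ℓ, 0)] with hG₁
  have hrow₁ : ∀ q, Btw ℓ p q →
      (tab c L G₁ j).x q = 0 ∧ (tab c L G₁ j).z q = if q = ℓ then 1 else 0 := by
    intro q hq
    rw [hG₁, tab_append]
    by_cases e : q = ℓ
    · subst e; simp [pull, hrow _ hmem]
    · have := hrow q hq
      rw [if_neg e] at this
      simp [pull, e, this]
  have a13 : σ₁.arr 13 = PZ := by rw [hσ₁, gateG_arr (by decide), h13]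
  have e40 : σ₁.reg 40 = ν := by rw [f₁ 40 (by decide), h40]
  have hrun : concPair.run σ = (CProg.assign 46 (.add (.reg 46) (.const 1))).run
    ((cond (.cell 13 (.reg 40))
      (.assign 29 (.sub (.cell 13 (.reg 40)) (.const 1)) ;; reduce)).run σ₁) := rfl
  rw [hrun, assign_run]
  by_cases hz : PZ ν = 0
  · rw [cond_run_neg (by simpa [Expr.eval, e40, a13] using hz)]
    exact ⟨_, R₁.setReg _ (by decide), in₁, by simp [Expr.eval, f₁ 46 (by decide), h46],
      C₁.advance R₁ hℓ hν hj hP hrow₁ fun i _ h => by omega⟩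
  · rw [cond_run_pos (by simpa [Expr.eval, e40, a13] using hz)]
    obtain ⟨i, hi, ei, hAi, hmi⟩ := C₁.pz ν hν hz
    obtain ⟨j', hj', e, hAj, hm⟩ := C₁.px ν hν
    obtain rfl : j' = j := by omega
    have hxi : (tab c L G₁ i).x ℓ = 1 := by
      have f := C₁.form_add R₁ hℓ.le hj hi hAj hAi (C₁.todo j' hj ν le_rfl (.inl hP))
        (C₁.todo i hi ν le_rfl (.inr ei))
      rw [C₁.form_magic_left hν hm, (hmi _ ⟨by omega, by have := hC.le_t; rw [Ctx.W]; omega⟩).1,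
        if_pos rfl, form_of_Z (u := ℓ) (Finset.mem_Ico.2 ⟨le_rfl, hℓ⟩) fun q hq =>
        hrow₁ q (Finset.mem_Ico.1 hq)] at f
      rcases zmod2_cases ((tab c L G₁ i).x ℓ) with h0 | h0
      · rw [h0, zero_add] at f; exact absurd f one_ne_zero
      · exact h0
    set σ₂ := σ₁.setReg 29 i with hσ₂
    have hrun₂ : (CProg.assign 29 (.sub (.cell 13 (.reg 40)) (.const 1)) ;; reduce).run σ₁ =
        reduce.run σ₂ := by
      rw [seq_run, assign_run]
      simp [Expr.eval, e40, a13, ei, hσ₂]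
    rw [hrun₂]
    have f₂ : ∀ r ∈ [20, 21, 22, 23, 40, 46], σ₂.reg r = σ.reg r := fun r hr => by
      rw [← f₁ r hr, hσ₂, Mem.setReg_reg, if_neg]
      rintro rfl
      simp at hr
    obtain ⟨gl, R₃, in₃, mild, hred⟩ := reduce_witness_spec (σ := σ₂) (lo := ℓ) (hi := p) (u := ℓ)
      (j := i) (R₁.setReg _ (by decide)) (by rw [f₂ 20 (by decide), h20])
      (by rw [f₂ 21 (by decide), h21]) (by rw [f₂ 22 (by decide), h22])
      (by rw [f₂ 23 (by decide), h23]) (by simp [hσ₂]) hi hle (by omega)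
    have ht : Trivial (Btw (ℓ + 1) p) (tab c L (G₁ ++ gl) i) := by
      rcases hred with ⟨-, ht⟩ | ⟨-, -, hr⟩
      · exact ht.mono fun q hq => ⟨by have := hq.1; omega, hq.2⟩
      · intro q hq
        have h1 := hq.1
        have := hr q ⟨by omega, hq.2⟩
        rwa [if_neg (by omega)] at this
    refine ⟨[(0, ℓ, 0)] ++ gl, ?_, ?_, ?_, ?_⟩
    · rw [← List.append_assoc]
      exact R₃.setReg _ (by decide)
    · intro g hg
      rcases List.mem_append.1 hg with hg | hg
      · exact in₁ g hg
      · exact in₃ g hg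
    · have : (reduce.run σ₂).reg 46 = ℓ := by rw [run_reg (by decide), f₂ 46 (by decide), h46]
      simp [Expr.eval, this]
    · rw [← List.append_assoc]
      refine (C₁.append in₃).advance R₃ hℓ hν hj hP ?_ fun i' _ h' => ?_
      · rw [tab_append]
        exact pullList_of_mild in₃ (mild hxi) hrow₁
      · obtain rfl : i' = i := by omega
        exact ht

/-- Each pair advances `ℓ` by at most one, and `le_ν` turns this into the bound by the number of
magic qubits. -/
theorem pairRows_spec (h : Rep c σ L G) (h20 : σ.reg 20 = 0) (h45 : σ.reg 45 = p)
    (hC : Conc c A cl (σ.arr 12) (σ.arr 13) μ p 0 0 L G) :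
    ∃ gl ℓ, Rep c (pairRows.run σ) L (G ++ gl) ∧ (∀ g ∈ gl, GateIn (Btw 0 c.n) g) ∧
      Conc c A cl (σ.arr 12) (σ.arr 13) μ p ℓ c.t L (G ++ gl) := by
  set PX := σ.arr 12 with hPX
  set PZ := σ.arr 13 with hPZ
  set body : CProg := cond (.cell 12 (.reg 40))
    (.assign 21 (.reg 46) ;; .assign 23 (.reg 46) ;;
      .assign 29 (.sub (.cell 12 (.reg 40)) (.const 1)) ;; reduce ;;
      cond (.reg 25) concPair) with hbody
  set σ₀ := (σ.setReg 46 0).setReg 22 p with hσ₀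
  have hrun : pairRows.run σ = (CProg.forC 40 5 body).run σ₀ := by
    have e : (CProg.assign 46 (.const 0) ;; .assign 22 (.reg 45)).run σ = σ₀ := by
      simp [run, Expr.eval, hσ₀, h45]
    rw [← e]
    rfl
  have R₀ : Rep c σ₀ L G := (h.setReg _ (by decide)).setReg _ (by decide)
  have hle := hC.stab.le
  have key := forC_invariant (i := 40) (b := 5) (p := body) (σ := σ₀)
    (fun k τ => ∃ gl, Rep c τ L (G ++ gl) ∧ (∀ g ∈ gl, GateIn (Btw 0 c.n) g) ∧
      Conc c A cl PX PZ μ p (τ.reg 46) k L (G ++ gl))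
    ⟨[], by simpa using R₀.setReg (i := 40) 0 (by decide), by simp, by simpa [hσ₀] using hC⟩ ?_
  · rw [R₀.r5, ← hrun] at key
    obtain ⟨gl, k1, k2, k3⟩ := key
    exact ⟨gl, _, k1, k2, k3⟩
  · rintro ν hν τ h40 hreg harr ⟨gl, b1, b2, b3⟩
    have a12 : τ.arr 12 = PX := harr 12 (by decide)
    have a13 : τ.arr 13 = PZ := harr 13 (by decide)
    set ℓ := τ.reg 46 with hℓ
    by_cases hP : PX ν = 0
    · have hrun : body.run τ = τ := cond_run_neg (by simpa [Expr.eval, h40, a12] using hP)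
      rw [hrun]
      refine ⟨gl, b1.setReg _ (by decide), b2, ?_⟩
      rw [Mem.setReg_reg, if_neg (by decide)]
      have hμν : μ ≤ ν := by
        by_contra hlt
        obtain ⟨j, -, e, -⟩ := b3.px ν (by omega)
        omega
      have := b3.out ν hμν
      exact b3.succ fun j _ h => by omega
    · have hνμ : ν < μ := by
        by_contra hge
        exact hP (b3.out ν (by omega)).1
      obtain ⟨j, hj, ej, hAj, -⟩ := b3.px ν hνμ
      set τ₁ := ((τ.setReg 21 ℓ).setReg 23 ℓ).setReg 29 j with hτ₁
      have hrun : body.run τ = (cond (.reg 25) concPair).run (reduce.run τ₁) := by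
        rw [hbody, cond_run_pos (by simpa [Expr.eval, h40, a12] using hP)]
        simp only [seq_run]
        congr 2
        simp [run, Expr.eval, h40, a12, ej, hτ₁, ← hℓ]
      have R₁ : Rep c τ₁ L (G ++ gl) :=
        ((b1.setReg _ (by decide)).setReg _ (by decide)).setReg _ (by decide)
      have e20 : τ₁.reg 20 = 0 := by
        simp only [hτ₁, Mem.setReg_reg]
        norm_num
        rw [hreg 20 (by decide) (by decide)]; simpa [hσ₀] using h20
      have e22 : τ₁.reg 22 = p := by
        simp only [hτ₁, Mem.setReg_reg]
        norm_num
        rw [hreg 22 (by decide) (by decide)]; simp [hσ₀]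
      obtain ⟨gl₂, R₂, in₂, -, hred⟩ := reduce_witness_spec (lo := ℓ) (hi := p) (u := ℓ) (j := j)
        R₁ e20 (by simp [hτ₁]) e22 (by simp [hτ₁]) (by simp [hτ₁]) hj hle (by omega)
      rw [hrun]
      set τ₂ := reduce.run τ₁ with hτ₂
      have C₂ := b3.append in₂
      have in₀ : ∀ g ∈ gl ++ gl₂, GateIn (Btw 0 c.n) g := by
        intro g hg
        rcases List.mem_append.1 hg with hg | hg
        · exact b2 g hg
        · exact (in₂ g hg).mono fun q hq => ⟨Nat.zero_le _, by have := hq.2; omega⟩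
      have f₂ : ∀ r ∈ [20, 21, 22, 23, 40, 46], τ₂.reg r = τ₁.reg r := fun r hr => by
        rw [hτ₂, run_reg]; revert r; decide
      have e46 : τ₂.reg 46 = ℓ := by rw [f₂ 46 (by decide)]; simp [hτ₁, ← hℓ]
      rcases hred with ⟨h25, ht⟩ | ⟨h25, hlt, hr⟩
      · rw [cond_run_neg (by simpa [Expr.eval] using h25)]
        refine ⟨gl ++ gl₂, by rw [← List.append_assoc]; exact R₂.setReg _ (by decide), in₀, ?_⟩
        rw [Mem.setReg_reg, if_neg (by decide), e46, ← List.append_assoc]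
        refine C₂.succ fun i hi hPi => ?_
        rcases hPi with hPi | hPi
        · obtain rfl : i = j := by omega
          exact ht
        -- A partner would anticommute with row `j` on the magic qubits, although row `j` has no
        -- part left on the open witness qubits to compensate for it.
        · exfalso
          obtain ⟨i', hi', ei, hAi, hmi⟩ := C₂.pz ν hνμ (by omega)
          obtain ⟨j', hj', ej', -, hmj⟩ := C₂.px ν hνμ
          obtain rfl : j' = j := by omega
          have hμt := C₂.le_t
          have hmag := C₂.form_magic_left hνμ hmj (tab c L (G ++ gl ++ gl₂) i')
          rw [(hmi _ ⟨by omega, by rw [Ctx.W]; omega⟩).1, if_pos rfl] at hmag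
          -- The invariant does not record `ℓ ≤ p`. In the other case neither row has an X before
          -- `p`, and the form vanishes there as well.
          by_cases hℓp : ℓ ≤ p
          · have f := C₂.form_add R₂ hℓp hj hi' hAj hAi (C₂.todo j' hj ν le_rfl (.inl ej'))
              (C₂.todo i' hi' ν le_rfl (.inr ei))
            have f1 : form (Finset.Ico ℓ p) (tab c L (G ++ gl ++ gl₂) j')
                (tab c L (G ++ gl ++ gl₂) i') = 0 :=
              Finset.sum_eq_zero fun q hq => by
                have := ht q (Finset.mem_Ico.1 hq)
                rw [this.1, this.2]; ring
            rw [f1, hmag] at f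
            simp at f
          · have f := form_witness_add_magic R₂ C₂.stab.drop C₂.stab.le C₂.stab.x_zero hj hi' hAj hAi
            rw [form_of_x (T := Finset.Ico 0 p)
              (fun q hq => C₂.todo j' hj ν le_rfl (.inl ej') q (by
                have := (Finset.mem_Ico.1 hq).2; omega))
              (fun q hq => C₂.todo i' hi' ν le_rfl (.inr ei) q (by
                have := (Finset.mem_Ico.1 hq).2; omega)), hmag] at f
            simp at f
      · rw [cond_run_pos (by simpa [Expr.eval] using h25)]
        obtain ⟨gl₃, R₃, in₃, e46', C₃⟩ := concPair_spec R₂ C₂ hlt hνμ hj ej hr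
          (by rw [hτ₂, run_arr (by decide), hτ₁]; exact a13)
          (by rw [f₂ 20 (by decide), e20])
          (by rw [f₂ 21 (by decide)]; simp [hτ₁]) (by rw [f₂ 22 (by decide), e22])
          (by rw [f₂ 23 (by decide)]; simp [hτ₁])
          (by rw [f₂ 40 (by decide)]; simp [hτ₁, h40]) e46
        refine ⟨gl ++ gl₂ ++ gl₃, ?_, ?_, ?_⟩
        · rw [← List.append_assoc, ← List.append_assoc]
          exact R₃.setReg _ (by decide)
        · intro g hg
          rcases List.mem_append.1 hg with hg | hg
          · exact in₀ g hg
          · exact (in₃ g hg).mono fun q hq => ⟨Nat.zero_le _, by have := hq.2; omega⟩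
        · rw [Mem.setReg_reg, if_neg (by decide), e46', ← List.append_assoc, ← List.append_assoc]
          exact C₃

/-- The result of the main part of the program. -/
theorem mainProg_spec (h : Rep c σ L G) (h11 : ∀ i, σ.arr 11 i = 0) (h12 : ∀ i, σ.arr 12 i = 0)
    (h13 : ∀ i, σ.arr 13 i = 0) :
    ∃ L' Fm Fw A p ℓ, Rep c (mainProg.run σ) L' (G ++ (Fm ++ Fw)) ∧
      (mainProg.run σ).reg 47 = (G ++ Fm).length ∧
      (∀ g ∈ Fm, GateIn (magicFrom c 0) g) ∧ (∀ g ∈ Fw, GateIn (Btw 0 c.n) g) ∧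
      Drop c A L' (G ++ (Fm ++ Fw)) ∧ ℓ ≤ c.t ∧
      (∀ i < c.K, A i = 0 → Trivial (Btw ℓ p) (tab c L' (G ++ (Fm ++ Fw)) i)) ∧
      ∀ w, p ≤ w → w < c.n → ∃ i < c.K, A i = 0 ∧
        (∀ q < c.W, (tab c L' (G ++ (Fm ++ Fw)) i).x q = 0) ∧
        (∀ q < w, (tab c L' (G ++ (Fm ++ Fw)) i).z q = 0) ∧
        (tab c L' (G ++ (Fm ++ Fw)) i).z w = 1 ∧
        (∀ q, magicFrom c 0 q → (tab c L' (G ++ (Fm ++ Fw)) i).z q = 0) ∧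
        (tab c L' (G ++ (Fm ++ Fw)) i).p = 0 := by
  obtain ⟨L₁, A, R₁, hD, c11⟩ := dropRows_spec h h11
  set σ₁ := dropRows.run σ with hσ₁
  obtain ⟨L₂, Fm, R₂, in₂, M⟩ := magicRows_spec R₁ hD c11
    (by rw [hσ₁, run_arr (by decide)]; exact h12) (by rw [hσ₁, run_arr (by decide)]; exact h13)
  set σ₂ := magicRows.run σ₁ with hσ₂
  set μ := σ₂.reg 44
  set σ₃ := σ₂.setReg 47 (σ₂.reg 10) with hσ₃
  have R₃ : Rep c σ₃ L₂ (G ++ Fm) := R₂.setReg _ (by decide)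
  have S₃ : Stab c A (σ₃.arr 11) c.n 0 L₂ (G ++ Fm) :=
    ⟨M.drop, le_rfl, fun i _ _ q hq => by have := hq.1; have := hq.2; omega,
      fun i hi hl => M.done i hi hi hl, fun i hi hl => M.A_eq_zero hi (by
        have : σ₂.arr 11 i = 0 := hl
        omega),
      fun i _ hi => absurd hi (by omega), fun w hw hwn => absurd hw (by omega)⟩
  obtain ⟨gl, p, R₄, in₄, h45, h20, S₄⟩ := stabRows_spec R₃ S₃
  set σ₄ := stabRows.run σ₃ with hσ₄
  have hmag : ∀ j q, magicFrom c 0 q → (tab c L₂ (G ++ Fm ++ gl) j).x q =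
      (tab c L₂ (G ++ Fm) j).x q ∧ (tab c L₂ (G ++ Fm ++ gl) j).z q =
      (tab c L₂ (G ++ Fm) j).z q := by
    intro j q hq
    have hN := c.hnN
    rw [tab_append]
    exact pullList_of_not in₄ _ fun hq' => by have := hq.1; have := hq'.2; omega
  have C₄ : Conc c A (σ₃.arr 11) (σ₄.arr 12) (σ₄.arr 13) μ p 0 0 L₂ (G ++ Fm ++ gl) := by
    have e12 : σ₄.arr 12 = σ₂.arr 12 := by rw [hσ₄, run_arr (by decide)]; rfl
    have e13 : σ₄.arr 13 = σ₂.arr 13 := by rw [hσ₄, run_arr (by decide)]; rfl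
    rw [e12, e13]
    refine ⟨S₄, fun ν hν => ?_, fun ν hν hP => ?_, M.out, fun i hi hA => ?_, M.le, le_rfl,
      fun j _ ν hν => absurd hν (by omega), fun j _ ν _ _ q hq => absurd hq (by omega)⟩
    · obtain ⟨j, hj, e1, e2, e3⟩ := M.px ν hν
      refine ⟨j, hj, e1, M.A_eq_zero hj (by omega), fun q hq => ?_⟩
      rw [(hmag j q hq).1, (hmag j q hq).2]
      exact e3 q hq
    · obtain ⟨j, hj, e1, e2, e3⟩ := M.pz ν hν hP
      refine ⟨j, hj, e1, M.A_eq_zero hj (by omega), fun q hq => ?_⟩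
      rw [(hmag j q hq).1, (hmag j q hq).2]
      exact e3 q hq
    · exact (M.cl_zero i hi hA).imp id fun h => M.cover i hi h
  obtain ⟨gl₂, ℓ, R₅, in₅, C₅⟩ := pairRows_spec R₄ h20 h45 C₄
  have hrun : mainProg.run σ = pairRows.run σ₄ := rfl
  have eG : G ++ (Fm ++ (gl ++ gl₂)) = G ++ Fm ++ gl ++ gl₂ := by simp
  refine ⟨L₂, Fm, gl ++ gl₂, A, p, ℓ, ?_, ?_, in₂, ?_, ?_, C₅.le_ν, ?_, ?_⟩
  · rw [hrun, eG]
    exact R₅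
  · rw [hrun, run_reg (by decide), hσ₄, run_reg (by decide), hσ₃, Mem.setReg_reg, if_pos rfl, R₂.rG]
  · intro g hg
    rcases List.mem_append.1 hg with hg | hg
    · exact in₄ g hg
    · exact in₅ g hg
  · rw [eG]
    exact C₅.stab.drop
  -- Every row that was not dropped either has no magic part or belongs to a pair; in both cases its
  -- part from `ℓ` to `p` is gone.
  · intro i hi hA
    rw [eG]
    rcases C₅.cover i hi hA with hl | ⟨ν, hν, hP⟩
    · exact (C₅.stab.done i hi hi hl).mono fun q hq => ⟨Nat.zero_le _, hq.2⟩
    · exact C₅.done i hi ν (by have := C₅.le_t; omega) hP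
  · intro w hw hwn
    obtain ⟨i, hi, -, hl, hr⟩ := C₅.stab.fixed w hw hwn
    rw [eG]
    exact ⟨i, hi, C₅.stab.A_zero i hi hl, hr⟩

end Synth
end QCSAT

/-! ### Correctness of reading the instance -/

namespace QCSAT

namespace Synth
open RAM RAM.CProg RAM.Expr Row

/-! ### Reading the instance -/

/-- The memory holds the list `G` of gates. -/
def Holds (σ : Mem) (G : List (ℕ × ℕ × ℕ)) : Prop :=
  σ.reg 10 = G.length ∧ ∀ i (h : i < G.length), (σ.arr 4 i, σ.arr 5 i, σ.arr 6 i) = G[i]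

theorem Holds.congr {σ τ : Mem} {G : List (ℕ × ℕ × ℕ)} (h : Holds σ G)
    (h10 : τ.reg 10 = σ.reg 10) (h4 : τ.arr 4 = σ.arr 4) (h5 : τ.arr 5 = σ.arr 5)
    (h6 : τ.arr 6 = σ.arr 6) : Holds τ G := by
  unfold Holds
  rw [h10, h4, h5, h6]
  exact h

theorem Holds.pushG {σ : Mem} {G : List (ℕ × ℕ × ℕ)} (h : Holds σ G) :
    Holds (Synth.pushG.run σ) (G ++ [(σ.reg 14, σ.reg 15, σ.reg 16)]) := by
  have hrun : Synth.pushG.run σ = (((σ.setCell 4 G.length (σ.reg 14)).setCell 5 G.length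
      (σ.reg 15)).setCell 6 G.length (σ.reg 16)).setReg 10 (G.length + 1) := by
    simp [Synth.pushG, run, Expr.eval, h.1]
  rw [hrun]
  refine ⟨by simp, fun i hi => ?_⟩
  rw [List.getElem_append]
  split
  · have := h.2 i (by assumption)
    have hne : i ≠ G.length := by omega
    simpa [hne] using this
  · have : i = G.length := by simp at hi; omega
    simp [this]

theorem Holds.gateG {σ : Mem} {G : List (ℕ × ℕ × ℕ)} (h : Holds σ G) {k i a : ℕ}
    (hi : i ∉ [14, 15, 16, 10]) (ha : σ.reg i = a) :
    Holds ((Synth.gateG k (.reg i) (.const 0)).run σ) (G ++ [(k, a, 0)]) ∧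
      ((Synth.gateG k (.reg i) (.const 0)).run σ).reg i = a := by
  have hi14 : i ≠ 14 := by rintro rfl; simp at hi
  constructor
  · have hrun : (Synth.gateG k (.reg i) (.const 0)).run σ =
        Synth.pushG.run (((σ.setReg 14 k).setReg 15 a).setReg 16 0) := by
      have e : (Expr.reg i).eval (σ.setReg 14 k) = a := by simpa [Expr.eval, hi14] using ha
      have e' : Expr.eval σ (.const k) = k := rfl
      simp only [Synth.gateG, run, e, e']
      rfl
    rw [hrun]
    have : Holds (((σ.setReg 14 k).setReg 15 a).setReg 16 0) G :=
      h.congr (by simp) rfl rfl rfl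
    simpa using this.pushG
  · rw [gateG_reg (by exact hi), ha]

theorem rowQubits_map_val {n m : ℕ} (t : ℕ) (outs : List (Fin (n + m))) :
    (rowQubits t outs).map Fin.val = outs.map Fin.val ++ (List.range t).map (n + m + ·) := by
  rw [rowQubits, List.map_append, List.map_map, List.map_map, ← List.map_coe_finRange_eq_range,
    List.map_map]
  rfl

/-- The parameters of an instance. -/
def instCtx {n m : ℕ} (t : ℕ) (outs : List (Fin (n + m))) (hn : outs.Nodup) : Ctx where
  n := n
  N := n + m
  t := t
  K := (rowQubits t outs).length
  Q j := ((rowQubits t outs).map Fin.val).getD j 0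
  hnN := Nat.le_add_right _ _
  hQ j hj := by
    rw [List.getD_eq_getElem _ _ (by simpa using hj), List.getElem_map]
    exact Fin.is_lt _
  inj i hi j hj h := by
    rw [List.getD_eq_getElem _ _ (by simpa using hi), List.getD_eq_getElem _ _ (by simpa using hj)]
      at h
    exact (List.Nodup.getElem_inj_iff ((rowQubits_nodup hn).map Fin.val_injective)).1 h

/-- The memory holds the description of an instance, with a modified output register. -/
structure Loaded (I : QCSATInstance) (outs : List (Fin (I.n + I.m))) (σ : Mem) : Prop where
  r0 : σ.reg 0 = I.n
  r2 : σ.reg 2 = I.s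
  r3 : σ.reg 3 = outs.length
  r4 : σ.reg 4 = I.n + I.m
  r9 : σ.reg 9 = 0
  r10 : σ.reg 10 = 0
  code : ∀ j (h : j < I.circuit.length),
    (σ.arr 0 j, σ.arr 1 j, σ.arr 2 j) = (I.circuit[j]).code
  out : ∀ j (h : j < outs.length), σ.arr 3 j = (outs[j]).val
  zero : ∀ a, 4 ≤ a → ∀ j, σ.arr a j = 0

/-- The first part of the reading. -/
def readOut : CProg :=
  .forC 40 3 (.assign 41 (.cell 3 (.reg 40)) ;;
    gateG 0 (.reg 41) (.const 0) ;; gateG 1 (.reg 41) (.const 0) ;;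
    gateG 1 (.reg 41) (.const 0) ;; gateG 0 (.reg 41) (.const 0) ;;
    .store 14 (.reg 40) (.reg 41))

/-- The second part of the reading. -/
def readGates : CProg :=
  .forC 40 2 (.assign 42 (.sub (.sub (.reg 2) (.const 1)) (.reg 40)) ;;
    .assign 14 (.cell 0 (.reg 42)) ;; .assign 15 (.cell 1 (.reg 42)) ;;
    .assign 16 (.cell 2 (.reg 42)) ;;
    cond (.sub (.reg 14) (.const 2))
      (.assign 14 (.const 2) ;; .assign 16 (.add (.reg 4) (.reg 5)) ;;
        .store 14 (.add (.reg 3) (.reg 5)) (.reg 16) ;; .assign 5 (.add (.reg 5) (.const 1))) ;;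
    pushG)

theorem xGates_code {n m : ℕ} (t : ℕ) (outs : List (Fin (n + m))) :
    (xGates t outs).map CliffordGate.code = outs.flatMap fun q => xCodes q.val := by
  rw [xGates, List.map_flatMap]
  rfl

theorem readOut_spec {I : QCSATInstance} {outs : List (Fin (I.n + I.m))} {σ : Mem}
    (h : Loaded I outs σ) :
    Holds (readOut.run σ) ((xGates I.t outs).map CliffordGate.code) ∧
      ∀ j (hj : j < outs.length), (readOut.run σ).arr 14 j = (outs[j]).val := by
  rw [xGates_code]
  have key := forC_invariant (i := 40) (b := 3) (σ := σ) (p := .assign 41 (.cell 3 (.reg 40)) ;;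
    gateG 0 (.reg 41) (.const 0) ;; gateG 1 (.reg 41) (.const 0) ;;
    gateG 1 (.reg 41) (.const 0) ;; gateG 0 (.reg 41) (.const 0) ;;
    .store 14 (.reg 40) (.reg 41))
    (fun k τ => Holds τ ((outs.take k).flatMap fun q => xCodes q.val) ∧
      ∀ j (hj : j < outs.length), j < k → τ.arr 14 j = (outs[j]).val)
    ⟨⟨by simpa using h.r10, by simp⟩, by simp⟩ ?_
  · rw [h.r3, List.take_of_length_le le_rfl] at key
    exact ⟨key.1, fun j hj => key.2 j hj hj⟩
  · rintro k hk τ h40 hreg harr ⟨b1, b2⟩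
    rw [h.r3] at hk
    have a3 : τ.arr 3 = σ.arr 3 := harr 3 (by decide)
    set a := (outs[k]).val with ha
    have hrun : (CProg.assign 41 (.cell 3 (.reg 40)) ;;
        gateG 0 (.reg 41) (.const 0) ;; gateG 1 (.reg 41) (.const 0) ;;
        gateG 1 (.reg 41) (.const 0) ;; gateG 0 (.reg 41) (.const 0) ;;
        .store 14 (.reg 40) (.reg 41)).run τ = (CProg.store 14 (.reg 40) (.reg 41)).run
          ((gateG 0 (.reg 41) (.const 0)).run ((gateG 1 (.reg 41) (.const 0)).run
          ((gateG 1 (.reg 41) (.const 0)).run ((gateG 0 (.reg 41) (.const 0)).run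
            (τ.setReg 41 a))))) := by
      simp only [seq_run, assign_run]
      simp [Expr.eval, h40, a3, h.out k hk, ha]
    rw [hrun]
    have b0 : Holds (τ.setReg 41 a) ((outs.take k).flatMap fun q => xCodes q.val) :=
      b1.congr (by simp) rfl rfl rfl
    obtain ⟨c1, e1⟩ := b0.gateG (k := 0) (i := 41) (a := a) (by decide) (by simp)
    set τ₁ := (gateG 0 (.reg 41) (.const 0)).run (τ.setReg 41 a) with hτ₁
    obtain ⟨c2, e2⟩ := c1.gateG (k := 1) (by decide) e1
    set τ₂ := (gateG 1 (.reg 41) (.const 0)).run τ₁ with hτ₂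
    obtain ⟨c3, e3⟩ := c2.gateG (k := 1) (by decide) e2
    set τ₃ := (gateG 1 (.reg 41) (.const 0)).run τ₂ with hτ₃
    obtain ⟨c4, e4⟩ := c3.gateG (k := 0) (by decide) e3
    set τ₄ := (gateG 0 (.reg 41) (.const 0)).run τ₃ with hτ₄
    have e40 : τ₄.reg 40 = k := by
      rw [hτ₄, gateG_reg (by decide), hτ₃, gateG_reg (by decide), hτ₂, gateG_reg (by decide), hτ₁,
        gateG_reg (by decide)]
      simpa using h40
    have a14 : τ₄.arr 14 = τ.arr 14 := by
      rw [hτ₄, gateG_arr (by decide), hτ₃, gateG_arr (by decide), hτ₂, gateG_arr (by decide), hτ₁,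
        gateG_arr (by decide)]
      rfl
    have hst : (CProg.store 14 (.reg 40) (.reg 41)).run τ₄ = τ₄.setCell 14 k a := by
      simp [run, Expr.eval, e40, e4]
    rw [hst]
    refine ⟨?_, fun j hj hjk => ?_⟩
    · rw [List.take_add_one, List.getElem?_eq_getElem hk, List.flatMap_append]
      have := c4.congr (τ := (τ₄.setCell 14 k a).setReg 40 (k + 1)) (by simp) (by
        rw [Mem.setReg_arr, Mem.setCell_arr_ne _ (by decide)]) (by
        rw [Mem.setReg_arr, Mem.setCell_arr_ne _ (by decide)]) (by
        rw [Mem.setReg_arr, Mem.setCell_arr_ne _ (by decide)])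
      simpa [xCodes, ← ha] using this
    · rw [Mem.setReg_arr, setCell_arr_self, a14]
      by_cases e : j = k
      · subst e; rw [Function.update_self]
      · rw [Function.update_of_ne e]
        exact b2 j hj (by omega)

/-- After `k` passes the last `k` gates have been read, so register 5 counts the T gates of that
tail, exactly the index that `gadget` uses for the next T gate. -/
theorem readGates_spec {I : QCSATInstance} {outs : List (Fin (I.n + I.m))} {σ : Mem}
    {G : List (ℕ × ℕ × ℕ)} (h2 : σ.reg 2 = I.s) (h3 : σ.reg 3 = outs.length)
    (h4 : σ.reg 4 = I.n + I.m) (h5 : σ.reg 5 = 0)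
    (hcode : ∀ j (h : j < I.circuit.length),
      (σ.arr 0 j, σ.arr 1 j, σ.arr 2 j) = (I.circuit[j]).code) (hG : Holds σ G)
    (hout : ∀ j (hj : j < outs.length), σ.arr 14 j = (outs[j]).val) :
    Holds (readGates.run σ) (G ++ ((gadget I.t I.circuit).reverse.map CliffordGate.code)) ∧
      (readGates.run σ).reg 5 = I.t ∧
      (∀ j (hj : j < outs.length), (readGates.run σ).arr 14 j = (outs[j]).val) ∧
      ∀ i < I.t, (readGates.run σ).arr 14 (outs.length + i) = I.n + I.m + i := by
  set body : CProg := .assign 42 (.sub (.sub (.reg 2) (.const 1)) (.reg 40)) ;;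
    .assign 14 (.cell 0 (.reg 42)) ;; .assign 15 (.cell 1 (.reg 42)) ;;
    .assign 16 (.cell 2 (.reg 42)) ;;
    cond (.sub (.reg 14) (.const 2))
      (.assign 14 (.const 2) ;; .assign 16 (.add (.reg 4) (.reg 5)) ;;
        .store 14 (.add (.reg 3) (.reg 5)) (.reg 16) ;; .assign 5 (.add (.reg 5) (.const 1))) ;;
    pushG with hbody
  have key := forC_invariant (i := 40) (b := 2) (σ := σ) (p := body)
    (fun k τ =>
      Holds τ (G ++ ((gadget I.t (I.circuit.drop (I.s - k))).reverse.map CliffordGate.code)) ∧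
      τ.reg 5 = (I.circuit.drop (I.s - k)).countP Gate.isT ∧
      (∀ j (hj : j < outs.length), τ.arr 14 j = (outs[j]).val) ∧
      ∀ i < τ.reg 5, τ.arr 14 (outs.length + i) = I.n + I.m + i)
    ⟨?_, by simpa [QCSATInstance.s] using h5, hout, by simp [h5]⟩ ?_
  · rw [h2, Nat.sub_self, List.drop_zero] at key
    obtain ⟨k1, k2, k3, k4⟩ := key
    have k2' : ((CProg.forC 40 2 body).run σ).reg 5 = I.t := k2
    rw [k2'] at k4
    exact ⟨k1, k2', k3, k4⟩
  · have : Holds (σ.setReg 40 0) G := hG.congr (by simp) rfl rfl rfl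
    simpa [QCSATInstance.s, gadget] using this
  · rintro k hk τ h40 hreg harr ⟨b1, b2, b3, b4⟩
    rw [h2] at hk
    have hks : I.s - 1 - k < I.circuit.length := by
      have : I.s = I.circuit.length := rfl
      omega
    set g := I.circuit[I.s - 1 - k] with hg
    have hdrop : I.circuit.drop (I.s - (k + 1)) = g :: I.circuit.drop (I.s - k) := by
      have e1 : I.s - (k + 1) = I.s - 1 - k := by omega
      have e2 : I.s - k = I.s - 1 - k + 1 := by omega
      rw [e1, e2, List.drop_eq_getElem_cons hks]
    set tail := I.circuit.drop (I.s - k) with htail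
    have hcount : (g :: tail).countP Gate.isT ≤ I.t := by
      rw [← hdrop]
      exact (List.drop_sublist _ _).countP_le
    have hc := hcode _ hks
    rw [← hg] at hc
    have r2 : τ.reg 2 = I.s := by rw [hreg 2 (by decide) (by decide), h2]
    have r3 : τ.reg 3 = outs.length := by rw [hreg 3 (by decide) (by decide), h3]
    have r4 : τ.reg 4 = I.n + I.m := by rw [hreg 4 (by decide) (by decide), h4]
    have a0 : τ.arr 0 = σ.arr 0 := harr 0 (by decide)
    have a1 : τ.arr 1 = σ.arr 1 := harr 1 (by decide)
    have a2 : τ.arr 2 = σ.arr 2 := harr 2 (by decide)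
    have c0 : τ.arr 0 (I.s - 1 - k) = g.code.1 := by rw [a0, ← hc]
    have c1 : τ.arr 1 (I.s - 1 - k) = g.code.2.1 := by rw [a1, ← hc]
    have c2 : τ.arr 2 (I.s - 1 - k) = g.code.2.2 := by rw [a2, ← hc]
    set τ₁ := (((τ.setReg 42 (I.s - 1 - k)).setReg 14 g.code.1).setReg 15 g.code.2.1).setReg 16
      g.code.2.2 with hτ₁
    have hrun : body.run τ = pushG.run ((cond (.sub (.reg 14) (.const 2))
        (.assign 14 (.const 2) ;; .assign 16 (.add (.reg 4) (.reg 5)) ;;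
        .store 14 (.add (.reg 3) (.reg 5)) (.reg 16) ;;
        .assign 5 (.add (.reg 5) (.const 1)))).run τ₁) := by
      rw [hbody]
      simp only [seq_run]
      congr 2
      simp [run, Expr.eval, h40, r2, c0, c1, c2, hτ₁]
    have B₁ : Holds τ₁ (G ++ ((gadget I.t tail).reverse.map CliffordGate.code)) :=
      b1.congr (by simp [hτ₁]) rfl rfl rfl
    rw [hrun, hdrop]
    simp only [gadget, List.reverse_cons, List.map_append, List.map_cons, List.map_nil]
    rw [← List.append_assoc]
    have hcases : (g.isT = false ∧ g.code.1 < 3 ∧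
        (gadgetGate I.t (tail.countP Gate.isT) g).code = g.code) ∨ (g.isT = true ∧ g.code.1 = 3 ∧
        (gadgetGate I.t (tail.countP Gate.isT) g).code =
          (2, g.code.2.1, I.n + I.m + tail.countP Gate.isT)) := by
      rcases hgc : g with g' | q
      · left
        refine ⟨rfl, ?_, ?_⟩
        · cases g' <;> simp [Gate.code, CliffordGate.code]
        · simp only [gadgetGate, CliffordGate.embed_code, Gate.code]
      · right
        refine ⟨rfl, rfl, ?_⟩
        have : tail.countP Gate.isT < I.t := by
          rw [hgc, List.countP_cons_of_pos (by rfl)] at hcount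
          omega
        simp [gadgetGate, this, CliffordGate.code, Gate.code]
    rcases hcases with ⟨hT, h3', hcd⟩ | ⟨hT, h3', hcd⟩
    · rw [cond_run_neg (by simp [Expr.eval, hτ₁]; omega), hcd, List.countP_cons_of_neg (by simp [hT])]
      have e5 : ((pushG.run τ₁).setReg 40 (k + 1)).reg 5 = τ.reg 5 := by
        rw [Mem.setReg_reg, if_neg (by decide), run_reg (by decide)]; simp [hτ₁]
      have e14 : ((pushG.run τ₁).setReg 40 (k + 1)).arr 14 = τ.arr 14 := by
        rw [Mem.setReg_arr, run_arr (by decide)]; rfl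
      rw [e5, e14]
      refine ⟨?_, b2, b3, b4⟩
      have := B₁.pushG
      refine (show Holds (pushG.run τ₁) _ from ?_).congr (by simp) rfl rfl rfl
      simpa [hτ₁] using this
    · rw [cond_run_pos (by simp [Expr.eval, hτ₁]; omega), hcd, List.countP_cons_of_pos hT]
      set τ₂ := (((τ₁.setReg 14 2).setReg 16 (I.n + I.m + τ.reg 5)).setCell 14
        (outs.length + τ.reg 5) (I.n + I.m + τ.reg 5)).setReg 5 (τ.reg 5 + 1) with hτ₂
      have hrun₂ : (CProg.assign 14 (.const 2) ;; .assign 16 (.add (.reg 4) (.reg 5)) ;;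
          .store 14 (.add (.reg 3) (.reg 5)) (.reg 16) ;;
          .assign 5 (.add (.reg 5) (.const 1))).run τ₁ = τ₂ := by
        have f : ∀ r ∈ [3, 4, 5], τ₁.reg r = τ.reg r := by
          intro r hr
          simp only [List.mem_cons, List.not_mem_nil, or_false] at hr
          rcases hr with rfl | rfl | rfl <;> simp [hτ₁]
        simp [run, Expr.eval, f, r3, r4, hτ₂]
      rw [hrun₂]
      have e5 : ((pushG.run τ₂).setReg 40 (k + 1)).reg 5 = τ.reg 5 + 1 := by
        rw [Mem.setReg_reg, if_neg (by decide), run_reg (by decide)]; simp [hτ₂]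
      have e14 : ((pushG.run τ₂).setReg 40 (k + 1)).arr 14 =
          Function.update (τ.arr 14) (outs.length + τ.reg 5) (I.n + I.m + τ.reg 5) := by
        rw [Mem.setReg_arr, run_arr (by decide), hτ₂, Mem.setReg_arr, setCell_arr_self]; rfl
      rw [e5, e14]
      refine ⟨?_, by rw [b2], fun j hj => ?_, fun i hi => ?_⟩
      · have B₂ : Holds τ₂ (G ++ ((gadget I.t tail).reverse.map CliffordGate.code)) :=
          B₁.congr (by simp [hτ₂]) (by rw [hτ₂, Mem.setReg_arr, Mem.setCell_arr_ne _ (by decide)]; rfl)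
            (by rw [hτ₂, Mem.setReg_arr, Mem.setCell_arr_ne _ (by decide)]; rfl)
            (by rw [hτ₂, Mem.setReg_arr, Mem.setCell_arr_ne _ (by decide)]; rfl)
        refine (show Holds (pushG.run τ₂) _ from ?_).congr (by simp) rfl rfl rfl
        have := B₂.pushG
        rw [← b2]
        simpa [hτ₂, hτ₁] using this
      · rw [Function.update_of_ne (by omega)]
        exact b3 j hj
      · by_cases e : i = τ.reg 5
        · rw [e, Function.update_self]
        · rw [Function.update_of_ne (by omega)]
          exact b4 i (by omega)

theorem readInstance_spec {I : QCSATInstance} {outs : List (Fin (I.n + I.m))} (hn : outs.Nodup)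
    {σ : Mem} (h : Loaded I outs σ) :
    Rep (instCtx I.t outs hn) (readInstance.run σ) []
      ((baseGates I.t I.circuit outs).map CliffordGate.code) := by
  obtain ⟨H₁, out₁⟩ := readOut_spec h
  set σ₁ := readOut.run σ with hσ₁
  have f₁ : ∀ r ∈ [0, 2, 3, 4, 9], σ₁.reg r = σ.reg r := fun r hr => by
    rw [hσ₁, run_reg]; revert r; decide
  have a₁ : ∀ r ∈ [0, 1, 2], σ₁.arr r = σ.arr r := fun r hr => by
    rw [hσ₁, run_arr]; revert r; decide
  set σ₂ := σ₁.setReg 5 0 with hσ₂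
  obtain ⟨H₃, h5, out₃, magic₃⟩ := readGates_spec (I := I) (outs := outs) (σ := σ₂)
    (G := (xGates I.t outs).map CliffordGate.code)
    (by simp [hσ₂, f₁, h.r2]) (by simp [hσ₂, f₁, h.r3]) (by simp [hσ₂, f₁, h.r4]) (by simp [hσ₂])
    (fun j hj => by
      rw [hσ₂, Mem.setReg_arr, a₁ 0 (by decide), a₁ 1 (by decide), a₁ 2 (by decide)]
      exact h.code j hj)
    (H₁.congr (by simp [hσ₂]) rfl rfl rfl) out₁
  set σ₃ := readGates.run σ₂ with hσ₃
  have f₃ : ∀ r ∈ [0, 3, 4, 9], σ₃.reg r = σ.reg r := fun r hr => by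
    rw [hσ₃, run_reg (by revert r; decide), hσ₂, Mem.setReg_reg, if_neg (by revert r; decide),
      f₁ r (by revert r; decide)]
  have hrun : readInstance.run σ =
      ((σ₃.setReg 6 (outs.length + I.t)).setReg 7 (I.n + I.t)).setReg 8 (I.n + I.m + I.t) := by
    have e : readInstance.run σ = (CProg.assign 6 (.add (.reg 3) (.reg 5)) ;;
      .assign 7 (.add (.reg 0) (.reg 5)) ;; .assign 8 (.add (.reg 4) (.reg 5))).run σ₃ := rfl
    rw [e]
    simp [run, Expr.eval, f₃, h5, h.r3, h.r0, h.r4]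
  have hK : (rowQubits I.t outs).length = outs.length + I.t := by simp [rowQubits]
  have hbase : (baseGates I.t I.circuit outs).map CliffordGate.code =
      (xGates I.t outs).map CliffordGate.code ++
        (gadget I.t I.circuit).reverse.map CliffordGate.code := by
    rw [baseGates, List.map_append]
  rw [hrun]
  constructor
  · simpa [f₃, instCtx] using h.r0
  · simpa [f₃, instCtx] using h.r4
  · simpa [instCtx] using h5
  · simp [instCtx, hK]
  · simp [instCtx]
  · simp [Ctx.W, instCtx]
  · simpa [f₃] using h.r9
  · rw [hbase, ← H₃.1]; simp
  · simp
  · rw [hbase]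
    exact H₃.2
  · intro j hj
    simp only [instCtx, Mem.setReg_arr] at hj ⊢
    rw [hK] at hj
    rw [rowQubits_map_val]
    by_cases hjl : j < outs.length
    · rw [out₃ j hjl, List.getD_append _ _ _ _ (by simpa using hjl),
        List.getD_eq_getElem _ _ (by simpa using hjl), List.getElem_map]
    · obtain ⟨i, rfl⟩ : ∃ i, j = outs.length + i := ⟨j - outs.length, by omega⟩
      rw [magic₃ i (by omega), List.getD_append_right _ _ _ _ (by simp),
        List.getD_eq_getElem _ _ (by simp; omega)]
      simp
  · simp
  · intro g hg
    obtain ⟨g', -, rfl⟩ := List.mem_map.1 hg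
    exact g'.code_gateIn
  · intro a _
    simp only [Mem.setReg_arr]
    have : ∀ r ∈ [9, 10], σ₃.arr r = σ.arr r := fun r hr => by
      rw [hσ₃, run_arr (by revert r; decide), hσ₂, Mem.setReg_arr, hσ₁,
        run_arr (by revert r; decide)]
    rw [this 9 (by decide), this 10 (by decide)]
    exact ⟨h.zero 9 (by decide) a, h.zero 10 (by decide) a⟩

end Synth
end QCSAT

/-! ### The whole program and its running time -/

namespace QCSAT

namespace Synth
open RAM RAM.CProg RAM.Expr Row

/-! ### The whole program -/

/-- The output register that the program uses. -/
def usedOut (I : QCSATInstance) : List (Fin (I.n + I.m)) :=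
  if I.n + 2 * I.s < I.out.length then [] else I.out

theorem usedOut_nodup (I : QCSATInstance) : (usedOut I).Nodup := by
  unfold usedOut
  split
  · exact List.nodup_nil
  · exact I.out_nodup

theorem usedOut_length (I : QCSATInstance) : (usedOut I).length ≤ I.n + 2 * I.s := by
  unfold usedOut
  split
  · simp
  · omega

theorem initRegs_spec (I : QCSATInstance) :
    Loaded I (usedOut I) (initRegs.run (inputMem I)) := by
  have arr : (initRegs.run (inputMem I)).arr = (inputMem I).arr := by
    funext a
    exact run_arr (by simp [initRegs, cond, wa]) _
  have hrun : initRegs.run (inputMem I) =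
      if I.out.length - (I.n + (I.s + I.s)) ≠ 0 then
        ((inputMem I).setReg 4 (I.n + I.m)).setReg 3 0
      else (inputMem I).setReg 4 (I.n + I.m) := by
    simp [initRegs, cond, run, Expr.eval, inputMem]
  have reg : ∀ r ∈ [0, 2, 9, 10], (initRegs.run (inputMem I)).reg r = (inputMem I).reg r :=
    fun r hr => run_reg (by revert r; decide) _
  constructor
  · rw [reg 0 (by decide)]; rfl
  · rw [reg 2 (by decide)]; rfl
  · rw [hrun, usedOut]
    by_cases h : I.n + 2 * I.s < I.out.length
    · rw [if_pos h, if_pos (by omega)]; simp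
    · rw [if_neg h, if_neg (by omega)]; simp [inputMem]
  · rw [hrun]
    split <;> simp
  · rw [reg 9 (by decide)]; rfl
  · rw [reg 10 (by decide)]; rfl
  · intro j hj
    rw [arr]
    simp [inputMem, hj]
  · intro j hj
    rw [arr]
    unfold usedOut at hj ⊢
    split at hj
    · simp at hj
    · rename_i h
      simp only [if_neg h]
      simp [inputMem, hj]
  · intro a ha j
    rw [arr]
    match a, ha with
    | a + 4, _ => rfl

theorem writeCircuit_spec {σ : Mem} {G : List (ℕ × ℕ × ℕ)} (h : Holds σ G)
    (h48 : σ.reg 48 ≤ G.length) :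
    (writeCircuit.run σ).reg 0 = σ.reg 48 ∧ ∀ j < σ.reg 48,
      ((writeCircuit.run σ).arr 0 j, (writeCircuit.run σ).arr 1 j, (writeCircuit.run σ).arr 2 j) =
        G.getD (G.length - 1 - j) (0, 0, 0) := by
  have key := forC_invariant (i := 40) (b := 48) (σ := σ)
    (p := .assign 42 (.sub (.sub (.reg 10) (.const 1)) (.reg 40)) ;;
      .store 0 (.reg 40) (.cell 4 (.reg 42)) ;; .store 1 (.reg 40) (.cell 5 (.reg 42)) ;;
      .store 2 (.reg 40) (.cell 6 (.reg 42)))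
    (fun k τ => ∀ j < k, (τ.arr 0 j, τ.arr 1 j, τ.arr 2 j) =
      G.getD (G.length - 1 - j) (0, 0, 0)) (by simp) ?_
  · have e : writeCircuit.run σ = ((CProg.forC 40 48
        (.assign 42 (.sub (.sub (.reg 10) (.const 1)) (.reg 40)) ;;
      .store 0 (.reg 40) (.cell 4 (.reg 42)) ;; .store 1 (.reg 40) (.cell 5 (.reg 42)) ;;
      .store 2 (.reg 40) (.cell 6 (.reg 42)))).run σ).setReg 0 (σ.reg 48) := by
      rw [writeCircuit, seq_run, assign_run]
      congr 1
      exact run_reg (by decide) _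
    rw [e]
    refine ⟨by simp, fun j hj => ?_⟩
    rw [Mem.setReg_arr]
    exact key j hj
  · intro k hk τ h40 hreg harr ih j hj
    have b : Holds τ G := h.congr (hreg 10 (by decide) (by decide)) (harr 4 (by decide))
      (harr 5 (by decide)) (harr 6 (by decide))
    have hrun : (CProg.assign 42 (.sub (.sub (.reg 10) (.const 1)) (.reg 40)) ;;
      .store 0 (.reg 40) (.cell 4 (.reg 42)) ;; .store 1 (.reg 40) (.cell 5 (.reg 42)) ;;
      .store 2 (.reg 40) (.cell 6 (.reg 42))).run τ =
        ((((τ.setReg 42 (G.length - 1 - k)).setCell 0 k (τ.arr 4 (G.length - 1 - k))).setCell 1 k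
          (τ.arr 5 (G.length - 1 - k))).setCell 2 k (τ.arr 6 (G.length - 1 - k))) := by
      simp [run, Expr.eval, h40, b.1]
    rw [hrun]
    by_cases hjk : j = k
    · subst hjk
      rw [List.getD_eq_getElem _ _ (by omega), ← b.2]
      simp
    · simpa [hjk] using ih j (by omega)

/-- The program that computes the Clifford circuit. -/
def solver : CProg := initRegs ;; readInstance ;; mainProg ;; countGates ;; writeCircuit

/-- The stages are timed separately, because registers written by one stage are loop bounds of the
next, while `exec_run` wants bounds that are never written. The parameter bound 3(n + s) covers the
at most n + 2s output qubits together with the t ≤ s magic qubits. -/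
theorem exec_solver : ∃ c, ∀ I : QCSATInstance, I.t ≤ I.n → ∃ T,
    Exec solver.compile (inputMem I) T (solver.run (inputMem I)) ∧ T ≤ c * (I.n + I.s + 1) ^ c := by
  set D : ℕ → ℕ := fun X => 3 * X with hD
  set V : ℕ → ℕ := fun X => readInstance.weight (D X) + mainProg.weight (D X) with hV
  set Y : ℕ → ℕ := fun X => D X + V X with hY
  have hp : PolyBdd fun X => solver.cost (Y X) (Y X) := by
    have pD : PolyBdd D := (PolyBdd.const 3).mul PolyBdd.id
    have pV : PolyBdd V := ((polyBdd_weight readInstance).comp pD).add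
      ((polyBdd_weight mainProg).comp pD)
    exact (polyBdd_cost solver).comp (pD.add pV)
  obtain ⟨c, hc⟩ := hp
  refine ⟨c, fun I ht => ?_⟩
  set X := I.n + I.s with hX
  have hDX : D X = 3 * (I.n + I.s) := rfl
  have hVX : V X = readInstance.weight (D X) + mainProg.weight (D X) := rfl
  have hts : I.t ≤ I.s := List.countP_le_length
  have h₁ := initRegs_spec I
  obtain ⟨⟨T₁, e₁, l₁⟩, -⟩ := exec_run (cs := []) (D := D X) (V := V X) (p := initRegs)
    (by decide) (by decide) (σ := inputMem I) (by simp [initRegs, cond, bounds]) (by simp)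
  set σ₁ := initRegs.run (inputMem I) with hσ₁
  obtain ⟨⟨T₂, e₂, l₂⟩, w₂⟩ := exec_run (D := D X) (V := V X) readInstance_wf readInstance_bounds
    (σ := σ₁)
    (fun r hr => by
      have : r = 3 ∨ r = 2 := by
        revert r; decide
      have := usedOut_length I
      rcases ‹r = 3 ∨ r = 2› with rfl | rfl
      · rw [h₁.r3]; omega
      · rw [h₁.r2]; omega)
    (fun r hr => by
      have : σ₁.reg r = 0 := by
        simp only [List.mem_cons, List.not_mem_nil, or_false] at hr
        rcases hr with rfl | rfl
        · exact h₁.r9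
        · exact h₁.r10
      rw [this]
      omega)
  have h₂ := readInstance_spec (usedOut_nodup I) h₁
  set σ₂ := readInstance.run σ₁ with hσ₂
  obtain ⟨⟨T₃, e₃, l₃⟩, w₃⟩ := exec_run (D := D X) (V := V X) mainProg_wf mainProg_bounds
    (σ := σ₂)
    (fun r hr => by
      have hK : (rowQubits I.t (usedOut I)).length = (usedOut I).length + I.t := by simp [rowQubits]
      have := usedOut_length I
      rcases mainProg_bounds_mem r hr with rfl | rfl | rfl
      · rw [h₂.r5]; simp only [instCtx]; omega
      · rw [h₂.r6]; simp only [instCtx]; omega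
      · rw [h₂.r7]; simp only [instCtx]; omega)
    (fun r hr => by
      have := w₂ r hr
      have : σ₁.reg r = 0 := by
        simp only [List.mem_cons, List.not_mem_nil, or_false] at hr
        rcases hr with rfl | rfl
        · exact h₁.r9
        · exact h₁.r10
      omega)
  set σ₃ := mainProg.run σ₂ with hσ₃
  obtain ⟨⟨T₄, e₄, l₄⟩, -⟩ := exec_run (cs := []) (D := D X) (V := V X) (p := countGates)
    (by decide) (by decide) (σ := σ₃) (by simp [countGates, bounds]) (by simp)
  set σ₄ := countGates.run σ₃ with hσ₄
  -- The number of gates to be written is at most the counter bound, which therefore serves as the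
  -- parameter bound of the last stage.
  obtain ⟨⟨T₅, e₅, l₅⟩, -⟩ := exec_run (D := V X) (V := V X) writeCircuit_wf writeCircuit_bounds
    (σ := σ₄)
    (fun r hr => by
      have : r = 48 := by revert r; decide
      subst this
      have a₁ := w₂ 10 (by decide)
      have a₂ := w₃ 10 (by decide)
      have : σ₄.reg 48 = σ₃.reg 10 - σ₃.reg 47 := by
        simp [hσ₄, countGates, run, Expr.eval]
      rw [h₁.r10] at a₁
      omega) (by simp)
  refine ⟨_, .seq e₁ (.seq e₂ (.seq e₃ (.seq e₄ e₅))), le_trans ?_ (hc X)⟩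
  have m : ∀ (p : CProg) {d v : ℕ}, d ≤ Y X → v ≤ Y X → p.cost d v ≤ p.cost (Y X) (Y X) :=
    fun p _ _ => cost_mono p
  have hDY : D X ≤ Y X := Nat.le_add_right _ _
  have hVY : V X ≤ Y X := Nat.le_add_left _ _
  have := l₁.trans (m _ hDY hVY)
  have := l₂.trans (m _ hDY hVY)
  have := l₃.trans (m _ hDY hVY)
  have := l₄.trans (m _ hDY hVY)
  have := l₅.trans (m _ hVY hVY)
  simp only [solver, CProg.cost]
  omega

end Synth
end QCSAT

/-! ### Existence of an optimum and conclusion -/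

namespace QCSAT
open Synth

/-! ### Optimal witness states -/

theorem norm_eq_one_iff {n : ℕ} (ψ : Qubits n) : ‖ψ‖ = 1 ↔ normSum ψ.ofLp = 1 := by
  have h : normSum ψ.ofLp = ‖ψ‖ ^ 2 := (EuclideanSpace.norm_sq_eq ψ).symm
  rw [h, pow_eq_one_iff_of_nonneg (norm_nonneg _) two_ne_zero]

theorem accept_eq (I : QCSATInstance) (ψ : Qubits I.n) :
    I.accept ψ = accProb I.circuit I.out ψ.ofLp := rfl

theorem continuous_accProb {n m : ℕ} (circ : List (Gate (n + m))) (outs : List (Fin (n + m))) :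
    Continuous (accProb circ outs) := by
  have hp : Continuous (pad : (Bits n → ℂ) → Bits (n + m) → ℂ) := by
    refine continuous_pi fun x => ?_
    unfold pad
    split
    · exact continuous_apply _
    · exact continuous_const
  have hm : Continuous fun ψ : Bits n → ℂ => circuitOp circ *ᵥ pad ψ :=
    continuous_const.matrix_mulVec hp
  exact continuous_finsetSum _ fun x _ => (((continuous_apply x).comp hm).norm).pow 2

/-- The acceptance probability is continuous and the unit sphere is compact and nonempty. -/
theorem exists_isOptimal (I : QCSATInstance) : ∃ ψ, I.IsOptimal ψ := by
  have hc : Continuous I.accept :=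
    (continuous_accProb I.circuit I.out).comp (PiLp.continuous_ofLp 2 _)
  obtain ⟨ψ₀, h₀, -⟩ := exists_zeroFrom_unit I.n 0
  obtain ⟨ψ, hψ, hmax⟩ := (isCompact_sphere (0 : Qubits I.n) 1).exists_isMaxOn
    ⟨WithLp.toLp 2 ψ₀, by simpa using (norm_eq_one_iff (WithLp.toLp 2 ψ₀)).2 h₀⟩ hc.continuousOn
  exact ⟨ψ, by simpa using hψ, fun ψ' h' => hmax (by simpa using h')⟩

theorem normSum_mulVec {n : ℕ} {V : Op n} (hV : Vᴴ * V = 1) (ψ : Bits n → ℂ) :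
    normSum (V *ᵥ ψ) = normSum ψ := by
  have e : ∀ χ : Bits n → ℂ, (normSum χ : ℂ) = ∑ u, star (χ u) * χ u := fun χ => by
    simp [normSum, Complex.conj_mul']
  have := sum_star_unitary hV ψ ψ
  rw [← e, ← e] at this
  exact_mod_cast this

theorem exists_padZero {a b : ℕ} (h : a ≤ b) {ℓ : ℕ} (hℓ : ℓ ≤ a) {ψ : Bits b → ℂ}
    (hψ : ZeroFrom ℓ ψ) (h1 : normSum ψ = 1) :
    ∃ φ : Qubits a, ‖φ‖ = 1 ∧ (padZero h φ).ofLp = ψ := by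
  set f : Bits a → Bits b := fun y i => if hi : i.val < a then y ⟨i, hi⟩ else false with hf
  have hfi : Function.Injective f := fun y y' e => by
    funext i
    have := congrFun e (i.castLE h)
    simpa [hf] using this
  have hfr : ∀ x : Bits b, (∀ i : Fin b, a ≤ i.val → x i = false) →
      f (fun i => x (Fin.castLE h i)) = x := fun x hx => by
    funext i
    by_cases hi : i.val < a
    · simp [hf, hi]
    · simp [hf, hi, hx i (by omega)]
  have hψ0 : ∀ x : Bits b, (¬ ∀ i : Fin b, a ≤ i.val → x i = false) → ψ x = 0 := fun x hx => by
    push Not at hx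
    obtain ⟨i, hi, hxi⟩ := hx
    exact hψ x ⟨i, by omega, by simpa using hxi⟩
  refine ⟨WithLp.toLp 2 fun y => ψ (f y), (norm_eq_one_iff _).2 ?_, ?_⟩
  · rw [← h1]
    refine Fintype.sum_of_injective f hfi _ _ (fun x hx => ?_) fun y => rfl
    rw [hψ0 x fun hx' => hx ⟨fun i => x (Fin.castLE h i), hfr x hx'⟩]
    simp
  · funext x
    by_cases hx : ∀ i : Fin b, a ≤ i.val → x i = false
    · simp only [padZero, if_pos hx, hfr x hx]
    · simp only [padZero, if_neg hx, hψ0 x hx]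

/-- For a one-qubit gate the second index is 0 by convention, so the qubit 0 counts as touched. This
only strengthens the hypothesis and fits the count of two qubits per gate. -/
theorem Gate.op_apply_eq_zero {N : ℕ} {g : Gate N} {q : Fin N} (h1 : g.code.2.1 ≠ q)
    (h2 : g.code.2.2 ≠ q) {x y : Bits N} (hxy : x q ≠ y q) : g.op x y = 0 := by
  have one : ∀ (A : Matrix Bool Bool ℂ) (a : Fin N), a.val ≠ q → oneQubit A a x y = 0 := by
    intro A a ha
    simp only [oneQubit, Matrix.of_apply]
    rw [if_neg]
    exact fun h => hxy (h q fun e => ha (by rw [e]))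
  match g with
  | .T a => exact one _ a h1
  | .clifford (.H a) => exact one _ a h1
  | .clifford (.S a) => exact one _ a h1
  | .clifford (.CNOT a b hab) =>
    simp only [Gate.op, CliffordGate.op, cnotOp, Matrix.of_apply]
    rw [if_neg]
    rintro rfl
    exact hxy (Function.update_of_ne (fun e => h2 (by rw [e]; rfl)) _ _)

/-- A qubit that no gate touches keeps its value 0. For an output qubit among the ancillas this
excludes acceptance. -/
theorem circuitOp_mulVec_eq_zero {N : ℕ} {l : List (Gate N)} {q : Fin N}
    (hl : ∀ g ∈ l, g.code.2.1 ≠ q ∧ g.code.2.2 ≠ q) {Ψ : Bits N → ℂ}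
    (hΨ : ∀ x, x q = true → Ψ x = 0) : ∀ x, x q = true → (circuitOp l *ᵥ Ψ) x = 0 := by
  induction l generalizing Ψ with
  | nil => simpa [circuitOp] using hΨ
  | cons g l ih =>
    intro x hx
    rw [circuitOp, ← Matrix.mulVec_mulVec]
    refine ih (fun g' h' => hl g' (List.mem_cons_of_mem _ h')) (fun y hy => ?_) x hx
    refine Finset.sum_eq_zero fun z _ => ?_
    by_cases hz : z q = true
    · rw [hΨ z hz, mul_zero]
    · have hg := hl g List.mem_cons_self
      change g.op y z * Ψ z = 0
      rw [Gate.op_apply_eq_zero hg.1 hg.2 fun e : y q = z q => hz (e ▸ hy), zero_mul]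

/-- If there are more output qubits than witness qubits and qubits that gates act on, then the
circuit never accepts. -/
theorem accProb_eq_zero {n m : ℕ} {circ : List (Gate (n + m))} {outs : List (Fin (n + m))}
    (hn : outs.Nodup) (hl : n + 2 * circ.length < outs.length) (ψ : Bits n → ℂ) :
    accProb circ outs ψ = 0 := by
  set touched := circ.map (fun g => g.code.2.1) ++ circ.map (fun g => g.code.2.2) with htouched
  obtain ⟨q, hq, hq'⟩ : ∃ q ∈ outs, q.val ∉ List.range n ++ touched := by
    by_contra! hall
    have hsub : outs.map Fin.val ⊆ List.range n ++ touched := fun v hv => by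
      obtain ⟨q, hq, rfl⟩ := List.mem_map.1 hv
      exact hall q hq
    have := ((hn.map Fin.val_injective).subperm hsub).length_le
    simp [htouched] at this
    omega
  simp only [htouched, List.mem_append, List.mem_range, List.mem_map, not_or, not_exists,
    not_and] at hq'
  obtain ⟨hqn, hq1, hq2⟩ := hq'
  refine Finset.sum_eq_zero fun x hx => ?_
  have hx := (Finset.mem_filter.1 hx).2 q hq
  rw [circuitOp_mulVec_eq_zero (fun g hg => ⟨hq1 g hg, hq2 g hg⟩) (fun y hy => ?_) x hx]
  · simp
  · unfold pad
    rw [if_neg fun h => by simp [h q (by omega)] at hy]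

theorem displays_reverse {n : ℕ} {σ : RAM.Mem} {G : List (ℕ × ℕ × ℕ)} {W : List (CliffordGate n)}
    (h : Holds σ (G ++ W.map CliffordGate.code)) (h48 : σ.reg 48 = W.length) :
    Displays (writeCircuit.run σ) W.reverse := by
  obtain ⟨e0, eg⟩ := writeCircuit_spec h (by rw [h48]; simp)
  refine ⟨by rw [e0, h48, List.length_reverse], fun j hj => ?_⟩
  rw [List.length_reverse] at hj
  rw [eg j (by omega), List.getElem_reverse, List.getD_append_right _ _ _ _ (by simp; omega),
    List.getD_eq_getElem _ _ (by simp; omega), List.getElem_map]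
  congr 2
  simp
  omega

/-- Write an optimal state as W applied to W†ψ₀, and replace W†ψ₀ by a vector whose bits from ℓ ≤ t
on are 0 without lowering the acceptance probability. -/
theorem exists_circuit (I : QCSATInstance) (ht : I.t ≤ I.n) :
    ∃ W : List (CliffordGate I.n), Displays (solver.run (inputMem I)) W ∧
      ∃ φ : Qubits I.t, ‖φ‖ = 1 ∧ I.IsOptimal (applyOp (cliffordOp W) (padZero ht φ)) := by
  have h₁ := initRegs_spec I
  set σ₁ := initRegs.run (inputMem I) with hσ₁
  have hn := usedOut_nodup I
  set c := instCtx I.t (usedOut I) hn with hc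
  have h₂ := readInstance_spec hn h₁
  set σ₂ := readInstance.run σ₁ with hσ₂
  have z₂ : ∀ a ∈ [11, 12, 13], ∀ i, σ₂.arr a i = 0 := fun a ha i => by
    rw [hσ₂, RAM.CProg.run_arr (by revert a; decide)]
    exact h₁.zero a (by revert a; decide) i
  obtain ⟨L, Fm, Fw, A, p, ℓ, h₃, h47, hFm, hFw, hD, hℓ, hfree, hzero⟩ :=
    mainProg_spec h₂ (z₂ 11 (by decide)) (z₂ 12 (by decide)) (z₂ 13 (by decide))
  set σ₃ := mainProg.run σ₂ with hσ₃
  set G := (baseGates I.t I.circuit (usedOut I)).map CliffordGate.code with hG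
  obtain ⟨W, hW, hopt⟩ := exists_zeroFrom_ge I.circuit rfl (usedOut I) hn L Fm Fw
    (fun g hg => by
      obtain ⟨a, b, ha, hb, hab, rfl⟩ := h₃.okL g hg
      have mem : ∀ j < c.K, c.Q j ∈ (rowQubits I.t (usedOut I)).map Fin.val := fun j hj => by
        have : j < ((rowQubits I.t (usedOut I)).map Fin.val).length := by
          rw [List.length_map]; exact hj
        change List.getD _ j 0 ∈ _
        rw [List.getD_eq_getElem _ _ this]
        exact List.getElem_mem _
      exact ⟨⟨mem a ha, .inr ⟨rfl, mem b hb, fun e => hab (c.inj a ha b hb e)⟩⟩, rfl⟩)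
    (fun g hg => (hFm g hg).mono fun q hq => ⟨hq.1, hq.2⟩)
    (fun g hg => (hFw g hg).mono fun q hq => hq.2)
    (tab c L (G ++ (Fm ++ Fw))) (fun i => rfl) A hD.pos ℓ p
    (fun i hi hA q h h' => hfree i hi hA q ⟨h, h'⟩)
    (fun w hw hw' => by
      obtain ⟨i, hi, h1, h2, h3, h4, h5, h6⟩ := hzero w hw hw'
      exact ⟨i, hi, h1, h2, h3, h4, fun q a b => h5 q ⟨a, b⟩, h6⟩)
  refine ⟨W.reverse, ?_, ?_⟩
  · set σ₄ := countGates.run σ₃ with hσ₄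
    have h48 : σ₄.reg 48 = W.length := by
      have : σ₄.reg 48 = σ₃.reg 10 - σ₃.reg 47 := by
        simp [hσ₄, countGates, RAM.CProg.run, RAM.Expr.eval]
      rw [this, h₃.rG, h47, ← hW]
      simp
      omega
    have H₄ : Holds σ₄ ((G ++ Fm) ++ W.map CliffordGate.code) := by
      rw [hW, List.append_assoc]
      exact Holds.congr ⟨h₃.rG, h₃.aG⟩ (RAM.CProg.run_reg (by decide) _)
        (RAM.CProg.run_arr (by decide) _) (RAM.CProg.run_arr (by decide) _)
        (RAM.CProg.run_arr (by decide) _)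
    have e : solver.run (inputMem I) = writeCircuit.run σ₄ := by
      simp only [solver, seq_run, hσ₄, hσ₃, hσ₂, hσ₁]
    rw [e]
    exact displays_reverse H₄ h48
  · rw [cliffordOp_reverse]
    -- If the output register was discarded, both probabilities for the true register are 0;
    -- otherwise the two registers coincide.
    have hle : ∀ a b : Bits I.n → ℂ, accProb I.circuit (usedOut I) a ≤
        accProb I.circuit (usedOut I) b → accProb I.circuit I.out a ≤ accProb I.circuit I.out b := by
      intro a b hab
      by_cases h : I.n + 2 * I.s < I.out.length
      · rw [accProb_eq_zero I.out_nodup h, accProb_eq_zero I.out_nodup h]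
      · rwa [usedOut, if_neg h] at hab
    have hV := prodOp_conjTranspose_mul W
    have hV' : prodOp W * (prodOp W)ᴴ = 1 := mul_eq_one_comm.1 hV
    obtain ⟨ψ₀, hψ₀, hmax⟩ := exists_isOptimal I
    have hψ₁ : normSum ((prodOp W)ᴴ *ᵥ ψ₀.ofLp) = 1 := by
      rw [normSum_mulVec (by rwa [Matrix.conjTranspose_conjTranspose])]
      exact (norm_eq_one_iff ψ₀).1 hψ₀
    obtain ⟨ψ', h1, hz, hacc⟩ := hopt _ hψ₁
    rw [Matrix.mulVec_mulVec, hV', Matrix.one_mulVec] at hacc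
    obtain ⟨φ, hφ, hpad⟩ := exists_padZero ht hℓ hz h1
    refine ⟨φ, hφ, (norm_eq_one_iff _).2 ?_, fun χ hχ => (hmax χ hχ).trans ?_⟩
    · change normSum (prodOp W *ᵥ (padZero ht φ).ofLp) = 1
      rw [hpad, normSum_mulVec hV, h1]
    · rw [accept_eq, accept_eq]
      change _ ≤ accProb _ _ (prodOp W *ᵥ (padZero ht φ).ofLp)
      rw [hpad]
      exact hle _ _ hacc

end QCSAT

theorem theorem1 :
    ∃ W : (I : QCSATInstance) → List (QCSAT.CliffordGate I.n),
      QCSAT.ComputableInPolyTime (fun I => I.t ≤ I.n) W ∧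
      ∀ (I : QCSATInstance) (ht : I.t ≤ I.n),
        QCSAT.IsClifford (QCSAT.cliffordOp (W I)) ∧
        ∃ φ : QCSAT.Qubits I.t, ‖φ‖ = 1 ∧
          I.IsOptimal (QCSAT.applyOp (QCSAT.cliffordOp (W I)) (QCSAT.padZero ht φ)) := by
  classical
  obtain ⟨c, hc⟩ := QCSAT.Synth.exec_solver
  choose W hW using QCSAT.exists_circuit
  refine ⟨fun I => if ht : I.t ≤ I.n then W I ht else [],
    ⟨QCSAT.Synth.solver.compile, c, fun I ht => ?_⟩, fun I ht => ⟨?_, ?_⟩⟩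
  · obtain ⟨T, he, hT⟩ := hc I ht
    exact ⟨T, _, he, by simpa only [dif_pos (show I.t ≤ I.n from ht)] using (hW I ht).1, hT⟩
  · generalize (fun I => if ht : I.t ≤ I.n then W I ht else []) I = l
    rw [← l.reverse_reverse, QCSAT.cliffordOp_reverse]
    exact QCSAT.isClifford_prodOp _
  · simpa only [dif_pos ht] using (hW I ht).2
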